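/- Let $\Lambda>0$, $|a|<m$, $a\neq 0$, and suppose that $\Delta(r)=r^2-2mr+a^2-\frac{\Lambda r^2}{3}(r^2+a^2)$ has one negative root and three distinct positive roots $r_-<r_+<r_c$. Put $\Sigma_0=r^2+a^2\cos^2\theta$, $\Pi=1+\frac{\Lambda}{3}a^2\cos^2\theta$, $\Xi=1+\frac{\Lambda}{3}a^2$, and let $$\bar g=-\tfrac{\Delta}{\Sigma_0}\Big(\tfrac{dt-a\sin^2\theta\,d\phi}{\Xi}\Big)^2+\tfrac{\Sigma_0}{\Delta}dr^2+\tfrac{\Sigma_0}{\Pi}d\theta^2+\tfrac{\Pi\sin^2\theta}{\Sigma_0}\Big(\tfrac{a\,dt-(r^2+a^2)d\phi}{\Xi}\Big)^2$$ be the Kerr-de Sitter metric on $\bar M=\mathbb R\times\{r_+<r<r_c\}\times S^2$. Let $\Sigma=(r_+,r_c)\times(0,\pi)\ni(r,\theta)$ be the interior of the quotient of the $t$-slices by rotations and $\Gamma=\{\theta=0\}\cup\{\theta=\pi\}$ the axes. Write $\bar g=e^{-2\gamma}\mathfrak g+e^{2\gamma}(d\phi+\mathcal A_\nu dx^\nu)^2$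 with $\nu\in\{t,r,\theta\}$, $\mathcal A_0=\mathcal A_t$, and $\mathfrak g=-N^2dt^2+q_{ab}dx^adx^b$ with $a,b\in\{r,\theta\}$, $\mu_q=\sqrt{\det q}$, $\epsilon^{r\theta}=\epsilon_{r\theta}=1$. A gravitational twist potential is a smooth function $\omega$ on $\Sigma$ with $\partial_a\mathcal A_0+Ne^{-4\gamma}\epsilon_{ab}\mu_q q^{bc}\partial_c\omega=0$. Phase space: $X$ is the set of all quadruples $P=\{(\lambda,v),(\eta,u)\}$ of functions that are smooth on $(r_+,r_c)\times[0,\pi]$, vanish for $r$ outside a compact subinterval of $(r_+,r_c)$, and satisfy $\lambda=\eta=u=v=0$, $d\lambda=d\eta=0$ on $\Gamma$. A smooth curve in $X$ is a family of points $P(t)\in X$, $t\in\mathbb R$, whose components are smooth in $(t,r,\theta)$. On $X$ let $$H^{ADM}=\int_\Sigma\Big(\tfrac12N\mu_q^{-1}e^{2\gamma}(u^2+v^2)+\tfrac12N\mu_qq^{ab}e^{-2\gamma}(\partial_a\eta\,\partial_b\eta+\partial_a\lambda\,\partial_b\lambda)-\mathcal A_0\epsilon^{ab}\partial_a\eta\,\partial_b\lambda\Big)d^2x,$$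 and let $H^{Alt}=\int_\Sigma\mathcal E^{Alt}d^2x$, where, with $|\alpha|_q^2=q^{ab}\alpha_a\alpha_b$, $$\begin{aligned}\mathcal E^{Alt}={}&\tfrac12Ne^{2\gamma}\mu_q^{-1}(u^2+v^2)+\tfrac12\Lambda N\mu_qe^{-4\gamma}(\lambda^2+\eta^2)+\tfrac14Ne^{-2\gamma}\mu_q\big(|d\lambda-2\lambda d\gamma|_q^2+|d\eta-2\eta d\gamma|_q^2\big)\\&+\tfrac14Ne^{-2\gamma}\mu_q\big(|d\eta+\lambda e^{-2\gamma}d\omega|_q^2+|d\lambda-\eta e^{-2\gamma}d\omega|_q^2\big).\end{aligned}$$ For $\underline P=\{(\underline\lambda,\underline v),(\underline\eta,\underline u)\}$ let $H^{Reg}=\int_\Sigma\mathcal E^{Reg}d^2x$, where $$\begin{aligned}\mathcal E^{Reg}={}&\tfrac12N\mu_q^{-1}(\underline u^2+\underline v^2)+\tfrac12N\Lambda\mu_qe^{-2\gamma}(\underline\lambda^2+\underline\eta^2)+\tfrac12N\mu_q\big(|d\gamma|_q^2+\tfrac14e^{-4\gamma}|d\omega|_q^2\big)(\underline\lambda^2+\underline\eta^2)\\&+\tfrac12N\mu_q\big(|d\underline\lambda-\tfrac12\underline\eta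 e^{-2\gamma}d\omega|_q^2+|d\underline\eta+\tfrac12\underline\lambda e^{-2\gamma}d\omega|_q^2\big).\end{aligned}$$ The field equations for a smooth curve in $X$ are, on $\Sigma$ for all $t$, $$\partial_t\eta=Ne^{2\gamma}\mu_q^{-1}u,\qquad\partial_t\lambda=Ne^{2\gamma}\mu_q^{-1}v,$$ $$\partial_tu=\partial_b(N\mu_qq^{ab}e^{-2\gamma}\partial_a\eta)+N\mu_qq^{ab}e^{-4\gamma}\partial_a\omega\,\partial_b\lambda,\qquad\partial_tv=\partial_b(N\mu_qq^{ab}e^{-2\gamma}\partial_a\lambda)-N\mu_qq^{ab}e^{-4\gamma}\partial_a\omega\,\partial_b\eta.$$ Hamilton's equations of a functional $H$ are $D_uH=\partial_t\eta$, $D_\eta H=-\partial_tu$, $D_vH=\partial_t\lambda$, $D_\lambda H=-\partial_tv$, where $D$ is the variational derivative: $D_fH=g$ means $\frac{d}{ds}\big|_{s=0}H(\dots,f+sh,\dots)=\int_\Sigma gh\,d^2x$ for all $h\in C_c^\infty(\Sigma)$. Theorem. A gravitational twist potential exists. For every gravitational twist potential $\omega$ the following hold. (A) For all $P\in X$ the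 integrals $H^{ADM}$, $H^{Alt}$ converge absolutely and $H^{ADM}(P)=H^{Alt}(P)$. $H^{Alt}$ is positive-definite on $X$: $H^{Alt}(P)\ge0$, with equality iff $P=0$ on $\Sigma$. A smooth curve in $X$ satisfies Hamilton's equations of $H^{Alt}$ if and only if it satisfies the field equations. (B) The map $U:\lambda\mapsto e^{-\gamma}\lambda,\ \eta\mapsto e^{-\gamma}\eta,\ u\mapsto e^{\gamma}u,\ v\mapsto e^{\gamma}v$ is a bijection from $X$ onto its image $\underline X$; it preserves the symplectic form $\int_\Sigma(\lambda v'-\lambda'v+\eta u'-\eta'u)\,d^2x$, and $H^{Reg}\circ U=H^{Alt}$. On $\underline X$ the integral $H^{Reg}$ converges absolutely and is positive-definite. For a smooth curve $P$ in $X$, the curve $U(P)$ satisfies Hamilton's equations of $H^{Reg}$ in the variables of $\underline X$ if and only if $P$ satisfies the field equations. (C) Let $A$ be a smooth one-form on $\bar M$ with $\mathcal L_{\partial_\phi}A=0$ whose field $F=dA$ satisfies Maxwell's equations $\partial_\mu(\sqrt{-\det\bar g}\,F^{\mu\nu})=0$, and suppose that at some time $t_0$ the data $F|_{t=t_0}$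 are supported over a compact subset of $\Sigma$. Put $\mathfrak E^i=\sqrt{-\det\bar g}\,F^{ti}$ and $\mathfrak B^i=\frac12\epsilon^{ijk}F_{jk}$. Then there is a smooth curve $P(t)=\{(\lambda,v),(\eta,u)\}$ in $X$ with $\lambda=A_\phi$, $\mathfrak E^a=\epsilon^{ab}\partial_b\eta$, $u=\mathfrak B^\phi$, $v=-\mathfrak E^\phi$ on $\Sigma$, for which the ADM energy density of $F$, $\frac12\bar N\bar\mu_{\bar q}^{-1}\bar q_{ij}(\mathfrak E^i\mathfrak E^j+\mathfrak B^i\mathfrak B^j)-\epsilon_{ijk}\bar N^i\mathfrak E^j\mathfrak B^k$ (with $\bar N$, $\bar N^i$, $\bar q$ the lapse, shift and induced metric of the $t$-slices of $\bar g$, and $\bar\mu_{\bar q}=\sqrt{\det\bar q}$), is the density of $H^{ADM}$, and: (1) $P$ satisfies the field equations and Hamilton's equations of the positive-definite Hamiltonian $H^{Alt}$; (2) the vector density $J$ on $\mathbb R\times\Sigma$ with $J^t=\mathcal E^{Alt}$ and $$J^b=-uN^2q^{ab}(\partial_a\eta+\tfrac12\lambda e^{-2\gamma}\partial_a\omega-\eta\,\partial_a\gamma)-vN^2q^{ab}(\partial_a\lambda-\tfrac12\eta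 e^{-2\gamma}\partial_a\omega-\lambda\,\partial_a\gamma)$$ is divergence-free, $\partial_tJ^t+\partial_bJ^b=0$, and its flux $\int_\Sigma J^td^2x$ through each $t$-slice is $\ge0$, with equality iff $P(t)=0$ on $\Sigma$; (3) $U(P)$ satisfies Hamilton's equations of the positive-definite Hamiltonian $H^{Reg}$, and the vector density $J^{Reg}$ with $(J^{Reg})^t=\mathcal E^{Reg}$ and $$(J^{Reg})^b=-N^2q^{ab}\underline u(\partial_a\underline\eta+\tfrac12\underline\lambda e^{-2\gamma}\partial_a\omega)-N^2q^{ab}\underline v(\partial_a\underline\lambda-\tfrac12\underline\eta e^{-2\gamma}\partial_a\omega)$$ is divergence-free, with flux through each $t$-slice $\ge0$ and equal to $0$ iff $P(t)=0$ on $\Sigma$. -/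

import Mathlib

open MeasureTheory Set Real
open scoped ContDiff Matrix

noncomputable section

/-! ### Kerr-de Sitter parameters and metric -/

/-- Parameters of a subextremal Kerr-de Sitter black hole: `Δ(r)` has one negative root `rn` and
three distinct positive roots `rm < rp < rc` (`rp` the event and `rc` the cosmological horizon). -/
structure KerrDeSitter where
  Lam : ℝ
  m : ℝ
  a : ℝ
  rn : ℝ
  rm : ℝ
  rp : ℝ
  rc : ℝ
  Lam_pos : 0 < Lam
  a_ne_zero : a ≠ 0
  abs_a_lt : |a| < m
  rn_neg : rn < 0
  rm_pos : 0 < rm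
  rm_lt : rm < rp
  rp_lt : rp < rc
  roots : {r : ℝ | r ^ 2 - 2 * m * r + a ^ 2 - Lam * r ^ 2 / 3 * (r ^ 2 + a ^ 2) = 0}
    = {rn, rm, rp, rc}

/-- Lapse of a Lorentzian metric matrix whose index `0` is the time coordinate:
`g^{tt} = -1/N²`. -/
def lapse {n : ℕ} (g : Matrix (Fin (n + 1)) (Fin (n + 1)) ℝ) : ℝ :=
  1 / √(-(g⁻¹ 0 0))

/-- Shift vector of a Lorentzian metric matrix: `g^{ti} = N^i/N²`. -/
def shift {n : ℕ} (g : Matrix (Fin (n + 1)) (Fin (n + 1)) ℝ) (i : Fin n) : ℝ :=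
  -(g⁻¹ 0 i.succ) / g⁻¹ 0 0

/-- Metric induced on the slices of constant time. -/
def spatialMetric {n : ℕ} (g : Matrix (Fin (n + 1)) (Fin (n + 1)) ℝ) : Matrix (Fin n) (Fin n) ℝ :=
  g.submatrix Fin.succ Fin.succ

/-- Partial derivatives on the quotient `Σ`, whose points are `x = (r, θ)`:
index `0` is `r`, index `1` is `θ`. -/
def pd (b : Fin 2) (f : ℝ × ℝ → ℝ) (x : ℝ × ℝ) : ℝ :=
  fderiv ℝ f x (if b = 0 then (1, 0) else (0, 1))

/-- Partial derivatives in the coordinates `(t, r, θ, φ)`. -/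
def pd4 (μ : Fin 4) (f : (Fin 4 → ℝ) → ℝ) (c : Fin 4 → ℝ) : ℝ :=
  fderiv ℝ f c (Pi.single μ 1)

/-- The antisymmetric symbol in two dimensions, `ε^{rθ} = 1`. -/
def eps2 : Matrix (Fin 2) (Fin 2) ℝ := !![0, 1; -1, 0]

namespace KerrDeSitter

variable (K : KerrDeSitter)

def Delta (r : ℝ) : ℝ :=
  r ^ 2 - 2 * K.m * r + K.a ^ 2 - K.Lam * r ^ 2 / 3 * (r ^ 2 + K.a ^ 2)

def SigmaFn (x : ℝ × ℝ) : ℝ := x.1 ^ 2 + K.a ^ 2 * cos x.2 ^ 2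

def PiFn (x : ℝ × ℝ) : ℝ := 1 + K.Lam / 3 * K.a ^ 2 * cos x.2 ^ 2

def Xi : ℝ := 1 + K.Lam / 3 * K.a ^ 2

/-- The one-form `(dt - a sin²θ dφ) / (1 + Λa²/3)`. -/
def tau (x : ℝ × ℝ) : Fin 4 → ℝ := ![1 / K.Xi, 0, 0, -(K.a * sin x.2 ^ 2) / K.Xi]

/-- The one-form `(a dt - (r² + a²) dφ) / (1 + Λa²/3)`. -/
def sig (x : ℝ × ℝ) : Fin 4 → ℝ := ![K.a / K.Xi, 0, 0, -(x.1 ^ 2 + K.a ^ 2) / K.Xi]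

/-- The Kerr-de Sitter metric in the coordinates `(t, r, θ, φ)`, at `x = (r, θ)`. -/
def metric (x : ℝ × ℝ) : Matrix (Fin 4) (Fin 4) ℝ :=
  (-(K.Delta x.1 / K.SigmaFn x)) • Matrix.vecMulVec (K.tau x) (K.tau x)
    + (K.SigmaFn x / K.Delta x.1) • Matrix.vecMulVec ![0, 1, 0, 0] ![0, 1, 0, 0]
    + (K.SigmaFn x / K.PiFn x) • Matrix.vecMulVec ![0, 0, 1, 0] ![0, 0, 1, 0]
    + (sin x.2 ^ 2 * K.PiFn x / K.SigmaFn x) • Matrix.vecMulVec (K.sig x) (K.sig x)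

/-- Interior of the quotient `Σ`, in the coordinates `(r, θ)`. -/
def quot : Set (ℝ × ℝ) := Ioo K.rp K.rc ×ˢ Ioo 0 π

/-- The quotient `Σ` together with the axes `Γ = {θ = 0} ∪ {θ = π}`. -/
def quotAxis : Set (ℝ × ℝ) := Ioo K.rp K.rc ×ˢ Icc 0 π

/-- The axes `Γ`. -/
def axes : Set (ℝ × ℝ) := Ioo K.rp K.rc ×ˢ {0, π}

/-! ### Weyl-Papapetrou form `ḡ = e^{-2γ} gg + e^{2γ} (dφ + 𝒜)²` -/

/-- `γ`, from `e^{2γ} = ḡ_φφ`. -/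
def gam (x : ℝ × ℝ) : ℝ := log (K.metric x 3 3) / 2

/-- The components `𝒜_ν = ḡ_νφ / ḡ_φφ`, `ν = t, r, θ`. -/
def twistForm (x : ℝ × ℝ) (ν : Fin 3) : ℝ := K.metric x ν.castSucc 3 / K.metric x 3 3

/-- The Lorentzian metric `gg = e^{2γ} (ḡ - e^{2γ} (dφ + 𝒜)²)` on the quotient `M`. -/
def quotMetric (x : ℝ × ℝ) : Matrix (Fin 3) (Fin 3) ℝ := fun μ ν =>
  exp (2 * K.gam x) * (K.metric x μ.castSucc ν.castSucc
    - exp (2 * K.gam x) * K.twistForm x μ * K.twistForm x ν)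

/-- The lapse `N` of `gg`. -/
def N (x : ℝ × ℝ) : ℝ := lapse (K.quotMetric x)

/-- The Riemannian metric `q_{ab}` induced by `gg` on `Σ`. -/
def q (x : ℝ × ℝ) : Matrix (Fin 2) (Fin 2) ℝ := spatialMetric (K.quotMetric x)

/-- The square root of the determinant of `q`. -/
def muq (x : ℝ × ℝ) : ℝ := √(K.q x).det

/-- The contraction `q^{ab} α_a β_b`. -/
def qInner (x : ℝ × ℝ) (α β : Fin 2 → ℝ) : ℝ := ∑ b, ∑ c, (K.q x)⁻¹ b c * α b * β c

/-- `om` is a gravitational twist potential: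
`∂_a 𝒜_0 + N e^{-4γ} ε_{ab} μ_q q^{bc} ∂_c ω = 0` (the components `𝒜_r`, `𝒜_θ` vanish). -/
def IsTwistPotential (om : ℝ × ℝ → ℝ) : Prop :=
  ContDiffOn ℝ ∞ om K.quot ∧ ∀ x ∈ K.quot, ∀ b : Fin 2,
    pd b (fun y => K.twistForm y 0) x
      + K.N x * exp (-4 * K.gam x) *
        ∑ c, ∑ d, eps2 b c * K.muq x * (K.q x)⁻¹ c d * pd d om x = 0

end KerrDeSitter

/-! ### Phase space -/

/-- A quadruple of canonical variables `(λ, v), (η, u)` on `Σ`, as functions of `(r, θ)`. -/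
@[ext] structure PhasePoint where
  lam : ℝ × ℝ → ℝ
  eta : ℝ × ℝ → ℝ
  u : ℝ × ℝ → ℝ
  v : ℝ × ℝ → ℝ

namespace KerrDeSitter

variable (K : KerrDeSitter)

/-- The phase space `X`: smooth up to the axes, supported away from both horizons, with
`λ`, `η` and their first derivatives, and `u`, `v`, zero on the axes. -/
def phaseSpace : Set PhasePoint :=
  {P | (ContDiffOn ℝ ∞ P.lam K.quotAxis ∧ ContDiffOn ℝ ∞ P.eta K.quotAxis ∧
      ContDiffOn ℝ ∞ P.u K.quotAxis ∧ ContDiffOn ℝ ∞ P.v K.quotAxis) ∧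
    (∃ r₁ r₂, K.rp < r₁ ∧ r₂ < K.rc ∧ ∀ x ∈ K.quotAxis, x.1 ∉ Icc r₁ r₂ →
      P.lam x = 0 ∧ P.eta x = 0 ∧ P.u x = 0 ∧ P.v x = 0) ∧
    ∀ x ∈ K.axes, P.lam x = 0 ∧ P.eta x = 0 ∧ P.u x = 0 ∧ P.v x = 0 ∧
      fderivWithin ℝ P.lam K.quotAxis x = 0 ∧ fderivWithin ℝ P.eta K.quotAxis x = 0}

/-- The phase point vanishes on `Σ`. -/
def Vanishes (P : PhasePoint) : Prop :=
  ∀ x ∈ K.quot, P.lam x = 0 ∧ P.eta x = 0 ∧ P.u x = 0 ∧ P.v x = 0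

/-- A smooth curve in the phase space `X`, parametrized by the time `t`. -/
def IsSmoothCurve (Q : ℝ → PhasePoint) : Prop :=
  (∀ t, Q t ∈ K.phaseSpace) ∧
  ContDiffOn ℝ ∞ (fun p : ℝ × (ℝ × ℝ) => (Q p.1).lam p.2) (univ ×ˢ K.quotAxis) ∧
  ContDiffOn ℝ ∞ (fun p : ℝ × (ℝ × ℝ) => (Q p.1).eta p.2) (univ ×ˢ K.quotAxis) ∧
  ContDiffOn ℝ ∞ (fun p : ℝ × (ℝ × ℝ) => (Q p.1).u p.2) (univ ×ˢ K.quotAxis) ∧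
  ContDiffOn ℝ ∞ (fun p : ℝ × (ℝ × ℝ) => (Q p.1).v p.2) (univ ×ˢ K.quotAxis)

/-- Maxwell's equations in the phase space `X`. -/
def FieldEquations (om : ℝ × ℝ → ℝ) (Q : ℝ → PhasePoint) : Prop :=
  ∀ t, ∀ x ∈ K.quot,
    deriv (fun s => (Q s).eta x) t = K.N x * exp (2 * K.gam x) * (K.muq x)⁻¹ * (Q t).u x ∧
    deriv (fun s => (Q s).lam x) t = K.N x * exp (2 * K.gam x) * (K.muq x)⁻¹ * (Q t).v x ∧
    deriv (fun s => (Q s).u x) t =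
      ∑ b, pd b (fun y => ∑ c, K.N y * K.muq y * (K.q y)⁻¹ c b * exp (-2 * K.gam y)
          * pd c (Q t).eta y) x
        + K.N x * K.muq x * exp (-4 * K.gam x)
          * K.qInner x (fun b => pd b om x) (fun b => pd b (Q t).lam x) ∧
    deriv (fun s => (Q s).v x) t =
      ∑ b, pd b (fun y => ∑ c, K.N y * K.muq y * (K.q y)⁻¹ c b * exp (-2 * K.gam y)
          * pd c (Q t).lam y) x
        - K.N x * K.muq x * exp (-4 * K.gam x)
          * K.qInner x (fun b => pd b om x) (fun b => pd b (Q t).eta x)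

/-! ### Hamiltonians -/

/-- The energy functional with density `E`. -/
def energy (E : PhasePoint → ℝ × ℝ → ℝ) (P : PhasePoint) : ℝ := ∫ x in K.quot, E P x

/-- The ADM energy density in the phase space `X`. -/
def densityADM (P : PhasePoint) (x : ℝ × ℝ) : ℝ :=
  1 / 2 * K.N x * (K.muq x)⁻¹ * exp (2 * K.gam x) * (P.u x ^ 2 + P.v x ^ 2)
    + 1 / 2 * K.N x * K.muq x * exp (-2 * K.gam x)
      * (K.qInner x (fun b => pd b P.eta x) (fun b => pd b P.eta x)
        + K.qInner x (fun b => pd b P.lam x) (fun b => pd b P.lam x))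
    - K.twistForm x 0 * ∑ b, ∑ c, eps2 b c * pd b P.eta x * pd c P.lam x

/-- The density of `H^Alt`. -/
def densityAlt (om : ℝ × ℝ → ℝ) (P : PhasePoint) (x : ℝ × ℝ) : ℝ :=
  let α₁ : Fin 2 → ℝ := fun b => pd b P.lam x - 2 * P.lam x * pd b K.gam x
  let α₂ : Fin 2 → ℝ := fun b => pd b P.eta x - 2 * P.eta x * pd b K.gam x
  let β₁ : Fin 2 → ℝ := fun b => pd b P.eta x + P.lam x * exp (-2 * K.gam x) * pd b om x
  let β₂ : Fin 2 → ℝ := fun b => pd b P.lam x - P.eta x * exp (-2 * K.gam x) * pd b om x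
  1 / 2 * K.N x * exp (2 * K.gam x) * (K.muq x)⁻¹ * (P.u x ^ 2 + P.v x ^ 2)
    + 1 / 2 * K.Lam * K.N x * K.muq x * exp (-4 * K.gam x) * (P.lam x ^ 2 + P.eta x ^ 2)
    + 1 / 4 * K.N x * exp (-2 * K.gam x) * K.muq x * (K.qInner x α₁ α₁ + K.qInner x α₂ α₂)
    + 1 / 4 * K.N x * exp (-2 * K.gam x) * K.muq x * (K.qInner x β₁ β₁ + K.qInner x β₂ β₂)

/-- The density of `H^Reg`, as a function of the regularized variables. -/
def densityReg (om : ℝ × ℝ → ℝ) (P : PhasePoint) (x : ℝ × ℝ) : ℝ :=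
  let α₁ : Fin 2 → ℝ := fun b =>
    pd b P.lam x - 1 / 2 * P.eta x * exp (-2 * K.gam x) * pd b om x
  let α₂ : Fin 2 → ℝ := fun b =>
    pd b P.eta x + 1 / 2 * P.lam x * exp (-2 * K.gam x) * pd b om x
  1 / 2 * K.N x * (K.muq x)⁻¹ * (P.u x ^ 2 + P.v x ^ 2)
    + 1 / 2 * K.N x * K.Lam * K.muq x * exp (-2 * K.gam x) * (P.lam x ^ 2 + P.eta x ^ 2)
    + 1 / 2 * K.N x * K.muq x
      * (K.qInner x (fun b => pd b K.gam x) (fun b => pd b K.gam x)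
        + 1 / 4 * exp (-4 * K.gam x) * K.qInner x (fun b => pd b om x) (fun b => pd b om x))
      * (P.lam x ^ 2 + P.eta x ^ 2)
    + 1 / 2 * K.N x * K.muq x * (K.qInner x α₁ α₁ + K.qInner x α₂ α₂)

/-- The functional with density `E` is finite and positive-definite on `S`. -/
def IsPositiveDefinite (E : PhasePoint → ℝ × ℝ → ℝ) (S : Set PhasePoint) : Prop :=
  ∀ P ∈ S, IntegrableOn (E P) K.quot ∧ 0 ≤ K.energy E P ∧ (K.energy E P = 0 ↔ K.Vanishes P)

/-- `g` is the variational derivative of the functional `F` at `f`: for all smooth `h` with compact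
support in `Σ`, the derivative of `F (f + s h)` at `s = 0` is `∫ g h`. -/
def HasVarDeriv (F : (ℝ × ℝ → ℝ) → ℝ) (f g : ℝ × ℝ → ℝ) : Prop :=
  ∀ h : ℝ × ℝ → ℝ, ContDiff ℝ ∞ h → HasCompactSupport h → tsupport h ⊆ K.quot →
    HasDerivAt (fun s : ℝ => F (fun x => f x + s * h x)) (∫ x in K.quot, g x * h x) 0

/-- The curve `Q` satisfies Hamilton's equations of `H` for the canonical pairs
`(η, u)` and `(λ, v)`. -/
def IsHamiltonFlow (H : PhasePoint → ℝ) (Q : ℝ → PhasePoint) : Prop :=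
  ∀ t,
    K.HasVarDeriv (fun w => H { Q t with u := w }) (Q t).u
      (fun x => deriv (fun s => (Q s).eta x) t) ∧
    K.HasVarDeriv (fun w => H { Q t with eta := w }) (Q t).eta
      (fun x => -deriv (fun s => (Q s).u x) t) ∧
    K.HasVarDeriv (fun w => H { Q t with v := w }) (Q t).v
      (fun x => deriv (fun s => (Q s).lam x) t) ∧
    K.HasVarDeriv (fun w => H { Q t with lam := w }) (Q t).lam
      (fun x => -deriv (fun s => (Q s).v x) t)

/-- The transformation `U` to the regularized variables. -/
def regularize (P : PhasePoint) : PhasePoint where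
  lam := fun x => exp (-K.gam x) * P.lam x
  eta := fun x => exp (-K.gam x) * P.eta x
  u := fun x => exp (K.gam x) * P.u x
  v := fun x => exp (K.gam x) * P.v x

/-- The regularized phase space. -/
def regPhaseSpace : Set PhasePoint := K.regularize '' K.phaseSpace

/-- The canonical symplectic form of the pairs `(λ, v)` and `(η, u)`. -/
def symplecticForm (P P' : PhasePoint) : ℝ :=
  ∫ x in K.quot, (P.lam x * P'.v x - P'.lam x * P.v x + P.eta x * P'.u x - P'.eta x * P.u x)

/-! ### Currents -/

/-- The vector density `J = J^t ∂_t + J^b ∂_b` of `H^Alt` along the curve `Q`. -/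
def currentAlt (om : ℝ × ℝ → ℝ) (Q : ℝ → PhasePoint) (t : ℝ) (x : ℝ × ℝ) : ℝ × (Fin 2 → ℝ) :=
  (K.densityAlt om (Q t) x, fun b => ∑ c,
    (-((Q t).u x * K.N x ^ 2 * (K.q x)⁻¹ c b * (pd c (Q t).eta x
        + 1 / 2 * (Q t).lam x * exp (-2 * K.gam x) * pd c om x - (Q t).eta x * pd c K.gam x))
      - (Q t).v x * K.N x ^ 2 * (K.q x)⁻¹ c b * (pd c (Q t).lam x
        - 1 / 2 * (Q t).eta x * exp (-2 * K.gam x) * pd c om x - (Q t).lam x * pd c K.gam x)))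

/-- The vector density of `H^Reg` along the curve `Q` of regularized variables. -/
def currentReg (om : ℝ × ℝ → ℝ) (Q : ℝ → PhasePoint) (t : ℝ) (x : ℝ × ℝ) : ℝ × (Fin 2 → ℝ) :=
  (K.densityReg om (Q t) x, fun b => ∑ c,
    (-(K.N x ^ 2 * (K.q x)⁻¹ c b * (Q t).u x * (pd c (Q t).eta x
        + 1 / 2 * (Q t).lam x * exp (-2 * K.gam x) * pd c om x))
      - K.N x ^ 2 * (K.q x)⁻¹ c b * (Q t).v x * (pd c (Q t).lam x
        - 1 / 2 * (Q t).eta x * exp (-2 * K.gam x) * pd c om x)))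

/-- The vector density `J` on `M = ℝ × Σ` is divergence-free: `∂_t J^t + ∂_b J^b = 0`. -/
def IsDivergenceFree (J : ℝ → ℝ × ℝ → ℝ × (Fin 2 → ℝ)) : Prop :=
  ∀ t, ∀ x ∈ K.quot,
    deriv (fun s => (J s x).1) t + ∑ b, pd b (fun y => (J t y).2 b) x = 0

/-- The flux of `J` through the hypersurface of constant `t`. -/
def flux (J : ℝ → ℝ × ℝ → ℝ × (Fin 2 → ℝ)) (t : ℝ) : ℝ := ∫ x in K.quot, (J t x).1

/-! ### Maxwell fields -/

/-- The spherical coordinates `(t, r, θ, φ) ↦ (t, x, y, z)` on the spacetime. -/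
def sph (c : Fin 4 → ℝ) : Fin 4 → ℝ :=
  ![c 0, c 1 * sin (c 2) * cos (c 3), c 1 * sin (c 2) * sin (c 3), c 1 * cos (c 2)]

/-- The spacetime region `r₊ < r < r_c` (including the axes), in the coordinates
`(t, x, y, z)` with `r² = x² + y² + z²`. -/
def spacetime : Set (Fin 4 → ℝ) :=
  {y | √(y 1 ^ 2 + y 2 ^ 2 + y 3 ^ 2) ∈ Ioo K.rp K.rc}

/-- The domain of the coordinates `(t, r, θ, φ)`: the spacetime without the axes. -/
def chart : Set (Fin 4 → ℝ) := {c | (c 1, c 2) ∈ K.quot}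

/-- The components `A_μ` of the one-form `A` in the coordinates `(t, r, θ, φ)`. -/
def comp (A : (Fin 4 → ℝ) → ((Fin 4 → ℝ) →L[ℝ] ℝ)) (μ : Fin 4) (c : Fin 4 → ℝ) : ℝ :=
  A (sph c) (fderiv ℝ sph c (Pi.single μ 1))

/-- The Faraday tensor `F = dA`, `F_{μν} = ∂_μ A_ν - ∂_ν A_μ`. -/
def faraday (A : (Fin 4 → ℝ) → ((Fin 4 → ℝ) →L[ℝ] ℝ)) (c : Fin 4 → ℝ) :
    Matrix (Fin 4) (Fin 4) ℝ :=
  fun μ ν => pd4 μ (comp A ν) c - pd4 ν (comp A μ) c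

/-- The tensor density `√(-det ḡ) F^{μν}`. -/
def faradayDensity (A : (Fin 4 → ℝ) → ((Fin 4 → ℝ) →L[ℝ] ℝ)) (c : Fin 4 → ℝ) :
    Matrix (Fin 4) (Fin 4) ℝ :=
  √(-(K.metric (c 1, c 2)).det) •
    ((K.metric (c 1, c 2))⁻¹ * faraday A c * ((K.metric (c 1, c 2))⁻¹)ᵀ)

/-- `F = dA` is a smooth axially symmetric solution of Maxwell's equations
`∂_μ (√(-det ḡ) F^{μν}) = 0`; the potential `A` is smooth on the spacetime, axes included, and its
Lie derivative along `∂_φ` (hence also that of `F`) is zero. -/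
def IsAxisymmetricMaxwell (A : (Fin 4 → ℝ) → ((Fin 4 → ℝ) →L[ℝ] ℝ)) : Prop :=
  ContDiffOn ℝ ∞ A K.spacetime ∧
  (∀ c ∈ K.chart, ∀ μ, pd4 3 (comp A μ) c = 0) ∧
  (∀ c ∈ K.chart, ∀ ν, ∑ μ, pd4 μ (fun c' => K.faradayDensity A c' μ ν) c = 0)

/-- The initial data of `F` at `t = t₀` have compact support in the interior of `Σ`. -/
def HasCompactData (A : (Fin 4 → ℝ) → ((Fin 4 → ℝ) →L[ℝ] ℝ)) (t₀ : ℝ) : Prop :=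
  ∃ S : Set (ℝ × ℝ), IsCompact S ∧ S ⊆ K.quot ∧
    ∀ c ∈ K.chart, c 0 = t₀ → (c 1, c 2) ∉ S → faraday A c = 0

/-- The electric vector density `𝔈^i = ½ ε^{ijk} (*F)_{jk} = √(-det ḡ) F^{ti}`. -/
def electric (A : (Fin 4 → ℝ) → ((Fin 4 → ℝ) →L[ℝ] ℝ)) (c : Fin 4 → ℝ) : Fin 3 → ℝ :=
  fun i => K.faradayDensity A c 0 i.succ

/-- The magnetic vector density `𝔅^i = ½ ε^{ijk} (∂_j A_k - ∂_k A_j)`. -/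
def magnetic (A : (Fin 4 → ℝ) → ((Fin 4 → ℝ) →L[ℝ] ℝ)) (c : Fin 4 → ℝ) : Fin 3 → ℝ :=
  ![faraday A c 2 3, faraday A c 3 1, faraday A c 1 2]

/-- The ADM energy density of the Maxwell field,
`½ N̄ μ̄⁻¹ q̄_ij (𝔈^i 𝔈^j + 𝔅^i 𝔅^j) - ε_ijk N̄^i 𝔈^j 𝔅^k`. -/
def maxwellDensityADM (A : (Fin 4 → ℝ) → ((Fin 4 → ℝ) →L[ℝ] ℝ)) (c : Fin 4 → ℝ) : ℝ :=
  let g := K.metric (c 1, c 2)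
  let E := K.electric A c
  let B := magnetic A c
  1 / 2 * lapse g * (√(spatialMetric g).det)⁻¹
      * ∑ i, ∑ j, spatialMetric g i j * (E i * E j + B i * B j)
    - shift g ⬝ᵥ (crossProduct E B)

/-- The curve `Q` consists of the canonical variables of the Maxwell field `F = dA`:
`λ = A_φ`, `𝔈^a = ε^{ab} ∂_b η`, `u = 𝔅^φ`, `v = -𝔈^φ`. -/
def IsReduction (A : (Fin 4 → ℝ) → ((Fin 4 → ℝ) →L[ℝ] ℝ)) (Q : ℝ → PhasePoint) : Prop :=
  ∀ c ∈ K.chart,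
    (Q (c 0)).lam (c 1, c 2) = comp A 3 c ∧
    (∀ b : Fin 2, K.electric A c b.castSucc = ∑ d, eps2 b d * pd d (Q (c 0)).eta (c 1, c 2)) ∧
    (Q (c 0)).u (c 1, c 2) = magnetic A c 2 ∧
    (Q (c 0)).v (c 1, c 2) = -K.electric A c 2

end KerrDeSitter

end

/-! Between the two horizons the quotient metric is diagonal, so the whole problem can be written
with `gphi` = e^{2γ}, `twistT` = 𝒜_t, `kap b` = N μ_q q^{bb}, `wgt` = N e^{2γ} / μ_q and `nu` = N
μ_q e^{-2γ}. Only two consequences of the Einstein equations are used. One is the duality between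
d𝒜_t and dω (`twist_equation_iff`). The other is the equation div(kap dγ) + kap |dω|² / (2 e^{4γ}) +
Λ nu = 0 (`gam_equation`). Both are checked as rational identities in r, sin θ and cos θ.

The ADM density is indefinite because of the term -𝒜_t dη ∧ dλ. Completing squares with covariant
derivatives of η and λ gives `densityAlt_eq`, a sum of squares whose mass term is strictly positive
since Λ > 0. By the two background equations the two densities differ by the divergence of
`gaugeCurrent` (`densityAlt_sub_densityADM`). On X the boundary terms vanish: at the horizons by the
support condition, at the axes because λ and η are O(sin² θ). Hence the two functionals agree on X
(`energy_densityADM_eq`). Since X is stable under adding test functions, the variational derivatives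
of H^Alt can be computed from the simpler H^ADM, and they give the field equations
(`isHamiltonFlow_densityAlt_iff`).

The regularized variables differ by the time-independent factors e^{∓γ}. The density of H^Reg at
U(P) equals that of H^Alt at P pointwise (`densityReg_regularize`), so part (B) is transported from
part (A).

For a Maxwell field three things have to be shown. First, the reduced variables are smooth up to the
axes with the right boundary values: the coordinate change (θ, φ) ↦ (-θ, φ + π) fixes every point of
space, so components odd under it vanish on an axis. Secondly, the dual potential η exists:
Maxwell's equations say that `dualForm` is closed on a convex set, and compactness of the data makes
one normalization serve both axes (`exists_dualPotential`). Thirdly, the support stays away from the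
horizons for all t. This is finite speed of propagation (`exists_support`): E^Alt is locally
conserved, its radial flux is at most the coordinate speed times E^Alt, and this speed vanishes
linearly at both horizons, so it is bounded in the coordinate log((r - r₊)/(r_c - r)), in which the
horizons lie at infinity. The positive density is essential here as well. The statements about the
currents follow from local conservation and positivity. -/

noncomputable section

/-! ### Signs and closed forms of the background fields. -/

namespace KerrDeSitter

variable (K : KerrDeSitter)

/-! ### Signs of the metric functions -/

/-- Newton interpolation at the four distinct roots: the divided differences up to order three
vanish, so only the top term with leading coefficient -Λ/3 survives, and its sign is absorbed in the
factor r_c - r. -/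
theorem Delta_eq (r : ℝ) :
    K.Delta r = K.Lam / 3 * ((r - K.rn) * (r - K.rm) * (r - K.rp) * (K.rc - r)) := by
  have hmem : ∀ r ∈ ({K.rn, K.rm, K.rp, K.rc} : Set ℝ), K.Delta r = 0 := by
    intro r hr
    rw [← K.roots] at hr
    exact hr
  have h1 := hmem K.rn (by simp)
  have h2 := hmem K.rm (by simp)
  have h3 := hmem K.rp (by simp)
  have h4 := hmem K.rc (by simp)
  have hn := K.rn_neg
  have hm := K.rm_pos
  have hmp := K.rm_lt
  have hpc := K.rp_lt
  simp only [Delta] at *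
  set l := K.Lam / 3 with hl
  have key : ∀ a b : ℝ, a ≠ b → ∀ f : ℝ → ℝ, (a - b) * f a = 0 → f a = 0 := by
    intro a b hab f h
    rcases mul_eq_zero.1 h with h | h
    · exact absurd (sub_eq_zero.1 h) hab
    · exact h
  -- divided differences at the roots
  have e12 : (K.rn + K.rm) - 2 * K.m
      - l * ((K.rn + K.rm) * (K.rn ^ 2 + K.rm ^ 2) + K.a ^ 2 * (K.rn + K.rm)) = 0 := by
    have : (K.rn - K.rm) ≠ 0 := by linarith
    apply mul_left_cancel₀ this
    linear_combination h1 - h2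
  have e13 : (K.rn + K.rp) - 2 * K.m
      - l * ((K.rn + K.rp) * (K.rn ^ 2 + K.rp ^ 2) + K.a ^ 2 * (K.rn + K.rp)) = 0 := by
    have : (K.rn - K.rp) ≠ 0 := by linarith
    apply mul_left_cancel₀ this
    linear_combination h1 - h3
  have e14 : (K.rn + K.rc) - 2 * K.m
      - l * ((K.rn + K.rc) * (K.rn ^ 2 + K.rc ^ 2) + K.a ^ 2 * (K.rn + K.rc)) = 0 := by
    have : (K.rn - K.rc) ≠ 0 := by linarith
    apply mul_left_cancel₀ this
    linear_combination h1 - h4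
  have e123 : 1 - l * (K.rn ^ 2 + K.rm ^ 2 + K.rp ^ 2 + K.rn * K.rm + K.rn * K.rp + K.rm * K.rp
      + K.a ^ 2) = 0 := by
    have : (K.rm - K.rp) ≠ 0 := by linarith
    apply mul_left_cancel₀ this
    linear_combination e12 - e13
  have e124 : 1 - l * (K.rn ^ 2 + K.rm ^ 2 + K.rc ^ 2 + K.rn * K.rm + K.rn * K.rc + K.rm * K.rc
      + K.a ^ 2) = 0 := by
    have : (K.rm - K.rc) ≠ 0 := by linarith
    apply mul_left_cancel₀ this
    linear_combination e12 - e14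
  have e1234 : l * (K.rn + K.rm + K.rp + K.rc) = 0 := by
    have : (K.rp - K.rc) ≠ 0 := by linarith
    apply mul_left_cancel₀ this
    linear_combination e124 - e123
  linear_combination h1 + (r - K.rn) * e12 + (r - K.rn) * (r - K.rm) * e123
    - (r - K.rn) * (r - K.rm) * (r - K.rp) * e1234

variable {K}

theorem Delta_pos {r : ℝ} (hr : r ∈ Ioo K.rp K.rc) : 0 < K.Delta r := by
  have h1 := K.rn_neg
  have h2 := K.rm_pos
  have h3 := K.rm_lt
  have h4 := K.Lam_pos
  rw [Delta_eq]
  have e1 : 0 < r - K.rn := by linarith [hr.1]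
  have e2 : 0 < r - K.rm := by linarith [hr.1]
  have e3 : 0 < r - K.rp := by linarith [hr.1]
  have e4 : 0 < K.rc - r := by linarith [hr.2]
  positivity

theorem r_pos {r : ℝ} (hr : r ∈ Ioo K.rp K.rc) : 0 < r := by
  linarith [hr.1, K.rm_pos, K.rm_lt]

variable (K)

theorem m_pos : 0 < K.m := (abs_nonneg _).trans_lt K.abs_a_lt

theorem Xi_pos : 0 < K.Xi := by
  have := K.Lam_pos
  unfold Xi; positivity

theorem PiFn_pos (x : ℝ × ℝ) : 0 < K.PiFn x := by
  have := K.Lam_pos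
  unfold PiFn; positivity

variable {K}

theorem SigmaFn_pos {x : ℝ × ℝ} (hr : x.1 ∈ Ioo K.rp K.rc) : 0 < K.SigmaFn x := by
  have := r_pos hr
  unfold SigmaFn; positivity

variable (K)

/-- `Ξ² Σ₀ ḡ_φφ / sin² θ`. -/
def bigB (x : ℝ × ℝ) : ℝ :=
  K.Xi * (x.1 ^ 2 + K.a ^ 2) * K.SigmaFn x + 2 * K.m * x.1 * K.a ^ 2 * sin x.2 ^ 2

/-- `-Ξ² Σ₀ ḡ_tφ / (a sin² θ)`. -/
def bigT (x : ℝ × ℝ) : ℝ :=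
  K.Lam / 3 * (x.1 ^ 2 + K.a ^ 2) * K.SigmaFn x + 2 * K.m * x.1

variable {K}

/-- The axial Killing field is spacelike off the axes, so that γ is a genuine logarithm there. In
the form chosen for `bigB` every summand is nonnegative and the first is positive. -/
theorem bigB_pos {x : ℝ × ℝ} (hr : x.1 ∈ Ioo K.rp K.rc) : 0 < K.bigB x := by
  have := r_pos hr
  have := SigmaFn_pos hr
  have := K.m_pos
  have := K.Xi_pos
  unfold bigB; positivity

variable (K)

/-- The difference on the right is what the metric produces directly; positivity is hidden there
until Δ is expanded. -/
theorem bigB_eq (x : ℝ × ℝ) : K.bigB x =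
    K.PiFn x * (x.1 ^ 2 + K.a ^ 2) ^ 2 - K.Delta x.1 * K.a ^ 2 * sin x.2 ^ 2 := by
  have h := sin_sq x.2
  simp only [bigB, PiFn, Delta, SigmaFn, Xi, h]
  ring

theorem bigT_eq (x : ℝ × ℝ) : K.bigT x = K.PiFn x * (x.1 ^ 2 + K.a ^ 2) - K.Delta x.1 := by
  simp only [bigT, PiFn, Delta, SigmaFn]
  ring

theorem SigmaFn_eq (x : ℝ × ℝ) : K.SigmaFn x = x.1 ^ 2 + K.a ^ 2 - K.a ^ 2 * sin x.2 ^ 2 := by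
  rw [sin_sq, SigmaFn]; ring

/-! ### Closed forms of the background fields -/

/-- `e^{2γ} = ḡ_φφ` in closed form. -/
def gphi (x : ℝ × ℝ) : ℝ := sin x.2 ^ 2 * K.bigB x / (K.SigmaFn x * K.Xi ^ 2)

/-- `𝒜_t` in closed form. -/
def twistT (x : ℝ × ℝ) : ℝ := -K.a * K.bigT x / K.bigB x

/-- The diagonal entries `N μ_q q^{bb}`, in closed form. -/
def kap (b : Fin 2) (x : ℝ × ℝ) : ℝ :=
  if b = 0 then K.Delta x.1 * sin x.2 / K.Xi ^ 2 else K.PiFn x * sin x.2 / K.Xi ^ 2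

/-- `N e^{2γ} μ_q⁻¹` in closed form. -/
def wgt (x : ℝ × ℝ) : ℝ := K.Delta x.1 * K.PiFn x * sin x.2 / (K.Xi ^ 2 * K.SigmaFn x)

/-- `N μ_q e^{-2γ}` in closed form. -/
def nu (x : ℝ × ℝ) : ℝ := K.SigmaFn x * sin x.2 / K.Xi ^ 2

theorem metric_tt (x : ℝ × ℝ) : K.metric x 0 0 =
    (sin x.2 ^ 2 * K.PiFn x * K.a ^ 2 - K.Delta x.1) / (K.SigmaFn x * K.Xi ^ 2) := by
  simp [metric, tau, sig, Matrix.vecMulVec]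
  field_simp
  ring

theorem metric_tphi (x : ℝ × ℝ) : K.metric x 0 3 =
    -K.a * sin x.2 ^ 2 * K.bigT x / (K.SigmaFn x * K.Xi ^ 2) := by
  simp [metric, tau, sig, Matrix.vecMulVec, bigT_eq]
  field_simp
  ring

theorem metric_phiphi (x : ℝ × ℝ) : K.metric x 3 3 = K.gphi x := by
  simp [metric, tau, sig, Matrix.vecMulVec, gphi, bigB_eq]
  field_simp
  ring

theorem metric_eq (x : ℝ × ℝ) : K.metric x =
    !![K.metric x 0 0, 0, 0, -K.a * sin x.2 ^ 2 * K.bigT x / (K.SigmaFn x * K.Xi ^ 2);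
       0, K.SigmaFn x / K.Delta x.1, 0, 0;
       0, 0, K.SigmaFn x / K.PiFn x, 0;
       -K.a * sin x.2 ^ 2 * K.bigT x / (K.SigmaFn x * K.Xi ^ 2), 0, 0, K.gphi x] := by
  have h1 := K.metric_tphi x
  have h2 := K.metric_phiphi x
  have h3 : K.metric x 3 0 = K.metric x 0 3 := by
    simp [metric, tau, sig, Matrix.vecMulVec]; ring
  ext i j
  fin_cases i <;> fin_cases j
  all_goals first
    | rfl
    | (simp only [Fin.zero_eta, Fin.reduceFinMk]; simpa using h1)
    | (simp only [Fin.zero_eta, Fin.reduceFinMk]; simpa using h2)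
    | (simp only [Fin.zero_eta, Fin.reduceFinMk]; rw [h3]; simpa using h1)
    | (simp [metric, tau, sig, Matrix.vecMulVec, Matrix.vecHead, Matrix.vecTail])

/-- The determinant of the `(t, φ)` block. -/
theorem metric_block_det (x : ℝ × ℝ) (hx : K.SigmaFn x ≠ 0) :
    K.metric x 0 0 * K.gphi x - (-K.a * sin x.2 ^ 2 * K.bigT x / (K.SigmaFn x * K.Xi ^ 2)) ^ 2
      = -(K.Delta x.1 * K.PiFn x * sin x.2 ^ 2 / K.Xi ^ 4) := by
  have hX := K.Xi_pos.ne'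
  rw [metric_tt, gphi, bigT_eq, bigB_eq]
  field_simp
  rw [SigmaFn_eq]
  ring

variable {K}
variable {x : ℝ × ℝ}

theorem sin_pos_of_mem_quot (hx : x ∈ K.quot) : 0 < sin x.2 :=
  sin_pos_of_mem_Ioo hx.2

theorem gphi_pos (hx : x ∈ K.quot) : 0 < K.gphi x := by
  have := sin_pos_of_mem_quot hx
  have := SigmaFn_pos hx.1
  have := bigB_pos hx.1
  have := K.Xi_pos
  unfold gphi; positivity

theorem exp_two_gam (hx : x ∈ K.quot) : exp (2 * K.gam x) = K.gphi x := by
  rw [gam, metric_phiphi, mul_div_cancel₀ _ two_ne_zero, exp_log (gphi_pos hx)]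

theorem exp_neg_two_gam (hx : x ∈ K.quot) : exp (-2 * K.gam x) = (K.gphi x)⁻¹ := by
  rw [← exp_two_gam hx, ← exp_neg]; ring_nf

theorem exp_neg_four_gam (hx : x ∈ K.quot) : exp (-4 * K.gam x) = (K.gphi x ^ 2)⁻¹ := by
  rw [← exp_two_gam hx, ← exp_nat_mul, ← exp_neg]; push_cast; ring_nf

theorem twistForm_zero (hx : x.1 ∈ Ioo K.rp K.rc) (hs : sin x.2 ≠ 0) :
    K.twistForm x 0 = K.twistT x := by
  have h0 : (0 : Fin 3).castSucc = (0 : Fin 4) := rfl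
  have := (SigmaFn_pos hx).ne'
  have := (bigB_pos hx).ne'
  have := K.Xi_pos.ne'
  rw [twistForm, h0, metric_tphi, metric_phiphi, gphi, twistT]
  field_simp

/-- Only the (t, φ) block of the metric is not diagonal, and passing to the quotient completes the
square in dφ. The new tt entry is therefore the determinant of that block. -/
theorem quotMetric_eq (hx : x ∈ K.quot) : K.quotMetric x =
    Matrix.diagonal ![-(K.Delta x.1 * K.PiFn x * sin x.2 ^ 2 / K.Xi ^ 4),
      K.gphi x * K.SigmaFn x / K.Delta x.1, K.gphi x * K.SigmaFn x / K.PiFn x] := by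
  have hG := (gphi_pos hx).ne'
  have hdet := K.metric_block_det x (SigmaFn_pos hx.1).ne'
  have h33 := K.metric_phiphi x
  have h03 := K.metric_tphi x
  ext i j
  simp only [quotMetric, exp_two_gam hx, twistForm, h33]
  rw [← h03] at hdet
  have hm := K.metric_eq x
  rw [← h03] at hm
  have e13 : K.metric x 1 3 = 0 := by rw [hm]; rfl
  have e23 : K.metric x 2 3 = 0 := by rw [hm]; rfl
  have e01 : K.metric x 0 1 = 0 := by rw [hm]; rfl
  have e02 : K.metric x 0 2 = 0 := by rw [hm]; rfl
  have e12 : K.metric x 1 2 = 0 := by rw [hm]; rfl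
  have e21 : K.metric x 2 1 = 0 := by rw [hm]; rfl
  have e10 : K.metric x 1 0 = 0 := by rw [hm]; rfl
  have e20 : K.metric x 2 0 = 0 := by rw [hm]; rfl
  have e11 : K.metric x 1 1 = K.SigmaFn x / K.Delta x.1 := by rw [hm]; rfl
  have e22 : K.metric x 2 2 = K.SigmaFn x / K.PiFn x := by rw [hm]; rfl
  fin_cases i <;> fin_cases j
  · have : (0 : Fin 3).castSucc = (0 : Fin 4) := rfl
    simp [this]
    rw [← hdet]
    field_simp
  all_goals simp [Matrix.diagonal, e13, e23, e01, e02, e12, e21, e10, e20, e11, e22]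
  all_goals ring

theorem N_eq (hx : x ∈ K.quot) : K.N x = √(K.Delta x.1 * K.PiFn x) * sin x.2 / K.Xi ^ 2 := by
  have hS := sin_pos_of_mem_quot hx
  have hD := Delta_pos hx.1
  have hP := K.PiFn_pos x
  have hX := K.Xi_pos
  have hG := gphi_pos hx
  have hSi := SigmaFn_pos hx.1
  have hpos : 0 < K.Delta x.1 * K.PiFn x * sin x.2 ^ 2 / K.Xi ^ 4 := by positivity
  have hinv : (K.quotMetric x)⁻¹ 0 0 = (-(K.Delta x.1 * K.PiFn x * sin x.2 ^ 2 / K.Xi ^ 4))⁻¹ := by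
    rw [quotMetric_eq hx, Matrix.inv_diagonal]
    rw [Matrix.diagonal_apply_eq]
    -- The inverse of a diagonal matrix is expressed by `Ring.inverse` of the vector of entries,
    -- which is the componentwise inverse only once this vector is known to be a unit.
    have hu : IsUnit ![-(K.Delta x.1 * K.PiFn x * sin x.2 ^ 2 / K.Xi ^ 4),
      K.gphi x * K.SigmaFn x / K.Delta x.1, K.gphi x * K.SigmaFn x / K.PiFn x] := by
      rw [Pi.isUnit_iff]
      intro i
      fin_cases i
      · exact (neg_ne_zero.2 hpos.ne').isUnit
      · exact (show K.gphi x * K.SigmaFn x / K.Delta x.1 ≠ 0 by positivity).isUnit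
      · exact (show K.gphi x * K.SigmaFn x / K.PiFn x ≠ 0 by positivity).isUnit
    rw [Ring.inverse_of_isUnit hu]
    have := congrFun hu.mul_val_inv 0
    simp only [Pi.mul_apply, Matrix.cons_val_zero, Pi.one_apply] at this
    exact eq_inv_of_mul_eq_one_right this
  rw [N, lapse, hinv, inv_neg, neg_neg, one_div, ← Real.sqrt_inv, inv_inv]
  rw [show K.Delta x.1 * K.PiFn x * sin x.2 ^ 2 / K.Xi ^ 4
    = (K.Delta x.1 * K.PiFn x) * (sin x.2 / K.Xi ^ 2) ^ 2 by ring]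
  rw [Real.sqrt_mul (by positivity), Real.sqrt_sq (by positivity)]
  ring

theorem q_eq (hx : x ∈ K.quot) : K.q x =
    Matrix.diagonal ![K.gphi x * K.SigmaFn x / K.Delta x.1,
      K.gphi x * K.SigmaFn x / K.PiFn x] := by
  rw [q, quotMetric_eq hx, spatialMetric]
  ext i j
  fin_cases i <;> fin_cases j <;> simp [Matrix.diagonal]

theorem q_inv (hx : x ∈ K.quot) : (K.q x)⁻¹ =
    Matrix.diagonal ![K.Delta x.1 / (K.gphi x * K.SigmaFn x),
      K.PiFn x / (K.gphi x * K.SigmaFn x)] := by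
  have hD := Delta_pos hx.1
  have hP := K.PiFn_pos x
  have hG := gphi_pos hx
  have hSi := SigmaFn_pos hx.1
  apply Matrix.inv_eq_right_inv
  rw [q_eq hx, Matrix.diagonal_mul_diagonal, ← Matrix.diagonal_one]
  congr 1
  ext i
  fin_cases i
  · simp; field_simp
  · simp; field_simp

theorem muq_eq (hx : x ∈ K.quot) :
    K.muq x = K.gphi x * K.SigmaFn x / √(K.Delta x.1 * K.PiFn x) := by
  have hD := Delta_pos hx.1
  have hP := K.PiFn_pos x
  have hG := gphi_pos hx
  have hSi := SigmaFn_pos hx.1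
  rw [muq, q_eq hx, Matrix.det_diagonal, Fin.prod_univ_two]
  simp only [Matrix.cons_val_zero, Matrix.cons_val_one]
  rw [show K.gphi x * K.SigmaFn x / K.Delta x.1 * (K.gphi x * K.SigmaFn x / K.PiFn x)
    = (K.gphi x * K.SigmaFn x) ^ 2 / (K.Delta x.1 * K.PiFn x) by field_simp]
  rw [Real.sqrt_div (by positivity), Real.sqrt_sq (by positivity)]

theorem sqrt_Delta_PiFn_pos (hx : x ∈ K.quot) : 0 < √(K.Delta x.1 * K.PiFn x) :=
  Real.sqrt_pos.2 (mul_pos (Delta_pos hx.1) (K.PiFn_pos x))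

theorem N_mul_muq (hx : x ∈ K.quot) : K.N x * K.muq x = K.nu x * K.gphi x := by
  have := (sqrt_Delta_PiFn_pos hx).ne'
  have := K.Xi_pos.ne'
  rw [N_eq hx, muq_eq hx, nu]
  field_simp

theorem N_mul_muq_inv (hx : x ∈ K.quot) : K.N x * (K.muq x)⁻¹ = K.wgt x * (K.gphi x)⁻¹ := by
  have h := Real.sq_sqrt (mul_pos (Delta_pos hx.1) (K.PiFn_pos x)).le
  have := (sqrt_Delta_PiFn_pos hx).ne'
  have := K.Xi_pos.ne'
  have := (gphi_pos hx).ne'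
  have := (SigmaFn_pos hx.1).ne'
  rw [N_eq hx, muq_eq hx, wgt]
  field_simp
  linear_combination sin x.2 * h

theorem N_sq (hx : x ∈ K.quot) : K.N x ^ 2 = K.wgt x * K.nu x := by
  have h := Real.sq_sqrt (mul_pos (Delta_pos hx.1) (K.PiFn_pos x)).le
  have := K.Xi_pos.ne'
  have := (SigmaFn_pos hx.1).ne'
  rw [N_eq hx, wgt, nu, div_pow, mul_pow, h]
  field_simp

/-- With `N_mul_muq` this says that N μ_q q^{bb} is `kap b`. In two dimensions μ_q q^{ab} is
conformally invariant, so the common factor e^{2γ} Σ₀ of q drops out of `kap`. -/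
theorem nu_mul_q_inv (hx : x ∈ K.quot) (b : Fin 2) :
    K.nu x * (K.q x)⁻¹ b b = K.kap b x / K.gphi x := by
  have := K.Xi_pos.ne'
  have := (gphi_pos hx).ne'
  have := (SigmaFn_pos hx.1).ne'
  rw [q_inv hx, Matrix.diagonal_apply_eq, nu, kap]
  fin_cases b
  · simp; field_simp
  · simp; field_simp

theorem q_inv_off_diag (hx : x ∈ K.quot) {b c : Fin 2} (h : b ≠ c) : (K.q x)⁻¹ b c = 0 := by
  rw [q_inv hx, Matrix.diagonal_apply_ne _ h]

/-- The inner product of `q`, weighted. -/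
theorem nu_mul_qInner (hx : x ∈ K.quot) (α β : Fin 2 → ℝ) :
    K.nu x * K.qInner x α β = (∑ b, K.kap b x * α b * β b) / K.gphi x := by
  have h0 := nu_mul_q_inv hx 0
  have h1 := nu_mul_q_inv hx 1
  have h2 := q_inv_off_diag hx (b := 0) (c := 1) (by decide)
  have h3 := q_inv_off_diag hx (b := 1) (c := 0) (by decide)
  simp only [qInner, Fin.sum_univ_two, h2, h3]
  linear_combination (α 0 * β 0) * h0 + (α 1 * β 1) * h1

theorem kap_pos (hx : x ∈ K.quot) (b : Fin 2) : 0 < K.kap b x := by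
  have := sin_pos_of_mem_quot hx
  have := Delta_pos hx.1
  have := K.PiFn_pos x
  have := K.Xi_pos
  unfold kap
  split_ifs <;> positivity

theorem wgt_pos (hx : x ∈ K.quot) : 0 < K.wgt x := by
  have := sin_pos_of_mem_quot hx
  have := Delta_pos hx.1
  have := K.PiFn_pos x
  have := K.Xi_pos
  have := SigmaFn_pos hx.1
  unfold wgt
  positivity

theorem nu_pos (hx : x ∈ K.quot) : 0 < K.nu x := by
  have := sin_pos_of_mem_quot hx
  have := K.Xi_pos
  have := SigmaFn_pos hx.1
  unfold nu
  positivity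

variable (K)

theorem isOpen_quot : IsOpen K.quot := isOpen_Ioo.prod isOpen_Ioo

theorem quot_subset_quotAxis : K.quot ⊆ K.quotAxis :=
  prod_mono_right Ioo_subset_Icc_self

end KerrDeSitter

end

/-! ### Partial derivatives, and the background equations for 𝒜_t, ω and γ. -/

noncomputable section

/-! ### Calculus of partial derivatives on the quotient -/

section PartialDerivatives

variable {f g : ℝ × ℝ → ℝ} {x : ℝ × ℝ} {U : Set (ℝ × ℝ)}

theorem pd_add (b : Fin 2) (hf : DifferentiableAt ℝ f x) (hg : DifferentiableAt ℝ g x) :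
    pd b (fun y => f y + g y) x = pd b f x + pd b g x := by
  simp only [pd, fderiv_fun_add hf hg, add_apply]

theorem pd_sub (b : Fin 2) (hf : DifferentiableAt ℝ f x) (hg : DifferentiableAt ℝ g x) :
    pd b (fun y => f y - g y) x = pd b f x - pd b g x := by
  simp only [pd, fderiv_fun_sub hf hg, sub_apply]

theorem pd_mul (b : Fin 2) (hf : DifferentiableAt ℝ f x) (hg : DifferentiableAt ℝ g x) :
    pd b (fun y => f y * g y) x = f x * pd b g x + g x * pd b f x := by
  simp only [pd, fderiv_fun_mul hf hg, add_apply,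
    smul_apply, smul_eq_mul]

theorem pd_neg (b : Fin 2) : pd b (fun y => -f y) x = -pd b f x := by
  simp only [pd, fderiv_fun_neg, neg_apply]

theorem pd_const_mul (b : Fin 2) (c : ℝ) (hf : DifferentiableAt ℝ f x) :
    pd b (fun y => c * f y) x = c * pd b f x := by
  simp only [pd, fderiv_const_mul hf, smul_apply, smul_eq_mul]

theorem pd_congr (b : Fin 2) (hU : IsOpen U) (h : EqOn f g U) (hx : x ∈ U) :
    pd b f x = pd b g x := by
  simp only [pd, (Filter.eventuallyEq_of_mem (hU.mem_nhds hx) h).fderiv_eq]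

theorem hasDerivAt_pd_zero (hf : DifferentiableAt ℝ f x) :
    HasDerivAt (fun r => f (r, x.2)) (pd 0 f x) x.1 := by
  have h1 : HasDerivAt (fun r : ℝ => ((r, x.2) : ℝ × ℝ)) (1, 0) x.1 :=
    (hasDerivAt_id x.1).prodMk (hasDerivAt_const x.1 x.2)
  exact hf.hasFDerivAt.comp_hasDerivAt x.1 h1

theorem hasDerivAt_pd_one (hf : DifferentiableAt ℝ f x) :
    HasDerivAt (fun θ => f (x.1, θ)) (pd 1 f x) x.2 := by
  have h1 : HasDerivAt (fun θ : ℝ => ((x.1, θ) : ℝ × ℝ)) (0, 1) x.2 :=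
    (hasDerivAt_const x.2 x.1).prodMk (hasDerivAt_id x.2)
  exact hf.hasFDerivAt.comp_hasDerivAt x.2 h1

/-- Once differentiability is known, `pd` may be computed by one-variable calculus along a
coordinate line. All derivatives of the background are obtained in this way. -/
theorem pd_zero_eq (hf : DifferentiableAt ℝ f x) {f' : ℝ}
    (h : HasDerivAt (fun r => f (r, x.2)) f' x.1) : pd 0 f x = f' :=
  (hasDerivAt_pd_zero hf).unique h

theorem pd_one_eq (hf : DifferentiableAt ℝ f x) {f' : ℝ}
    (h : HasDerivAt (fun θ => f (x.1, θ)) f' x.2) : pd 1 f x = f' :=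
  (hasDerivAt_pd_one hf).unique h

theorem fderiv_eq_pd (f : ℝ × ℝ → ℝ) (x y : ℝ × ℝ) :
    fderiv ℝ f x y = y.1 * pd 0 f x + y.2 * pd 1 f x := by
  have : y = y.1 • ((1, 0) : ℝ × ℝ) + y.2 • ((0, 1) : ℝ × ℝ) := by ext <;> simp
  conv_lhs => rw [this, map_add, map_smul, map_smul]
  simp [pd]

theorem ContDiffOn.pd (hf : ContDiffOn ℝ ∞ f U) (hU : IsOpen U) (b : Fin 2) :
    ContDiffOn ℝ ∞ (pd b f) U := by
  have := hf.fderiv_of_isOpen hU (m := ∞) (by simp)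
  exact this.clm_apply contDiffOn_const

theorem ContDiffOn.differentiableAt_of_isOpen {n : WithTop ℕ∞} (hf : ContDiffOn ℝ n f U)
    (hU : IsOpen U) (hn : n ≠ 0) (hx : x ∈ U) : DifferentiableAt ℝ f x :=
  (hf.contDiffAt (hU.mem_nhds hx)).differentiableAt hn

theorem pd_comm (hf : ContDiffOn ℝ ∞ f U) (hU : IsOpen U) (hx : x ∈ U) :
    pd 0 (pd 1 f) x = pd 1 (pd 0 f) x := by
  have hd : DifferentiableAt ℝ (fderiv ℝ f) x :=
    (hf.fderiv_of_isOpen hU (m := 1) (by norm_cast)).contDiffAt (hU.mem_nhds hx)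
      |>.differentiableAt (by simp)
  have hs : IsSymmSndFDerivAt ℝ f x :=
    (hf.contDiffAt (hU.mem_nhds hx)).isSymmSndFDerivAt (by simp; norm_cast)
  have h := hs (1, 0) (0, 1)
  have h1 : ∀ v w : ℝ × ℝ, fderiv ℝ (fun y => fderiv ℝ f y w) x v
      = fderiv ℝ (fderiv ℝ f) x v w := by
    intro v w
    rw [fderiv_clm_apply hd (differentiableAt_const w)]
    simp
  unfold pd
  simpa [h1] using h

end PartialDerivatives

namespace KerrDeSitter

variable (K : KerrDeSitter)

/-! ### Smoothness of the background -/

/-- The coordinate domain `(r, θ)` with `θ` unrestricted. -/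
def strip : Set (ℝ × ℝ) := Ioo K.rp K.rc ×ˢ univ

theorem isOpen_strip : IsOpen K.strip := isOpen_Ioo.prod isOpen_univ

theorem quot_subset_strip : K.quot ⊆ K.strip := prod_mono_right (subset_univ _)

theorem quotAxis_subset_strip : K.quotAxis ⊆ K.strip := prod_mono_right (subset_univ _)

theorem contDiff_Delta : ContDiff ℝ ∞ K.Delta := by
  unfold Delta; fun_prop

theorem contDiff_SigmaFn : ContDiff ℝ ∞ K.SigmaFn := by
  unfold SigmaFn; fun_prop

theorem contDiff_PiFn : ContDiff ℝ ∞ K.PiFn := by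
  unfold PiFn; fun_prop

theorem contDiff_bigB : ContDiff ℝ ∞ K.bigB := by
  have := K.contDiff_SigmaFn
  unfold bigB; fun_prop

theorem contDiff_bigT : ContDiff ℝ ∞ K.bigT := by
  have := K.contDiff_SigmaFn
  unfold bigT; fun_prop

theorem contDiff_kap (b : Fin 2) : ContDiff ℝ ∞ (K.kap b) := by
  have := K.contDiff_PiFn
  have := K.contDiff_Delta
  unfold kap
  split_ifs <;> fun_prop

theorem contDiff_nu : ContDiff ℝ ∞ K.nu := by
  have := K.contDiff_SigmaFn
  unfold nu; fun_prop

theorem contDiffOn_wgt : ContDiffOn ℝ ∞ K.wgt K.strip := by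
  have := K.contDiff_SigmaFn.contDiffOn (s := K.strip)
  have := K.contDiff_PiFn.contDiffOn (s := K.strip)
  have := (K.contDiff_Delta.comp contDiff_fst).contDiffOn (s := K.strip)
  unfold wgt
  refine ContDiffOn.div (by fun_prop) (by fun_prop) fun x hx => ?_
  exact (mul_pos (pow_pos K.Xi_pos 2) (SigmaFn_pos hx.1)).ne'

theorem contDiffOn_twistT : ContDiffOn ℝ ∞ K.twistT K.strip := by
  have := K.contDiff_bigB.contDiffOn (s := K.strip)
  have := K.contDiff_bigT.contDiffOn (s := K.strip)
  unfold twistT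
  exact ContDiffOn.div (by fun_prop) (by fun_prop) fun x hx => (bigB_pos hx.1).ne'

theorem contDiffOn_gphi : ContDiffOn ℝ ∞ K.gphi K.strip := by
  have := K.contDiff_SigmaFn.contDiffOn (s := K.strip)
  have := K.contDiff_bigB.contDiffOn (s := K.strip)
  unfold gphi
  refine ContDiffOn.div (by fun_prop) (by fun_prop) fun x hx => ?_
  exact (mul_pos (SigmaFn_pos hx.1) (pow_pos K.Xi_pos 2)).ne'

theorem gam_eq (x : ℝ × ℝ) : K.gam x = log (K.gphi x) / 2 := by
  rw [gam, metric_phiphi]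

theorem contDiffOn_gam : ContDiffOn ℝ ∞ K.gam K.quot := by
  have h : ContDiffOn ℝ ∞ (fun x => log (K.gphi x) / 2) K.quot :=
    ((K.contDiffOn_gphi.mono K.quot_subset_strip).log fun x hx => (gphi_pos hx).ne').div_const 2
  exact h.congr fun x _ => K.gam_eq x

theorem twistForm_eqOn : EqOn (fun y => K.twistForm y 0) K.twistT K.quot :=
  fun _ hx => twistForm_zero hx.1 (sin_pos_of_mem_quot hx).ne'

variable {K} {x : ℝ × ℝ} {om : ℝ × ℝ → ℝ}

/-! ### Derivatives of the background -/

theorem hasDerivAt_Delta (r : ℝ) : HasDerivAt K.Delta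
    (2 * r - 2 * K.m - K.Lam / 3 * (4 * r ^ 3 + 2 * K.a ^ 2 * r)) r := by
  have h : HasDerivAt (fun r : ℝ => r) 1 r := hasDerivAt_id r
  have := (((h.pow 2).sub (h.const_mul (2 * K.m))).add_const (K.a ^ 2)).sub
    ((((h.pow 2).const_mul K.Lam).div_const 3).mul ((h.pow 2).add_const (K.a ^ 2)))
  refine this.congr_deriv ?_
  simp
  ring

theorem hasDerivAt_SigmaFn_r (r θ : ℝ) : HasDerivAt (fun r => K.SigmaFn (r, θ)) (2 * r) r := by
  have h : HasDerivAt (fun r : ℝ => r) 1 r := hasDerivAt_id r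
  exact ((h.pow 2).add_const (K.a ^ 2 * cos θ ^ 2)).congr_deriv (by simp)

theorem hasDerivAt_SigmaFn_θ (r θ : ℝ) :
    HasDerivAt (fun θ => K.SigmaFn (r, θ)) (-(2 * K.a ^ 2 * sin θ * cos θ)) θ := by
  have h := (((hasDerivAt_cos θ).pow 2).const_mul (K.a ^ 2)).const_add (r ^ 2)
  exact h.congr_deriv (by simp; ring)

/-- `∂_r` of `bigB`. -/
def bigBr (K : KerrDeSitter) (x : ℝ × ℝ) : ℝ :=
  K.Xi * (2 * x.1 * K.SigmaFn x + (x.1 ^ 2 + K.a ^ 2) * (2 * x.1)) + 2 * K.m * K.a ^ 2 * sin x.2 ^ 2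

/-- The derivative of `bigB` with respect to `sin² θ`. -/
def bigBs (K : KerrDeSitter) (r : ℝ) : ℝ :=
  K.a ^ 2 * (2 * K.m * r - K.Xi * (r ^ 2 + K.a ^ 2))

theorem hasDerivAt_bigB_r (r θ : ℝ) :
    HasDerivAt (fun r => K.bigB (r, θ)) (K.bigBr (r, θ)) r := by
  have h : HasDerivAt (fun r : ℝ => r) 1 r := hasDerivAt_id r
  have := ((((h.pow 2).add_const (K.a ^ 2)).const_mul K.Xi).mul (hasDerivAt_SigmaFn_r (K := K) r θ)).add
    (((h.const_mul (2 * K.m)).mul_const (K.a ^ 2)).mul_const (sin θ ^ 2))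
  refine this.congr_deriv ?_
  simp [bigBr]
  ring

theorem hasDerivAt_bigBr_r (r θ : ℝ) : HasDerivAt (fun r => K.bigBr (r, θ))
    (K.Xi * (2 * K.SigmaFn (r, θ) + 10 * r ^ 2 + 2 * K.a ^ 2)) r := by
  have h : HasDerivAt (fun r : ℝ => r) 1 r := hasDerivAt_id r
  have := ((((h.const_mul 2).mul (hasDerivAt_SigmaFn_r (K := K) r θ)).add
    (((h.pow 2).add_const (K.a ^ 2)).mul (h.const_mul 2))).const_mul K.Xi).add_const
    (2 * K.m * K.a ^ 2 * sin θ ^ 2)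
  refine this.congr_deriv ?_
  simp only [Pi.pow_apply, Nat.cast_ofNat, Nat.add_one_sub_one, pow_one]
  ring

theorem hasDerivAt_bigB_θ (r θ : ℝ) :
    HasDerivAt (fun θ => K.bigB (r, θ)) (2 * sin θ * cos θ * K.bigBs r) θ := by
  have := ((hasDerivAt_SigmaFn_θ (K := K) r θ).const_mul (K.Xi * (r ^ 2 + K.a ^ 2))).add
    (((hasDerivAt_sin θ).pow 2).const_mul (2 * K.m * r * K.a ^ 2))
  refine this.congr_deriv ?_
  simp [bigBs]
  ring

theorem hasDerivAt_bigT_r (r θ : ℝ) : HasDerivAt (fun r => K.bigT (r, θ))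
    (K.Lam / 3 * (2 * r * K.SigmaFn (r, θ) + (r ^ 2 + K.a ^ 2) * (2 * r)) + 2 * K.m) r := by
  have h : HasDerivAt (fun r : ℝ => r) 1 r := hasDerivAt_id r
  have := ((((h.pow 2).add_const (K.a ^ 2)).const_mul (K.Lam / 3)).mul
    (hasDerivAt_SigmaFn_r (K := K) r θ)).add (h.const_mul (2 * K.m))
  refine this.congr_deriv ?_
  simp
  ring

theorem hasDerivAt_bigT_θ (r θ : ℝ) : HasDerivAt (fun θ => K.bigT (r, θ))
    (-(2 * K.Lam / 3 * (r ^ 2 + K.a ^ 2) * K.a ^ 2 * sin θ * cos θ)) θ := by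
  have := ((hasDerivAt_SigmaFn_θ (K := K) r θ).const_mul
    (K.Lam / 3 * (r ^ 2 + K.a ^ 2))).add_const (2 * K.m * r)
  refine this.congr_deriv ?_
  ring

/-- `∂_r ω` of every gravitational twist potential. -/
def omr (K : KerrDeSitter) (x : ℝ × ℝ) : ℝ :=
  -(4 * K.m * K.a ^ 3 * x.1 * cos x.2 * sin x.2 ^ 4) / (K.SigmaFn x ^ 2 * K.Xi ^ 2)

/-- `∂_θ ω` of every gravitational twist potential. -/
def omθ (K : KerrDeSitter) (x : ℝ × ℝ) : ℝ :=
  -(2 * K.m * K.a * sin x.2 ^ 3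
    * (2 * x.1 ^ 2 * (x.1 ^ 2 + K.a ^ 2) + K.SigmaFn x * (x.1 ^ 2 - K.a ^ 2)))
    / (K.SigmaFn x ^ 2 * K.Xi ^ 2)

/-- Half of the duality between d𝒜_t and dω, the other half being `pd_one_twistT`. After the
denominators are cleared and Σ₀ and cos² θ are replaced by sin² θ, it is a polynomial identity. -/
theorem pd_zero_twistT (hx : x ∈ K.quot) :
    pd 0 K.twistT x = -(K.kap 1 x * K.omθ x / K.gphi x ^ 2) := by
  have hB := (bigB_pos hx.1).ne'
  have hS := (sin_pos_of_mem_quot hx).ne'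
  have hSi := (SigmaFn_pos hx.1).ne'
  have hX := K.Xi_pos.ne'
  refine pd_zero_eq (ContDiffOn.differentiableAt_of_isOpen K.contDiffOn_twistT K.isOpen_strip
    (by simp) (K.quot_subset_strip hx)) ?_
  have := ((hasDerivAt_bigT_r (K := K) x.1 x.2).const_mul (-K.a)).div
    (hasDerivAt_bigB_r (K := K) x.1 x.2) hB
  refine this.congr_deriv ?_
  simp only [Prod.mk.eta, kap, omθ, gphi]
  rw [if_neg one_ne_zero]
  field_simp
  have h1 : K.SigmaFn x = x.1 ^ 2 + K.a ^ 2 - K.a ^ 2 * sin x.2 ^ 2 := K.SigmaFn_eq x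
  simp only [bigBr, bigB, bigT, Xi, PiFn, cos_sq', h1]
  ring

theorem pd_one_twistT (hx : x ∈ K.quot) :
    pd 1 K.twistT x = K.kap 0 x * K.omr x / K.gphi x ^ 2 := by
  have hB := (bigB_pos hx.1).ne'
  have hS := (sin_pos_of_mem_quot hx).ne'
  have hSi := (SigmaFn_pos hx.1).ne'
  have hX := K.Xi_pos.ne'
  refine pd_one_eq (ContDiffOn.differentiableAt_of_isOpen K.contDiffOn_twistT K.isOpen_strip
    (by simp) (K.quot_subset_strip hx)) ?_
  have := ((hasDerivAt_bigT_θ (K := K) x.1 x.2).const_mul (-K.a)).div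
    (hasDerivAt_bigB_θ (K := K) x.1 x.2) hB
  refine this.congr_deriv ?_
  simp only [Prod.mk.eta, kap, omr, gphi, if_true]
  field_simp
  have h1 : K.SigmaFn x = x.1 ^ 2 + K.a ^ 2 - K.a ^ 2 * sin x.2 ^ 2 := K.SigmaFn_eq x
  simp only [bigBs, bigB, bigT, Xi, Delta, h1]
  ring

/-- `q` is diagonal, so that the twist equation reads `∂_r 𝒜_t = -k_θ ∂_θ ω / e^{4γ}`,
`∂_θ 𝒜_t = k_r ∂_r ω / e^{4γ}`. -/
theorem twist_equation_iff (hx : x ∈ K.quot) :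
    (∀ b : Fin 2, pd b (fun y => K.twistForm y 0) x
      + K.N x * exp (-4 * K.gam x) *
        ∑ c, ∑ d, eps2 b c * K.muq x * (K.q x)⁻¹ c d * pd d om x = 0) ↔
      pd 0 om x = K.omr x ∧ pd 1 om x = K.omθ x := by
  have hG := (gphi_pos hx).ne'
  have k0 := (kap_pos hx 0).ne'
  have k1 := (kap_pos hx 1).ne'
  have h0 := nu_mul_q_inv hx 0
  have h1 := nu_mul_q_inv hx 1
  have h2 := q_inv_off_diag hx (b := 0) (c := 1) (by decide)
  have h3 := q_inv_off_diag hx (b := 1) (c := 0) (by decide)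
  have hN := N_mul_muq hx
  have e0 : K.N x * exp (-4 * K.gam x) *
        ∑ c, ∑ d, eps2 0 c * K.muq x * (K.q x)⁻¹ c d * pd d om x
        = K.kap 1 x * pd 1 om x / K.gphi x ^ 2 := by
    simp only [Fin.sum_univ_two, h2, h3, eps2, exp_neg_four_gam hx]
    simp
    field_simp at h1 ⊢
    linear_combination (K.q x)⁻¹ 1 1 * pd 1 om x * hN + pd 1 om x * h1
  have e1 : K.N x * exp (-4 * K.gam x) *
        ∑ c, ∑ d, eps2 1 c * K.muq x * (K.q x)⁻¹ c d * pd d om x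
        = -(K.kap 0 x * pd 0 om x / K.gphi x ^ 2) := by
    simp only [Fin.sum_univ_two, h2, h3, eps2, exp_neg_four_gam hx]
    simp
    field_simp at h0 ⊢
    linear_combination (K.q x)⁻¹ 0 0 * pd 0 om x * hN + pd 0 om x * h0
  rw [Fin.forall_fin_two, e0, e1, pd_congr 0 K.isOpen_quot K.twistForm_eqOn hx,
    pd_congr 1 K.isOpen_quot K.twistForm_eqOn hx, pd_zero_twistT hx, pd_one_twistT hx]
  constructor
  · rintro ⟨ha, hb⟩
    constructor
    · have : K.kap 0 x * (K.omr x - pd 0 om x) = 0 := by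
        field_simp at hb
        linear_combination hb
      linarith [(mul_eq_zero.1 this).resolve_left k0]
    · have : K.kap 1 x * (K.omθ x - pd 1 om x) = 0 := by
        field_simp at ha
        linear_combination -ha
      linarith [(mul_eq_zero.1 this).resolve_left k1]
  · rintro ⟨ha, hb⟩
    rw [ha, hb]
    constructor <;> ring

variable (K) in
/-- A gravitational twist potential in closed form. -/
def twistPotential (x : ℝ × ℝ) : ℝ :=
  2 * K.m * K.a / K.Xi ^ 2
    * (K.a ^ 2 * cos x.2 * sin x.2 ^ 4 / K.SigmaFn x + 3 * cos x.2 - cos x.2 ^ 3)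

variable (K) in
-- The quotient by Σ₀ carries all of the dependence on r, which fixes it from `omr`. The remaining
-- part 3 cos θ - cos³ θ has θ-derivative -3 sin³ θ and supplies what is still missing in `omθ`.
theorem isTwistPotential_twistPotential : K.IsTwistPotential K.twistPotential := by
  have hc : ContDiffOn ℝ ∞ K.twistPotential K.strip := by
    have h : ContDiffOn ℝ ∞ (fun x : ℝ × ℝ => K.a ^ 2 * cos x.2 * sin x.2 ^ 4 / K.SigmaFn x)
        K.strip :=
      ContDiffOn.div (by fun_prop) K.contDiff_SigmaFn.contDiffOn
        fun x hx => (SigmaFn_pos hx.1).ne'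
    exact contDiffOn_const.mul ((h.add (by fun_prop)).sub (by fun_prop))
  refine ⟨hc.mono K.quot_subset_strip, fun x hx => (twist_equation_iff hx).2 ?_⟩
  have hSi := (SigmaFn_pos hx.1).ne'
  have hX := K.Xi_pos.ne'
  have hd := ContDiffOn.differentiableAt_of_isOpen hc K.isOpen_strip
    (by simp) (K.quot_subset_strip hx)
  have h1 : K.SigmaFn x = x.1 ^ 2 + K.a ^ 2 - K.a ^ 2 * sin x.2 ^ 2 := K.SigmaFn_eq x
  constructor
  · refine pd_zero_eq hd ?_
    have := (((((hasDerivAt_const x.1 (K.a ^ 2 * cos x.2 * sin x.2 ^ 4)).div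
      (hasDerivAt_SigmaFn_r (K := K) x.1 x.2) hSi).add_const (3 * cos x.2)).sub_const
      (cos x.2 ^ 3)).const_mul (2 * K.m * K.a / K.Xi ^ 2))
    refine this.congr_deriv ?_
    simp only [Prod.mk.eta, omr]
    field_simp
    ring
  · refine pd_one_eq hd ?_
    have := ((((((hasDerivAt_cos x.2).const_mul (K.a ^ 2)).mul ((hasDerivAt_sin x.2).pow 4)).div
      (hasDerivAt_SigmaFn_θ (K := K) x.1 x.2) hSi).add ((hasDerivAt_cos x.2).const_mul 3)).sub
      ((hasDerivAt_cos x.2).pow 3)).const_mul (2 * K.m * K.a / K.Xi ^ 2)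
    refine this.congr_deriv ?_
    simp only [Prod.mk.eta, omθ]
    have hc : cos x.2 ^ 2 = 1 - sin x.2 ^ 2 := cos_sq' x.2
    simp
    field_simp
    ring_nf
    simp only [hc, h1]
    ring

theorem IsTwistPotential.pd_zero (h : K.IsTwistPotential om) (hx : x ∈ K.quot) :
    pd 0 om x = K.omr x := ((twist_equation_iff hx).1 (h.2 x hx)).1

theorem IsTwistPotential.pd_one (h : K.IsTwistPotential om) (hx : x ∈ K.quot) :
    pd 1 om x = K.omθ x := ((twist_equation_iff hx).1 (h.2 x hx)).2

variable (K) in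
/-- `∂_r γ`. -/
def gamr (x : ℝ × ℝ) : ℝ := (K.bigBr x / K.bigB x - 2 * x.1 / K.SigmaFn x) / 2

variable (K) in
/-- `tan θ ∂_θ γ`. -/
def gams (x : ℝ × ℝ) : ℝ :=
  1 + sin x.2 ^ 2 * (K.bigBs x.1 / K.bigB x + K.a ^ 2 / K.SigmaFn x)

theorem pd_zero_gam (hx : x ∈ K.quot) : pd 0 K.gam x = K.gamr x := by
  have hB := (bigB_pos hx.1).ne'
  have hS := (sin_pos_of_mem_quot hx).ne'
  have hSi := (SigmaFn_pos hx.1).ne'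
  have hX := K.Xi_pos.ne'
  have hG := (gphi_pos hx).ne'
  refine pd_zero_eq (ContDiffOn.differentiableAt_of_isOpen K.contDiffOn_gam K.isOpen_quot
    (by simp) hx) ?_
  have h1 := ((hasDerivAt_bigB_r (K := K) x.1 x.2).const_mul (sin x.2 ^ 2)).div
    ((hasDerivAt_SigmaFn_r (K := K) x.1 x.2).mul_const (K.Xi ^ 2))
    (mul_ne_zero hSi (pow_ne_zero 2 hX))
  have h2 := (h1.log hG).div_const 2
  simp only [gam_eq]
  refine h2.congr_deriv ?_
  simp only [Pi.div_apply, Prod.mk.eta, gamr]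
  field_simp

theorem pd_one_gam (hx : x ∈ K.quot) : pd 1 K.gam x = cos x.2 / sin x.2 * K.gams x := by
  have hB := (bigB_pos hx.1).ne'
  have hS := (sin_pos_of_mem_quot hx).ne'
  have hSi := (SigmaFn_pos hx.1).ne'
  have hX := K.Xi_pos.ne'
  have hG := (gphi_pos hx).ne'
  refine pd_one_eq (ContDiffOn.differentiableAt_of_isOpen K.contDiffOn_gam K.isOpen_quot
    (by simp) hx) ?_
  have h1 := (((hasDerivAt_sin x.2).pow 2).mul (hasDerivAt_bigB_θ (K := K) x.1 x.2)).div
    ((hasDerivAt_SigmaFn_θ (K := K) x.1 x.2).mul_const (K.Xi ^ 2))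
    (mul_ne_zero hSi (pow_ne_zero 2 hX))
  have h2 := (h1.log hG).div_const 2
  simp only [gam_eq]
  refine h2.congr_deriv ?_
  simp only [Pi.div_apply, Pi.mul_apply, Pi.pow_apply, Prod.mk.eta, gams]
  field_simp
  ring

/-- Here and in `pd_one_kap_mul_gam` the factor sin θ / Ξ² is pulled out, so that in `gam_equation`
it is common to all terms. -/
theorem pd_zero_kap_mul_gam (hx : x ∈ K.quot) :
    pd 0 (fun y => K.kap 0 y * pd 0 K.gam y) x =
      sin x.2 / K.Xi ^ 2 * ((2 * x.1 - 2 * K.m - K.Lam / 3 * (4 * x.1 ^ 3 + 2 * K.a ^ 2 * x.1))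
        * K.gamr x + K.Delta x.1 *
          (((K.Xi * (2 * K.SigmaFn x + 10 * x.1 ^ 2 + 2 * K.a ^ 2)) * K.bigB x - K.bigBr x ^ 2)
            / K.bigB x ^ 2 - (2 * K.SigmaFn x - 4 * x.1 ^ 2) / K.SigmaFn x ^ 2) / 2) := by
  have hB := (bigB_pos hx.1).ne'
  have hSi := (SigmaFn_pos hx.1).ne'
  have hX := K.Xi_pos.ne'
  have hd : DifferentiableAt ℝ (fun y => K.kap 0 y * pd 0 K.gam y) x :=
    ((K.contDiff_kap 0).contDiffOn.mul (K.contDiffOn_gam.pd K.isOpen_quot 0)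
      ).differentiableAt_of_isOpen K.isOpen_quot (by simp) hx
  refine pd_zero_eq hd ?_
  have h1 := (((hasDerivAt_bigBr_r (K := K) x.1 x.2).div
    (hasDerivAt_bigB_r (K := K) x.1 x.2) hB).sub
    (((hasDerivAt_id x.1).const_mul 2).div (hasDerivAt_SigmaFn_r (K := K) x.1 x.2) hSi)).div_const 2
  have h2 := (((hasDerivAt_Delta (K := K) x.1).mul_const (sin x.2)).div_const (K.Xi ^ 2)).mul h1
  -- The closed form of ∂_r γ is available only inside the quotient, hence only near the point.
  refine HasDerivAt.congr_of_eventuallyEq (h2.congr_deriv ?_) ?_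
  · simp only [Pi.div_apply, Pi.sub_apply, Prod.mk.eta, gamr, id]
    field_simp
    ring
  · filter_upwards [isOpen_Ioo.mem_nhds hx.1] with r hr
    have : (r, x.2) ∈ K.quot := ⟨hr, hx.2⟩
    rw [pd_zero_gam this]
    simp [kap, gamr]

theorem pd_one_kap_mul_gam (hx : x ∈ K.quot) :
    pd 1 (fun y => K.kap 1 y * pd 1 K.gam y) x =
      sin x.2 / K.Xi ^ 2 * (-(K.PiFn x * K.gams x) + 2 * (1 - sin x.2 ^ 2) *
        (-(K.Lam / 3 * K.a ^ 2) * K.gams x + K.PiFn x *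
          ((K.bigBs x.1 / K.bigB x + K.a ^ 2 / K.SigmaFn x) + sin x.2 ^ 2 *
            (-(K.bigBs x.1) ^ 2 / K.bigB x ^ 2 + K.a ^ 4 / K.SigmaFn x ^ 2)))) := by
  have hB := (bigB_pos hx.1).ne'
  have hSi := (SigmaFn_pos hx.1).ne'
  have hX := K.Xi_pos.ne'
  have hS := (sin_pos_of_mem_quot hx).ne'
  have hd : DifferentiableAt ℝ (fun y => K.kap 1 y * pd 1 K.gam y) x :=
    ((K.contDiff_kap 1).contDiffOn.mul (K.contDiffOn_gam.pd K.isOpen_quot 1)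
      ).differentiableAt_of_isOpen K.isOpen_quot (by simp) hx
  refine pd_one_eq hd ?_
  have hP := (((hasDerivAt_cos x.2).pow 2).const_mul (K.Lam / 3 * K.a ^ 2)).const_add 1
  have hg := (((hasDerivAt_sin x.2).pow 2).mul
    (((hasDerivAt_const x.2 (K.bigBs x.1)).div (hasDerivAt_bigB_θ (K := K) x.1 x.2) hB).add
    ((hasDerivAt_const x.2 (K.a ^ 2)).div (hasDerivAt_SigmaFn_θ (K := K) x.1 x.2) hSi))).const_add 1
  have h2 := ((hP.mul hg).mul (hasDerivAt_cos x.2)).div_const (K.Xi ^ 2)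
  refine HasDerivAt.congr_of_eventuallyEq (h2.congr_deriv ?_) ?_
  · simp only [Pi.div_apply, Pi.mul_apply, Pi.pow_apply, Pi.add_apply, Prod.mk.eta, gams, PiFn]
    have hc : cos x.2 ^ 2 = 1 - sin x.2 ^ 2 := cos_sq' x.2
    have hc4 : cos x.2 ^ 4 = (1 - sin x.2 ^ 2) ^ 2 := by rw [← hc]; ring
    field_simp
    simp
    ring_nf
    simp only [hc, hc4]
    ring
  · filter_upwards [isOpen_Ioo.mem_nhds hx.2] with θ hθ
    have : (x.1, θ) ∈ K.quot := ⟨hx.1, hθ⟩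
    have hs := (sin_pos_of_mem_quot this).ne'
    simp only at hs
    rw [pd_one_gam this]
    simp [kap, gams, PiFn]
    field_simp

/-- The Einstein equation for `γ`. -/
theorem gam_equation (h : K.IsTwistPotential om) (hx : x ∈ K.quot) :
    (∑ b, pd b (fun y => K.kap b y * pd b K.gam y) x)
      + (∑ b, K.kap b x * pd b om x ^ 2) / (2 * K.gphi x ^ 2) + K.Lam * K.nu x = 0 := by
  have hB := (bigB_pos hx.1).ne'
  have hSi := (SigmaFn_pos hx.1).ne'
  have hX := K.Xi_pos.ne'
  have hS := (sin_pos_of_mem_quot hx).ne'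
  rw [Fin.sum_univ_two, Fin.sum_univ_two, pd_zero_kap_mul_gam hx, pd_one_kap_mul_gam hx,
    h.pd_zero hx, h.pd_one hx]
  -- The zeros of dω and of e^{4γ} on the axes are cancelled here, so that this term too has the
  -- common factor sin θ / Ξ² and otherwise contains only even powers of sin θ.
  have hom : (K.kap 0 x * K.omr x ^ 2 + K.kap 1 x * K.omθ x ^ 2) / (2 * K.gphi x ^ 2) =
      sin x.2 / K.Xi ^ 2 * (2 * K.m ^ 2 * K.a ^ 2 * sin x.2 ^ 2 *
      (4 * K.Delta x.1 * K.a ^ 4 * (1 - sin x.2 ^ 2) * sin x.2 ^ 2 * x.1 ^ 2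
        + K.PiFn x * (2 * x.1 ^ 2 * (x.1 ^ 2 + K.a ^ 2) + K.SigmaFn x * (x.1 ^ 2 - K.a ^ 2)) ^ 2)
        / (K.bigB x ^ 2 * K.SigmaFn x ^ 2)) := by
    simp only [kap, omr, omθ, gphi, if_true]
    rw [if_neg one_ne_zero, ← cos_sq']
    field_simp
    ring
  rw [hom, nu, show K.Lam * (K.SigmaFn x * sin x.2 / K.Xi ^ 2)
    = sin x.2 / K.Xi ^ 2 * (K.Lam * K.SigmaFn x) by ring, ← mul_add, ← mul_add, ← mul_add]
  -- Without the common factor a rational identity in r and sin² θ remains, with denominators `bigB`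
  -- and `SigmaFn`.
  refine mul_eq_zero_of_right _ ?_
  have h1 : K.SigmaFn x = x.1 ^ 2 + K.a ^ 2 - K.a ^ 2 * sin x.2 ^ 2 := K.SigmaFn_eq x
  simp only [gamr, gams]
  field_simp
  simp only [bigB, bigBr, bigBs, Delta, PiFn, Xi, cos_sq', h1]
  ring

/-- By duality the two components are ∂_θ 𝒜_t and -∂_r 𝒜_t, so the divergence is a commutator of
second derivatives. -/
theorem twist_divergence (h : K.IsTwistPotential om) (hx : x ∈ K.quot) :
    ∑ b, pd b (fun y => K.kap b y * pd b om y / K.gphi y ^ 2) x = 0 := by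
  have h0 : EqOn (fun y => K.kap 0 y * pd 0 om y / K.gphi y ^ 2) (pd 1 K.twistT) K.quot := by
    intro y hy
    simp only
    rw [pd_one_twistT hy, h.pd_zero hy]
  have h1 : EqOn (fun y => K.kap 1 y * pd 1 om y / K.gphi y ^ 2)
      (fun y => -pd 0 K.twistT y) K.quot := by
    intro y hy
    simp only
    rw [pd_zero_twistT hy, h.pd_one hy, neg_neg]
  rw [Fin.sum_univ_two, pd_congr 0 K.isOpen_quot h0 hx, pd_congr 1 K.isOpen_quot h1 hx, pd_neg,
    pd_comm (K.contDiffOn_twistT.mono K.quot_subset_strip) K.isOpen_quot hx]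
  ring

end KerrDeSitter

end

/-! ### Energy densities as sums of squares, and the field equations in closed form. -/

noncomputable section

namespace KerrDeSitter

variable {K : KerrDeSitter} {x : ℝ × ℝ} {om : ℝ × ℝ → ℝ} {P : PhasePoint} {Q : ℝ → PhasePoint}

/-! ### The densities in closed form -/

theorem N_mul_muq_mul_qInner (hx : x ∈ K.quot) (α β : Fin 2 → ℝ) :
    K.N x * K.muq x * K.qInner x α β = ∑ b, K.kap b x * α b * β b := by
  have hG := (gphi_pos hx).ne'
  have h := nu_mul_qInner hx α β
  rw [N_mul_muq hx, mul_right_comm, h, div_mul_cancel₀ _ hG]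

theorem N_mul_exp_mul_muq_inv (hx : x ∈ K.quot) :
    K.N x * exp (2 * K.gam x) * (K.muq x)⁻¹ = K.wgt x := by
  have hG := (gphi_pos hx).ne'
  rw [mul_right_comm, N_mul_muq_inv hx, exp_two_gam hx, inv_mul_cancel_right₀ hG]

theorem densityADM_eq (P : PhasePoint) (hx : x ∈ K.quot) : K.densityADM P x =
    1 / 2 * K.wgt x * (P.u x ^ 2 + P.v x ^ 2)
      + (∑ b, K.kap b x * (pd b P.eta x ^ 2 + pd b P.lam x ^ 2)) / (2 * K.gphi x)
      - K.twistT x * (pd 0 P.eta x * pd 1 P.lam x - pd 1 P.eta x * pd 0 P.lam x) := by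
  have hG := (gphi_pos hx).ne'
  have h1 := N_mul_muq_mul_qInner hx (fun b => pd b P.eta x) (fun b => pd b P.eta x)
  have h2 := N_mul_muq_mul_qInner hx (fun b => pd b P.lam x) (fun b => pd b P.lam x)
  have h3 := N_mul_exp_mul_muq_inv hx
  have h4 : K.twistForm x 0 = K.twistT x := K.twistForm_eqOn hx
  rw [densityADM, exp_neg_two_gam hx, h4]
  have h5 : 1 / 2 * K.N x * (K.muq x)⁻¹ * exp (2 * K.gam x) * (P.u x ^ 2 + P.v x ^ 2)
      = 1 / 2 * K.wgt x * (P.u x ^ 2 + P.v x ^ 2) := by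
    rw [← h3]; ring
  rw [h5]
  simp only [Fin.sum_univ_two, eps2] at h1 h2 ⊢
  simp
  field_simp
  linear_combination h1 + h2

/-- The gauge-covariant derivative of `η` that enters `E^Alt`. -/
def covEta (K : KerrDeSitter) (om : ℝ × ℝ → ℝ) (P : PhasePoint) (b : Fin 2) (x : ℝ × ℝ) : ℝ :=
  pd b P.eta x + P.lam x * pd b om x / (2 * K.gphi x) - P.eta x * pd b K.gam x

/-- The gauge-covariant derivative of `λ` that enters `E^Alt`. -/
def covLam (K : KerrDeSitter) (om : ℝ × ℝ → ℝ) (P : PhasePoint) (b : Fin 2) (x : ℝ × ℝ) : ℝ :=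
  pd b P.lam x - P.eta x * pd b om x / (2 * K.gphi x) - P.lam x * pd b K.gam x

/-- The mass term of `E^Alt`. -/
def mass (K : KerrDeSitter) (om : ℝ × ℝ → ℝ) (x : ℝ × ℝ) : ℝ :=
  K.Lam * K.nu x
    + ∑ b, K.kap b x * (pd b K.gam x ^ 2 + pd b om x ^ 2 / (4 * K.gphi x ^ 2))

/-- `E^Alt` as a sum of squares. -/
theorem densityAlt_eq (om : ℝ × ℝ → ℝ) (P : PhasePoint) (hx : x ∈ K.quot) :
    K.densityAlt om P x =
    1 / 2 * K.wgt x * (P.u x ^ 2 + P.v x ^ 2)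
      + (K.mass om x * (P.lam x ^ 2 + P.eta x ^ 2)
        + ∑ b, K.kap b x * (K.covEta om P b x ^ 2 + K.covLam om P b x ^ 2)) / (2 * K.gphi x) := by
  have hG := (gphi_pos hx).ne'
  have h3 := N_mul_exp_mul_muq_inv hx
  have h4 := N_mul_muq hx
  have h5 := fun α => N_mul_muq_mul_qInner hx α α
  simp only [densityAlt, exp_neg_two_gam hx, exp_neg_four_gam hx]
  have h6 : ∀ α β : Fin 2 → ℝ,
      1 / 4 * K.N x * (K.gphi x)⁻¹ * K.muq x * (K.qInner x α α + K.qInner x β β) =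
      1 / 4 * (K.gphi x)⁻¹ * ((∑ b, K.kap b x * α b * α b) + ∑ b, K.kap b x * β b * β b) := by
    intro α β
    rw [← h5, ← h5]
    ring
  have h7 : 1 / 2 * K.N x * exp (2 * K.gam x) * (K.muq x)⁻¹ * (P.u x ^ 2 + P.v x ^ 2)
      = 1 / 2 * K.wgt x * (P.u x ^ 2 + P.v x ^ 2) := by
    rw [← h3]; ring
  have h8 : 1 / 2 * K.Lam * K.N x * K.muq x * (K.gphi x ^ 2)⁻¹ * (P.lam x ^ 2 + P.eta x ^ 2)
      = 1 / 2 * K.Lam * K.nu x * (K.gphi x)⁻¹ * (P.lam x ^ 2 + P.eta x ^ 2) := by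
    rw [mul_assoc (1 / 2 * K.Lam), h4]
    field_simp
  rw [h6, h6, h7, h8]
  -- The squares of E^Alt are paired as (dλ - 2λ dγ, dλ - η e^{-2γ} dω) and (dη - 2η dγ, dη + λ
  -- e^{-2γ} dω), and the parallelogram law is applied. The means are `covLam` and `covEta`. The
  -- half-differences are λ dγ - η e^{-2γ} dω / 2 and η dγ + λ e^{-2γ} dω / 2; the cross terms in
  -- their squares cancel and what is left belongs to `mass`.
  simp only [mass, covEta, covLam, Fin.sum_univ_two]
  field_simp
  ring

/-- Λ > 0 makes the inequality strict even where dγ and dω vanish. -/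
theorem mass_pos (om : ℝ × ℝ → ℝ) (hx : x ∈ K.quot) : 0 < K.mass om x := by
  have h1 := mul_pos K.Lam_pos (nu_pos hx)
  have h2 : 0 ≤ ∑ b, K.kap b x * (pd b K.gam x ^ 2 + pd b om x ^ 2 / (4 * K.gphi x ^ 2)) :=
    Finset.sum_nonneg fun b _ => mul_nonneg (kap_pos hx b).le (by positivity)
  unfold mass
  linarith

theorem densityAlt_nonneg (om : ℝ × ℝ → ℝ) (P : PhasePoint) (hx : x ∈ K.quot) :
    0 ≤ K.densityAlt om P x := by
  have h1 := mass_pos om hx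
  have h2 := gphi_pos hx
  have h3 := wgt_pos hx
  have h4 : 0 ≤ ∑ b, K.kap b x * (K.covEta om P b x ^ 2 + K.covLam om P b x ^ 2) :=
    Finset.sum_nonneg fun b _ => mul_nonneg (kap_pos hx b).le (by positivity)
  rw [densityAlt_eq om P hx]
  positivity

/-- Because of the mass term, definiteness holds pointwise: no differential equation for λ and η has
to be solved. This is also how vanishing is recovered from the weighted energy in the propagation
argument. -/
theorem densityAlt_eq_zero_iff (om : ℝ × ℝ → ℝ) (P : PhasePoint) (hx : x ∈ K.quot)
    (h : K.densityAlt om P x = 0) :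
    P.lam x = 0 ∧ P.eta x = 0 ∧ P.u x = 0 ∧ P.v x = 0 := by
  have h1 := mass_pos om hx
  have h2 := gphi_pos hx
  have h3 := wgt_pos hx
  have h4 : 0 ≤ ∑ b, K.kap b x * (K.covEta om P b x ^ 2 + K.covLam om P b x ^ 2) :=
    Finset.sum_nonneg fun b _ => mul_nonneg (kap_pos hx b).le (by positivity)
  rw [densityAlt_eq om P hx] at h
  have h5 : 0 ≤ 1 / 2 * K.wgt x * (P.u x ^ 2 + P.v x ^ 2) := by positivity
  have h6 : 0 ≤ K.mass om x * (P.lam x ^ 2 + P.eta x ^ 2) := by positivity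
  have h7 : 0 ≤ (K.mass om x * (P.lam x ^ 2 + P.eta x ^ 2)
        + ∑ b, K.kap b x * (K.covEta om P b x ^ 2 + K.covLam om P b x ^ 2)) / (2 * K.gphi x) := by
    positivity
  have h8 : (K.mass om x * (P.lam x ^ 2 + P.eta x ^ 2)
        + ∑ b, K.kap b x * (K.covEta om P b x ^ 2 + K.covLam om P b x ^ 2)) / (2 * K.gphi x) = 0 := by
    linarith
  rw [div_eq_zero_iff, or_iff_left (by positivity)] at h8
  have h9 : K.mass om x * (P.lam x ^ 2 + P.eta x ^ 2) = 0 := by linarith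
  have h10 : P.lam x ^ 2 + P.eta x ^ 2 = 0 := (mul_eq_zero.1 h9).resolve_left h1.ne'
  have h11 : 1 / 2 * K.wgt x * (P.u x ^ 2 + P.v x ^ 2) = 0 := by linarith
  have h12 : P.u x ^ 2 + P.v x ^ 2 = 0 := (mul_eq_zero.1 h11).resolve_left (by positivity)
  refine ⟨?_, ?_, ?_, ?_⟩ <;> nlinarith [sq_nonneg (P.lam x), sq_nonneg (P.eta x),
    sq_nonneg (P.u x), sq_nonneg (P.v x)]

theorem pd_exp_neg_gam_mul {f : ℝ × ℝ → ℝ} (hx : x ∈ K.quot) (hf : DifferentiableAt ℝ f x)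
    (b : Fin 2) : pd b (fun y => exp (-K.gam y) * f y) x =
      exp (-K.gam x) * (pd b f x - f x * pd b K.gam x) := by
  have hg : DifferentiableAt ℝ K.gam x :=
    K.contDiffOn_gam.differentiableAt_of_isOpen K.isOpen_quot (by simp) hx
  have he : pd b (fun y => exp (-K.gam y)) x = -(exp (-K.gam x) * pd b K.gam x) := by
    unfold pd
    rw [fderiv_exp hg.fun_neg, fderiv_fun_neg]
    simp
  rw [pd_mul b hg.fun_neg.exp hf, he]
  ring

theorem exp_neg_gam_sq (hx : x ∈ K.quot) : exp (-K.gam x) ^ 2 = (K.gphi x)⁻¹ := by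
  rw [← exp_neg_two_gam hx, ← exp_nat_mul]
  congr 1
  push_cast
  ring

theorem exp_gam_sq (hx : x ∈ K.quot) : exp (K.gam x) ^ 2 = K.gphi x := by
  rw [← exp_two_gam hx, ← exp_nat_mul]
  congr 1

/-- The factor e^{-γ} absorbs the connection term, d(e^{-γ} η) = e^{-γ} (dη - η dγ), so the
derivatives in E^Reg are e^{-γ} times `covEta` and `covLam`. The agreement is pointwise, without
integration by parts. -/
theorem densityReg_regularize (om : ℝ × ℝ → ℝ) (hx : x ∈ K.quot)
    (hl : DifferentiableAt ℝ P.lam x) (he : DifferentiableAt ℝ P.eta x) :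
    K.densityReg om (K.regularize P) x = K.densityAlt om P x := by
  have hG := (gphi_pos hx).ne'
  have h4 := N_mul_muq hx
  have h3 := N_mul_muq_inv hx
  have h5 := fun α => N_mul_muq_mul_qInner hx α α
  have e1 := exp_neg_gam_sq hx
  have e2 := exp_gam_sq hx
  rw [densityAlt_eq om P hx]
  simp only [densityReg, regularize, exp_neg_two_gam hx, exp_neg_four_gam hx,
    pd_exp_neg_gam_mul hx hl, pd_exp_neg_gam_mul hx he]
  have h6 : ∀ α β : Fin 2 → ℝ,
      1 / 2 * K.N x * K.muq x * (K.qInner x α α + K.qInner x β β) =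
      1 / 2 * ((∑ b, K.kap b x * α b * α b) + ∑ b, K.kap b x * β b * β b) := by
    intro α β
    rw [← h5, ← h5]
    ring
  have h7 : 1 / 2 * K.N x * K.muq x * (K.qInner x (fun b => pd b K.gam x) (fun b => pd b K.gam x)
        + 1 / 4 * (K.gphi x ^ 2)⁻¹ * K.qInner x (fun b => pd b om x) (fun b => pd b om x)) =
      1 / 2 * ((∑ b, K.kap b x * pd b K.gam x * pd b K.gam x)
        + 1 / 4 * (K.gphi x ^ 2)⁻¹ * ∑ b, K.kap b x * pd b om x * pd b om x) := by
    rw [← h5 fun b => pd b K.gam x, ← h5 fun b => pd b om x]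
    ring
  rw [h6, h7]
  have h8 : 1 / 2 * K.N x * (K.muq x)⁻¹
      * ((exp (K.gam x) * P.u x) ^ 2 + (exp (K.gam x) * P.v x) ^ 2)
      = 1 / 2 * K.wgt x * (P.u x ^ 2 + P.v x ^ 2) := by
    rw [mul_pow, mul_pow, e2, mul_assoc (1 / 2), h3]
    field_simp
  have h9 : 1 / 2 * K.N x * K.Lam * K.muq x * (K.gphi x)⁻¹
      * ((exp (-K.gam x) * P.lam x) ^ 2 + (exp (-K.gam x) * P.eta x) ^ 2)
      = 1 / 2 * K.Lam * K.nu x * (K.gphi x)⁻¹ * (P.lam x ^ 2 + P.eta x ^ 2) := by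
    rw [mul_pow, mul_pow, e1]
    field_simp
    linear_combination K.Lam * (P.lam x ^ 2 + P.eta x ^ 2) * h4
  rw [h8, h9, mul_pow, mul_pow, e1]
  simp only [mass, covEta, covLam, Fin.sum_univ_two]
  -- The exponential occurs only quadratically. It is abstracted below to a variable E of which only
  -- E² = 1 / `gphi` is used.
  have e3 : ∀ z, K.kap z x = K.kap z x * (exp (-K.gam x) ^ 2 * K.gphi x) := by
    intro z
    rw [e1, inv_mul_cancel₀ hG, mul_one]
  generalize exp (-K.gam x) = E at *
  have e4 : ∀ a c : ℝ, ∀ b, K.kap b x * (E * a + 1 / 2 * (E * c) * (K.gphi x)⁻¹ * pd b om x)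
      * (E * a + 1 / 2 * (E * c) * (K.gphi x)⁻¹ * pd b om x)
      = K.kap b x * (a + 1 / 2 * c * (K.gphi x)⁻¹ * pd b om x) ^ 2 * (K.gphi x)⁻¹ := by
    intro a c b
    rw [← e1]
    ring
  have e5 : ∀ a c : ℝ, ∀ b, K.kap b x * (E * a - 1 / 2 * (E * c) * (K.gphi x)⁻¹ * pd b om x)
      * (E * a - 1 / 2 * (E * c) * (K.gphi x)⁻¹ * pd b om x)
      = K.kap b x * (a - 1 / 2 * c * (K.gphi x)⁻¹ * pd b om x) ^ 2 * (K.gphi x)⁻¹ := by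
    intro a c b
    rw [← e1]
    ring
  simp only [e4, e5]
  field_simp
  ring

theorem currentAlt_snd (om : ℝ × ℝ → ℝ) (Q : ℝ → PhasePoint) (t : ℝ) (hx : x ∈ K.quot)
    (b : Fin 2) : (K.currentAlt om Q t x).2 b =
      -(K.wgt x * K.kap b x / K.gphi x
        * ((Q t).u x * K.covEta om (Q t) b x + (Q t).v x * K.covLam om (Q t) b x)) := by
  have hG := (gphi_pos hx).ne'
  have h0 := nu_mul_q_inv hx b
  simp only [currentAlt, N_sq hx, exp_neg_two_gam hx]
  rw [Finset.sum_eq_single b]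
  · rw [mul_div_assoc, ← h0]
    simp only [covEta, covLam]
    field_simp
    ring
  · intro c _ hcb
    rw [q_inv_off_diag hx hcb]
    ring
  · simp

theorem currentReg_snd_regularize (om : ℝ × ℝ → ℝ) (Q : ℝ → PhasePoint) (t : ℝ) (hx : x ∈ K.quot)
    (hl : DifferentiableAt ℝ (Q t).lam x) (he : DifferentiableAt ℝ (Q t).eta x)
    (b : Fin 2) : (K.currentReg om (fun t => K.regularize (Q t)) t x).2 b =
      (K.currentAlt om Q t x).2 b := by
  have hE : exp (K.gam x) * exp (-K.gam x) = 1 := by rw [← exp_add]; simp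
  simp only [currentReg, currentAlt, regularize, pd_exp_neg_gam_mul hx hl,
    pd_exp_neg_gam_mul hx he]
  refine Finset.sum_congr rfl fun c _ => ?_
  generalize exp (-K.gam x) = E at *
  generalize exp (K.gam x) = E' at *
  linear_combination -(K.N x ^ 2 * (K.q x)⁻¹ c b * ((Q t).u x * (pd c (Q t).eta x
    + 1 / 2 * (Q t).lam x * exp (-2 * K.gam x) * pd c om x - (Q t).eta x * pd c K.gam x)
    + (Q t).v x * (pd c (Q t).lam x - 1 / 2 * (Q t).eta x * exp (-2 * K.gam x) * pd c om x
    - (Q t).lam x * pd c K.gam x))) * hE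

/-! ### The field equations in closed form -/

/-- The right-hand side of the equation for `∂_t u`. -/
def forceU (K : KerrDeSitter) (om : ℝ × ℝ → ℝ) (P : PhasePoint) (x : ℝ × ℝ) : ℝ :=
  (∑ b, pd b (fun y => K.kap b y * pd b P.eta y / K.gphi y) x)
    + (∑ b, K.kap b x * pd b om x * pd b P.lam x) / K.gphi x ^ 2

/-- The right-hand side of the equation for `∂_t v`. -/
def forceV (K : KerrDeSitter) (om : ℝ × ℝ → ℝ) (P : PhasePoint) (x : ℝ × ℝ) : ℝ :=
  (∑ b, pd b (fun y => K.kap b y * pd b P.lam y / K.gphi y) x)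
    - (∑ b, K.kap b x * pd b om x * pd b P.eta x) / K.gphi x ^ 2

theorem flux_term_eqOn (f : ℝ × ℝ → ℝ) (b : Fin 2) :
    EqOn (fun y => ∑ c, K.N y * K.muq y * (K.q y)⁻¹ c b * exp (-2 * K.gam y) * pd c f y)
      (fun y => K.kap b y * pd b f y / K.gphi y) K.quot := by
  intro y hy
  have hG := (gphi_pos hy).ne'
  have h0 := nu_mul_q_inv hy b
  simp only [exp_neg_two_gam hy, N_mul_muq hy]
  rw [Finset.sum_eq_single b]
  · field_simp at h0 ⊢
    linear_combination pd b f y * h0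
  · intro c _ hcb
    rw [q_inv_off_diag hy hcb]
    ring
  · simp

theorem twist_term_eq (hx : x ∈ K.quot) (α β : Fin 2 → ℝ) :
    K.N x * K.muq x * exp (-4 * K.gam x) * K.qInner x α β
      = (∑ b, K.kap b x * α b * β b) / K.gphi x ^ 2 := by
  rw [← N_mul_muq_mul_qInner hx, exp_neg_four_gam hx]
  ring

/-- From here on N, μ_q and q no longer enter the evolution equations. -/
theorem fieldEquations_iff : K.FieldEquations om Q ↔ ∀ t, ∀ x ∈ K.quot,
    deriv (fun s => (Q s).eta x) t = K.wgt x * (Q t).u x ∧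
    deriv (fun s => (Q s).lam x) t = K.wgt x * (Q t).v x ∧
    deriv (fun s => (Q s).u x) t = K.forceU om (Q t) x ∧
    deriv (fun s => (Q s).v x) t = K.forceV om (Q t) x := by
  refine forall_congr' fun t => forall₂_congr fun x hx => ?_
  have h (f : ℝ × ℝ → ℝ) (b : Fin 2) := pd_congr b K.isOpen_quot (flux_term_eqOn (K := K) f b) hx
  simp only [h, twist_term_eq hx, N_mul_exp_mul_muq_inv hx, forceU, forceV]

end KerrDeSitter

end

/-! ### The divergence identities: E^Alt against E^ADM, and local conservation of energy. -/

noncomputable section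

/-! ### Derivatives along coordinate lines and in time -/

section Lines

variable {f : ℝ × ℝ → ℝ} {x : ℝ × ℝ}

/-- The coordinate vectors on the quotient. -/
def coordVec (b : Fin 2) : ℝ × ℝ := if b = 0 then (1, 0) else (0, 1)

theorem hasDerivAt_pd (b : Fin 2) (hf : DifferentiableAt ℝ f x) :
    HasDerivAt (fun s : ℝ => f (x + s • coordVec b)) (pd b f x) 0 := by
  have h1 : HasDerivAt (fun s : ℝ => x + s • coordVec b) (coordVec b) 0 := by
    simpa using ((hasDerivAt_id (0 : ℝ)).smul_const (coordVec b)).const_add x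
  have h2 : HasFDerivAt f (fderiv ℝ f x) (x + (0 : ℝ) • coordVec b) := by
    simpa using hf.hasFDerivAt
  exact h2.comp_hasDerivAt 0 h1

theorem pd_eq (b : Fin 2) (hf : DifferentiableAt ℝ f x) {f' : ℝ}
    (h : HasDerivAt (fun s : ℝ => f (x + s • coordVec b)) f' 0) : pd b f x = f' :=
  (hasDerivAt_pd b hf).unique h

variable {U : Set (ℝ × ℝ)} {F : ℝ × (ℝ × ℝ) → ℝ} {t : ℝ}

theorem pd_slice (b : Fin 2) (hF : DifferentiableAt ℝ F (t, x)) :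
    pd b (fun y => F (t, y)) x = fderiv ℝ F (t, x) (0, coordVec b) := by
  have h : HasFDerivAt (fun y : ℝ × ℝ => (t, y)) (ContinuousLinearMap.inr ℝ ℝ (ℝ × ℝ)) x :=
    hasFDerivAt_prodMk_right t x
  have h2 : HasFDerivAt (fun y => F (t, y))
      ((fderiv ℝ F (t, x)).comp (ContinuousLinearMap.inr ℝ ℝ (ℝ × ℝ))) x := hF.hasFDerivAt.comp x h
  rw [pd, h2.fderiv]
  rfl

theorem hasDerivAt_slice (hF : DifferentiableAt ℝ F (t, x)) :
    HasDerivAt (fun s => F (s, x)) (fderiv ℝ F (t, x) (1, 0)) t := by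
  have h : HasDerivAt (fun s : ℝ => (s, x)) (1, 0) t :=
    (hasDerivAt_id t).prodMk (hasDerivAt_const t x)
  exact hF.hasFDerivAt.comp_hasDerivAt t h

theorem ContDiffOn.slice {n : WithTop ℕ∞} {T : Set ℝ} (hF : ContDiffOn ℝ n F (T ×ˢ U))
    (ht : t ∈ T) : ContDiffOn ℝ n (fun y => F (t, y)) U :=
  hF.comp (contDiff_prodMk_right t).contDiffOn fun _ hy => ⟨ht, hy⟩

theorem ContDiffOn.fderiv_apply_of_isOpen {E : Type*} [NormedAddCommGroup E] [NormedSpace ℝ E]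
    {f : E → ℝ} {s : Set E}
    (hF : ContDiffOn ℝ ∞ f s) (hU : IsOpen s) (v : E) :
    ContDiffOn ℝ ∞ (fun p => fderiv ℝ f p v) s :=
  (hF.fderiv_of_isOpen hU (m := ∞) (by simp)).clm_apply contDiffOn_const

theorem fderiv_fderiv_comm {E : Type*} [NormedAddCommGroup E] [NormedSpace ℝ E] {f : E → ℝ}
    {s : Set E} {p : E} (hF : ContDiffOn ℝ ∞ f s) (hU : IsOpen s) (hp : p ∈ s) (v w : E) :
    fderiv ℝ (fun y => fderiv ℝ f y w) p v = fderiv ℝ (fun y => fderiv ℝ f y v) p w := by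
  have hd : DifferentiableAt ℝ (fderiv ℝ f) p :=
    (hF.fderiv_of_isOpen hU (m := 1) (by norm_cast)).contDiffAt (hU.mem_nhds hp)
      |>.differentiableAt (by simp)
  have hs : IsSymmSndFDerivAt ℝ f p :=
    (hF.contDiffAt (hU.mem_nhds hp)).isSymmSndFDerivAt (by simp; norm_cast)
  rw [fderiv_clm_apply hd (differentiableAt_const w), fderiv_clm_apply hd (differentiableAt_const v)]
  simpa using hs v w

/-- Time and space derivatives are second derivatives of one function on the open set ℝ × U, so they
commute by symmetry of the second derivative. -/
theorem hasDerivAt_pd_slice (hF : ContDiffOn ℝ ∞ F (univ ×ˢ U)) (hU : IsOpen U) (hx : x ∈ U)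
    (b : Fin 2) (t : ℝ) :
    HasDerivAt (fun s => pd b (fun y => F (s, y)) x)
      (pd b (fun y => deriv (fun s => F (s, y)) t) x) t := by
  have hO : IsOpen ((univ : Set ℝ) ×ˢ U) := isOpen_univ.prod hU
  have hd : ∀ s, ∀ y ∈ U, DifferentiableAt ℝ F (s, y) := fun s y hy =>
    (hF.contDiffAt (hO.mem_nhds ⟨mem_univ s, hy⟩)).differentiableAt (by simp)
  have hdd : ∀ v, DifferentiableAt ℝ (fun p => fderiv ℝ F p v) (t, x) := fun v =>
    ((hF.fderiv_apply_of_isOpen hO v).contDiffAt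
      (hO.mem_nhds ⟨mem_univ t, hx⟩)).differentiableAt (by simp)
  have h1 := hasDerivAt_slice (hdd (0, coordVec b))
  have h2 : pd b (fun y => deriv (fun s => F (s, y)) t) x
      = pd b (fun y => fderiv ℝ F (t, y) (1, 0)) x :=
    pd_congr b hU (fun y hy => (hasDerivAt_slice (hd t y hy)).deriv) hx
  rw [h2, pd_slice b (hdd (1, 0)), ← fderiv_fderiv_comm hF hO ⟨mem_univ t, hx⟩]
  exact h1.congr_of_eventuallyEq (Filter.Eventually.of_forall fun s => pd_slice b (hd s x hx))

end Lines

namespace KerrDeSitter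

variable (K : KerrDeSitter)

/-- The components of `Q` are smooth in the interior of `ℝ × Σ`. -/
def InteriorSmooth (Q : ℝ → PhasePoint) : Prop :=
  ContDiffOn ℝ ∞ (fun p : ℝ × (ℝ × ℝ) => (Q p.1).lam p.2) (univ ×ˢ K.quot) ∧
  ContDiffOn ℝ ∞ (fun p : ℝ × (ℝ × ℝ) => (Q p.1).eta p.2) (univ ×ˢ K.quot) ∧
  ContDiffOn ℝ ∞ (fun p : ℝ × (ℝ × ℝ) => (Q p.1).u p.2) (univ ×ˢ K.quot) ∧
  ContDiffOn ℝ ∞ (fun p : ℝ × (ℝ × ℝ) => (Q p.1).v p.2) (univ ×ˢ K.quot)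

variable {K} {x : ℝ × ℝ} {om : ℝ × ℝ → ℝ} {P : PhasePoint} {Q : ℝ → PhasePoint}

theorem differentiableAt_gphi (hx : x ∈ K.quot) : DifferentiableAt ℝ K.gphi x :=
  K.contDiffOn_gphi.differentiableAt_of_isOpen K.isOpen_strip (by simp) (K.quot_subset_strip hx)

/-- Lets every division by `gphi` be differentiated in terms of dγ, the form in which `gam_equation`
applies. -/
theorem pd_gphi (hx : x ∈ K.quot) (b : Fin 2) :
    pd b K.gphi x = 2 * K.gphi x * pd b K.gam x := by
  have hg : DifferentiableAt ℝ K.gam x :=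
    K.contDiffOn_gam.differentiableAt_of_isOpen K.isOpen_quot (by simp) hx
  rw [pd_congr b K.isOpen_quot (fun y hy => (exp_two_gam hy).symm) hx]
  have := ((hasDerivAt_pd b hg).const_mul 2).exp
  rw [pd_eq b (hg.const_mul 2).exp this, zero_smul, add_zero, exp_two_gam hx]
  ring

theorem contDiffOn_kap_mul_pd {f : ℝ × ℝ → ℝ} (hf : ContDiffOn ℝ ∞ f K.quot) (b : Fin 2) :
    ContDiffOn ℝ ∞ (fun y => K.kap b y * pd b f y) K.quot :=
  (K.contDiff_kap b).contDiffOn.mul (hf.pd K.isOpen_quot b)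

theorem contDiffOn_kap_mul_pd_div {f : ℝ × ℝ → ℝ} (hf : ContDiffOn ℝ ∞ f K.quot) (b : Fin 2) :
    ContDiffOn ℝ ∞ (fun y => K.kap b y * pd b f y / K.gphi y) K.quot :=
  (contDiffOn_kap_mul_pd hf b).div (K.contDiffOn_gphi.mono K.quot_subset_strip)
    fun _ hx => (gphi_pos hx).ne'

theorem contDiffOn_kap_mul_pd_div_sq {f : ℝ × ℝ → ℝ} (hf : ContDiffOn ℝ ∞ f K.quot) (b : Fin 2) :
    ContDiffOn ℝ ∞ (fun y => K.kap b y * pd b f y / K.gphi y ^ 2) K.quot :=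
  (contDiffOn_kap_mul_pd hf b).div ((K.contDiffOn_gphi.mono K.quot_subset_strip).pow 2)
    fun _ hx => pow_ne_zero 2 (gphi_pos hx).ne'

/-- The vector density whose divergence is `E^Alt - E^ADM`. -/
def gaugeCurrent (K : KerrDeSitter) (P : PhasePoint) (b : Fin 2) (y : ℝ × ℝ) : ℝ :=
  -(1 / 2) * ((P.lam y ^ 2 + P.eta y ^ 2) * (K.kap b y * pd b K.gam y / K.gphi y))
    + 1 / 2 * (K.twistT y * ∑ c, eps2 b c * (P.eta y * pd c P.lam y - P.lam y * pd c P.eta y))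

theorem contDiffOn_gaugeCurrent (hl : ContDiffOn ℝ ∞ P.lam K.quot)
    (he : ContDiffOn ℝ ∞ P.eta K.quot) (b : Fin 2) :
    ContDiffOn ℝ ∞ (K.gaugeCurrent P b) K.quot := by
  have h1 := contDiffOn_kap_mul_pd_div K.contDiffOn_gam b
  have h2 := K.contDiffOn_twistT.mono K.quot_subset_strip
  have h3 := fun c => hl.pd K.isOpen_quot c
  have h4 := fun c => he.pd K.isOpen_quot c
  have h5 : ContDiffOn ℝ ∞ (fun y => ∑ c, eps2 b c *
      (P.eta y * pd c P.lam y - P.lam y * pd c P.eta y)) K.quot :=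
    ContDiffOn.sum fun c _ => contDiffOn_const.mul ((he.mul (h3 c)).sub (hl.mul (h4 c)))
  exact (contDiffOn_const.mul (((hl.pow 2).add (he.pow 2)).mul h1)).add
    (contDiffOn_const.mul (h2.mul h5))

/-- `E^Alt` and `E^ADM` differ by a divergence. -/
theorem densityAlt_sub_densityADM (h : K.IsTwistPotential om)
    (hl : ContDiffOn ℝ ∞ P.lam K.quot) (he : ContDiffOn ℝ ∞ P.eta K.quot) (hx : x ∈ K.quot) :
    K.densityAlt om P x - K.densityADM P x = ∑ b, pd b (K.gaugeCurrent P b) x := by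
  have hO := K.isOpen_quot
  have dl := hl.differentiableAt_of_isOpen hO (by simp) hx
  have de := he.differentiableAt_of_isOpen hO (by simp) hx
  have dlb := fun c => (hl.pd hO c).differentiableAt_of_isOpen hO (by simp) hx
  have deb := fun c => (he.pd hO c).differentiableAt_of_isOpen hO (by simp) hx
  have dM := fun b => (contDiffOn_kap_mul_pd K.contDiffOn_gam b).differentiableAt_of_isOpen hO
    (by simp) hx
  have dA := (K.contDiffOn_twistT.mono K.quot_subset_strip).differentiableAt_of_isOpen hO
    (by simp) hx
  have dG := differentiableAt_gphi hx
  have hG := (gphi_pos hx).ne'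
  have hpd : ∀ b, pd b (K.gaugeCurrent P b) x = -(1 / 2) * (
      2 * (P.lam x * pd b P.lam x + P.eta x * pd b P.eta x)
          * (K.kap b x * pd b K.gam x / K.gphi x)
        + (P.lam x ^ 2 + P.eta x ^ 2) * (pd b (fun y => K.kap b y * pd b K.gam y) x / K.gphi x
          - 2 * K.kap b x * pd b K.gam x ^ 2 / K.gphi x))
      + 1 / 2 * (pd b K.twistT x * (∑ c, eps2 b c *
        (P.eta x * pd c P.lam x - P.lam x * pd c P.eta x)) + K.twistT x * (∑ c, eps2 b c *
        (pd b P.eta x * pd c P.lam x + P.eta x * pd b (pd c P.lam) x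
          - (pd b P.lam x * pd c P.eta x + P.lam x * pd b (pd c P.eta) x)))) := by
    intro b
    refine pd_eq b ((contDiffOn_gaugeCurrent hl he b).differentiableAt_of_isOpen hO (by simp) hx) ?_
    have hG' : K.gphi (x + (0 : ℝ) • coordVec b) ≠ 0 := by simpa using hG
    have h1 := (((hasDerivAt_pd b dl).pow 2).add ((hasDerivAt_pd b de).pow 2)).mul
      ((hasDerivAt_pd b (dM b)).div (hasDerivAt_pd b dG) hG')
    have h2 := fun c => (((hasDerivAt_pd b de).mul (hasDerivAt_pd b (dlb c))).sub
      ((hasDerivAt_pd b dl).mul (hasDerivAt_pd b (deb c)))).const_mul (eps2 b c)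
    have h3 := (hasDerivAt_pd b dA).mul ((h2 0).add (h2 1))
    have h4 := (h1.const_mul (-(1 / 2))).add (h3.const_mul (1 / 2))
    refine HasDerivAt.congr_of_eventuallyEq (h4.congr_deriv ?_)
      (Filter.Eventually.of_forall fun s => ?_)
    · simp only [Fin.sum_univ_two, Pi.pow_apply, Pi.mul_apply, Pi.add_apply, Pi.sub_apply,
        Pi.div_apply, zero_smul, add_zero, pd_gphi hx b]
      field_simp
      push_cast
      ring
    · simp only [gaugeCurrent, Fin.sum_univ_two, Pi.pow_apply, Pi.mul_apply, Pi.add_apply,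
        Pi.sub_apply, Pi.div_apply]
  -- The terms in λ² + η² combine to 2 kap |dγ|² + Λ nu + kap |dω|² / (2 e^{4γ}), where the last two
  -- are -div(kap dγ). Together with -d(λ² + η²) · kap dγ this is the first half of the divergence.
  -- In the twist cross terms kap dω / e^{4γ} becomes a rotated d𝒜_t; with 𝒜_t dη ∧ dλ this is the
  -- second half, the second derivatives of λ and η cancelling by symmetry.
  have hγ := gam_equation h hx
  have t0 : pd 0 K.twistT x = -(K.kap 1 x * pd 1 om x / K.gphi x ^ 2) := by
    rw [h.pd_one hx, pd_zero_twistT hx]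
  have t1 : pd 1 K.twistT x = K.kap 0 x * pd 0 om x / K.gphi x ^ 2 := by
    rw [h.pd_zero hx, pd_one_twistT hx]
  have cl := pd_comm hl hO hx
  have ce := pd_comm he hO hx
  rw [Fin.sum_univ_two, hpd, hpd, densityAlt_eq om P hx, densityADM_eq P hx, t0, t1]
  simp only [mass, covEta, covLam, Fin.sum_univ_two, eps2] at hγ ⊢
  simp
  rw [cl, ce]
  have hγ' : pd 0 (fun y => K.kap 0 y * pd 0 K.gam y) x = -(
      pd 1 (fun y => K.kap 1 y * pd 1 K.gam y) x +
      (K.kap 0 x * pd 0 om x ^ 2 + K.kap 1 x * pd 1 om x ^ 2) / (2 * K.gphi x ^ 2)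
      + K.Lam * K.nu x) := by linarith
  rw [hγ']
  field_simp
  ring

theorem InteriorSmooth.lam (h : K.InteriorSmooth Q) (t : ℝ) : ContDiffOn ℝ ∞ (Q t).lam K.quot :=
  h.1.slice (mem_univ t)

theorem InteriorSmooth.eta (h : K.InteriorSmooth Q) (t : ℝ) : ContDiffOn ℝ ∞ (Q t).eta K.quot :=
  h.2.1.slice (mem_univ t)

theorem InteriorSmooth.u (h : K.InteriorSmooth Q) (t : ℝ) : ContDiffOn ℝ ∞ (Q t).u K.quot :=
  h.2.2.1.slice (mem_univ t)

theorem InteriorSmooth.v (h : K.InteriorSmooth Q) (t : ℝ) : ContDiffOn ℝ ∞ (Q t).v K.quot :=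
  h.2.2.2.slice (mem_univ t)

theorem hasDerivAt_of_contDiffOn_slice {F : ℝ × (ℝ × ℝ) → ℝ}
    (hF : ContDiffOn ℝ ∞ F (univ ×ˢ K.quot)) (hx : x ∈ K.quot) (t : ℝ) :
    HasDerivAt (fun s => F (s, x)) (deriv (fun s => F (s, x)) t) t := by
  have hO : IsOpen ((univ : Set ℝ) ×ˢ K.quot) := isOpen_univ.prod K.isOpen_quot
  exact (hasDerivAt_slice ((hF.contDiffAt (hO.mem_nhds ⟨mem_univ t, hx⟩)).differentiableAt
    (by simp))).differentiableAt.hasDerivAt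

/-- The time derivative of the energy density. -/
theorem hasDerivAt_densityAlt (hQ : K.InteriorSmooth Q) (hx : x ∈ K.quot) (t : ℝ) :
    HasDerivAt (fun s => K.densityAlt om (Q s) x)
      (K.wgt x * ((Q t).u x * deriv (fun s => (Q s).u x) t
          + (Q t).v x * deriv (fun s => (Q s).v x) t)
        + (K.mass om x * ((Q t).lam x * deriv (fun s => (Q s).lam x) t
            + (Q t).eta x * deriv (fun s => (Q s).eta x) t)
          + ∑ b, K.kap b x * (K.covEta om (Q t) b x *
              (pd b (fun y => deriv (fun s => (Q s).eta y) t) x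
                + deriv (fun s => (Q s).lam x) t * pd b om x / (2 * K.gphi x)
                - deriv (fun s => (Q s).eta x) t * pd b K.gam x)
            + K.covLam om (Q t) b x *
              (pd b (fun y => deriv (fun s => (Q s).lam y) t) x
                - deriv (fun s => (Q s).eta x) t * pd b om x / (2 * K.gphi x)
                - deriv (fun s => (Q s).lam x) t * pd b K.gam x))) / K.gphi x) t := by
  obtain ⟨h1, h2, h3, h4⟩ := hQ
  have dl : HasDerivAt (fun s => (Q s).lam x) (deriv (fun s => (Q s).lam x) t) t :=
    hasDerivAt_of_contDiffOn_slice h1 hx t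
  have de : HasDerivAt (fun s => (Q s).eta x) (deriv (fun s => (Q s).eta x) t) t :=
    hasDerivAt_of_contDiffOn_slice h2 hx t
  have du : HasDerivAt (fun s => (Q s).u x) (deriv (fun s => (Q s).u x) t) t :=
    hasDerivAt_of_contDiffOn_slice h3 hx t
  have dv : HasDerivAt (fun s => (Q s).v x) (deriv (fun s => (Q s).v x) t) t :=
    hasDerivAt_of_contDiffOn_slice h4 hx t
  have dlb (b : Fin 2) : HasDerivAt (fun s => pd b (Q s).lam x)
      (pd b (fun y => deriv (fun s => (Q s).lam y) t) x) t :=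
    hasDerivAt_pd_slice h1 K.isOpen_quot hx b t
  have deb (b : Fin 2) : HasDerivAt (fun s => pd b (Q s).eta x)
      (pd b (fun y => deriv (fun s => (Q s).eta y) t) x) t :=
    hasDerivAt_pd_slice h2 K.isOpen_quot hx b t
  have cE := fun b => ((deb b).add ((dl.mul_const (pd b om x)).div_const (2 * K.gphi x))).sub
    (de.mul_const (pd b K.gam x))
  have cL := fun b => ((dlb b).sub ((de.mul_const (pd b om x)).div_const (2 * K.gphi x))).sub
    (dl.mul_const (pd b K.gam x))
  have k1 := fun b => (((cE b).pow 2).add ((cL b).pow 2)).const_mul (K.kap b x)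
  have k2 := ((((dl.pow 2).add (de.pow 2)).const_mul (K.mass om x)).add
    ((k1 0).add (k1 1))).div_const (2 * K.gphi x)
  have k3 := (((du.pow 2).add (dv.pow 2)).const_mul (1 / 2 * K.wgt x)).add k2
  have hG := (gphi_pos hx).ne'
  refine HasDerivAt.congr_of_eventuallyEq (k3.congr_deriv ?_)
    (Filter.Eventually.of_forall fun s => ?_)
  · simp only [Fin.sum_univ_two, covEta, covLam, Pi.add_apply, Pi.sub_apply,
      Nat.add_one_sub_one, pow_one, Nat.cast_ofNat]
    field_simp
  · simp only [densityAlt_eq om (Q s) hx, Fin.sum_univ_two, covEta, covLam, Pi.pow_apply,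
      Pi.add_apply, Pi.sub_apply]

/-- The spatial part of the current of `E^Alt`, in closed form. -/
def momentum (K : KerrDeSitter) (om : ℝ × ℝ → ℝ) (P : PhasePoint) (b : Fin 2) (y : ℝ × ℝ) : ℝ :=
  -(K.wgt y * P.u y * (K.kap b y * pd b P.eta y / K.gphi y
      + P.lam y * (K.kap b y * pd b om y / K.gphi y ^ 2) / 2
      - P.eta y * (K.kap b y * pd b K.gam y / K.gphi y)))
    - K.wgt y * P.v y * (K.kap b y * pd b P.lam y / K.gphi y
      - P.eta y * (K.kap b y * pd b om y / K.gphi y ^ 2) / 2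
      - P.lam y * (K.kap b y * pd b K.gam y / K.gphi y))

theorem currentAlt_snd_eqOn (om : ℝ × ℝ → ℝ) (Q : ℝ → PhasePoint) (t : ℝ) (b : Fin 2) :
    EqOn (fun y => (K.currentAlt om Q t y).2 b) (K.momentum om (Q t) b) K.quot := by
  intro y hy
  have hG := (gphi_pos hy).ne'
  simp only
  rw [currentAlt_snd om Q t hy b, momentum]
  simp only [covEta, covLam]
  field_simp
  ring

theorem contDiffOn_momentum (hom : ContDiffOn ℝ ∞ om K.quot) (hl : ContDiffOn ℝ ∞ P.lam K.quot)
    (he : ContDiffOn ℝ ∞ P.eta K.quot) (hu : ContDiffOn ℝ ∞ P.u K.quot)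
    (hv : ContDiffOn ℝ ∞ P.v K.quot) (b : Fin 2) :
    ContDiffOn ℝ ∞ (K.momentum om P b) K.quot := by
  have h1 := contDiffOn_kap_mul_pd_div K.contDiffOn_gam b
  have h2 := contDiffOn_kap_mul_pd_div_sq hom b
  have h3 := contDiffOn_kap_mul_pd_div hl b
  have h4 := contDiffOn_kap_mul_pd_div he b
  have hw := K.contDiffOn_wgt.mono K.quot_subset_strip
  exact ((hw.mul hu).mul ((h4.add ((hl.mul h2).div_const 2)).sub (he.mul h1))).neg.sub
    ((hw.mul hv).mul ((h3.sub ((he.mul h2).div_const 2)).sub (hl.mul h1)))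

/-- Local conservation of energy. -/
theorem deriv_densityAlt_add_div (h : K.IsTwistPotential om) (hQ : K.InteriorSmooth Q)
    (hF : K.FieldEquations om Q) (hx : x ∈ K.quot) (t : ℝ) :
    deriv (fun s => K.densityAlt om (Q s) x) t + ∑ b, pd b (K.momentum om (Q t) b) x = 0 := by
  have hO := K.isOpen_quot
  rw [fieldEquations_iff] at hF
  have hl := hQ.lam t
  have he := hQ.eta t
  have hu := hQ.u t
  have hv := hQ.v t
  have hw := K.contDiffOn_wgt.mono K.quot_subset_strip
  have dl := hl.differentiableAt_of_isOpen hO (by simp) hx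
  have de := he.differentiableAt_of_isOpen hO (by simp) hx
  have dwu := (hw.mul hu).differentiableAt_of_isOpen hO (by simp) hx
  have dwv := (hw.mul hv).differentiableAt_of_isOpen hO (by simp) hx
  have dM := fun b => (contDiffOn_kap_mul_pd K.contDiffOn_gam b).differentiableAt_of_isOpen hO
    (by simp) hx
  have dT := fun b => (contDiffOn_kap_mul_pd_div_sq h.1 b).differentiableAt_of_isOpen hO
    (by simp) hx
  have dfe := fun b => (contDiffOn_kap_mul_pd_div he b).differentiableAt_of_isOpen hO
    (by simp) hx
  have dfl := fun b => (contDiffOn_kap_mul_pd_div hl b).differentiableAt_of_isOpen hO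
    (by simp) hx
  have dG := differentiableAt_gphi hx
  have hG := (gphi_pos hx).ne'
  have hpd : ∀ b, pd b (K.momentum om (Q t) b) x =
      -(pd b (fun y => K.wgt y * (Q t).u y) x * (K.kap b x / K.gphi x * K.covEta om (Q t) b x)
        + K.wgt x * (Q t).u x * (
          pd b (fun y => K.kap b y * pd b (Q t).eta y / K.gphi y) x
          + (pd b (Q t).lam x * (K.kap b x * pd b om x / K.gphi x ^ 2)
            + (Q t).lam x * pd b (fun y => K.kap b y * pd b om y / K.gphi y ^ 2) x) / 2
          - (pd b (Q t).eta x * (K.kap b x * pd b K.gam x / K.gphi x)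
            + (Q t).eta x * (pd b (fun y => K.kap b y * pd b K.gam y) x / K.gphi x
              - 2 * K.kap b x * pd b K.gam x ^ 2 / K.gphi x))))
      - (pd b (fun y => K.wgt y * (Q t).v y) x * (K.kap b x / K.gphi x * K.covLam om (Q t) b x)
        + K.wgt x * (Q t).v x * (
          pd b (fun y => K.kap b y * pd b (Q t).lam y / K.gphi y) x
          - (pd b (Q t).eta x * (K.kap b x * pd b om x / K.gphi x ^ 2)
            + (Q t).eta x * pd b (fun y => K.kap b y * pd b om y / K.gphi y ^ 2) x) / 2
          - (pd b (Q t).lam x * (K.kap b x * pd b K.gam x / K.gphi x)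
            + (Q t).lam x * (pd b (fun y => K.kap b y * pd b K.gam y) x / K.gphi x
              - 2 * K.kap b x * pd b K.gam x ^ 2 / K.gphi x)))) := by
    intro b
    refine pd_eq b ((contDiffOn_momentum h.1 hl he hu hv b).differentiableAt_of_isOpen hO
      (by simp) hx) ?_
    have hG' : K.gphi (x + (0 : ℝ) • coordVec b) ≠ 0 := by simpa using hG
    have h0 := (hasDerivAt_pd b (dM b)).div (hasDerivAt_pd b dG) hG'
    have h1 := ((hasDerivAt_pd b (dfe b)).add (((hasDerivAt_pd b dl).mul
      (hasDerivAt_pd b (dT b))).div_const 2)).sub ((hasDerivAt_pd b de).mul h0)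
    have h2 := ((hasDerivAt_pd b (dfl b)).sub (((hasDerivAt_pd b de).mul
      (hasDerivAt_pd b (dT b))).div_const 2)).sub ((hasDerivAt_pd b dl).mul h0)
    have h3 := ((hasDerivAt_pd b dwu).mul h1).neg.sub ((hasDerivAt_pd b dwv).mul h2)
    refine HasDerivAt.congr_of_eventuallyEq (h3.congr_deriv ?_)
      (Filter.Eventually.of_forall fun s => ?_)
    · simp only [Pi.mul_apply, Pi.add_apply, Pi.sub_apply, covEta, covLam,
        Pi.div_apply, zero_smul, add_zero, pd_gphi hx b]
      field_simp
    · simp only [momentum, Pi.mul_apply, Pi.add_apply, Pi.neg_apply,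
        Pi.sub_apply, Pi.div_apply]
  -- After the field equations are inserted, the divergence in the force cancels against the one
  -- from the momentum. The remaining multiples of div(kap dγ) are removed by `gam_equation`, and
  -- those of div(kap dω / e^{4γ}) by `twist_divergence`.
  have hγ := gam_equation h hx
  have hT := twist_divergence h hx
  have e1 := fun b => pd_congr b hO (fun y hy => (hF t y hy).1) hx
  have e2 := fun b => pd_congr b hO (fun y hy => (hF t y hy).2.1) hx
  obtain ⟨f1, f2, f3, f4⟩ := hF t x hx
  rw [(hasDerivAt_densityAlt hQ hx t).deriv]
  simp only [e1, e2, f1, f2, f3, f4, hpd]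
  simp only [mass, covEta, covLam, Fin.sum_univ_two, forceU, forceV] at hγ hT ⊢
  have hγ' : pd 0 (fun y => K.kap 0 y * pd 0 K.gam y) x = -(
      pd 1 (fun y => K.kap 1 y * pd 1 K.gam y) x +
      (K.kap 0 x * pd 0 om x ^ 2 + K.kap 1 x * pd 1 om x ^ 2) / (2 * K.gphi x ^ 2)
      + K.Lam * K.nu x) := by linarith
  have hT' : pd 0 (fun y => K.kap 0 y * pd 0 om y / K.gphi y ^ 2) x
      = -pd 1 (fun y => K.kap 1 y * pd 1 om y / K.gphi y ^ 2) x := by linarith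
  rw [hγ', hT']
  field_simp
  ring

end KerrDeSitter

end

/-! ### Orders of vanishing at the axes. -/

noncomputable section

namespace KerrDeSitter

variable (K : KerrDeSitter)

/-! ### Bounds near the axes -/

/-- The set `[t₁, t₂] × [r₁, r₂] × [0, π]`. -/
def closedBox (t₁ t₂ r₁ r₂ : ℝ) : Set (ℝ × (ℝ × ℝ)) := Icc t₁ t₂ ×ˢ (Icc r₁ r₂ ×ˢ Icc 0 π)

/-- The set `[t₁, t₂] × [r₁, r₂] × (0, π)`. -/
def box (t₁ t₂ r₁ r₂ : ℝ) : Set (ℝ × (ℝ × ℝ)) := Icc t₁ t₂ ×ˢ (Icc r₁ r₂ ×ˢ Ioo 0 π)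

/-- The product of the time axis with `Σ ∪ Γ`. -/
def cyl : Set (ℝ × (ℝ × ℝ)) := univ ×ˢ K.quotAxis

theorem isCompact_closedBox (t₁ t₂ r₁ r₂ : ℝ) : IsCompact (closedBox t₁ t₂ r₁ r₂) :=
  isCompact_Icc.prod (isCompact_Icc.prod isCompact_Icc)

theorem box_subset_closedBox (t₁ t₂ r₁ r₂ : ℝ) : box t₁ t₂ r₁ r₂ ⊆ closedBox t₁ t₂ r₁ r₂ :=
  prod_mono_right (prod_mono_right Ioo_subset_Icc_self)

theorem uniqueDiffOn_quotAxis : UniqueDiffOn ℝ K.quotAxis :=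
  isOpen_Ioo.uniqueDiffOn.prod (uniqueDiffOn_Icc pi_pos)

theorem uniqueDiffOn_cyl : UniqueDiffOn ℝ K.cyl :=
  uniqueDiffOn_univ.prod K.uniqueDiffOn_quotAxis

theorem axes_subset_quotAxis : K.axes ⊆ K.quotAxis := by
  refine prod_mono_right ?_
  rintro θ (rfl | rfl)
  · exact ⟨le_rfl, pi_pos.le⟩
  · exact ⟨pi_pos.le, le_rfl⟩

variable {K}

theorem closedBox_subset_cyl {t₁ t₂ r₁ r₂ : ℝ} (h₁ : K.rp < r₁) (h₂ : r₂ < K.rc) :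
    closedBox t₁ t₂ r₁ r₂ ⊆ K.cyl := by
  rintro p ⟨_, hr, hθ⟩
  exact ⟨mem_univ _, ⟨h₁.trans_le hr.1, hr.2.trans_lt h₂⟩, hθ⟩

theorem box_subset_quot {t₁ t₂ r₁ r₂ : ℝ} (h₁ : K.rp < r₁) (h₂ : r₂ < K.rc)
    {p : ℝ × (ℝ × ℝ)} (hp : p ∈ box t₁ t₂ r₁ r₂) : p.2 ∈ K.quot :=
  ⟨⟨h₁.trans_le hp.2.1.1, hp.2.1.2.trans_lt h₂⟩, hp.2.2⟩

theorem cyl_mem_nhds {p : ℝ × (ℝ × ℝ)} (hp : p.2 ∈ K.quot) : K.cyl ∈ nhds p :=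
  Filter.mem_of_superset ((isOpen_univ.prod K.isOpen_quot).mem_nhds ⟨mem_univ _, hp⟩)
    (prod_mono_right K.quot_subset_quotAxis)

theorem sin_pos_of_mem_box {t₁ t₂ r₁ r₂ : ℝ} {p : ℝ × (ℝ × ℝ)} (hp : p ∈ box t₁ t₂ r₁ r₂) :
    0 < sin p.2.2 := sin_pos_of_mem_Ioo hp.2.2

section Hadamard

variable {E : Type*} [NormedAddCommGroup E] [NormedSpace ℝ E] {f : ℝ × (ℝ × ℝ) → E}
  {t₁ t₂ r₁ r₂ : ℝ}

/-- A function that vanishes on the axes gains one power of `sin θ` over its derivative. -/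
theorem norm_le_sin_pow_succ (h₁ : K.rp < r₁) (h₂ : r₂ < K.rc) (hf : DifferentiableOn ℝ f K.cyl)
    (h0 : ∀ t, ∀ x ∈ K.axes, f (t, x) = 0) {k : ℕ} {C : ℝ}
    (hC : ∀ p ∈ closedBox t₁ t₂ r₁ r₂, ‖fderivWithin ℝ f K.cyl p‖ ≤ C * sin p.2.2 ^ k)
    {p : ℝ × (ℝ × ℝ)} (hp : p ∈ closedBox t₁ t₂ r₁ r₂) :
    ‖f p‖ ≤ C * (π / 2) * sin p.2.2 ^ (k + 1) := by
  obtain ⟨t, r, θ⟩ := p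
  obtain ⟨ht, hr, hθ⟩ := hp
  simp only at ht hr hθ
  have hs0 : 0 ≤ sin θ := sin_nonneg_of_mem_Icc hθ
  have hr' : r ∈ Ioo K.rp K.rc := ⟨h₁.trans_le hr.1, hr.2.trans_lt h₂⟩
  -- the segment from the nearest axis
  have key : ∀ θ₀ ∈ Icc 0 π, (r, θ₀) ∈ K.axes → |θ - θ₀| ≤ π / 2 * sin θ →
      (∀ θ' ∈ uIcc θ₀ θ, sin θ' ≤ sin θ) → ‖f (t, r, θ)‖ ≤ C * (π / 2) * sin θ ^ (k + 1) := by
    intro θ₀ hθ₀ hax hd hmono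
    set s : Set (ℝ × (ℝ × ℝ)) := {t} ×ˢ ({r} ×ˢ uIcc θ₀ θ)
    have hsub : uIcc θ₀ θ ⊆ Icc 0 π := (convex_Icc 0 π).ordConnected.uIcc_subset hθ₀ hθ
    have hsbox : s ⊆ closedBox t₁ t₂ r₁ r₂ := by
      rintro ⟨a, b, c⟩ ⟨ha, hb, hc⟩
      rw [mem_singleton_iff] at ha hb
      simp only at ha hb
      subst ha hb
      exact ⟨ht, hr, hsub hc⟩
    have hconv : Convex ℝ s := (convex_singleton t).prod ((convex_singleton r).prod (convex_uIcc _ _))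
    have hC0 : 0 ≤ C * sin θ ^ k := (norm_nonneg _).trans (hC (t, r, θ) ⟨ht, hr, hθ⟩)
    have hb : ∀ p ∈ s, ‖fderivWithin ℝ f K.cyl p‖ ≤ C * sin θ ^ k := by
      intro p hp
      have hp2 := hp.2.2
      have hps := hmono p.2.2 hp2
      have hp0 : 0 ≤ sin p.2.2 := sin_nonneg_of_mem_Icc (hsub hp2)
      -- The sign of C is not prescribed. If C < 0, the hypothesis already forces the derivative to
      -- vanish along the segment.
      by_cases hCneg : 0 ≤ C
      · exact (hC p (hsbox hp)).trans
          (mul_le_mul_of_nonneg_left (pow_le_pow_left₀ hp0 hps k) hCneg)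
      · push Not at hCneg
        have h1 := (norm_nonneg _).trans (hC p (hsbox hp))
        have h2 : C * sin p.2.2 ^ k ≤ 0 := mul_nonpos_of_nonpos_of_nonneg hCneg.le (by positivity)
        exact ((hC p (hsbox hp)).trans h2).trans hC0
    have hmv := hconv.norm_image_sub_le_of_norm_hasFDerivWithin_le
      (f' := fun p => fderivWithin ℝ f K.cyl p)
      (fun p hp => ((hf p (closedBox_subset_cyl h₁ h₂ (hsbox hp))).hasFDerivWithinAt).mono
        (hsbox.trans (closedBox_subset_cyl h₁ h₂))) hb
      (x := (t, r, θ₀)) (y := (t, r, θ)) ⟨rfl, rfl, left_mem_uIcc⟩ ⟨rfl, rfl, right_mem_uIcc⟩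
    rw [h0 t _ hax, sub_zero] at hmv
    have hn : ‖((t, r, θ) : ℝ × (ℝ × ℝ)) - (t, r, θ₀)‖ = |θ - θ₀| := by
      simp [Prod.norm_def]
    rw [hn] at hmv
    calc ‖f (t, r, θ)‖ ≤ C * sin θ ^ k * |θ - θ₀| := hmv
      _ ≤ C * sin θ ^ k * (π / 2 * sin θ) := mul_le_mul_of_nonneg_left hd hC0
      _ = C * (π / 2) * sin θ ^ (k + 1) := by ring
  have hpi := pi_pos
  rcases le_total θ (π / 2) with h | h
  · refine key 0 ⟨le_rfl, hpi.le⟩ ⟨hr', by simp⟩ ?_ ?_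
    -- Jordan's inequality (2/π) θ ≤ sin θ on [0, π/2] is the source of the constant π/2.
    · have := mul_le_sin hθ.1 h
      rw [sub_zero, abs_of_nonneg hθ.1]
      calc θ = π / 2 * (2 / π * θ) := by field_simp
        _ ≤ _ := by gcongr
    · intro θ' h'
      rw [uIcc_of_le hθ.1] at h'
      exact sin_le_sin_of_le_of_le_pi_div_two (by linarith [h'.1]) h h'.2
  · refine key π ⟨hpi.le, le_rfl⟩ ⟨hr', by simp⟩ ?_ ?_
    · have := mul_le_sin (x := π - θ) (by linarith [hθ.2]) (by linarith)
      rw [sin_pi_sub] at this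
      rw [abs_sub_comm, abs_of_nonneg (by linarith [hθ.2])]
      calc π - θ = π / 2 * (2 / π * (π - θ)) := by field_simp
        _ ≤ _ := by gcongr
    · intro θ' h'
      rw [uIcc_of_ge hθ.2] at h'
      rw [← sin_pi_sub θ', ← sin_pi_sub θ]
      exact sin_le_sin_of_le_of_le_pi_div_two (by linarith [h'.2]) (by linarith)
        (by linarith [h'.1])

theorem exists_norm_le_sin (h₁ : K.rp < r₁) (h₂ : r₂ < K.rc) (hf : ContDiffOn ℝ 1 f K.cyl)
    (h0 : ∀ t, ∀ x ∈ K.axes, f (t, x) = 0) :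
    ∃ C, ∀ p ∈ closedBox t₁ t₂ r₁ r₂, ‖f p‖ ≤ C * sin p.2.2 := by
  have hc : ContinuousOn (fderivWithin ℝ f K.cyl) (closedBox t₁ t₂ r₁ r₂) :=
    (hf.continuousOn_fderivWithin K.uniqueDiffOn_cyl le_rfl).mono (closedBox_subset_cyl h₁ h₂)
  obtain ⟨C, hC⟩ := (isCompact_closedBox t₁ t₂ r₁ r₂).exists_bound_of_continuousOn hc
  refine ⟨C * (π / 2), fun p hp => ?_⟩
  simpa using norm_le_sin_pow_succ h₁ h₂ (hf.differentiableOn (by simp)) h0 (k := 0)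
    (by simpa using hC) hp

end Hadamard

/-- `f = O(sin^k θ)` on a subset of `ℝ × Σ`. -/
def AxisBound (D : Set (ℝ × (ℝ × ℝ))) (k : ℤ) (f : ℝ × (ℝ × ℝ) → ℝ) : Prop :=
  ∃ C, 0 ≤ C ∧ ∀ p ∈ D, |f p| ≤ C * sin p.2.2 ^ k

namespace AxisBound

variable {D : Set (ℝ × (ℝ × ℝ))} {f g : ℝ × (ℝ × ℝ) → ℝ} {j k : ℤ}

theorem mul (hD : ∀ p ∈ D, 0 < sin p.2.2) (hf : AxisBound D j f) (hg : AxisBound D k g) :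
    AxisBound D (j + k) (fun p => f p * g p) := by
  obtain ⟨C, hC, hf⟩ := hf
  obtain ⟨C', hC', hg⟩ := hg
  refine ⟨C * C', mul_nonneg hC hC', fun p hp => ?_⟩
  have hs := hD p hp
  rw [abs_mul, zpow_add₀ hs.ne']
  calc |f p| * |g p| ≤ (C * sin p.2.2 ^ j) * (C' * sin p.2.2 ^ k) :=
        mul_le_mul (hf p hp) (hg p hp) (abs_nonneg _) (by positivity)
    _ = _ := by ring

theorem add (hf : AxisBound D k f) (hg : AxisBound D k g) :
    AxisBound D k (fun p => f p + g p) := by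
  obtain ⟨C, hC, hf⟩ := hf
  obtain ⟨C', hC', hg⟩ := hg
  refine ⟨C + C', add_nonneg hC hC', fun p hp => ?_⟩
  rw [add_mul]
  exact (abs_add_le _ _).trans (add_le_add (hf p hp) (hg p hp))

theorem neg (hf : AxisBound D k f) : AxisBound D k (fun p => -f p) := by
  obtain ⟨C, hC, hf⟩ := hf
  exact ⟨C, hC, fun p hp => by rw [abs_neg]; exact hf p hp⟩

theorem sub (hf : AxisBound D k f) (hg : AxisBound D k g) :
    AxisBound D k (fun p => f p - g p) := by
  simpa [sub_eq_add_neg] using hf.add hg.neg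

theorem const_mul (c : ℝ) (hf : AxisBound D k f) : AxisBound D k (fun p => c * f p) := by
  obtain ⟨C, hC, hf⟩ := hf
  refine ⟨|c| * C, mul_nonneg (abs_nonneg c) hC, fun p hp => ?_⟩
  rw [abs_mul, mul_assoc]
  exact mul_le_mul_of_nonneg_left (hf p hp) (abs_nonneg c)

/-- Since 0 < sin θ ≤ 1, a larger exponent is the stronger bound. Estimates of composite expressions
therefore reduce to adding exponents, negative ones included, and comparing the total with the one
required. -/
theorem mono (hD : ∀ p ∈ D, 0 < sin p.2.2) (hf : AxisBound D k f) (h : j ≤ k) :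
    AxisBound D j f := by
  obtain ⟨C, hC, hf⟩ := hf
  refine ⟨C, hC, fun p hp => (hf p hp).trans ?_⟩
  exact mul_le_mul_of_nonneg_left (zpow_le_zpow_right_of_le_one₀ (hD p hp) (sin_le_one _) h) hC

theorem congr (hf : AxisBound D k f) (h : ∀ p ∈ D, g p = f p) : AxisBound D k g := by
  obtain ⟨C, hC, hf⟩ := hf
  exact ⟨C, hC, fun p hp => by rw [h p hp]; exact hf p hp⟩

theorem sum {f : Fin 2 → ℝ × (ℝ × ℝ) → ℝ} (hf : ∀ b, AxisBound D k (f b)) :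
    AxisBound D k (fun p => ∑ b, f b p) := by
  simpa only [Fin.sum_univ_two] using (hf 0).add (hf 1)

theorem of_norm_le {k : ℕ} {C : ℝ} (hD : ∀ p ∈ D, 0 < sin p.2.2)
    (h : ∀ p ∈ D, |f p| ≤ C * sin p.2.2 ^ k) : AxisBound D k f := by
  refine ⟨|C|, abs_nonneg C, fun p hp => (h p hp).trans ?_⟩
  rw [zpow_natCast]
  exact mul_le_mul_of_nonneg_right (le_abs_self C) (pow_nonneg (hD p hp).le k)

theorem sin_pow (hD : ∀ p ∈ D, 0 < sin p.2.2) (k : ℤ) :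
    AxisBound D k (fun p => sin p.2.2 ^ k) :=
  ⟨1, zero_le_one, fun p hp => by rw [abs_of_pos (zpow_pos (hD p hp) k), one_mul]⟩

end AxisBound

variable {t₁ t₂ r₁ r₂ : ℝ}

theorem axisBound_zero_of_continuousOn {f : ℝ × (ℝ × ℝ) → ℝ} (h₁ : K.rp < r₁) (h₂ : r₂ < K.rc)
    (hf : ContinuousOn f K.cyl) : AxisBound (box t₁ t₂ r₁ r₂) 0 f := by
  obtain ⟨C, hC⟩ := (isCompact_closedBox t₁ t₂ r₁ r₂).exists_bound_of_continuousOn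
    (hf.mono (closedBox_subset_cyl h₁ h₂))
  exact AxisBound.of_norm_le (k := 0) (C := C) (fun p hp => sin_pos_of_mem_box hp) fun p hp => by
    simpa using hC p (box_subset_closedBox _ _ _ _ hp)

theorem axisBound_zero_of_strip {f : ℝ × ℝ → ℝ} (h₁ : K.rp < r₁) (h₂ : r₂ < K.rc)
    (hf : ContinuousOn f K.strip) : AxisBound (box t₁ t₂ r₁ r₂) 0 (fun p => f p.2) :=
  axisBound_zero_of_continuousOn h₁ h₂ ((hf.mono K.quotAxis_subset_strip).comp
    continuous_snd.continuousOn fun _ hp => hp.2)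

/-- The function f itself may be singular on the axes; only the cofactor g has to be continuous
across them, and compactness bounds it. -/
theorem axisBound_mul_sin {f g : ℝ × ℝ → ℝ} (h₁ : K.rp < r₁) (h₂ : r₂ < K.rc) (k : ℤ)
    (hg : ContinuousOn g K.strip) (h : ∀ x ∈ K.quot, f x = sin x.2 ^ k * g x) :
    AxisBound (box t₁ t₂ r₁ r₂) k (fun p => f p.2) := by
  have h3 := (AxisBound.sin_pow (D := box t₁ t₂ r₁ r₂) (fun p hp => sin_pos_of_mem_box hp) k).mul
    (fun p hp => sin_pos_of_mem_box hp) (axisBound_zero_of_strip h₁ h₂ hg)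
  rw [add_zero] at h3
  exact h3.congr fun p hp => h _ (box_subset_quot h₁ h₂ hp)

section Background

variable (h₁ : K.rp < r₁) (h₂ : r₂ < K.rc)

include h₁ h₂

theorem axisBound_kap (b : Fin 2) :
    AxisBound (box t₁ t₂ r₁ r₂) 1 (fun p => K.kap b p.2) := by
  have c1 := K.contDiff_Delta.continuous
  have c2 := K.contDiff_PiFn.continuous
  refine axisBound_mul_sin h₁ h₂ 1
    (g := fun x => (if b = 0 then K.Delta x.1 else K.PiFn x) / K.Xi ^ 2) ?_ fun x _ => ?_
  · split_ifs
    · exact (by fun_prop : Continuous fun x : ℝ × ℝ => K.Delta x.1 / K.Xi ^ 2).continuousOn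
    · exact (by fun_prop : Continuous fun x : ℝ × ℝ => K.PiFn x / K.Xi ^ 2).continuousOn
  · rw [zpow_one, kap]
    split_ifs <;> ring

theorem axisBound_wgt : AxisBound (box t₁ t₂ r₁ r₂) 1 (fun p => K.wgt p.2) := by
  have c1 := K.contDiff_Delta.continuous
  have c2 := K.contDiff_PiFn.continuous
  have c3 := K.contDiff_SigmaFn.continuous
  refine axisBound_mul_sin h₁ h₂ 1
    (g := fun x => K.Delta x.1 * K.PiFn x / (K.Xi ^ 2 * K.SigmaFn x)) ?_ fun x _ => ?_
  · refine ContinuousOn.div (by fun_prop) (by fun_prop) fun x hx => ?_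
    exact (mul_pos (pow_pos K.Xi_pos 2) (SigmaFn_pos hx.1)).ne'
  · rw [zpow_one, wgt]
    ring

theorem axisBound_nu : AxisBound (box t₁ t₂ r₁ r₂) 1 (fun p => K.nu p.2) := by
  have c3 := K.contDiff_SigmaFn.continuous
  refine axisBound_mul_sin h₁ h₂ 1 (g := fun x => K.SigmaFn x / K.Xi ^ 2) ?_ fun x _ => ?_
  · exact (by fun_prop : Continuous fun x => K.SigmaFn x / K.Xi ^ 2).continuousOn
  · rw [zpow_one, nu]
    ring

theorem axisBound_gphi_inv : AxisBound (box t₁ t₂ r₁ r₂) (-2) (fun p => (K.gphi p.2)⁻¹) := by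
  have c2 := K.contDiff_bigB.continuous
  have c3 := K.contDiff_SigmaFn.continuous
  refine axisBound_mul_sin h₁ h₂ (-2) (f := fun x => (K.gphi x)⁻¹)
    (g := fun x => K.SigmaFn x * K.Xi ^ 2 / K.bigB x) ?_
    fun x hx => ?_
  · exact ContinuousOn.div (by fun_prop) (by fun_prop) fun x hx => (bigB_pos hx.1).ne'
  · have := (sin_pos_of_mem_quot hx).ne'
    rw [gphi, zpow_neg, zpow_ofNat]
    field_simp

theorem axisBound_twistT : AxisBound (box t₁ t₂ r₁ r₂) 0 (fun p => K.twistT p.2) :=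
  axisBound_zero_of_strip h₁ h₂ K.contDiffOn_twistT.continuousOn

/-- γ is log sin θ plus a regular function, hence a pole of order one in the θ-derivative. The
r-derivative is bounded, but one exponent for both components is enough. -/
theorem axisBound_pd_gam (b : Fin 2) :
    AxisBound (box t₁ t₂ r₁ r₂) (-1) (fun p => pd b K.gam p.2) := by
  have c1 : ContinuousOn K.bigB K.strip := K.contDiff_bigB.continuous.continuousOn
  have c2 : ContinuousOn K.SigmaFn K.strip := K.contDiff_SigmaFn.continuous.continuousOn
  have hS := fun x (hx : x ∈ K.strip) => (SigmaFn_pos (K := K) hx.1).ne'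
  have hB := fun x (hx : x ∈ K.strip) => (bigB_pos (K := K) hx.1).ne'
  have c4 : ContinuousOn K.gamr K.strip := by
    have : ContinuousOn K.bigBr K.strip := by unfold bigBr; fun_prop
    unfold gamr
    exact ((this.div c1 hB).sub (ContinuousOn.div (by fun_prop) c2 hS)).div_const 2
  have c5 : ContinuousOn K.gams K.strip := by
    have : Continuous K.bigBs := by unfold bigBs; fun_prop
    unfold gams
    exact continuousOn_const.add (ContinuousOn.mul (by fun_prop)
      ((ContinuousOn.div (by fun_prop) c1 hB).add (continuousOn_const.div c2 hS)))
  refine axisBound_mul_sin h₁ h₂ (-1)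
    (g := fun x => if b = 0 then sin x.2 * K.gamr x else cos x.2 * K.gams x) ?_ fun x hx => ?_
  · split_ifs
    · exact ContinuousOn.mul (by fun_prop) c4
    · exact ContinuousOn.mul (by fun_prop) c5
  · have := (sin_pos_of_mem_quot hx).ne'
    rw [zpow_neg_one]
    fin_cases b
    · simp [pd_zero_gam hx]
      field_simp
    · simp [pd_one_gam hx]
      field_simp

/-- The order three exceeds the order two of e^{2γ}, so e^{-2γ} dω still vanishes on the axes and
causes no singularity anywhere. -/
theorem axisBound_pd_twistPotential {om : ℝ × ℝ → ℝ} (h : K.IsTwistPotential om) (b : Fin 2) :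
    AxisBound (box t₁ t₂ r₁ r₂) 3 (fun p => pd b om p.2) := by
  have c2 : ContinuousOn K.SigmaFn K.strip := K.contDiff_SigmaFn.continuous.continuousOn
  have hS := fun x (hx : x ∈ K.strip) =>
    (mul_pos (pow_pos (SigmaFn_pos (K := K) hx.1) 2) (pow_pos K.Xi_pos 2)).ne'
  refine axisBound_mul_sin h₁ h₂ 3
    (g := fun x => if b = 0 then -(4 * K.m * K.a ^ 3 * x.1 * cos x.2 * sin x.2) /
        (K.SigmaFn x ^ 2 * K.Xi ^ 2)
      else -(2 * K.m * K.a
        * (2 * x.1 ^ 2 * (x.1 ^ 2 + K.a ^ 2) + K.SigmaFn x * (x.1 ^ 2 - K.a ^ 2)))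
        / (K.SigmaFn x ^ 2 * K.Xi ^ 2)) ?_ fun x hx => ?_
  · split_ifs
    · exact ContinuousOn.div (by fun_prop) (by fun_prop) hS
    · exact ContinuousOn.div (by fun_prop) (by fun_prop) hS
  · rw [zpow_ofNat]
    fin_cases b
    · simp [h.pd_zero hx, omr]
      ring
    · simp [h.pd_one hx, omθ]
      ring

end Background

variable (K) in
/-- Canonical variables that are smooth up to the axes and satisfy the boundary conditions of the
phase space there. -/
def AxisRegular (Q : ℝ → PhasePoint) : Prop :=
  (ContDiffOn ℝ ∞ (fun p : ℝ × (ℝ × ℝ) => (Q p.1).lam p.2) K.cyl ∧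
  ContDiffOn ℝ ∞ (fun p : ℝ × (ℝ × ℝ) => (Q p.1).eta p.2) K.cyl ∧
  ContDiffOn ℝ ∞ (fun p : ℝ × (ℝ × ℝ) => (Q p.1).u p.2) K.cyl ∧
  ContDiffOn ℝ ∞ (fun p : ℝ × (ℝ × ℝ) => (Q p.1).v p.2) K.cyl) ∧
  ∀ t, ∀ x ∈ K.axes, (Q t).lam x = 0 ∧ (Q t).eta x = 0 ∧ (Q t).u x = 0 ∧ (Q t).v x = 0 ∧
    fderivWithin ℝ (Q t).lam K.quotAxis x = 0 ∧ fderivWithin ℝ (Q t).eta K.quotAxis x = 0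

/-- `AxisRegular` omits the support condition of X. The energy estimates can thus be applied to a
Maxwell curve before its support at later times is known. -/
theorem IsSmoothCurve.axisRegular {Q : ℝ → PhasePoint} (h : K.IsSmoothCurve Q) :
    K.AxisRegular Q :=
  ⟨h.2, fun t => (h.1 t).2.2⟩

theorem AxisRegular.interiorSmooth {Q : ℝ → PhasePoint} (h : K.AxisRegular Q) :
    K.InteriorSmooth Q := by
  have hs : (univ : Set ℝ) ×ˢ K.quot ⊆ K.cyl := prod_mono_right K.quot_subset_quotAxis
  exact ⟨h.1.1.mono hs, h.1.2.1.mono hs, h.1.2.2.1.mono hs, h.1.2.2.2.mono hs⟩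

/-- A single phase point is treated as a constant curve, so that one set of bounds serves both
points and curves. -/
theorem isSmoothCurve_const {P : PhasePoint} (h : P ∈ K.phaseSpace) :
    K.IsSmoothCurve fun _ => P := by
  have hc : ∀ f : ℝ × ℝ → ℝ, ContDiffOn ℝ ∞ f K.quotAxis →
      ContDiffOn ℝ ∞ (fun p : ℝ × (ℝ × ℝ) => f p.2) (univ ×ˢ K.quotAxis) := fun f hf =>
    hf.comp contDiff_snd.contDiffOn fun _ hp => hp.2
  exact ⟨fun _ => h, hc _ h.1.1, hc _ h.1.2.1, hc _ h.1.2.2.1, hc _ h.1.2.2.2⟩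

section Fields

variable {f : ℝ × (ℝ × ℝ) → ℝ} (h₁ : K.rp < r₁) (h₂ : r₂ < K.rc)

theorem fderivWithin_cyl_eq {p : ℝ × (ℝ × ℝ)} (hp : p.2 ∈ K.quot) :
    fderivWithin ℝ f K.cyl p = fderiv ℝ f p := fderivWithin_of_mem_nhds (cyl_mem_nhds hp)

theorem differentiableAt_of_cyl (hf : ContDiffOn ℝ ∞ f K.cyl) {p : ℝ × (ℝ × ℝ)}
    (hp : p.2 ∈ K.quot) : DifferentiableAt ℝ f p :=
  (hf.contDiffAt (cyl_mem_nhds hp)).differentiableAt (by simp)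

/-- The time derivative vanishes because f is zero on the axes at all times; the spatial part is the
boundary condition of X. -/
theorem fderivWithin_cyl_axes (hf : ContDiffOn ℝ ∞ f K.cyl) (h0 : ∀ t, ∀ x ∈ K.axes, f (t, x) = 0)
    (h0' : ∀ t, ∀ x ∈ K.axes, fderivWithin ℝ (fun y => f (t, y)) K.quotAxis x = 0)
    (t : ℝ) {x : ℝ × ℝ} (hx : x ∈ K.axes) : fderivWithin ℝ f K.cyl (t, x) = 0 := by
  have hxq := K.axes_subset_quotAxis hx
  have hd := ((hf.differentiableOn (by simp)) (t, x) ⟨mem_univ t, hxq⟩).hasFDerivWithinAt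
  have e1 : HasFDerivWithinAt (fun y => f (t, y))
      ((fderivWithin ℝ f K.cyl (t, x)).comp (ContinuousLinearMap.inr ℝ ℝ (ℝ × ℝ))) K.quotAxis x :=
    hd.comp x (hasFDerivAt_prodMk_right t x).hasFDerivWithinAt fun y hy => ⟨mem_univ t, hy⟩
  have e2 := e1.fderivWithin (K.uniqueDiffOn_quotAxis x hxq)
  rw [h0' t x hx] at e2
  have e3 : HasFDerivAt (fun s => f (s, x))
      ((fderivWithin ℝ f K.cyl (t, x)).comp (ContinuousLinearMap.inl ℝ ℝ (ℝ × ℝ))) t := by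
    rw [← hasFDerivWithinAt_univ]
    exact hd.comp (s := univ) t (hasFDerivAt_prodMk_left t x).hasFDerivWithinAt
      fun s _ => (⟨mem_univ s, hxq⟩ : (s, x) ∈ K.cyl)
  have e4 : (fun s => f (s, x)) = fun _ => 0 := funext fun s => h0 s x hx
  rw [e4] at e3
  have e5 := e3.unique (hasFDerivAt_const 0 t)
  ext
  · simpa using congrArg (fun L : ℝ →L[ℝ] ℝ => L 1) e5
  · simpa using congrArg (fun L : ℝ × ℝ →L[ℝ] ℝ => L (1, 0)) e2.symm
  · simpa using congrArg (fun L : ℝ × ℝ →L[ℝ] ℝ => L (0, 1)) e2.symm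

include h₁ h₂

theorem axisBound_fderiv_of_zero (hf : ContDiffOn ℝ ∞ f K.cyl)
    (v : ℝ × (ℝ × ℝ)) : AxisBound (box t₁ t₂ r₁ r₂) 0 (fun p => fderiv ℝ f p v) := by
  have h : ContinuousOn (fun p => fderivWithin ℝ f K.cyl p v) K.cyl :=
    (hf.continuousOn_fderivWithin K.uniqueDiffOn_cyl (by simp)).clm_apply continuousOn_const
  exact (axisBound_zero_of_continuousOn h₁ h₂ h).congr fun p hp => by
    rw [fderivWithin_cyl_eq (box_subset_quot h₁ h₂ hp)]

theorem axisBound_one (hf : ContDiffOn ℝ ∞ f K.cyl) (h0 : ∀ t, ∀ x ∈ K.axes, f (t, x) = 0) :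
    AxisBound (box t₁ t₂ r₁ r₂) 1 f := by
  obtain ⟨C, hC⟩ := exists_norm_le_sin (t₁ := t₁) (t₂ := t₂) h₁ h₂ (hf.of_le (by simp)) h0
  exact AxisBound.of_norm_le (k := 1) (fun p hp => sin_pos_of_mem_box hp)
    fun p hp => by simpa using hC p (box_subset_closedBox _ _ _ _ hp)

theorem exists_norm_fderivWithin_le (hf : ContDiffOn ℝ ∞ f K.cyl)
    (h0 : ∀ t, ∀ x ∈ K.axes, fderivWithin ℝ f K.cyl (t, x) = 0) :
    ∃ C, ∀ p ∈ closedBox t₁ t₂ r₁ r₂, ‖fderivWithin ℝ f K.cyl p‖ ≤ C * sin p.2.2 :=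
  exists_norm_le_sin h₁ h₂ (hf.fderivWithin K.uniqueDiffOn_cyl (by norm_cast)) h0

/-- Integration from the nearest axis is used twice: first the derivative is O(sin θ), then the
function is O(sin² θ). -/
theorem axisBound_two (hf : ContDiffOn ℝ ∞ f K.cyl) (h0 : ∀ t, ∀ x ∈ K.axes, f (t, x) = 0)
    (h0' : ∀ t, ∀ x ∈ K.axes, fderivWithin ℝ f K.cyl (t, x) = 0) :
    AxisBound (box t₁ t₂ r₁ r₂) 2 f := by
  obtain ⟨C, hC⟩ := exists_norm_fderivWithin_le (t₁ := t₁) (t₂ := t₂) h₁ h₂ hf h0'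
  exact AxisBound.of_norm_le (k := 2) (fun p hp => sin_pos_of_mem_box hp)
    fun p hp => norm_le_sin_pow_succ h₁ h₂ (hf.differentiableOn (by simp)) h0 (k := 1)
      (by simpa using hC) (box_subset_closedBox _ _ _ _ hp)

theorem axisBound_fderiv_one (hf : ContDiffOn ℝ ∞ f K.cyl)
    (h0' : ∀ t, ∀ x ∈ K.axes, fderivWithin ℝ f K.cyl (t, x) = 0) (v : ℝ × (ℝ × ℝ)) :
    AxisBound (box t₁ t₂ r₁ r₂) 1 (fun p => fderiv ℝ f p v) := by
  obtain ⟨C, hC⟩ := exists_norm_fderivWithin_le (t₁ := t₁) (t₂ := t₂) h₁ h₂ hf h0'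
  refine AxisBound.of_norm_le (k := 1) (C := C * ‖v‖) (fun p hp => sin_pos_of_mem_box hp)
    fun p hp => ?_
  rw [← fderivWithin_cyl_eq (box_subset_quot h₁ h₂ hp), pow_one]
  calc |fderivWithin ℝ f K.cyl p v| ≤ ‖fderivWithin ℝ f K.cyl p‖ * ‖v‖ :=
        (fderivWithin ℝ f K.cyl p).le_opNorm v
    _ ≤ C * sin p.2.2 * ‖v‖ :=
        mul_le_mul_of_nonneg_right (hC p (box_subset_closedBox _ _ _ _ hp)) (norm_nonneg v)
    _ = _ := by ring

theorem axisBound_pd_deriv (hf : ContDiffOn ℝ ∞ f K.cyl) (b : Fin 2) :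
    AxisBound (box t₁ t₂ r₁ r₂) 0 (fun p => pd b (fun y => deriv (fun s => f (s, y)) p.1) p.2) := by
  have hg : ContDiffOn ℝ ∞ (fun p => fderivWithin ℝ f K.cyl p (1, 0)) K.cyl :=
    (hf.fderivWithin K.uniqueDiffOn_cyl (by simp)).clm_apply contDiffOn_const
  refine (axisBound_fderiv_of_zero h₁ h₂ hg (0, coordVec b)).congr fun p hp => ?_
  have hq := box_subset_quot h₁ h₂ hp
  have e1 : EqOn (fun y => deriv (fun s => f (s, y)) p.1)
      (fun y => fderivWithin ℝ f K.cyl (p.1, y) (1, 0)) K.quot := by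
    intro y hy
    have hy' : ((p.1, y) : ℝ × (ℝ × ℝ)).2 ∈ K.quot := hy
    simp only
    rw [fderivWithin_cyl_eq hy', (hasDerivAt_slice (differentiableAt_of_cyl hf hy')).deriv]
  rw [pd_congr b K.isOpen_quot e1 hq]
  exact pd_slice (F := fun q => fderivWithin ℝ f K.cyl q (1, 0)) (t := p.1) (x := p.2) b
    (differentiableAt_of_cyl hg hq)

end Fields

end KerrDeSitter

end

/-! ### The divergence theorem, test functions and variational derivatives on Σ. -/

noncomputable section

namespace KerrDeSitter

variable {K : KerrDeSitter}

/-! ### Integration over the quotient -/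

theorem measurableSet_quot : MeasurableSet K.quot := K.isOpen_quot.measurableSet

theorem volume_quot_lt_top : volume K.quot < ⊤ := by
  rw [quot, Measure.volume_eq_prod, Measure.prod_prod]
  exact ENNReal.mul_lt_top measure_Ioo_lt_top measure_Ioo_lt_top

theorem integrableOn_quot {F : ℝ × ℝ → ℝ} (hc : ContinuousOn F K.quot) {C : ℝ}
    (hC : ∀ x ∈ K.quot, |F x| ≤ C) : IntegrableOn F K.quot :=
  IntegrableOn.of_bound volume_quot_lt_top (hc.aestronglyMeasurable measurableSet_quot) C
    ((ae_restrict_iff' measurableSet_quot).2 (Filter.Eventually.of_forall hC))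

theorem integrableOn_quot_of_support {F : ℝ × ℝ → ℝ} (hc : ContinuousOn F K.quot) {r₁ r₂ C : ℝ}
    (hC : ∀ x ∈ K.quot, x.1 ∈ Icc r₁ r₂ → |F x| ≤ C)
    (h0 : ∀ x ∈ K.quot, x.1 ∉ Icc r₁ r₂ → F x = 0) : IntegrableOn F K.quot := by
  refine integrableOn_quot hc (C := |C|) fun x hx => ?_
  by_cases h : x.1 ∈ Icc r₁ r₂
  · exact (hC x hx h).trans (le_abs_self C)
  · rw [h0 x hx h, abs_zero]
    exact abs_nonneg C

/-- A set bounded away from the horizons is contained in a proper radial interval. -/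
theorem exists_radial_interval {r₁ r₂ : ℝ} (h₁ : K.rp < r₁) (h₂ : r₂ < K.rc) :
    ∃ s₁ s₂, K.rp < s₁ ∧ s₁ < s₂ ∧ s₂ < K.rc ∧ Icc r₁ r₂ ⊆ Ioo s₁ s₂ := by
  have h := K.rp_lt
  have hm : K.rp < (K.rp + K.rc) / 2 ∧ (K.rp + K.rc) / 2 < K.rc := by constructor <;> linarith
  obtain ⟨s₁, h3, h4⟩ := exists_between (lt_min h₁ hm.1)
  obtain ⟨s₂, h5, h6⟩ := exists_between (max_lt h₂ hm.2)
  refine ⟨s₁, s₂, h3, ?_, h6, fun r hr => ⟨?_, ?_⟩⟩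
  · exact (h4.trans_le (min_le_right _ _)).trans ((le_max_right _ _).trans_lt h5)
  · exact (h4.trans_le (min_le_left _ _)).trans_le hr.1
  · exact hr.2.trans_lt ((le_max_left _ _).trans_lt h5)

/-- The divergence theorem on `Σ` for vector fields that vanish near the horizons and tend to zero
at the axes. -/
theorem integral_divergence_eq_zero {V : Fin 2 → ℝ × ℝ → ℝ} {r₁ r₂ C : ℝ} (h₁ : K.rp < r₁)
    (h₂ : r₂ < K.rc) (hV : ∀ b, ContDiffOn ℝ ∞ (V b) K.quot)
    (hC : ∀ b, ∀ x ∈ K.quot, x.1 ∈ Icc r₁ r₂ → |V b x| ≤ C * sin x.2)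
    (h0 : ∀ b, ∀ x ∈ K.quot, x.1 ∉ Icc r₁ r₂ → V b x = 0)
    (hi : IntegrableOn (fun x => ∑ b, pd b (V b) x) K.quot) :
    ∫ x in K.quot, ∑ b, pd b (V b) x = 0 := by
  obtain ⟨s₁, s₂, hs₁, hs₁₂, hs₂, hsub⟩ := exists_radial_interval h₁ h₂
  have hC' : ∀ b, ∀ x ∈ K.quot, |V b x| ≤ |C| * sin x.2 := by
    intro b x hx
    by_cases h : x.1 ∈ Icc r₁ r₂
    · exact (hC b x hx h).trans
        (mul_le_mul_of_nonneg_right (le_abs_self C) (sin_pos_of_mem_quot hx).le)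
    · rw [h0 b x hx h, abs_zero]
      exact mul_nonneg (abs_nonneg C) (sin_pos_of_mem_quot hx).le
  set W : Fin 2 → ℝ × ℝ → ℝ := fun b => K.quot.indicator (V b) with hW
  have hWC : ∀ b, ∀ x : ℝ × ℝ, x.2 ∈ Icc 0 π → |W b x| ≤ |C| * sin x.2 := by
    intro b x hx
    by_cases h : x ∈ K.quot
    · simp only [hW, indicator_of_mem h]
      exact hC' b x h
    · simp only [hW, indicator_of_notMem h, abs_zero]
      exact mul_nonneg (abs_nonneg C) (sin_nonneg_of_mem_Icc hx)
  have hmem : ∀ x : ℝ × ℝ, x.1 ∈ Icc s₁ s₂ → x.2 ∈ Ioo 0 π → x ∈ K.quot := fun x h1 h2 =>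
    ⟨⟨hs₁.trans_le h1.1, h1.2.trans_lt hs₂⟩, h2⟩
  have hWd : ∀ b, ∀ x ∈ K.quot, HasFDerivAt (W b) (fderiv ℝ (V b) x) x := by
    intro b x hx
    exact ((hV b).differentiableAt_of_isOpen K.isOpen_quot (by simp) hx).hasFDerivAt.congr_of_eventuallyEq
      (Filter.eventuallyEq_of_mem (K.isOpen_quot.mem_nhds hx) fun y hy => indicator_of_mem hy _)
  have hIcc : Icc (s₁, 0) (s₂, π) = Icc s₁ s₂ ×ˢ Icc 0 π := Icc_prod_eq _ _
  have hWcont : ∀ b, ContinuousOn (W b) (Icc (s₁, 0) (s₂, π)) := by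
    intro b x hx
    rw [hIcc] at hx
    by_cases h : x.2 ∈ Ioo 0 π
    · exact (hWd b x (hmem x hx.1 h)).continuousAt.continuousWithinAt
    · have hsin : sin x.2 = 0 := by
        rcases eq_endpoints_or_mem_Ioo_of_mem_Icc hx.2 with h' | h' | h'
        · rw [h', sin_zero]
        · rw [h', sin_pi]
        · exact absurd h' h
      have hWx : W b x = 0 := by
        simp only [hW]
        rw [indicator_of_notMem]
        exact fun h' => h h'.2
      rw [ContinuousWithinAt, hWx, hIcc]
      refine squeeze_zero_norm' (a := fun y : ℝ × ℝ => |C| * sin y.2) ?_ ?_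
      · filter_upwards [self_mem_nhdsWithin] with y hy
        exact hWC b y hy.2
      · have : Filter.Tendsto (fun y : ℝ × ℝ => |C| * sin y.2) (nhds x) (nhds (|C| * sin x.2)) :=
          (by fun_prop : Continuous fun y : ℝ × ℝ => |C| * sin y.2).tendsto x
        rw [hsin, mul_zero] at this
        exact this.mono_left nhdsWithin_le_nhds
  have hpd0 : ∀ x ∈ K.quot, x.1 ∉ Icc r₁ r₂ → ∑ b, pd b (V b) x = 0 := by
    intro x hx hr
    refine Finset.sum_eq_zero fun b _ => ?_
    have hO : IsOpen (K.quot ∩ Prod.fst ⁻¹' (Icc r₁ r₂)ᶜ) :=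
      K.isOpen_quot.inter (isClosed_Icc.isOpen_compl.preimage continuous_fst)
    rw [pd_congr (g := fun _ => 0) b hO (fun y hy => h0 b y hy.1 hy.2) ⟨hx, hr⟩]
    simp [pd]
  have hsets : (Icc (s₁, 0) (s₂, π) : Set (ℝ × ℝ)) =ᵐ[volume] Ioo s₁ s₂ ×ˢ Ioo 0 π := by
    rw [hIcc, Measure.volume_eq_prod]
    exact Measure.set_prod_ae_eq Ioo_ae_eq_Icc.symm Ioo_ae_eq_Icc.symm
  have hsubq : Ioo s₁ s₂ ×ˢ Ioo 0 π ⊆ K.quot := fun x hx =>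
    hmem x (Ioo_subset_Icc_self hx.1) hx.2
  have hdiv := integral_divergence_prod_Icc_of_hasFDerivAt_of_le (W 0) (W 1)
    (fun x => fderiv ℝ (V 0) x) (fun x => fderiv ℝ (V 1) x) (s₁, 0) (s₂, π)
    ⟨hs₁₂.le, pi_pos.le⟩ (hWcont 0) (hWcont 1)
    (fun x hx => hWd 0 x (hsubq hx)) (fun x hx => hWd 1 x (hsubq hx))
    (by
      have h2 : IntegrableOn (fun x => ∑ b, pd b (V b) x) (Icc (s₁, 0) (s₂, π)) :=
        (hi.mono_set hsubq).congr_set_ae hsets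
      simpa [pd, Fin.sum_univ_two] using h2)
  have e1 : ∫ x in K.quot, ∑ b, pd b (V b) x
      = ∫ x in Ioo s₁ s₂ ×ˢ Ioo 0 π, ∑ b, pd b (V b) x := by
    refine setIntegral_eq_of_subset_of_forall_sdiff_eq_zero measurableSet_quot hsubq ?_
    intro x hx
    exact hpd0 x hx.1 fun h => hx.2 ⟨hsub h, hx.1.2⟩
  have hWr : ∀ b y, W b (s₁, y) = 0 ∧ W b (s₂, y) = 0 := by
    intro b y
    constructor
    · by_cases h : (s₁, y) ∈ K.quot
      · simp only [hW, indicator_of_mem h]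
        exact h0 b _ h fun h' => lt_irrefl s₁ (hsub h').1
      · simp only [hW, indicator_of_notMem h]
    · by_cases h : (s₂, y) ∈ K.quot
      · simp only [hW, indicator_of_mem h]
        exact h0 b _ h fun h' => lt_irrefl s₂ (hsub h').2
      · simp only [hW, indicator_of_notMem h]
  have hWθ : ∀ b r, W b (r, 0) = 0 ∧ W b (r, π) = 0 := by
    intro b r
    constructor
    · exact indicator_of_notMem (fun h => lt_irrefl _ h.2.1) _
    · exact indicator_of_notMem (fun h => lt_irrefl _ h.2.2) _
  rw [e1, ← setIntegral_congr_set hsets]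
  simp only [hWr, hWθ, intervalIntegral.integral_zero, sub_zero, add_zero] at hdiv
  simpa [pd, Fin.sum_univ_two] using hdiv

/-- A nonnegative continuous function with zero integral vanishes. -/
theorem eqOn_zero_of_integral_eq_zero {F : ℝ × ℝ → ℝ} (hc : ContinuousOn F K.quot)
    (hi : IntegrableOn F K.quot) (h0 : ∀ x ∈ K.quot, 0 ≤ F x) (h : ∫ x in K.quot, F x = 0) :
    EqOn F 0 K.quot := by
  rw [setIntegral_eq_zero_iff_of_nonneg_ae
    ((ae_restrict_iff' measurableSet_quot).2 (Filter.Eventually.of_forall h0)) hi] at h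
  exact Measure.eqOn_open_of_ae_eq h K.isOpen_quot hc continuousOn_const

/-! ### Test functions -/

variable (K) in
/-- Smooth functions with compact support in `Σ`. -/
def IsTest (h : ℝ × ℝ → ℝ) : Prop :=
  ContDiff ℝ ∞ h ∧ HasCompactSupport h ∧ tsupport h ⊆ K.quot

/-- The factor c may be singular at the boundary of Σ: near any point outside the support of h the
product is identically zero. -/
theorem IsTest.mul {h : ℝ × ℝ → ℝ} (hh : K.IsTest h) {c : ℝ × ℝ → ℝ}
    (hc : ContDiffOn ℝ ∞ c K.quot) : K.IsTest fun x => c x * h x := by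
  have hs : tsupport (fun x => c x * h x) ⊆ tsupport h := tsupport_mul_subset_right
  refine ⟨contDiff_iff_contDiffAt.2 fun x => ?_, hh.2.1.mul_left, hs.trans hh.2.2⟩
  by_cases hx : x ∈ K.quot
  · exact (hc.contDiffAt (K.isOpen_quot.mem_nhds hx)).mul hh.1.contDiffAt
  · have : x ∉ tsupport h := fun h' => hx (hh.2.2 h')
    have h0 := notMem_tsupport_iff_eventuallyEq.1 this
    refine (contDiffAt_const (c := (0 : ℝ))).congr_of_eventuallyEq ?_
    filter_upwards [h0] with y hy
    rw [hy, Pi.zero_apply, mul_zero]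

theorem IsTest.exists_interval {h : ℝ × ℝ → ℝ} (hh : K.IsTest h) :
    ∃ r₁ r₂, K.rp < r₁ ∧ r₂ < K.rc ∧ ∀ x, x.1 ∉ Icc r₁ r₂ → h x = 0 := by
  have hc : IsCompact (Prod.fst '' tsupport h) := hh.2.1.isCompact.image continuous_fst
  by_cases hne : (Prod.fst '' tsupport h).Nonempty
  · obtain ⟨p, hp, hp1⟩ := hc.exists_isLeast hne
    obtain ⟨p', hp', hp1'⟩ := hc.exists_isGreatest hne
    obtain ⟨y, hy, rfl⟩ := hp
    obtain ⟨y', hy', rfl⟩ := hp'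
    refine ⟨y.1, y'.1, (hh.2.2 hy).1.1, (hh.2.2 hy').1.2, fun x hx => ?_⟩
    by_contra h0
    have : x ∈ tsupport h := subset_tsupport _ h0
    exact hx ⟨hp1 ⟨x, this, rfl⟩, hp1' ⟨x, this, rfl⟩⟩
  · refine ⟨(K.rp + K.rc) / 2, (K.rp + K.rc) / 2, by linarith [K.rp_lt], by linarith [K.rp_lt],
      fun x _ => ?_⟩
    by_contra h0
    exact hne ⟨x.1, x, subset_tsupport _ h0, rfl⟩

theorem integrableOn_of_eqOn_zero {h F : ℝ × ℝ → ℝ} (hh : K.IsTest h) (hc : ContinuousOn F K.quot)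
    (h0 : ∀ x ∈ K.quot, x ∉ tsupport h → F x = 0) : IntegrableOn F K.quot := by
  obtain ⟨C, hC⟩ := hh.2.1.isCompact.exists_bound_of_continuousOn (hc.mono hh.2.2)
  refine integrableOn_quot hc (C := |C|) fun x hx => ?_
  by_cases h : x ∈ tsupport h
  · exact (hC x h).trans (le_abs_self C)
  · rw [h0 x hx h, abs_zero]
    exact abs_nonneg C

theorem pd_eq_zero_of_notMem_tsupport {h : ℝ × ℝ → ℝ} {x : ℝ × ℝ} (hx : x ∉ tsupport h)
    (b : Fin 2) : pd b h x = 0 := by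
  have h0 := notMem_tsupport_iff_eventuallyEq.1 hx
  rw [pd, h0.fderiv_eq]
  simp

/-- Integration by parts against a test function. -/
theorem integral_divergence_test {h : ℝ × ℝ → ℝ} (hh : K.IsTest h) {V : Fin 2 → ℝ × ℝ → ℝ}
    (hV : ∀ b, ContDiffOn ℝ ∞ (V b) K.quot) :
    ∫ x in K.quot, ∑ b, pd b (fun y => V b y * h y) x = 0 := by
  obtain ⟨r₁, r₂, h₁, h₂, hr⟩ := hh.exists_interval
  have hVh : ∀ b, K.IsTest fun y => V b y * h y := fun b => hh.mul (hV b)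
  have hc : Continuous fun x : ℝ × ℝ => sin x.2 := by fun_prop
  have hbd : ∀ b, ∃ C, ∀ x ∈ K.quot, |V b x * h x| ≤ C * sin x.2 := by
    intro b
    -- The bound by sin θ demanded by the divergence theorem is free here, since sin θ has a
    -- positive minimum on the compact support.
    have hcont : ContinuousOn (fun x => V b x * h x / sin x.2) (tsupport h) :=
      ((hVh b).1.continuous.continuousOn).div hc.continuousOn
        fun x hx => (sin_pos_of_mem_quot (hh.2.2 hx)).ne'
    obtain ⟨C, hC⟩ := hh.2.1.isCompact.exists_bound_of_continuousOn hcont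
    refine ⟨|C|, fun x hx => ?_⟩
    have hs := sin_pos_of_mem_quot hx
    by_cases h' : x ∈ tsupport h
    · have := hC x h'
      rw [norm_div, Real.norm_eq_abs, Real.norm_eq_abs, abs_of_pos hs, div_le_iff₀ hs] at this
      exact this.trans (mul_le_mul_of_nonneg_right (le_abs_self C) hs.le)
    · rw [image_eq_zero_of_notMem_tsupport h', mul_zero, abs_zero]
      positivity
  choose C hC using hbd
  refine integral_divergence_eq_zero (V := fun b y => V b y * h y) (C := |C 0| + |C 1|) h₁ h₂
    (fun b => (hVh b).1.contDiffOn) (fun b x hx _ => (hC b x hx).trans ?_)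
    (fun b x _ hx => by rw [hr x hx, mul_zero]) ?_
  · refine mul_le_mul_of_nonneg_right ?_ (sin_pos_of_mem_quot hx).le
    fin_cases b
    · exact (le_abs_self _).trans (le_add_of_nonneg_right (abs_nonneg _))
    · exact (le_abs_self _).trans (le_add_of_nonneg_left (abs_nonneg _))
  · refine integrableOn_of_eqOn_zero hh ?_ fun x hx hx' => ?_
    · exact continuousOn_finsetSum _ fun b _ =>
        (((hVh b).1.contDiffOn (s := K.quot)).pd K.isOpen_quot b).continuousOn
    · refine Finset.sum_eq_zero fun b _ => pd_eq_zero_of_notMem_tsupport (fun h' => hx' ?_) b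
      exact tsupport_mul_subset_right h'

/-- The fundamental lemma of the calculus of variations on `Σ`. -/
theorem eqOn_of_integral_test {f g : ℝ × ℝ → ℝ} (hf : ContinuousOn f K.quot)
    (hg : ContinuousOn g K.quot)
    (h : ∀ h, K.IsTest h → ∫ x in K.quot, f x * h x = ∫ x in K.quot, g x * h x) :
    EqOn f g K.quot := by
  have hli : LocallyIntegrableOn (fun x => f x - g x) K.quot :=
    (hf.sub hg).locallyIntegrableOn measurableSet_quot
  have key := K.isOpen_quot.ae_eq_zero_of_integral_contDiff_smul_eq_zero hli (fun k hk hk' hk'' => by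
    have hi : ∀ f, ContinuousOn f K.quot → IntegrableOn (fun x => f x * k x) K.quot := fun f hf =>
      integrableOn_of_eqOn_zero ⟨hk, hk', hk''⟩ (hf.mul hk.continuous.continuousOn)
        fun x _ hx => by rw [image_eq_zero_of_notMem_tsupport hx, mul_zero]
    have e1 : ∫ x, k x • (f x - g x) = ∫ x in K.quot, k x • (f x - g x) := by
      refine (setIntegral_eq_integral_of_forall_compl_eq_zero fun x hx => ?_).symm
      rw [image_eq_zero_of_notMem_tsupport (fun h' => hx (hk'' h')), zero_smul]
    rw [e1]
    have e2 : ∀ x, k x • (f x - g x) = f x * k x - g x * k x := fun x => by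
      rw [smul_eq_mul]; ring
    simp only [e2]
    rw [integral_sub (hi f hf) (hi g hg), h k ⟨hk, hk', hk''⟩, sub_self])
  have hae : f =ᵐ[volume.restrict K.quot] g := by
    rw [Filter.EventuallyEq, ae_restrict_iff' measurableSet_quot]
    filter_upwards [key] with x hx hxq
    exact sub_eq_zero.1 (hx hxq)
  exact Measure.eqOn_open_of_ae_eq hae K.isOpen_quot hf hg

/-- The variational derivative is unique. -/
theorem HasVarDeriv.iff_eqOn {F : (ℝ × ℝ → ℝ) → ℝ} {f g₀ g : ℝ × ℝ → ℝ}
    (h : K.HasVarDeriv F f g₀) (hg₀ : ContinuousOn g₀ K.quot) (hg : ContinuousOn g K.quot) :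
    K.HasVarDeriv F f g ↔ EqOn g g₀ K.quot := by
  constructor
  · intro h'
    exact eqOn_of_integral_test hg hg₀ fun k hk =>
      (h' k hk.1 hk.2.1 hk.2.2).unique (h k hk.1 hk.2.1 hk.2.2)
  · intro he k h1 h2 h3
    have := h k h1 h2 h3
    rwa [← setIntegral_congr_fun (f := fun x => g x * k x) measurableSet_quot
      fun x hx => by simp only [he hx]] at this

/-- Variational derivatives under a rescaling of the field. -/
theorem hasVarDeriv_rescale {c : ℝ × ℝ → ℝ} (hc : ContDiffOn ℝ ∞ c K.quot) (hc0 : ∀ x, c x ≠ 0)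
    {F F' : (ℝ × ℝ → ℝ) → ℝ} {f g : ℝ × ℝ → ℝ}
    (hF : ∀ h, K.IsTest h → ∀ s : ℝ,
      F' (fun x => c x * f x + s * (c x * h x)) = F (fun x => f x + s * h x)) :
    K.HasVarDeriv F' (fun x => c x * f x) (fun x => (c x)⁻¹ * g x) ↔ K.HasVarDeriv F f g := by
  constructor
  · intro h k h1 h2 h3
    -- Multiplication by the nowhere vanishing c permutes the test functions; varying by k on one
    -- side is varying by c k on the other, and the factor c⁻¹ in the gradient compensates.
    have hk := IsTest.mul (h := k) ⟨h1, h2, h3⟩ hc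
    have := h _ hk.1 hk.2.1 hk.2.2
    simp only [hF k ⟨h1, h2, h3⟩] at this
    refine this.congr_deriv (integral_congr_ae (Filter.Eventually.of_forall fun x => ?_))
    have := hc0 x
    simp only
    field_simp
  · intro h k h1 h2 h3
    have hk : K.IsTest fun x => (c x)⁻¹ * k x :=
      IsTest.mul (h := k) ⟨h1, h2, h3⟩ (hc.inv fun x _ => hc0 x)
    have h4 := h _ hk.1 hk.2.1 hk.2.2
    have e1 : ∀ (s : ℝ), F (fun x => f x + s * ((c x)⁻¹ * k x))
        = F' (fun x => c x * f x + s * k x) := fun s => by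
      have e0 : ∀ x, c x * ((c x)⁻¹ * k x) = k x := fun x => mul_inv_cancel_left₀ (hc0 x) _
      rw [← hF _ hk s]
      simp only [e0]
    have h4 := h4.congr_of_eventuallyEq (f₁ := fun s => F' (fun x => c x * f x + s * k x))
      (Filter.Eventually.of_forall fun s => (e1 s).symm)
    refine h4.congr_deriv (integral_congr_ae (Filter.Eventually.of_forall fun x => ?_))
    simp only
    ring

/-! ### Linear structure of the phase space -/

variable (K) in
/-- Functions that are smooth up to the axes and vanish near the horizons and on the axes. -/
def IsMomentumField (f : ℝ × ℝ → ℝ) : Prop :=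
  ContDiffOn ℝ ∞ f K.quotAxis ∧
    (∃ r₁ r₂, K.rp < r₁ ∧ r₂ < K.rc ∧ ∀ x ∈ K.quotAxis, x.1 ∉ Icc r₁ r₂ → f x = 0) ∧
    ∀ x ∈ K.axes, f x = 0

variable (K) in
/-- Functions that are smooth up to the axes, vanish near the horizons and vanish on the axes
together with their first derivatives. -/
def IsConfigField (f : ℝ × ℝ → ℝ) : Prop :=
  K.IsMomentumField f ∧ ∀ x ∈ K.axes, fderivWithin ℝ f K.quotAxis x = 0

/-- Separates the four components, so that the variation of one variable can be checked alone. The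
common radial interval is the hull of the four individual ones. -/
theorem mem_phaseSpace_iff {P : PhasePoint} : P ∈ K.phaseSpace ↔
    K.IsConfigField P.lam ∧ K.IsConfigField P.eta ∧ K.IsMomentumField P.u ∧
      K.IsMomentumField P.v := by
  constructor
  · rintro ⟨⟨c1, c2, c3, c4⟩, ⟨r₁, r₂, h₁, h₂, hr⟩, ha⟩
    exact ⟨⟨⟨c1, ⟨r₁, r₂, h₁, h₂, fun x hx h => (hr x hx h).1⟩, fun x hx => (ha x hx).1⟩,
        fun x hx => (ha x hx).2.2.2.2.1⟩,
      ⟨⟨c2, ⟨r₁, r₂, h₁, h₂, fun x hx h => (hr x hx h).2.1⟩, fun x hx => (ha x hx).2.1⟩,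
        fun x hx => (ha x hx).2.2.2.2.2⟩,
      ⟨c3, ⟨r₁, r₂, h₁, h₂, fun x hx h => (hr x hx h).2.2.1⟩, fun x hx => (ha x hx).2.2.1⟩,
      ⟨c4, ⟨r₁, r₂, h₁, h₂, fun x hx h => (hr x hx h).2.2.2⟩, fun x hx => (ha x hx).2.2.2.1⟩⟩
  · rintro ⟨⟨⟨c1, ⟨r₁, r₂, h₁, h₂, hr⟩, a1⟩, d1⟩, ⟨⟨c2, ⟨r₁', r₂', h₁', h₂', hr'⟩, a2⟩, d2⟩,
      ⟨c3, ⟨s₁, s₂, k₁, k₂, hs⟩, a3⟩, ⟨c4, ⟨s₁', s₂', k₁', k₂', hs'⟩, a4⟩⟩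
    refine ⟨⟨c1, c2, c3, c4⟩, ⟨min (min r₁ r₁') (min s₁ s₁'), max (max r₂ r₂') (max s₂ s₂'),
      by simp [*], by simp [*], fun x hx h => ?_⟩, fun x hx =>
      ⟨a1 x hx, a2 x hx, a3 x hx, a4 x hx, d1 x hx, d2 x hx⟩⟩
    refine ⟨hr x hx fun h' => h ⟨?_, ?_⟩, hr' x hx fun h' => h ⟨?_, ?_⟩, hs x hx fun h' => h ⟨?_, ?_⟩,
      hs' x hx fun h' => h ⟨?_, ?_⟩⟩ <;> simp [h'.1, h'.2]

theorem IsTest.isConfigField {h : ℝ × ℝ → ℝ} (hh : K.IsTest h) : K.IsConfigField h := by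
  obtain ⟨r₁, r₂, h₁, h₂, hr⟩ := hh.exists_interval
  have hax : ∀ x ∈ K.axes, x ∉ tsupport h := by
    intro x hx h'
    have := sin_pos_of_mem_quot (hh.2.2 h')
    rcases hx.2 with h0 | h0
    · rw [h0, sin_zero] at this
      exact lt_irrefl _ this
    · rw [mem_singleton_iff] at h0
      rw [h0, sin_pi] at this
      exact lt_irrefl _ this
  refine ⟨⟨hh.1.contDiffOn, ⟨r₁, r₂, h₁, h₂, fun x _ hx => hr x hx⟩,
    fun x hx => image_eq_zero_of_notMem_tsupport (hax x hx)⟩, fun x hx => ?_⟩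
  rw [(hh.1.differentiable (by simp) x).fderivWithin
    (K.uniqueDiffOn_quotAxis x (K.axes_subset_quotAxis hx)),
    (notMem_tsupport_iff_eventuallyEq.1 (hax x hx)).fderiv_eq]
  simp

theorem IsMomentumField.add_mul {f g : ℝ × ℝ → ℝ} (hf : K.IsMomentumField f)
    (hg : K.IsMomentumField g) (s : ℝ) : K.IsMomentumField fun x => f x + s * g x := by
  obtain ⟨c1, ⟨r₁, r₂, h₁, h₂, hr⟩, a1⟩ := hf
  obtain ⟨c2, ⟨r₁', r₂', h₁', h₂', hr'⟩, a2⟩ := hg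
  refine ⟨c1.add (contDiffOn_const.mul c2), ⟨min r₁ r₁', max r₂ r₂', by simp [*], by simp [*],
    fun x hx h => ?_⟩, fun x hx => by simp [a1 x hx, a2 x hx]⟩
  simp only
  rw [hr x hx fun h' => h ⟨by simp [h'.1], by simp [h'.2]⟩,
    hr' x hx fun h' => h ⟨by simp [h'.1], by simp [h'.2]⟩]
  simp

/-- With `IsTest.isConfigField` this keeps varied phase points inside X, where H^ADM and H^Alt are
known to agree. -/
theorem IsConfigField.add_mul {f g : ℝ × ℝ → ℝ} (hf : K.IsConfigField f)
    (hg : K.IsConfigField g) (s : ℝ) : K.IsConfigField fun x => f x + s * g x := by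
  refine ⟨hf.1.add_mul hg.1 s, fun x hx => ?_⟩
  have hq := K.axes_subset_quotAxis hx
  have d1 := (hf.1.1.differentiableOn (by simp)) x hq
  have d2 := (hg.1.1.differentiableOn (by simp)) x hq
  rw [fderivWithin_fun_add (K.uniqueDiffOn_quotAxis x hq) d1 (d2.const_mul s),
    fderivWithin_const_mul (K.uniqueDiffOn_quotAxis x hq) d2, hf.2 x hx, hg.2 x hx]
  simp

end KerrDeSitter

end

/-! ### Boundedness of the densities, and the Hamiltonians on X. -/

noncomputable section

namespace KerrDeSitter

variable {K : KerrDeSitter} {om : ℝ × ℝ → ℝ} {P : PhasePoint} {Q : ℝ → PhasePoint}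
  {t₁ t₂ r₁ r₂ : ℝ}

/-! ### Bounds for the densities -/

section Bounds

variable (h₁ : K.rp < r₁) (h₂ : r₂ < K.rc) (hQ : K.AxisRegular Q)

include h₁ h₂

theorem axisBound_pd_of_fderiv {f : ℝ × (ℝ × ℝ) → ℝ} (hf : ContDiffOn ℝ ∞ f K.cyl) {b : Fin 2}
    {k : ℤ} (h : AxisBound (box t₁ t₂ r₁ r₂) k (fun p => fderiv ℝ f p (0, coordVec b))) :
    AxisBound (box t₁ t₂ r₁ r₂) k (fun p => pd b (fun y => f (p.1, y)) p.2) :=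
  h.congr fun p hp => pd_slice (x := p.2) (t := p.1) b
    (differentiableAt_of_cyl hf (box_subset_quot h₁ h₂ hp))

theorem axisBound_deriv_of_fderiv {f : ℝ × (ℝ × ℝ) → ℝ} (hf : ContDiffOn ℝ ∞ f K.cyl)
    {k : ℤ} (h : AxisBound (box t₁ t₂ r₁ r₂) k (fun p => fderiv ℝ f p (1, 0))) :
    AxisBound (box t₁ t₂ r₁ r₂) k (fun p => deriv (fun s => f (s, p.2)) p.1) :=
  h.congr fun p hp => (hasDerivAt_slice (x := p.2) (t := p.1)
    (differentiableAt_of_cyl hf (box_subset_quot h₁ h₂ hp))).deriv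

include hQ

/-- The orders 2, 1, 1, 0 of λ, dλ, ∂_t λ and d∂_t λ are what the boundary conditions give by
integration from the axis. All later bounds add these exponents to those of the background. -/
theorem AxisRegular.bound_lam :
    AxisBound (box t₁ t₂ r₁ r₂) 2 (fun p => (Q p.1).lam p.2) ∧
    (∀ b, AxisBound (box t₁ t₂ r₁ r₂) 1 (fun p => pd b (Q p.1).lam p.2)) ∧
    AxisBound (box t₁ t₂ r₁ r₂) 1 (fun p => deriv (fun s => (Q s).lam p.2) p.1) ∧
    ∀ b, AxisBound (box t₁ t₂ r₁ r₂) 0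
      (fun p => pd b (fun y => deriv (fun s => (Q s).lam y) p.1) p.2) := by
  have hf := hQ.1.1
  have h0 : ∀ t, ∀ x ∈ K.axes, fderivWithin ℝ (fun p : ℝ × (ℝ × ℝ) => (Q p.1).lam p.2) K.cyl (t, x)
      = 0 := fun t x hx => fderivWithin_cyl_axes hf (fun t x hx => (hQ.2 t x hx).1)
    (fun t x hx => (hQ.2 t x hx).2.2.2.2.1) t hx
  exact ⟨axisBound_two h₁ h₂ hf (fun t x hx => (hQ.2 t x hx).1) h0,
    fun b => axisBound_pd_of_fderiv h₁ h₂ hf (axisBound_fderiv_one h₁ h₂ hf h0 _),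
    axisBound_deriv_of_fderiv h₁ h₂ hf (axisBound_fderiv_one h₁ h₂ hf h0 _),
    fun b => axisBound_pd_deriv h₁ h₂ hf b⟩

theorem AxisRegular.bound_eta :
    AxisBound (box t₁ t₂ r₁ r₂) 2 (fun p => (Q p.1).eta p.2) ∧
    (∀ b, AxisBound (box t₁ t₂ r₁ r₂) 1 (fun p => pd b (Q p.1).eta p.2)) ∧
    AxisBound (box t₁ t₂ r₁ r₂) 1 (fun p => deriv (fun s => (Q s).eta p.2) p.1) ∧
    ∀ b, AxisBound (box t₁ t₂ r₁ r₂) 0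
      (fun p => pd b (fun y => deriv (fun s => (Q s).eta y) p.1) p.2) := by
  have hf := hQ.1.2.1
  have h0 : ∀ t, ∀ x ∈ K.axes, fderivWithin ℝ (fun p : ℝ × (ℝ × ℝ) => (Q p.1).eta p.2) K.cyl (t, x)
      = 0 := fun t x hx => fderivWithin_cyl_axes hf (fun t x hx => (hQ.2 t x hx).2.1)
    (fun t x hx => (hQ.2 t x hx).2.2.2.2.2) t hx
  exact ⟨axisBound_two h₁ h₂ hf (fun t x hx => (hQ.2 t x hx).2.1) h0,
    fun b => axisBound_pd_of_fderiv h₁ h₂ hf (axisBound_fderiv_one h₁ h₂ hf h0 _),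
    axisBound_deriv_of_fderiv h₁ h₂ hf (axisBound_fderiv_one h₁ h₂ hf h0 _),
    fun b => axisBound_pd_deriv h₁ h₂ hf b⟩

theorem AxisRegular.bound_u :
    AxisBound (box t₁ t₂ r₁ r₂) 1 (fun p => (Q p.1).u p.2) ∧
    AxisBound (box t₁ t₂ r₁ r₂) 0 (fun p => deriv (fun s => (Q s).u p.2) p.1) :=
  ⟨axisBound_one h₁ h₂ hQ.1.2.2.1 fun t x hx => (hQ.2 t x hx).2.2.1,
    axisBound_deriv_of_fderiv h₁ h₂ hQ.1.2.2.1 (axisBound_fderiv_of_zero h₁ h₂ hQ.1.2.2.1 _)⟩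

theorem AxisRegular.bound_v :
    AxisBound (box t₁ t₂ r₁ r₂) 1 (fun p => (Q p.1).v p.2) ∧
    AxisBound (box t₁ t₂ r₁ r₂) 0 (fun p => deriv (fun s => (Q s).v p.2) p.1) :=
  ⟨axisBound_one h₁ h₂ hQ.1.2.2.2 fun t x hx => (hQ.2 t x hx).2.2.2.1,
    axisBound_deriv_of_fderiv h₁ h₂ hQ.1.2.2.2 (axisBound_fderiv_of_zero h₁ h₂ hQ.1.2.2.2 _)⟩

theorem AxisRegular.bound_densityADM :
    AxisBound (box t₁ t₂ r₁ r₂) 0 (fun p => K.densityADM (Q p.1) p.2) := by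
  have hD : ∀ p ∈ box t₁ t₂ r₁ r₂, 0 < sin p.2.2 := fun p hp => sin_pos_of_mem_box hp
  obtain ⟨-, bl, -, -⟩ := hQ.bound_lam (t₁ := t₁) (t₂ := t₂) h₁ h₂
  obtain ⟨-, be, -, -⟩ := hQ.bound_eta (t₁ := t₁) (t₂ := t₂) h₁ h₂
  obtain ⟨bu, -⟩ := hQ.bound_u (t₁ := t₁) (t₂ := t₂) h₁ h₂
  obtain ⟨bv, -⟩ := hQ.bound_v (t₁ := t₁) (t₂ := t₂) h₁ h₂
  have bw := axisBound_wgt (t₁ := t₁) (t₂ := t₂) h₁ h₂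
  have bG := axisBound_gphi_inv (t₁ := t₁) (t₂ := t₂) h₁ h₂
  have bA := axisBound_twistT (t₁ := t₁) (t₂ := t₂) h₁ h₂
  have bk := fun b => axisBound_kap (t₁ := t₁) (t₂ := t₂) h₁ h₂ b
  have e1 := ((bw.mul hD ((bu.mul hD bu).add (bv.mul hD bv))).const_mul (1 / 2)).mono hD
    (by norm_num : (0 : ℤ) ≤ _)
  have e2 := (((AxisBound.sum fun b => (bk b).mul hD (((be b).mul hD (be b)).add
    ((bl b).mul hD (bl b)))).mul hD bG).const_mul (1 / 2)).mono hD (by norm_num : (0 : ℤ) ≤ _)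
  have e3 := (bA.mul hD (((be 0).mul hD (bl 1)).sub ((be 1).mul hD (bl 0)))).mono hD
    (by norm_num : (0 : ℤ) ≤ _)
  refine ((e1.add e2).sub e3).congr fun p hp => ?_
  rw [densityADM_eq (Q p.1) (box_subset_quot h₁ h₂ hp)]
  simp only [Fin.sum_univ_two]
  ring

/-- Order one is what the divergence theorem asks for. The critical term (λ² + η²) kap dγ / e^{2γ}
has order 4 + (1 - 1 - 2) = 2; if λ and η were only O(sin θ), the count would drop to zero and no
longer exclude a flux through the axes. -/
theorem AxisRegular.bound_gaugeCurrent (b : Fin 2) :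
    AxisBound (box t₁ t₂ r₁ r₂) 1 (fun p => K.gaugeCurrent (Q p.1) b p.2) := by
  have hD : ∀ p ∈ box t₁ t₂ r₁ r₂, 0 < sin p.2.2 := fun p hp => sin_pos_of_mem_box hp
  obtain ⟨bl0, bl, -, -⟩ := hQ.bound_lam (t₁ := t₁) (t₂ := t₂) h₁ h₂
  obtain ⟨be0, be, -, -⟩ := hQ.bound_eta (t₁ := t₁) (t₂ := t₂) h₁ h₂
  have bG := axisBound_gphi_inv (t₁ := t₁) (t₂ := t₂) h₁ h₂
  have bA := axisBound_twistT (t₁ := t₁) (t₂ := t₂) h₁ h₂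
  have bk := axisBound_kap (t₁ := t₁) (t₂ := t₂) h₁ h₂ b
  have bg := axisBound_pd_gam (t₁ := t₁) (t₂ := t₂) h₁ h₂ b
  have e1 := ((((bl0.mul hD bl0).add (be0.mul hD be0)).mul hD
    ((bk.mul hD bg).mul hD bG)).const_mul (-(1 / 2))).mono hD (by norm_num : (1 : ℤ) ≤ _)
  have e2 := ((bA.mul hD (AxisBound.sum fun c => (((be0.mul hD (bl c)).sub
    (bl0.mul hD (be c)))).const_mul (eps2 b c))).const_mul (1 / 2)).mono hD
    (by norm_num : (1 : ℤ) ≤ _)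
  refine (e1.add e2).congr fun p hp => ?_
  rw [gaugeCurrent]
  simp only [Fin.sum_univ_two]
  ring

variable (hom : K.IsTwistPotential om)

include hom

theorem AxisRegular.bound_covEta (b : Fin 2) :
    AxisBound (box t₁ t₂ r₁ r₂) 1 (fun p => K.covEta om (Q p.1) b p.2) := by
  have hD : ∀ p ∈ box t₁ t₂ r₁ r₂, 0 < sin p.2.2 := fun p hp => sin_pos_of_mem_box hp
  obtain ⟨bl0, bl, -, -⟩ := hQ.bound_lam (t₁ := t₁) (t₂ := t₂) h₁ h₂
  obtain ⟨be0, be, -, -⟩ := hQ.bound_eta (t₁ := t₁) (t₂ := t₂) h₁ h₂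
  have bG := axisBound_gphi_inv (t₁ := t₁) (t₂ := t₂) h₁ h₂
  have bg := axisBound_pd_gam (t₁ := t₁) (t₂ := t₂) h₁ h₂ b
  have bo := axisBound_pd_twistPotential (t₁ := t₁) (t₂ := t₂) h₁ h₂ hom b
  have e1 := (((bl0.mul hD bo).mul hD bG).const_mul (1 / 2)).mono hD (by norm_num : (1 : ℤ) ≤ _)
  have e2 := (be0.mul hD bg).mono hD (by norm_num : (1 : ℤ) ≤ _)
  refine (((be b).add e1).sub e2).congr fun p hp => ?_
  rw [covEta]
  ring

theorem AxisRegular.bound_covLam (b : Fin 2) :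
    AxisBound (box t₁ t₂ r₁ r₂) 1 (fun p => K.covLam om (Q p.1) b p.2) := by
  have hD : ∀ p ∈ box t₁ t₂ r₁ r₂, 0 < sin p.2.2 := fun p hp => sin_pos_of_mem_box hp
  obtain ⟨bl0, bl, -, -⟩ := hQ.bound_lam (t₁ := t₁) (t₂ := t₂) h₁ h₂
  obtain ⟨be0, be, -, -⟩ := hQ.bound_eta (t₁ := t₁) (t₂ := t₂) h₁ h₂
  have bG := axisBound_gphi_inv (t₁ := t₁) (t₂ := t₂) h₁ h₂
  have bg := axisBound_pd_gam (t₁ := t₁) (t₂ := t₂) h₁ h₂ b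
  have bo := axisBound_pd_twistPotential (t₁ := t₁) (t₂ := t₂) h₁ h₂ hom b
  have e1 := (((be0.mul hD bo).mul hD bG).const_mul (1 / 2)).mono hD (by norm_num : (1 : ℤ) ≤ _)
  have e2 := (bl0.mul hD bg).mono hD (by norm_num : (1 : ℤ) ≤ _)
  refine (((bl b).sub e1).sub e2).congr fun p hp => ?_
  rw [covLam]
  ring

omit hQ in
theorem axisBound_mass : AxisBound (box t₁ t₂ r₁ r₂) (-1) (fun p => K.mass om p.2) := by
  have hD : ∀ p ∈ box t₁ t₂ r₁ r₂, 0 < sin p.2.2 := fun p hp => sin_pos_of_mem_box hp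
  have bG := axisBound_gphi_inv (t₁ := t₁) (t₂ := t₂) h₁ h₂
  have bn := axisBound_nu (t₁ := t₁) (t₂ := t₂) h₁ h₂
  have bk := fun b => axisBound_kap (t₁ := t₁) (t₂ := t₂) h₁ h₂ b
  have bg := fun b => axisBound_pd_gam (t₁ := t₁) (t₂ := t₂) h₁ h₂ b
  have bo := fun b => axisBound_pd_twistPotential (t₁ := t₁) (t₂ := t₂) h₁ h₂ hom b
  have e1 := (bn.const_mul K.Lam).mono hD (by norm_num : (-1 : ℤ) ≤ _)
  have e2 := AxisBound.sum fun b => ((bk b).mul hD ((bg b).mul hD (bg b))).mono hD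
    (by norm_num : (-1 : ℤ) ≤ _)
  have e3 := AxisBound.sum fun b => (((bk b).mul hD (((bo b).mul hD bG).mul hD
    ((bo b).mul hD bG))).const_mul (1 / 4)).mono hD (by norm_num : (-1 : ℤ) ≤ _)
  refine ((e1.add e2).add e3).congr fun p hp => ?_
  simp only [mass, Fin.sum_univ_two]
  ring

theorem AxisRegular.bound_densityAlt :
    AxisBound (box t₁ t₂ r₁ r₂) 0 (fun p => K.densityAlt om (Q p.1) p.2) := by
  have hD : ∀ p ∈ box t₁ t₂ r₁ r₂, 0 < sin p.2.2 := fun p hp => sin_pos_of_mem_box hp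
  obtain ⟨bl0, -, -, -⟩ := hQ.bound_lam (t₁ := t₁) (t₂ := t₂) h₁ h₂
  obtain ⟨be0, -, -, -⟩ := hQ.bound_eta (t₁ := t₁) (t₂ := t₂) h₁ h₂
  obtain ⟨bu, -⟩ := hQ.bound_u (t₁ := t₁) (t₂ := t₂) h₁ h₂
  obtain ⟨bv, -⟩ := hQ.bound_v (t₁ := t₁) (t₂ := t₂) h₁ h₂
  have bw := axisBound_wgt (t₁ := t₁) (t₂ := t₂) h₁ h₂
  have bG := axisBound_gphi_inv (t₁ := t₁) (t₂ := t₂) h₁ h₂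
  have bk := fun b => axisBound_kap (t₁ := t₁) (t₂ := t₂) h₁ h₂ b
  have bE := fun b => hQ.bound_covEta (t₁ := t₁) (t₂ := t₂) h₁ h₂ hom b
  have bL := fun b => hQ.bound_covLam (t₁ := t₁) (t₂ := t₂) h₁ h₂ hom b
  have bm := axisBound_mass (t₁ := t₁) (t₂ := t₂) h₁ h₂ hom
  have e1 := ((bw.mul hD ((bu.mul hD bu).add (bv.mul hD bv))).const_mul (1 / 2)).mono hD
    (by norm_num : (0 : ℤ) ≤ _)
  have e2 := (((AxisBound.sum fun b => (bk b).mul hD (((bE b).mul hD (bE b)).add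
    ((bL b).mul hD (bL b)))).mul hD bG).const_mul (1 / 2)).mono hD (by norm_num : (0 : ℤ) ≤ _)
  have e3 := (((bm.mul hD ((bl0.mul hD bl0).add (be0.mul hD be0))).mul hD bG).const_mul
    (1 / 2)).mono hD (by norm_num : (0 : ℤ) ≤ _)
  refine ((e1.add e2).add e3).congr fun p hp => ?_
  rw [densityAlt_eq om (Q p.1) (box_subset_quot h₁ h₂ hp)]
  simp only [Fin.sum_univ_two]
  ring

theorem AxisRegular.bound_momentum (b : Fin 2) :
    AxisBound (box t₁ t₂ r₁ r₂) 1 (fun p => K.momentum om (Q p.1) b p.2) := by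
  have hD : ∀ p ∈ box t₁ t₂ r₁ r₂, 0 < sin p.2.2 := fun p hp => sin_pos_of_mem_box hp
  obtain ⟨bu, -⟩ := hQ.bound_u (t₁ := t₁) (t₂ := t₂) h₁ h₂
  obtain ⟨bv, -⟩ := hQ.bound_v (t₁ := t₁) (t₂ := t₂) h₁ h₂
  have bw := axisBound_wgt (t₁ := t₁) (t₂ := t₂) h₁ h₂
  have bG := axisBound_gphi_inv (t₁ := t₁) (t₂ := t₂) h₁ h₂
  have bk := axisBound_kap (t₁ := t₁) (t₂ := t₂) h₁ h₂ b
  have bE := hQ.bound_covEta (t₁ := t₁) (t₂ := t₂) h₁ h₂ hom b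
  have bL := hQ.bound_covLam (t₁ := t₁) (t₂ := t₂) h₁ h₂ hom b
  have e1 := ((((bw.mul hD bk).mul hD bG).mul hD ((bu.mul hD bE).add (bv.mul hD bL))).neg).mono hD
    (by norm_num : (1 : ℤ) ≤ _)
  refine e1.congr fun p hp => ?_
  have h3 := currentAlt_snd_eqOn om Q p.1 b (box_subset_quot h₁ h₂ hp)
  simp only at h3
  rw [← h3, currentAlt_snd om Q p.1 (box_subset_quot h₁ h₂ hp) b]
  ring

/-- Serves to differentiate the weighted energy under the integral. The mass term and the gradient
term have exponent exactly zero, so nothing is wasted in these estimates. -/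
theorem AxisRegular.bound_deriv_densityAlt :
    AxisBound (box t₁ t₂ r₁ r₂) 0 (fun p => deriv (fun s => K.densityAlt om (Q s) p.2) p.1) := by
  have hD : ∀ p ∈ box t₁ t₂ r₁ r₂, 0 < sin p.2.2 := fun p hp => sin_pos_of_mem_box hp
  obtain ⟨bl0, -, blt, bltb⟩ := hQ.bound_lam (t₁ := t₁) (t₂ := t₂) h₁ h₂
  obtain ⟨be0, -, bet, betb⟩ := hQ.bound_eta (t₁ := t₁) (t₂ := t₂) h₁ h₂
  obtain ⟨bu, but⟩ := hQ.bound_u (t₁ := t₁) (t₂ := t₂) h₁ h₂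
  obtain ⟨bv, bvt⟩ := hQ.bound_v (t₁ := t₁) (t₂ := t₂) h₁ h₂
  have bw := axisBound_wgt (t₁ := t₁) (t₂ := t₂) h₁ h₂
  have bG := axisBound_gphi_inv (t₁ := t₁) (t₂ := t₂) h₁ h₂
  have bk := fun b => axisBound_kap (t₁ := t₁) (t₂ := t₂) h₁ h₂ b
  have bg := fun b => axisBound_pd_gam (t₁ := t₁) (t₂ := t₂) h₁ h₂ b
  have bo := fun b => axisBound_pd_twistPotential (t₁ := t₁) (t₂ := t₂) h₁ h₂ hom b
  have bE := fun b => hQ.bound_covEta (t₁ := t₁) (t₂ := t₂) h₁ h₂ hom b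
  have bL := fun b => hQ.bound_covLam (t₁ := t₁) (t₂ := t₂) h₁ h₂ hom b
  have bm := axisBound_mass (t₁ := t₁) (t₂ := t₂) h₁ h₂ hom
  have e1 := (bw.mul hD ((bu.mul hD but).add (bv.mul hD bvt))).mono hD
    (by norm_num : (0 : ℤ) ≤ _)
  have e3 := ((bm.mul hD ((bl0.mul hD blt).add (be0.mul hD bet))).mul hD bG).mono hD
    (by norm_num : (0 : ℤ) ≤ _)
  have f1 := fun b => (((blt.mul hD (bo b)).mul hD bG).const_mul (1 / 2)).mono hD
    (by norm_num : (0 : ℤ) ≤ _)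
  have f2 := fun b => (((bet.mul hD (bo b)).mul hD bG).const_mul (1 / 2)).mono hD
    (by norm_num : (0 : ℤ) ≤ _)
  have f3 := fun b => (bet.mul hD (bg b)).mono hD (by norm_num : (0 : ℤ) ≤ _)
  have f4 := fun b => (blt.mul hD (bg b)).mono hD (by norm_num : (0 : ℤ) ≤ _)
  have f5 := fun b => (bE b).mul hD (((betb b).add (f1 b)).sub (f3 b))
  have f6 := fun b => (bL b).mul hD (((bltb b).sub (f2 b)).sub (f4 b))
  have e2 := ((AxisBound.sum fun b => (bk b).mul hD ((f5 b).add (f6 b))).mul hD bG).mono hD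
    (by norm_num : (0 : ℤ) ≤ _)
  refine ((e1.add e3).add e2).congr fun p hp => ?_
  rw [(hasDerivAt_densityAlt hQ.interiorSmooth (box_subset_quot h₁ h₂ hp) p.1).deriv]
  simp only [Fin.sum_univ_two]
  ring

end Bounds

/-- The time interval degenerates to a point: bounds on space-time boxes specialize to a single
slice. -/
theorem AxisBound.exists_slice {k : ℤ} {F : ℝ × (ℝ × ℝ) → ℝ} {t : ℝ}
    (h : AxisBound (box t t r₁ r₂) k F) :
    ∃ C, ∀ x ∈ K.quot, x.1 ∈ Icc r₁ r₂ → |F (t, x)| ≤ C * sin x.2 ^ k := by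
  obtain ⟨C, -, hC⟩ := h
  exact ⟨C, fun x hx hr => hC (t, x) ⟨⟨le_rfl, le_rfl⟩, hr, hx.2⟩⟩

/-! ### Continuity and supports of the densities -/

theorem continuousOn_densityADM (hl : ContDiffOn ℝ ∞ P.lam K.quot)
    (he : ContDiffOn ℝ ∞ P.eta K.quot) (hu : ContinuousOn P.u K.quot)
    (hv : ContinuousOn P.v K.quot) : ContinuousOn (K.densityADM P) K.quot := by
  have hlb := fun b => (hl.pd K.isOpen_quot b).continuousOn
  have heb := fun b => (he.pd K.isOpen_quot b).continuousOn
  have hk := fun b => (K.contDiff_kap b).continuous.continuousOn (s := K.quot)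
  have hw := (K.contDiffOn_wgt.mono K.quot_subset_strip).continuousOn
  have hA := (K.contDiffOn_twistT.mono K.quot_subset_strip).continuousOn
  have hG := (K.contDiffOn_gphi.mono K.quot_subset_strip).continuousOn
  have hG0 : ∀ x ∈ K.quot, 2 * K.gphi x ≠ 0 := fun x hx => (mul_pos two_pos (gphi_pos hx)).ne'
  refine ContinuousOn.congr ?_ fun x hx => densityADM_eq P hx
  refine ((continuousOn_const.mul hw).mul ((hu.pow 2).add (hv.pow 2))).add
    ((continuousOn_finsetSum _ fun b _ => (hk b).mul (((heb b).pow 2).add ((hlb b).pow 2))).div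
      (continuousOn_const.mul hG) hG0) |>.sub (hA.mul (((heb 0).mul (hlb 1)).sub
      ((heb 1).mul (hlb 0))))

theorem continuousOn_densityAlt (hom : ContDiffOn ℝ ∞ om K.quot)
    (hl : ContDiffOn ℝ ∞ P.lam K.quot)
    (he : ContDiffOn ℝ ∞ P.eta K.quot) (hu : ContinuousOn P.u K.quot)
    (hv : ContinuousOn P.v K.quot) : ContinuousOn (K.densityAlt om P) K.quot := by
  have hlb := fun b => (hl.pd K.isOpen_quot b).continuousOn
  have heb := fun b => (he.pd K.isOpen_quot b).continuousOn
  have hob := fun b => (hom.pd K.isOpen_quot b).continuousOn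
  have hgb := fun b => (K.contDiffOn_gam.pd K.isOpen_quot b).continuousOn
  have hk := fun b => (K.contDiff_kap b).continuous.continuousOn (s := K.quot)
  have hn := K.contDiff_nu.continuous.continuousOn (s := K.quot)
  have hw := (K.contDiffOn_wgt.mono K.quot_subset_strip).continuousOn
  have hG := (K.contDiffOn_gphi.mono K.quot_subset_strip).continuousOn
  have hG0 : ∀ x ∈ K.quot, 2 * K.gphi x ≠ 0 := fun x hx => (mul_pos two_pos (gphi_pos hx)).ne'
  have hG1 : ∀ x ∈ K.quot, 4 * K.gphi x ^ 2 ≠ 0 := fun x hx =>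
    (mul_pos four_pos (pow_pos (gphi_pos hx) 2)).ne'
  have h2G := (continuousOn_const (c := (2 : ℝ))).mul hG
  have hm : ContinuousOn (K.mass om) K.quot :=
    (continuousOn_const.mul hn).add (continuousOn_finsetSum _ fun b _ => (hk b).mul
      (((hgb b).pow 2).add (((hob b).pow 2).div (continuousOn_const.mul (hG.pow 2)) hG1)))
  have hcE : ∀ b, ContinuousOn (K.covEta om P b) K.quot := fun b =>
    ((heb b).add ((hl.continuousOn.mul (hob b)).div h2G hG0)).sub (he.continuousOn.mul (hgb b))
  have hcL : ∀ b, ContinuousOn (K.covLam om P b) K.quot := fun b =>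
    ((hlb b).sub ((he.continuousOn.mul (hob b)).div h2G hG0)).sub (hl.continuousOn.mul (hgb b))
  refine ContinuousOn.congr ?_ fun x hx => densityAlt_eq om P hx
  exact ((continuousOn_const.mul hw).mul ((hu.pow 2).add (hv.pow 2))).add
    (((hm.mul ((hl.continuousOn.pow 2).add (he.continuousOn.pow 2))).add
      (continuousOn_finsetSum _ fun b _ =>
        (hk b).mul (((hcE b).pow 2).add ((hcL b).pow 2)))).div h2G hG0)

section Vanishing

variable {U : Set (ℝ × ℝ)} {x : ℝ × ℝ}

theorem pd_eq_zero_of_eqOn {f : ℝ × ℝ → ℝ} (hU : IsOpen U) (h : ∀ y ∈ U, f y = 0) (hx : x ∈ U)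
    (b : Fin 2) : pd b f x = 0 := by
  rw [pd_congr (g := fun _ => 0) b hU h hx]
  simp [pd]

variable (hU : IsOpen U) (hUq : U ⊆ K.quot)
  (h : ∀ y ∈ U, P.lam y = 0 ∧ P.eta y = 0 ∧ P.u y = 0 ∧ P.v y = 0) (hx : x ∈ U)

include hU hUq h hx

theorem densityADM_eq_zero : K.densityADM P x = 0 := by
  have hl := pd_eq_zero_of_eqOn hU (fun y hy => (h y hy).1) hx
  have he := pd_eq_zero_of_eqOn hU (fun y hy => (h y hy).2.1) hx
  rw [densityADM_eq P (hUq hx)]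
  simp [h x hx, hl, he]

theorem densityAlt_eq_zero : K.densityAlt om P x = 0 := by
  have hl := pd_eq_zero_of_eqOn hU (fun y hy => (h y hy).1) hx
  have he := pd_eq_zero_of_eqOn hU (fun y hy => (h y hy).2.1) hx
  rw [densityAlt_eq om P (hUq hx)]
  simp [h x hx, hl, he, covEta, covLam]

end Vanishing

theorem isOpen_quot_diff (r₁ r₂ : ℝ) : IsOpen (K.quot ∩ Prod.fst ⁻¹' (Icc r₁ r₂)ᶜ) :=
  K.isOpen_quot.inter (isClosed_Icc.isOpen_compl.preimage continuous_fst)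

/-! ### The Hamiltonians on the phase space -/

theorem smooth_of_mem_phaseSpace (hP : P ∈ K.phaseSpace) :
    ContDiffOn ℝ ∞ P.lam K.quot ∧ ContDiffOn ℝ ∞ P.eta K.quot ∧ ContDiffOn ℝ ∞ P.u K.quot ∧
      ContDiffOn ℝ ∞ P.v K.quot :=
  ⟨hP.1.1.mono K.quot_subset_quotAxis, hP.1.2.1.mono K.quot_subset_quotAxis,
    hP.1.2.2.1.mono K.quot_subset_quotAxis, hP.1.2.2.2.mono K.quot_subset_quotAxis⟩

theorem integrableOn_densityADM (hP : P ∈ K.phaseSpace) :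
    IntegrableOn (K.densityADM P) K.quot := by
  obtain ⟨hl, he, hu, hv⟩ := smooth_of_mem_phaseSpace hP
  obtain ⟨r₁, r₂, h₁, h₂, hr⟩ := hP.2.1
  obtain ⟨C, hC⟩ := ((isSmoothCurve_const hP).axisRegular.bound_densityADM (t₁ := 0) (t₂ := 0)
    h₁ h₂).exists_slice (K := K)
  refine integrableOn_quot_of_support (C := C)
    (continuousOn_densityADM hl he hu.continuousOn hv.continuousOn)
    (fun x hx hxr => by simpa using hC x hx hxr) fun x hx hxr => ?_
  exact densityADM_eq_zero (isOpen_quot_diff r₁ r₂) inter_subset_left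
    (fun y hy => hr y (K.quot_subset_quotAxis hy.1) hy.2) ⟨hx, hxr⟩

theorem integrableOn_densityAlt (hom : K.IsTwistPotential om) (hP : P ∈ K.phaseSpace) :
    IntegrableOn (K.densityAlt om P) K.quot := by
  obtain ⟨hl, he, hu, hv⟩ := smooth_of_mem_phaseSpace hP
  obtain ⟨r₁, r₂, h₁, h₂, hr⟩ := hP.2.1
  obtain ⟨C, hC⟩ := ((isSmoothCurve_const hP).axisRegular.bound_densityAlt (t₁ := 0) (t₂ := 0)
    h₁ h₂ hom).exists_slice (K := K)
  refine integrableOn_quot_of_support (C := C)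
    (continuousOn_densityAlt hom.1 hl he hu.continuousOn hv.continuousOn)
    (fun x hx hxr => by simpa using hC x hx hxr) fun x hx hxr => ?_
  exact densityAlt_eq_zero (isOpen_quot_diff r₁ r₂) inter_subset_left
    (fun y hy => hr y (K.quot_subset_quotAxis hy.1) hy.2) ⟨hx, hxr⟩

/-- The difference is the integral of div `gaugeCurrent`. There is no flux at the horizons by the
support condition and none at the axes by `AxisRegular.bound_gaugeCurrent`. -/
theorem energy_densityADM_eq (hom : K.IsTwistPotential om) (hP : P ∈ K.phaseSpace) :
    K.energy K.densityADM P = K.energy (K.densityAlt om) P := by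
  obtain ⟨hl, he, hu, hv⟩ := smooth_of_mem_phaseSpace hP
  obtain ⟨r₁, r₂, h₁, h₂, hr⟩ := hP.2.1
  have hb := fun b => ((isSmoothCurve_const hP).axisRegular.bound_gaugeCurrent (t₁ := 0) (t₂ := 0)
    h₁ h₂ b).exists_slice (K := K)
  choose C hC using hb
  have i1 := integrableOn_densityADM hP
  have i2 := integrableOn_densityAlt hom hP
  have heq : EqOn (fun x => K.densityAlt om P x - K.densityADM P x)
      (fun x => ∑ b, pd b (K.gaugeCurrent P b) x) K.quot :=
    fun x hx => densityAlt_sub_densityADM hom hl he hx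
  have hdiv := integral_divergence_eq_zero (V := K.gaugeCurrent P) (C := |C 0| + |C 1|) h₁ h₂
    (contDiffOn_gaugeCurrent hl he) (fun b x hx hxr => ?_) (fun b x hx hxr => ?_)
    ((i2.sub i1).congr_fun heq measurableSet_quot)
  · rw [← setIntegral_congr_fun measurableSet_quot heq, integral_sub i2 i1, sub_eq_zero] at hdiv
    exact hdiv.symm
  · refine (hC b x hx hxr).trans ?_
    rw [zpow_one]
    refine mul_le_mul_of_nonneg_right ?_ (sin_pos_of_mem_quot hx).le
    fin_cases b
    · exact (le_abs_self _).trans (le_add_of_nonneg_right (abs_nonneg _))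
    · exact (le_abs_self _).trans (le_add_of_nonneg_left (abs_nonneg _))
  · have := hr x (K.quot_subset_quotAxis hx) hxr
    simp [gaugeCurrent, this]

theorem energy_densityAlt_nonneg (om : ℝ × ℝ → ℝ) (P : PhasePoint) :
    0 ≤ K.energy (K.densityAlt om) P :=
  setIntegral_nonneg measurableSet_quot fun _ hx => densityAlt_nonneg om P hx

theorem isPositiveDefinite_densityAlt (hom : K.IsTwistPotential om) :
    K.IsPositiveDefinite (K.densityAlt om) K.phaseSpace := by
  refine fun P hP => ⟨integrableOn_densityAlt hom hP, energy_densityAlt_nonneg om P, ?_, ?_⟩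
  · intro h x hx
    obtain ⟨hl, he, hu, hv⟩ := smooth_of_mem_phaseSpace hP
    exact densityAlt_eq_zero_iff om P hx (eqOn_zero_of_integral_eq_zero
      (continuousOn_densityAlt hom.1 hl he hu.continuousOn hv.continuousOn)
      (integrableOn_densityAlt hom hP) (fun x hx => densityAlt_nonneg om P hx) h hx)
  · intro h
    rw [energy, setIntegral_congr_fun (g := fun _ => 0) measurableSet_quot fun x hx =>
      densityAlt_eq_zero K.isOpen_quot subset_rfl h hx, integral_zero]

end KerrDeSitter

end

/-! ### Hamilton's equations in the original and in the regularized variables. -/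

noncomputable section

namespace KerrDeSitter

variable {K : KerrDeSitter} {om : ℝ × ℝ → ℝ} {P : PhasePoint} {Q : ℝ → PhasePoint}

/-! ### Variational derivatives of the Hamiltonian -/

/-- The energy is a quadratic polynomial in each canonical variable, so along a line it is an
explicit polynomial in s. No limit has to be exchanged with the integral. -/
theorem hasDerivAt_integral_quadratic {E B C : ℝ × ℝ → ℝ} {F : ℝ → ℝ}
    (hE : IntegrableOn E K.quot) (hB : IntegrableOn B K.quot) (hC : IntegrableOn C K.quot)
    (hF : ∀ s, F s = ∫ x in K.quot, (E x + s * B x + s ^ 2 * C x)) :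
    HasDerivAt F (∫ x in K.quot, B x) 0 := by
  have h : F = fun s => (∫ x in K.quot, E x) + s * (∫ x in K.quot, B x)
      + s ^ 2 * ∫ x in K.quot, C x := by
    funext s
    rw [hF, integral_add (f := fun x => E x + s * B x) (hE.add (hB.const_mul s)) (hC.const_mul _),
      integral_add hE (hB.const_mul s), integral_const_mul, integral_const_mul]
  rw [h]
  have h1 := (((hasDerivAt_id (0 : ℝ)).mul_const (∫ x in K.quot, B x)).const_add
    (∫ x in K.quot, E x)).add (((hasDerivAt_id (0 : ℝ)).pow 2).mul_const (∫ x in K.quot, C x))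
  refine h1.congr_deriv ?_
  simp

/-- As in the three companion lemmas, the variation is computed on H^ADM. This is legitimate because
the varied point stays in X, and it is simpler because E^ADM contains λ and η only through their
derivatives. -/
theorem hasVarDeriv_u (hom : K.IsTwistPotential om) (hP : P ∈ K.phaseSpace) :
    K.HasVarDeriv (fun w => K.energy (K.densityAlt om) { P with u := w }) P.u
      (fun x => K.wgt x * P.u x) := by
  intro h h1 h2 h3
  have hh : K.IsTest h := ⟨h1, h2, h3⟩
  obtain ⟨hl, he, hu, hv⟩ := mem_phaseSpace_iff.1 hP
  have hw := (K.contDiffOn_wgt.mono K.quot_subset_strip).continuousOn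
  have hhc := h1.continuous.continuousOn (s := K.quot)
  have huc := (smooth_of_mem_phaseSpace hP).2.2.1.continuousOn
  refine hasDerivAt_integral_quadratic (C := fun x => 1 / 2 * K.wgt x * h x ^ 2)
    (integrableOn_densityADM hP) ?_ ?_ fun s => ?_
  · exact integrableOn_of_eqOn_zero hh ((hw.mul huc).mul hhc) fun x _ hx => by
      rw [image_eq_zero_of_notMem_tsupport hx, mul_zero]
  · exact integrableOn_of_eqOn_zero hh ((continuousOn_const.mul hw).mul (hhc.pow 2)) fun x _ hx => by
      rw [image_eq_zero_of_notMem_tsupport hx]; ring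
  · beta_reduce
    rw [← energy_densityADM_eq hom (mem_phaseSpace_iff (P := { P with u := fun x => P.u x + s * h x }).2
      ⟨hl, he, hu.add_mul hh.isConfigField.1 s, hv⟩), energy]
    refine setIntegral_congr_fun measurableSet_quot fun x hx => ?_
    simp only [densityADM_eq _ hx]
    ring

theorem hasVarDeriv_v (hom : K.IsTwistPotential om) (hP : P ∈ K.phaseSpace) :
    K.HasVarDeriv (fun w => K.energy (K.densityAlt om) { P with v := w }) P.v
      (fun x => K.wgt x * P.v x) := by
  intro h h1 h2 h3
  have hh : K.IsTest h := ⟨h1, h2, h3⟩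
  obtain ⟨hl, he, hu, hv⟩ := mem_phaseSpace_iff.1 hP
  have hw := (K.contDiffOn_wgt.mono K.quot_subset_strip).continuousOn
  have hhc := h1.continuous.continuousOn (s := K.quot)
  have hvc := (smooth_of_mem_phaseSpace hP).2.2.2.continuousOn
  refine hasDerivAt_integral_quadratic (C := fun x => 1 / 2 * K.wgt x * h x ^ 2)
    (integrableOn_densityADM hP) ?_ ?_ fun s => ?_
  · exact integrableOn_of_eqOn_zero hh ((hw.mul hvc).mul hhc) fun x _ hx => by
      rw [image_eq_zero_of_notMem_tsupport hx, mul_zero]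
  · exact integrableOn_of_eqOn_zero hh ((continuousOn_const.mul hw).mul (hhc.pow 2)) fun x _ hx => by
      rw [image_eq_zero_of_notMem_tsupport hx]; ring
  · beta_reduce
    rw [← energy_densityADM_eq hom (mem_phaseSpace_iff (P := { P with v := fun x => P.v x + s * h x }).2
      ⟨hl, he, hu, hv.add_mul hh.isConfigField.1 s⟩), energy]
    refine setIntegral_congr_fun measurableSet_quot fun x hx => ?_
    simp only [densityADM_eq _ hx]
    ring

section Configuration

variable {f g h : ℝ × ℝ → ℝ} (hf : ContDiffOn ℝ ∞ f K.quot) (hg : ContDiffOn ℝ ∞ g K.quot)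
  (hh : K.IsTest h) (σ : ℝ)

variable (K) in
/-- The first variation of the configuration part of the ADM energy density. -/
def firstVariation (σ : ℝ) (f g h : ℝ × ℝ → ℝ) (x : ℝ × ℝ) : ℝ :=
  (∑ b, K.kap b x * pd b f x * pd b h x) / K.gphi x
    - σ * K.twistT x * (pd 0 h x * pd 1 g x - pd 1 h x * pd 0 g x)

include hf hg hh in
theorem integrableOn_firstVariation : IntegrableOn (K.firstVariation σ f g h) K.quot := by
  have hfb := fun b => (hf.pd K.isOpen_quot b).continuousOn
  have hgb := fun b => (hg.pd K.isOpen_quot b).continuousOn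
  have hhb := fun b => ((hh.1.contDiffOn (s := K.quot)).pd K.isOpen_quot b).continuousOn
  have hk := fun b => (K.contDiff_kap b).continuous.continuousOn (s := K.quot)
  have hA := (K.contDiffOn_twistT.mono K.quot_subset_strip).continuousOn
  have hG := (K.contDiffOn_gphi.mono K.quot_subset_strip).continuousOn
  refine integrableOn_of_eqOn_zero hh (((continuousOn_finsetSum _ fun b _ =>
    ((hk b).mul (hfb b)).mul (hhb b)).div hG fun x hx => (gphi_pos hx).ne').sub
    ((continuousOn_const.mul hA).mul (((hhb 0).mul (hgb 1)).sub ((hhb 1).mul (hgb 0)))))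
    fun x _ hx => ?_
  simp [firstVariation, pd_eq_zero_of_notMem_tsupport hx]

include hh in
theorem integrableOn_secondVariation :
    IntegrableOn (fun x => (∑ b, K.kap b x * pd b h x ^ 2) / (2 * K.gphi x)) K.quot := by
  have hhb := fun b => ((hh.1.contDiffOn (s := K.quot)).pd K.isOpen_quot b).continuousOn
  have hk := fun b => (K.contDiff_kap b).continuous.continuousOn (s := K.quot)
  have hG := (K.contDiffOn_gphi.mono K.quot_subset_strip).continuousOn
  refine integrableOn_of_eqOn_zero hh ((continuousOn_finsetSum _ fun b _ =>
    (hk b).mul ((hhb b).pow 2)).div (continuousOn_const.mul hG) fun x hx =>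
      (mul_pos two_pos (gphi_pos hx)).ne') fun x _ hx => ?_
  simp [pd_eq_zero_of_notMem_tsupport hx]

include hf hg hh in
/-- Integration by parts in the first variation. -/
theorem integral_firstVariation (hom : K.IsTwistPotential om) :
    ∫ x in K.quot, K.firstVariation σ f g h x = ∫ x in K.quot,
      -((∑ b, pd b (fun y => K.kap b y * pd b f y / K.gphi y) x)
        + σ * ((∑ b, K.kap b x * pd b om x * pd b g x) / K.gphi x ^ 2)) * h x := by
  have hA := K.contDiffOn_twistT.mono K.quot_subset_strip
  have hgb := fun b => hg.pd K.isOpen_quot b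
  have hF := fun b => contDiffOn_kap_mul_pd_div hf b
  have hT : ∀ b, ContDiffOn ℝ ∞ (fun y => σ * (K.twistT y * ∑ c, eps2 b c * pd c g y)) K.quot :=
    fun b => contDiffOn_const.mul (hA.mul (ContDiffOn.sum fun c _ => contDiffOn_const.mul (hgb c)))
  -- The second part of this vector field moves the derivative off h in the twist term. Its
  -- divergence is d𝒜_t ∧ dg, since the second derivatives of g cancel, and the twist equation turns
  -- it into kap dω · dg / e^{4γ}.
  have h0 := integral_divergence_test hh (V := fun b y => K.kap b y * pd b f y / K.gphi y
    - σ * (K.twistT y * ∑ c, eps2 b c * pd c g y)) fun b => (hF b).sub (hT b)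
  set R : ℝ × ℝ → ℝ := fun x => -((∑ b, pd b (fun y => K.kap b y * pd b f y / K.gphi y) x)
        + σ * ((∑ b, K.kap b x * pd b om x * pd b g x) / K.gphi x ^ 2)) * h x with hR
  have hRi : IntegrableOn R K.quot := by
    refine integrableOn_of_eqOn_zero hh ?_ fun x _ hx => by
      rw [hR]; simp only [image_eq_zero_of_notMem_tsupport hx, mul_zero]
    have hk := fun b => (K.contDiff_kap b).continuous.continuousOn (s := K.quot)
    have hob := fun b => (hom.1.pd K.isOpen_quot b).continuousOn
    have hG := (K.contDiffOn_gphi.mono K.quot_subset_strip).continuousOn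
    exact (((continuousOn_finsetSum _ fun b _ => ((hF b).pd K.isOpen_quot b).continuousOn).add
      (continuousOn_const.mul ((continuousOn_finsetSum _ fun b _ => ((hk b).mul (hob b)).mul
        (hgb b).continuousOn).div (hG.pow 2) fun x hx => (pow_pos (gphi_pos hx) 2).ne'))).neg).mul
      hh.1.continuous.continuousOn
  rw [← sub_eq_zero, ← integral_sub (integrableOn_firstVariation hf hg hh σ) hRi, ← h0]
  refine setIntegral_congr_fun measurableSet_quot fun x hx => ?_
  have hd : ∀ {f : ℝ × ℝ → ℝ}, ContDiffOn ℝ ∞ f K.quot → DifferentiableAt ℝ f x :=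
    fun hf => hf.differentiableAt_of_isOpen K.isOpen_quot (by simp) hx
  have hhd : DifferentiableAt ℝ h x := hh.1.differentiable (by simp) x
  have e1 : ∀ b, pd b (fun y => (K.kap b y * pd b f y / K.gphi y
      - σ * (K.twistT y * ∑ c, eps2 b c * pd c g y)) * h y) x
      = (K.kap b x * pd b f x / K.gphi x - σ * (K.twistT x * ∑ c, eps2 b c * pd c g x)) * pd b h x
        + h x * (pd b (fun y => K.kap b y * pd b f y / K.gphi y) x
          - σ * (K.twistT x * pd b (fun y => ∑ c, eps2 b c * pd c g y) x
            + (∑ c, eps2 b c * pd c g x) * pd b K.twistT x)) := fun b => by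
    have hs : ContDiffOn ℝ ∞ (fun y => ∑ c, eps2 b c * pd c g y) K.quot :=
      ContDiffOn.sum fun c _ => contDiffOn_const.mul (hgb c)
    rw [pd_mul b (hd ((hF b).sub (hT b))) hhd, pd_sub b (hd (hF b)) (hd (hT b)),
      pd_const_mul b σ (hd (hA.mul hs)), pd_mul b (hd hA) (hd hs)]
  have e2 : pd 0 (fun y => ∑ c, eps2 0 c * pd c g y) x = pd 0 (pd 1 g) x := by
    congr 1; funext y; simp [eps2]
  have e3 : pd 1 (fun y => ∑ c, eps2 1 c * pd c g y) x = -pd 1 (pd 0 g) x := by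
    rw [← pd_neg]; congr 1; funext y; simp [eps2]
  have hG := (gphi_pos hx).ne'
  have hp0 := pd_zero_twistT hx
  have hp1 := pd_one_twistT hx
  rw [← hom.pd_one hx] at hp0
  rw [← hom.pd_zero hx] at hp1
  rw [Fin.sum_univ_two, e1, e1, e2, e3, pd_comm hg K.isOpen_quot hx, hp0, hp1, firstVariation, hR]
  simp only [Fin.sum_univ_two, eps2, Matrix.of_apply, Matrix.cons_val_zero, Matrix.cons_val_one,
    Matrix.cons_val', Matrix.cons_val_fin_one]
  field_simp
  ring

end Configuration

/-- The term -𝒜_t dη ∧ dλ is antisymmetric under exchange of η and λ. One formula for the first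
variation therefore serves both, with σ = 1 here and σ = -1 in `hasVarDeriv_lam`. -/
theorem hasVarDeriv_eta (hom : K.IsTwistPotential om) (hP : P ∈ K.phaseSpace) :
    K.HasVarDeriv (fun w => K.energy (K.densityAlt om) { P with eta := w }) P.eta
      (fun x => -K.forceU om P x) := by
  intro h h1 h2 h3
  have hh : K.IsTest h := ⟨h1, h2, h3⟩
  obtain ⟨hl, he, hu, hv⟩ := mem_phaseSpace_iff.1 hP
  obtain ⟨sl, se, -, -⟩ := smooth_of_mem_phaseSpace hP
  have key := hasDerivAt_integral_quadratic (integrableOn_densityADM hP)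
    (integrableOn_firstVariation se sl hh 1) (integrableOn_secondVariation hh)
    (F := fun s => K.energy (K.densityAlt om) { P with eta := fun x => P.eta x + s * h x })
    fun s => ?_
  · rw [integral_firstVariation se sl hh 1 hom] at key
    simpa only [one_mul, forceU] using key
  · rw [← energy_densityADM_eq hom (mem_phaseSpace_iff (P := { P with eta := fun x => P.eta x + s * h x }).2
      ⟨hl, he.add_mul hh.isConfigField s, hu, hv⟩), energy]
    refine setIntegral_congr_fun measurableSet_quot fun x hx => ?_
    have hd : DifferentiableAt ℝ P.eta x := se.differentiableAt_of_isOpen K.isOpen_quot (by simp) hx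
    have hhd : DifferentiableAt ℝ h x := h1.differentiable (by simp) x
    have e : ∀ b, pd b (fun y => P.eta y + s * h y) x = pd b P.eta x + s * pd b h x := fun b => by
      rw [pd_add b hd (hhd.const_mul s), pd_const_mul b s hhd]
    simp only [densityADM_eq _ hx, e, firstVariation, Fin.sum_univ_two]
    have := (gphi_pos hx).ne'
    field_simp
    ring

theorem hasVarDeriv_lam (hom : K.IsTwistPotential om) (hP : P ∈ K.phaseSpace) :
    K.HasVarDeriv (fun w => K.energy (K.densityAlt om) { P with lam := w }) P.lam
      (fun x => -K.forceV om P x) := by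
  intro h h1 h2 h3
  have hh : K.IsTest h := ⟨h1, h2, h3⟩
  obtain ⟨hl, he, hu, hv⟩ := mem_phaseSpace_iff.1 hP
  obtain ⟨sl, se, -, -⟩ := smooth_of_mem_phaseSpace hP
  have key := hasDerivAt_integral_quadratic (integrableOn_densityADM hP)
    (integrableOn_firstVariation sl se hh (-1)) (integrableOn_secondVariation hh)
    (F := fun s => K.energy (K.densityAlt om) { P with lam := fun x => P.lam x + s * h x })
    fun s => ?_
  · rw [integral_firstVariation sl se hh (-1) hom] at key
    simpa only [neg_mul, one_mul, forceV, sub_eq_add_neg] using key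
  · rw [← energy_densityADM_eq hom (mem_phaseSpace_iff (P := { P with lam := fun x => P.lam x + s * h x }).2
      ⟨hl.add_mul hh.isConfigField s, he, hu, hv⟩), energy]
    refine setIntegral_congr_fun measurableSet_quot fun x hx => ?_
    have hd : DifferentiableAt ℝ P.lam x := sl.differentiableAt_of_isOpen K.isOpen_quot (by simp) hx
    have hhd : DifferentiableAt ℝ h x := h1.differentiable (by simp) x
    have e : ∀ b, pd b (fun y => P.lam y + s * h y) x = pd b P.lam x + s * pd b h x := fun b => by
      rw [pd_add b hd (hhd.const_mul s), pd_const_mul b s hhd]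
    simp only [densityADM_eq _ hx, e, firstVariation, Fin.sum_univ_two]
    have := (gphi_pos hx).ne'
    field_simp
    ring

/-! ### Hamilton's equations -/

theorem continuousOn_deriv_slice {F : ℝ × (ℝ × ℝ) → ℝ} (hF : ContDiffOn ℝ ∞ F (univ ×ˢ K.quot))
    (t : ℝ) : ContinuousOn (fun x => deriv (fun s => F (s, x)) t) K.quot := by
  have hU : IsOpen ((univ : Set ℝ) ×ˢ K.quot) := isOpen_univ.prod K.isOpen_quot
  refine (((hF.fderiv_apply_of_isOpen hU (1, 0)).slice (mem_univ t)).continuousOn).congr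
    fun x hx => ?_
  exact (hasDerivAt_slice (((hF (t, x) ⟨mem_univ _, hx⟩).contDiffAt
    (hU.mem_nhds ⟨mem_univ _, hx⟩)).differentiableAt (by simp))).deriv

theorem continuousOn_forceU (hom : ContDiffOn ℝ ∞ om K.quot) (hl : ContDiffOn ℝ ∞ P.lam K.quot)
    (he : ContDiffOn ℝ ∞ P.eta K.quot) : ContinuousOn (K.forceU om P) K.quot := by
  have hk := fun b => (K.contDiff_kap b).continuous.continuousOn (s := K.quot)
  have hob := fun b => (hom.pd K.isOpen_quot b).continuousOn
  have hG := (K.contDiffOn_gphi.mono K.quot_subset_strip).continuousOn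
  exact (continuousOn_finsetSum _ fun b _ =>
    ((contDiffOn_kap_mul_pd_div he b).pd K.isOpen_quot b).continuousOn).add
    ((continuousOn_finsetSum _ fun b _ => ((hk b).mul (hob b)).mul
      (hl.pd K.isOpen_quot b).continuousOn).div (hG.pow 2) fun x hx =>
        (pow_pos (gphi_pos hx) 2).ne')

theorem continuousOn_forceV (hom : ContDiffOn ℝ ∞ om K.quot) (hl : ContDiffOn ℝ ∞ P.lam K.quot)
    (he : ContDiffOn ℝ ∞ P.eta K.quot) : ContinuousOn (K.forceV om P) K.quot := by
  have hk := fun b => (K.contDiff_kap b).continuous.continuousOn (s := K.quot)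
  have hob := fun b => (hom.pd K.isOpen_quot b).continuousOn
  have hG := (K.contDiffOn_gphi.mono K.quot_subset_strip).continuousOn
  exact (continuousOn_finsetSum _ fun b _ =>
    ((contDiffOn_kap_mul_pd_div hl b).pd K.isOpen_quot b).continuousOn).sub
    ((continuousOn_finsetSum _ fun b _ => ((hk b).mul (hob b)).mul
      (he.pd K.isOpen_quot b).continuousOn).div (hG.pow 2) fun x hx =>
        (pow_pos (gphi_pos hx) 2).ne')

/-- Hamilton's equations of `H^Alt` are the field equations. -/
theorem isHamiltonFlow_densityAlt_iff (hom : K.IsTwistPotential om) (hQ : K.IsSmoothCurve Q) :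
    K.IsHamiltonFlow (K.energy (K.densityAlt om)) Q ↔ K.FieldEquations om Q := by
  have hI := hQ.axisRegular.interiorSmooth
  have hw := (K.contDiffOn_wgt.mono K.quot_subset_strip).continuousOn
  rw [fieldEquations_iff, IsHamiltonFlow]
  refine forall_congr' fun t => ?_
  have c1 := (hasVarDeriv_u hom (hQ.1 t)).iff_eqOn (hw.mul (hI.u t).continuousOn)
    (g := fun x => deriv (fun s => (Q s).eta x) t) (continuousOn_deriv_slice hI.2.1 t)
  have c2 := (hasVarDeriv_v hom (hQ.1 t)).iff_eqOn (hw.mul (hI.v t).continuousOn)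
    (g := fun x => deriv (fun s => (Q s).lam x) t) (continuousOn_deriv_slice hI.1 t)
  have c3 := (hasVarDeriv_eta hom (hQ.1 t)).iff_eqOn
    (continuousOn_forceU hom.1 (hI.lam t) (hI.eta t)).neg
    (g := fun x => -deriv (fun s => (Q s).u x) t) (continuousOn_deriv_slice hI.2.2.1 t).neg
  have c4 := (hasVarDeriv_lam hom (hQ.1 t)).iff_eqOn
    (continuousOn_forceV hom.1 (hI.lam t) (hI.eta t)).neg
    (g := fun x => -deriv (fun s => (Q s).v x) t) (continuousOn_deriv_slice hI.2.2.2 t).neg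
  -- Both candidates for each gradient are continuous on Σ, so uniqueness of the variational
  -- derivative turns every Hamilton equation into a pointwise equation.
  refine (and_congr c1 (and_congr c3 (and_congr c2 c4))).trans ?_
  simp only [EqOn, neg_inj]
  constructor
  · rintro ⟨h1, h2, h3, h4⟩ x hx
    exact ⟨h1 hx, h3 hx, h2 hx, h4 hx⟩
  · intro h
    exact ⟨fun x hx => (h x hx).1, fun x hx => (h x hx).2.2.1, fun x hx => (h x hx).2.1,
      fun x hx => (h x hx).2.2.2⟩

/-! ### The regularized phase space -/

theorem energy_densityReg_regularize (om : ℝ × ℝ → ℝ) (hP : P ∈ K.phaseSpace) :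
    K.energy (K.densityReg om) (K.regularize P) = K.energy (K.densityAlt om) P :=
  setIntegral_congr_fun measurableSet_quot fun _ hx => densityReg_regularize om hx
    ((smooth_of_mem_phaseSpace hP).1.differentiableAt_of_isOpen K.isOpen_quot (by simp) hx)
    ((smooth_of_mem_phaseSpace hP).2.1.differentiableAt_of_isOpen K.isOpen_quot (by simp) hx)

theorem regularize_injective : Function.Injective K.regularize := by
  intro P P' h
  have hf := PhasePoint.ext_iff.1 h
  simp only [regularize, funext_iff, mul_right_inj' (exp_ne_zero _)] at hf
  ext x
  · exact hf.1 x
  · exact hf.2.1 x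
  · exact hf.2.2.1 x
  · exact hf.2.2.2 x

theorem symplecticForm_regularize (P P' : PhasePoint) :
    K.symplecticForm (K.regularize P) (K.regularize P') = K.symplecticForm P P' := by
  refine integral_congr_ae (Filter.Eventually.of_forall fun x => ?_)
  have h : exp (-K.gam x) * exp (K.gam x) = 1 := by rw [← exp_add]; simp
  simp only [regularize]
  linear_combination (P.lam x * P'.v x - P'.lam x * P.v x + P.eta x * P'.u x - P'.eta x * P.u x) * h

theorem vanishes_regularize_iff : K.Vanishes (K.regularize P) ↔ K.Vanishes P := by
  simp only [Vanishes, regularize, mul_eq_zero, exp_ne_zero, false_or]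

theorem isPositiveDefinite_densityReg (hom : K.IsTwistPotential om) :
    K.IsPositiveDefinite (K.densityReg om) K.regPhaseSpace := by
  rintro _ ⟨P, hP, rfl⟩
  obtain ⟨h1, h2, h3⟩ := isPositiveDefinite_densityAlt hom P hP
  rw [energy_densityReg_regularize om hP, vanishes_regularize_iff]
  refine ⟨h1.congr_fun (fun x hx => ?_) measurableSet_quot, h2, h3⟩
  exact (densityReg_regularize om hx
    ((smooth_of_mem_phaseSpace hP).1.differentiableAt_of_isOpen K.isOpen_quot (by simp) hx)
    ((smooth_of_mem_phaseSpace hP).2.1.differentiableAt_of_isOpen K.isOpen_quot (by simp) hx)).symm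

/-- Configurations are scaled by e^{-γ} and momenta by the inverse, independently of t. Gradients
scale inversely to their variable, hence both sides of each Hamilton equation acquire the same
nonzero factor. -/
theorem isHamiltonFlow_densityReg_iff (hom : K.IsTwistPotential om) (hQ : K.IsSmoothCurve Q) :
    K.IsHamiltonFlow (K.energy (K.densityReg om)) (fun t => K.regularize (Q t)) ↔
      K.FieldEquations om Q := by
  rw [← isHamiltonFlow_densityAlt_iff hom hQ]
  have hm : ContDiffOn ℝ ∞ (fun x => exp (-K.gam x)) K.quot := K.contDiffOn_gam.neg.exp
  have hp : ContDiffOn ℝ ∞ (fun x => exp (K.gam x)) K.quot := K.contDiffOn_gam.exp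
  have e1 : ∀ x, exp (-K.gam x) = (exp (K.gam x))⁻¹ := fun x => exp_neg _
  have e2 : ∀ x, exp (K.gam x) = (exp (-K.gam x))⁻¹ := fun x => by rw [exp_neg, inv_inv]
  have emul : ∀ (c f h s : ℝ), c * f + s * (c * h) = c * (f + s * h) := fun c f h s => by ring
  refine forall_congr' fun t => ?_
  obtain ⟨hl, he, hu, hv⟩ := mem_phaseSpace_iff.1 (hQ.1 t)
  refine and_congr ?_ (and_congr ?_ (and_congr ?_ ?_))
  · refine Iff.trans (iff_of_eq ?_) (hasVarDeriv_rescale hp (fun x => exp_ne_zero _)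
      (F' := fun w => K.energy (K.densityReg om) { K.regularize (Q t) with u := w })
      (F := fun w => K.energy (K.densityAlt om) { Q t with u := w }) (f := (Q t).u)
      (g := fun x => deriv (fun s => (Q s).eta x) t) fun h hh s => ?_)
    · simp only [regularize, deriv_const_mul_field, e1]
    · rw [← energy_densityReg_regularize om (mem_phaseSpace_iff
        (P := { Q t with u := fun x => (Q t).u x + s * h x }).2
        ⟨hl, he, hu.add_mul hh.isConfigField.1 s, hv⟩)]
      simp only [regularize, emul]
  · refine Iff.trans (iff_of_eq ?_) (hasVarDeriv_rescale hm (fun x => exp_ne_zero _)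
      (F' := fun w => K.energy (K.densityReg om) { K.regularize (Q t) with eta := w })
      (F := fun w => K.energy (K.densityAlt om) { Q t with eta := w }) (f := (Q t).eta)
      (g := fun x => -deriv (fun s => (Q s).u x) t) fun h hh s => ?_)
    · simp only [regularize, deriv_const_mul_field, ← e2, mul_neg]
    · rw [← energy_densityReg_regularize om (mem_phaseSpace_iff
        (P := { Q t with eta := fun x => (Q t).eta x + s * h x }).2
        ⟨hl, he.add_mul hh.isConfigField s, hu, hv⟩)]
      simp only [regularize, emul]
  · refine Iff.trans (iff_of_eq ?_) (hasVarDeriv_rescale hp (fun x => exp_ne_zero _)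
      (F' := fun w => K.energy (K.densityReg om) { K.regularize (Q t) with v := w })
      (F := fun w => K.energy (K.densityAlt om) { Q t with v := w }) (f := (Q t).v)
      (g := fun x => deriv (fun s => (Q s).lam x) t) fun h hh s => ?_)
    · simp only [regularize, deriv_const_mul_field, e1]
    · rw [← energy_densityReg_regularize om (mem_phaseSpace_iff
        (P := { Q t with v := fun x => (Q t).v x + s * h x }).2
        ⟨hl, he, hu, hv.add_mul hh.isConfigField.1 s⟩)]
      simp only [regularize, emul]
  · refine Iff.trans (iff_of_eq ?_) (hasVarDeriv_rescale hm (fun x => exp_ne_zero _)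
      (F' := fun w => K.energy (K.densityReg om) { K.regularize (Q t) with lam := w })
      (F := fun w => K.energy (K.densityAlt om) { Q t with lam := w }) (f := (Q t).lam)
      (g := fun x => -deriv (fun s => (Q s).v x) t) fun h hh s => ?_)
    · simp only [regularize, deriv_const_mul_field, ← e2, mul_neg]
    · rw [← energy_densityReg_regularize om (mem_phaseSpace_iff
        (P := { Q t with lam := fun x => (Q t).lam x + s * h x }).2
        ⟨hl.add_mul hh.isConfigField s, he, hu, hv⟩)]
      simp only [regularize, emul]

end KerrDeSitter

end

/-! ### Weighted energy estimates and the bound on the energy flux. -/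

noncomputable section

namespace KerrDeSitter

variable {K : KerrDeSitter} {om : ℝ × ℝ → ℝ} {P : PhasePoint} {Q R : ℝ → PhasePoint} {σ : ℝ}

/-! ### Weighted energies -/

section Weight

variable {χ : ℝ × ℝ → ℝ} (hχ : ContDiffOn ℝ ∞ χ (univ ×ˢ Ioo K.rp K.rc)) {s : ℝ} {x : ℝ × ℝ}

include hχ

theorem contDiffOn_weight_cyl :
    ContDiffOn ℝ ∞ (fun p : ℝ × (ℝ × ℝ) => χ (p.1, p.2.1)) K.cyl :=
  hχ.comp (contDiff_fst.prodMk (contDiff_fst.comp contDiff_snd)).contDiffOn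
    fun _ hp => ⟨mem_univ _, hp.2.1⟩

theorem contDiffOn_weight_slice (s : ℝ) : ContDiffOn ℝ ∞ (fun y : ℝ × ℝ => χ (s, y.1)) K.quot :=
  hχ.comp (contDiff_const.prodMk contDiff_fst).contDiffOn fun _ hp => ⟨mem_univ _, hp.1⟩

theorem differentiableAt_weight (hx : x ∈ K.quot) : DifferentiableAt ℝ χ (s, x.1) :=
  ((hχ (s, x.1) ⟨mem_univ _, hx.1⟩).contDiffAt
    ((isOpen_univ.prod isOpen_Ioo).mem_nhds ⟨mem_univ _, hx.1⟩)).differentiableAt (by simp)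

theorem hasDerivAt_weight_time (hx : x ∈ K.quot) :
    HasDerivAt (fun s => χ (s, x.1)) (fderiv ℝ χ (s, x.1) (1, 0)) s :=
  (differentiableAt_weight hχ hx).hasFDerivAt.comp_hasDerivAt s
    ((hasDerivAt_id s).prodMk (hasDerivAt_const s x.1))

theorem pd_weight (hx : x ∈ K.quot) (b : Fin 2) : pd b (fun y => χ (s, y.1)) x =
    if b = 0 then fderiv ℝ χ (s, x.1) (0, 1) else 0 := by
  have hd : DifferentiableAt ℝ (fun y : ℝ × ℝ => χ (s, y.1)) x :=
    (contDiffOn_weight_slice hχ s).differentiableAt_of_isOpen K.isOpen_quot (by simp) hx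
  fin_cases b
  · refine pd_zero_eq hd ?_
    exact (differentiableAt_weight hχ hx).hasFDerivAt.comp_hasDerivAt x.1
      ((hasDerivAt_const x.1 s).prodMk (hasDerivAt_id x.1))
  · exact pd_one_eq hd (hasDerivAt_const x.2 (χ (s, x.1)))

theorem axisBound_weight {t₁ t₂ r₁ r₂ : ℝ} (h₁ : K.rp < r₁) (h₂ : r₂ < K.rc) :
    AxisBound (box t₁ t₂ r₁ r₂) 0 (fun p => χ (p.1, p.2.1)) ∧
    ∀ v, AxisBound (box t₁ t₂ r₁ r₂) 0 (fun p => fderiv ℝ χ (p.1, p.2.1) v) := by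
  have hU : IsOpen ((univ : Set ℝ) ×ˢ Ioo K.rp K.rc) := isOpen_univ.prod isOpen_Ioo
  refine ⟨axisBound_zero_of_continuousOn h₁ h₂ (contDiffOn_weight_cyl hχ).continuousOn, fun v => ?_⟩
  exact axisBound_zero_of_continuousOn h₁ h₂
    (contDiffOn_weight_cyl (hχ.fderiv_apply_of_isOpen hU v)).continuousOn

end Weight

/-- The energy weighted by a function that cuts off the horizons does not increase if the weight
decreases along the flow. -/
theorem antitone_weighted_energy {χ : ℝ × ℝ → ℝ}
    (hχ : ContDiffOn ℝ ∞ χ (univ ×ˢ Ioo K.rp K.rc))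
    (hsupp : ∀ s₀, ∃ r₁ r₂, K.rp < r₁ ∧ r₂ < K.rc ∧ ∀ s ∈ Icc (s₀ - 1) (s₀ + 1),
      ∀ r ∈ Ioo K.rp K.rc, r ∉ Icc r₁ r₂ → χ (s, r) = 0)
    (hom : K.IsTwistPotential om) (hR : K.AxisRegular R) (hσ : σ ^ 2 = 1)
    (hcons : ∀ s, ∀ x ∈ K.quot, deriv (fun s => K.densityAlt om (R s) x) s
      + σ * ∑ b, pd b (K.momentum om (R s) b) x = 0)
    (hdec : ∀ s, ∀ x ∈ K.quot, fderiv ℝ χ (s, x.1) (1, 0) * K.densityAlt om (R s) x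
      + σ * (fderiv ℝ χ (s, x.1) (0, 1) * K.momentum om (R s) 0 x) ≤ 0) :
    Antitone fun s => ∫ x in K.quot, χ (s, x.1) * K.densityAlt om (R s) x := by
  have hI := hR.interiorSmooth
  have hU : IsOpen ((univ : Set ℝ) ×ˢ Ioo K.rp K.rc) := isOpen_univ.prod isOpen_Ioo
  have cE : ∀ s, ContinuousOn (K.densityAlt om (R s)) K.quot := fun s =>
    continuousOn_densityAlt hom.1 (hI.lam s) (hI.eta s) (hI.u s).continuousOn (hI.v s).continuousOn
  have cM : ∀ s b, ContDiffOn ℝ ∞ (K.momentum om (R s) b) K.quot := fun s b =>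
    contDiffOn_momentum hom.1 (hI.lam s) (hI.eta s) (hI.u s) (hI.v s) b
  have cχ : ∀ s, ContinuousOn (fun y : ℝ × ℝ => χ (s, y.1)) K.quot := fun s =>
    (contDiffOn_weight_slice hχ s).continuousOn
  have cχ' : ∀ s v, ContinuousOn (fun y : ℝ × ℝ => fderiv ℝ χ (s, y.1) v) K.quot := fun s v =>
    (contDiffOn_weight_slice (hχ.fderiv_apply_of_isOpen hU v) s).continuousOn
  -- Continuity of the time derivative is read off from the conservation law, which expresses it as
  -- a divergence of smooth functions.
  have cE' : ∀ s, ContinuousOn (fun x => deriv (fun s => K.densityAlt om (R s) x) s) K.quot :=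
    fun s => (continuousOn_const (c := -σ)).mul (continuousOn_finsetSum Finset.univ fun b _ =>
      ((cM s b).pd K.isOpen_quot b).continuousOn) |>.congr fun x hx => by
        have := hcons s x hx
        simp only [Pi.mul_apply]
        linarith
  have key : ∀ s₀, HasDerivAt (fun s => ∫ x in K.quot, χ (s, x.1) * K.densityAlt om (R s) x)
      (∫ x in K.quot, (fderiv ℝ χ (s₀, x.1) (1, 0) * K.densityAlt om (R s₀) x
        + χ (s₀, x.1) * deriv (fun s => K.densityAlt om (R s) x) s₀)) s₀ ∧
      ∫ x in K.quot, (fderiv ℝ χ (s₀, x.1) (1, 0) * K.densityAlt om (R s₀) x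
        + χ (s₀, x.1) * deriv (fun s => K.densityAlt om (R s) x) s₀) ≤ 0 := by
    intro s₀
    obtain ⟨r₁, r₂, h₁, h₂, h0⟩ := hsupp s₀
    have hs₀ : s₀ ∈ Icc (s₀ - 1) (s₀ + 1) := ⟨by linarith, by linarith⟩
    have hD : ∀ p ∈ box (s₀ - 1) (s₀ + 1) r₁ r₂, 0 < sin p.2.2 := fun p hp => sin_pos_of_mem_box hp
    obtain ⟨b1, b2⟩ := axisBound_weight hχ (t₁ := s₀ - 1) (t₂ := s₀ + 1) h₁ h₂
    have b3 := hR.bound_densityAlt (t₁ := s₀ - 1) (t₂ := s₀ + 1) h₁ h₂ hom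
    have b4 := hR.bound_deriv_densityAlt (t₁ := s₀ - 1) (t₂ := s₀ + 1) h₁ h₂ hom
    have b5 := fun b => hR.bound_momentum (t₁ := s₀ - 1) (t₂ := s₀ + 1) h₁ h₂ hom b
    -- vanishing of the weight and its derivatives
    have z1 : ∀ s ∈ Ioo (s₀ - 1) (s₀ + 1), ∀ x ∈ K.quot, x.1 ∉ Icc r₁ r₂ →
        ∀ v, fderiv ℝ χ (s, x.1) v = 0 := by
      intro s hs x hx hxr v
      have : χ =ᶠ[nhds (s, x.1)] fun _ => 0 := by
        filter_upwards [(isOpen_Ioo.prod (isOpen_Ioo.inter isClosed_Icc.isOpen_compl)).mem_nhds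
          (⟨hs, hx.1, hxr⟩ : (s, x.1) ∈ Ioo (s₀ - 1) (s₀ + 1) ×ˢ (Ioo K.rp K.rc ∩ (Icc r₁ r₂)ᶜ))]
          with p hp
        exact h0 p.1 (Ioo_subset_Icc_self hp.1) p.2 hp.2.1 hp.2.2
      rw [this.fderiv_eq]
      simp
    have hs₀' : s₀ ∈ Ioo (s₀ - 1) (s₀ + 1) := ⟨by linarith, by linarith⟩
    obtain ⟨C, hC0, hC⟩ := (((b2 (1, 0)).mul hD b3).add (b1.mul hD b4))
    -- A constant is an integrable majorant because Σ has finite coordinate volume; outside [r₁, r₂]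
    -- the weight and its derivatives vanish throughout this time window.
    have bound : ∀ x ∈ K.quot, ∀ s ∈ Ioo (s₀ - 1) (s₀ + 1),
        ‖fderiv ℝ χ (s, x.1) (1, 0) * K.densityAlt om (R s) x
          + χ (s, x.1) * deriv (fun s => K.densityAlt om (R s) x) s‖ ≤ C := by
      intro x hx s hs
      by_cases hxr : x.1 ∈ Icc r₁ r₂
      · have := hC (s, x) ⟨Ioo_subset_Icc_self hs, hxr, hx.2⟩
        simpa using this
      · rw [z1 s hs x hx hxr, h0 s (Ioo_subset_Icc_self hs) x.1 hx.1 hxr]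
        simpa using hC0
    have haem : ∀ {F : ℝ × ℝ → ℝ}, ContinuousOn F K.quot →
        AEStronglyMeasurable F (volume.restrict K.quot) :=
      fun hF => hF.aestronglyMeasurable measurableSet_quot
    have i0 : IntegrableOn (fun x => χ (s₀, x.1) * K.densityAlt om (R s₀) x) K.quot := by
      obtain ⟨C', hC'0, hC'⟩ := b1.mul hD b3
      refine integrableOn_quot_of_support (C := C') ((cχ s₀).mul (cE s₀))
        (fun x hx hxr => by simpa using hC' (s₀, x) ⟨hs₀, hxr, hx.2⟩) fun x hx hxr => ?_
      rw [h0 s₀ hs₀ x.1 hx.1 hxr, zero_mul]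
    obtain ⟨i1, hd⟩ := hasDerivAt_integral_of_dominated_loc_of_deriv_le
      (μ := volume.restrict K.quot) (F := fun s x => χ (s, x.1) * K.densityAlt om (R s) x)
      (F' := fun s x => fderiv ℝ χ (s, x.1) (1, 0) * K.densityAlt om (R s) x
        + χ (s, x.1) * deriv (fun s => K.densityAlt om (R s) x) s) (bound := fun _ => C)
      (Ioo_mem_nhds hs₀'.1 hs₀'.2)
      (Filter.Eventually.of_forall fun s => haem ((cχ s).mul (cE s))) i0
      (haem (((cχ' s₀ _).mul (cE s₀)).add ((cχ s₀).mul (cE' s₀))))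
      ((ae_restrict_iff' measurableSet_quot).2 (Filter.Eventually.of_forall bound))
      (by
        have : IsFiniteMeasure (volume.restrict K.quot) := ⟨by
          rw [Measure.restrict_apply_univ]; exact volume_quot_lt_top⟩
        exact integrable_const C)
      ((ae_restrict_iff' measurableSet_quot).2 (Filter.Eventually.of_forall fun x hx s _ =>
        (hasDerivAt_weight_time hχ hx).mul
          ((hasDerivAt_densityAlt hI hx s).differentiableAt.hasDerivAt)))
    refine ⟨hd, ?_⟩
    -- the divergence theorem
    set V : Fin 2 → ℝ × ℝ → ℝ := fun b y => χ (s₀, y.1) * K.momentum om (R s₀) b y with hVdef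
    have hV : ∀ b, ContDiffOn ℝ ∞ (V b) K.quot := fun b =>
      (contDiffOn_weight_slice hχ s₀).mul (cM s₀ b)
    have hdiv : EqOn (fun x => fderiv ℝ χ (s₀, x.1) (0, 1) * K.momentum om (R s₀) 0 x
        - σ * (χ (s₀, x.1) * deriv (fun s => K.densityAlt om (R s) x) s₀))
        (fun x => ∑ b, pd b (V b) x) K.quot := by
      intro x hx
      have hd1 : DifferentiableAt ℝ (fun y : ℝ × ℝ => χ (s₀, y.1)) x :=
        (contDiffOn_weight_slice hχ s₀).differentiableAt_of_isOpen K.isOpen_quot (by simp) hx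
      have hd2 := fun b => (cM s₀ b).differentiableAt_of_isOpen K.isOpen_quot (by simp) hx
      have hc := hcons s₀ x hx
      simp only [Fin.sum_univ_two] at hc ⊢
      rw [hVdef, pd_mul 0 hd1 (hd2 0), pd_mul 1 hd1 (hd2 1), pd_weight hχ hx, pd_weight hχ hx,
        if_pos rfl, if_neg (by decide)]
      linear_combination (-σ * χ (s₀, x.1)) * hc + χ (s₀, x.1) *
        (pd 0 (K.momentum om (R s₀) 0) x + pd 1 (K.momentum om (R s₀) 1) x) * hσ
    obtain ⟨C2, hC20, hC2⟩ := (b2 (0, 1)).mul hD ((b5 0).mono hD (by norm_num : (0 : ℤ) ≤ 1))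
    have i2 : IntegrableOn (fun x => fderiv ℝ χ (s₀, x.1) (0, 1) * K.momentum om (R s₀) 0 x)
        K.quot := by
      refine integrableOn_quot_of_support (C := C2) ((cχ' s₀ _).mul (cM s₀ 0).continuousOn)
        (fun x hx hxr => by simpa using hC2 (s₀, x) ⟨hs₀, hxr, hx.2⟩) fun x hx hxr => ?_
      rw [z1 s₀ hs₀' x hx hxr, zero_mul]
    obtain ⟨C3, hC30, hC3⟩ := b1.mul hD b4
    have i3 : IntegrableOn (fun x => χ (s₀, x.1) * deriv (fun s => K.densityAlt om (R s) x) s₀)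
        K.quot := by
      refine integrableOn_quot_of_support (C := C3) ((cχ s₀).mul (cE' s₀))
        (fun x hx hxr => by simpa using hC3 (s₀, x) ⟨hs₀, hxr, hx.2⟩) fun x hx hxr => ?_
      rw [h0 s₀ hs₀ x.1 hx.1 hxr, zero_mul]
    obtain ⟨C4, hC40, hC4⟩ := b1.mul hD (b5 0)
    obtain ⟨C5, hC50, hC5⟩ := b1.mul hD (b5 1)
    have idiv := (i2.sub (i3.const_mul σ)).congr_fun hdiv measurableSet_quot
    have h5 := integral_divergence_eq_zero (V := V) (C := C4 + C5) h₁ h₂ hV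
      (fun b x hx hxr => ?_) (fun b x hx hxr => ?_) idiv
    · rw [← setIntegral_congr_fun measurableSet_quot hdiv, integral_sub i2 (i3.const_mul σ),
        integral_const_mul] at h5
      have i4 : IntegrableOn (fun x => fderiv ℝ χ (s₀, x.1) (1, 0) * K.densityAlt om (R s₀) x)
          K.quot := by
        refine (Integrable.sub i1 i3).congr (Filter.Eventually.of_forall fun x => ?_)
        simp
      rw [integral_add i4 i3]
      have h6 : ∫ x in K.quot, (fderiv ℝ χ (s₀, x.1) (1, 0) * K.densityAlt om (R s₀) x
          + σ * (fderiv ℝ χ (s₀, x.1) (0, 1) * K.momentum om (R s₀) 0 x)) ≤ 0 :=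
        setIntegral_nonpos measurableSet_quot fun x hx => hdec s₀ x hx
      rw [integral_add i4 (i2.const_mul σ), integral_const_mul] at h6
      have h7 : ∫ x in K.quot, χ (s₀, x.1) * deriv (fun s => K.densityAlt om (R s) x) s₀
          = σ * ∫ x in K.quot, fderiv ℝ χ (s₀, x.1) (0, 1) * K.momentum om (R s₀) 0 x := by
        linear_combination (-σ) * h5 - (∫ x in K.quot, χ (s₀, x.1) *
          deriv (fun s => K.densityAlt om (R s) x) s₀) * hσ
      linarith
    · have hs := (sin_pos_of_mem_quot hx).le
      have h6 : |V b x| ≤ (if b = 0 then C4 else C5) * sin x.2 := by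
        fin_cases b
        · simpa [hVdef] using hC4 (s₀, x) ⟨hs₀, hxr, hx.2⟩
        · simpa [hVdef] using hC5 (s₀, x) ⟨hs₀, hxr, hx.2⟩
      refine h6.trans (mul_le_mul_of_nonneg_right ?_ hs)
      split_ifs <;> linarith
    · rw [hVdef]
      simp only [h0 s₀ hs₀ x.1 hx.1 hxr, zero_mul]
  refine antitone_of_deriv_nonpos (fun s => (key s).1.differentiableAt) fun s => ?_
  rw [(key s).1.deriv]
  exact (key s).2

/-! ### The speed of propagation -/

/-- With w = α² and k = β² one factor αβ ≤ κ is the speed, and the other is absorbed by 2|XY| ≤ X² +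
Y². -/
theorem abs_mul_mul_add_le {w k κ u v e l : ℝ} (hw : 0 ≤ w) (hk : 0 ≤ k) (hκ : 0 ≤ κ)
    (h : w * k ≤ κ ^ 2) :
    |w * k * (u * e + v * l)| ≤ κ * (1 / 2 * w * (u ^ 2 + v ^ 2) + 1 / 2 * k * (e ^ 2 + l ^ 2)) := by
  obtain ⟨α, hα, rfl⟩ : ∃ α, 0 ≤ α ∧ w = α ^ 2 := ⟨√w, sqrt_nonneg _, (sq_sqrt hw).symm⟩
  obtain ⟨β, hβ, rfl⟩ : ∃ β, 0 ≤ β ∧ k = β ^ 2 := ⟨√k, sqrt_nonneg _, (sq_sqrt hk).symm⟩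
  have h1 : α * β ≤ κ := by
    rw [← mul_pow] at h
    exact (sq_le_sq₀ (mul_nonneg hα hβ) hκ).1 h
  have h2 : |(α * u) * (β * e) + (α * v) * (β * l)| ≤
      1 / 2 * α ^ 2 * (u ^ 2 + v ^ 2) + 1 / 2 * β ^ 2 * (e ^ 2 + l ^ 2) := by
    rw [abs_le]
    constructor <;> nlinarith [sq_nonneg (α * u + β * e), sq_nonneg (α * v + β * l),
      sq_nonneg (α * u - β * e), sq_nonneg (α * v - β * l)]
  calc |α ^ 2 * β ^ 2 * (u * e + v * l)|
      = (α * β) * |(α * u) * (β * e) + (α * v) * (β * l)| := by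
        have h3 : α ^ 2 * β ^ 2 * (u * e + v * l)
            = α * β * ((α * u) * (β * e) + (α * v) * (β * l)) := by ring
        rw [h3, abs_mul, abs_of_nonneg (mul_nonneg hα hβ)]
    _ ≤ κ * _ := mul_le_mul h1 h2 (abs_nonneg _) hκ

variable (K) in
/-- A bound for the coordinate speed, relative to the product of the distances to the horizons. -/
def speed : ℝ := K.Lam / 3 * (K.rc - K.rn) * (K.rc - K.rm) / (K.Xi * K.rp ^ 2)

variable (K) in
theorem rp_pos : 0 < K.rp := K.rm_pos.trans K.rm_lt

variable (K) in
theorem speed_pos : 0 < K.speed := by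
  have h1 := K.rn_neg
  have h2 := K.rm_pos
  have h3 := K.rm_lt
  have h4 := K.rp_lt
  have := K.Lam_pos
  have := K.Xi_pos
  have := K.rp_pos
  have h5 : 0 < K.rc - K.rn := by linarith
  have h6 : 0 < K.rc - K.rm := by linarith
  unfold speed
  positivity

/-- The left side is N² q^{rr}, the square of the radial coordinate speed of light, equal to Δ² Π /
(Ξ² B) with B = `bigB`. The bounds Π ≤ Ξ and B ≥ Ξ r₊⁴ leave Δ, which vanishes linearly at both
horizons. -/
theorem wgt_mul_kap_div_le {x : ℝ × ℝ} (hx : x ∈ K.quot) :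
    K.wgt x * (K.kap 0 x / K.gphi x) ≤ (K.speed * ((x.1 - K.rp) * (K.rc - x.1))) ^ 2 := by
  have hS := sin_pos_of_mem_quot hx
  have hSg := SigmaFn_pos (K := K) (x := x) hx.1
  have hB := bigB_pos (K := K) (x := x) hx.1
  have hXi := K.Xi_pos
  have hP := K.PiFn_pos x
  have hrp := K.rp_pos
  have e : K.wgt x * (K.kap 0 x / K.gphi x)
      = K.Delta x.1 ^ 2 * K.PiFn x / (K.Xi ^ 2 * K.bigB x) := by
    simp only [wgt, kap, gphi, if_true]
    field_simp
  have hPX : K.PiFn x ≤ K.Xi := by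
    have := mul_nonneg (div_nonneg K.Lam_pos.le (by norm_num : (0 : ℝ) ≤ 3)) (sq_nonneg K.a)
    have hc : cos x.2 ^ 2 ≤ 1 := by nlinarith [sin_sq_add_cos_sq x.2, sq_nonneg (sin x.2)]
    simp only [PiFn, Xi]
    nlinarith
  have hr : K.rp ^ 2 ≤ x.1 ^ 2 := by nlinarith [hx.1.1]
  have hBX : K.Xi * K.rp ^ 4 ≤ K.bigB x := by
    have h1 : K.rp ^ 2 ≤ x.1 ^ 2 + K.a ^ 2 := by nlinarith [sq_nonneg K.a]
    have h2 : K.rp ^ 2 ≤ K.SigmaFn x := by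
      simp only [SigmaFn]; nlinarith [sq_nonneg (K.a * cos x.2)]
    have h3 : K.rp ^ 4 ≤ (x.1 ^ 2 + K.a ^ 2) * K.SigmaFn x := by
      calc K.rp ^ 4 = K.rp ^ 2 * K.rp ^ 2 := by ring
        _ ≤ _ := mul_le_mul h1 h2 (by positivity) (by positivity)
    have h4 : K.bigB x = K.Xi * (x.1 ^ 2 + K.a ^ 2) * K.SigmaFn x
        + 2 * K.m * x.1 * K.a ^ 2 * sin x.2 ^ 2 := by simp only [bigB]
    have h5 := K.m_pos
    have h6 := r_pos hx.1
    have h7 : 0 ≤ 2 * K.m * x.1 * K.a ^ 2 * sin x.2 ^ 2 := by positivity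
    rw [h4]
    nlinarith [mul_le_mul_of_nonneg_left h3 hXi.le]
  have hD := Delta_pos hx.1
  have hy : 0 ≤ (x.1 - K.rp) * (K.rc - x.1) :=
    mul_nonneg (sub_nonneg.2 hx.1.1.le) (sub_nonneg.2 hx.1.2.le)
  have hDle : K.Delta x.1 ≤ K.Lam / 3 * (K.rc - K.rn) * (K.rc - K.rm)
      * ((x.1 - K.rp) * (K.rc - x.1)) := by
    have h1 := K.rn_neg
    have h2 := K.rm_pos
    have h3 := K.rm_lt
    have h4 := hx.1.1
    have h5 := hx.1.2
    have h6 : (x.1 - K.rn) * (x.1 - K.rm) ≤ (K.rc - K.rn) * (K.rc - K.rm) :=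
      mul_le_mul (by linarith) (by linarith) (by linarith) (by linarith)
    calc K.Delta x.1 = K.Lam / 3 * (((x.1 - K.rn) * (x.1 - K.rm))
          * ((x.1 - K.rp) * (K.rc - x.1))) := by rw [Delta_eq]; ring
      _ ≤ K.Lam / 3 * (((K.rc - K.rn) * (K.rc - K.rm)) * ((x.1 - K.rp) * (K.rc - x.1))) :=
        mul_le_mul_of_nonneg_left (mul_le_mul_of_nonneg_right h6 hy)
          (div_nonneg K.Lam_pos.le (by norm_num))
      _ = _ := by ring
  rw [e]
  calc K.Delta x.1 ^ 2 * K.PiFn x / (K.Xi ^ 2 * K.bigB x)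
      ≤ K.Delta x.1 ^ 2 * K.Xi / (K.Xi ^ 2 * (K.Xi * K.rp ^ 4)) := by gcongr
    _ = (K.Delta x.1 / (K.Xi * K.rp ^ 2)) ^ 2 := by field_simp
    _ ≤ (K.Lam / 3 * (K.rc - K.rn) * (K.rc - K.rm) * ((x.1 - K.rp) * (K.rc - x.1))
        / (K.Xi * K.rp ^ 2)) ^ 2 := by gcongr
    _ = _ := by rw [speed]; ring

/-- Energy does not flow faster than light: the radial flux is already dominated by the momentum
terms and radial gradients of E^Alt; the mass and angular terms are nonnegative and are dropped. -/
theorem abs_momentum_le (om : ℝ × ℝ → ℝ) (P : PhasePoint) {x : ℝ × ℝ} (hx : x ∈ K.quot) :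
    |K.momentum om P 0 x| ≤
      K.speed * ((x.1 - K.rp) * (K.rc - x.1)) * K.densityAlt om P x := by
  have hw := (wgt_pos hx).le
  have hG := gphi_pos hx
  have hk : 0 ≤ K.kap 0 x / K.gphi x := div_nonneg (kap_pos hx 0).le hG.le
  have hκ : 0 ≤ K.speed * ((x.1 - K.rp) * (K.rc - x.1)) :=
    mul_nonneg K.speed_pos.le
      (mul_nonneg (sub_nonneg.2 hx.1.1.le) (sub_nonneg.2 hx.1.2.le))
  have h3 := currentAlt_snd_eqOn om (fun _ => P) 0 0 hx
  simp only at h3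
  rw [← h3, currentAlt_snd om _ 0 hx 0, abs_neg, mul_div_assoc]
  refine (abs_mul_mul_add_le hw hk hκ (wgt_mul_kap_div_le hx)).trans
    (mul_le_mul_of_nonneg_left ?_ hκ)
  rw [densityAlt_eq om P hx, Fin.sum_univ_two]
  have h4 : 0 ≤ K.mass om x * (P.lam x ^ 2 + P.eta x ^ 2)
      + K.kap 1 x * (K.covEta om P 1 x ^ 2 + K.covLam om P 1 x ^ 2) :=
    add_nonneg (mul_nonneg (mass_pos om hx).le (by positivity))
      (mul_nonneg (kap_pos hx 1).le (by positivity))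
  have h5 := div_nonneg h4 (mul_pos two_pos hG).le
  have h6 : (K.mass om x * (P.lam x ^ 2 + P.eta x ^ 2)
      + (K.kap 0 x * (K.covEta om P 0 x ^ 2 + K.covLam om P 0 x ^ 2)
        + K.kap 1 x * (K.covEta om P 1 x ^ 2 + K.covLam om P 1 x ^ 2))) / (2 * K.gphi x)
      = (K.mass om x * (P.lam x ^ 2 + P.eta x ^ 2)
      + K.kap 1 x * (K.covEta om P 1 x ^ 2 + K.covLam om P 1 x ^ 2)) / (2 * K.gphi x)
      + 1 / 2 * (K.kap 0 x / K.gphi x) * (K.covEta om P 0 x ^ 2 + K.covLam om P 0 x ^ 2) := by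
    field_simp
    ring
  rw [h6]
  linarith

end KerrDeSitter

end

/-! ### Finite speed of propagation. -/

noncomputable section

namespace KerrDeSitter

variable {K : KerrDeSitter} {om : ℝ × ℝ → ℝ} {P : PhasePoint} {Q R : ℝ → PhasePoint} {σ : ℝ}

/-! ### Finite speed of propagation -/

theorem deriv_expNegInvGlue_nonneg (x : ℝ) : 0 ≤ deriv expNegInvGlue x :=
  expNegInvGlue.monotone.deriv_nonneg

theorem hasDerivAt_expNegInvGlue (x : ℝ) :
    HasDerivAt expNegInvGlue (deriv expNegInvGlue x) x :=
  ((expNegInvGlue.contDiff (n := 1)).differentiable (by simp) x).hasDerivAt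

variable (K) in
/-- A radial coordinate that sends the horizons to `-∞` and `∞`. -/
def radial (r : ℝ) : ℝ := log ((r - K.rp) / (K.rc - r))

theorem radial_arg_pos {r : ℝ} (hr : r ∈ Ioo K.rp K.rc) : 0 < (r - K.rp) / (K.rc - r) :=
  div_pos (sub_pos.2 hr.1) (sub_pos.2 hr.2)

/-- The denominator cancels the degenerate factor of the speed bound: in this coordinate, as in a
tortoise coordinate, signals travel at most at the constant speed `speed * (rc - rp)`. -/
theorem hasDerivAt_radial {r : ℝ} (hr : r ∈ Ioo K.rp K.rc) :
    HasDerivAt K.radial ((K.rc - K.rp) / ((r - K.rp) * (K.rc - r))) r := by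
  have h1 : K.rc - r ≠ 0 := (sub_pos.2 hr.2).ne'
  have h2 : r - K.rp ≠ 0 := (sub_pos.2 hr.1).ne'
  have h := (((hasDerivAt_id r).sub_const K.rp).div ((hasDerivAt_id r).const_sub K.rc) h1).log
    (radial_arg_pos hr).ne'
  refine h.congr_deriv ?_
  simp only [id, Pi.div_apply]
  field_simp
  ring

variable (K) in
theorem contDiffOn_radial : ContDiffOn ℝ ∞ K.radial (Ioo K.rp K.rc) :=
  ((contDiffOn_id.sub contDiffOn_const).div (contDiffOn_const.sub contDiffOn_id)
    fun _ hr => (sub_pos.2 hr.2).ne').log fun _ hr => (radial_arg_pos hr).ne'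

/-- Bounded values of the radial coordinate stay away from the horizons. -/
theorem exists_radial_bounds (k M : ℝ) : ∃ r₁ r₂, K.rp < r₁ ∧ r₂ < K.rc ∧
    ∀ r ∈ Ioo K.rp K.rc, k ≤ K.radial r → K.radial r ≤ M → r ∈ Icc r₁ r₂ := by
  have hd : 0 < K.rc - K.rp := sub_pos.2 K.rp_lt
  have hek := exp_pos k
  have heM := exp_pos M
  refine ⟨(K.rp + exp k * K.rc) / (1 + exp k), (K.rp + exp M * K.rc) / (1 + exp M), ?_, ?_, ?_⟩
  · rw [lt_div_iff₀ (by positivity)]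
    nlinarith
  · rw [div_lt_iff₀ (by positivity)]
    nlinarith
  · intro r hr h1 h2
    have hc := sub_pos.2 hr.2
    rw [radial, le_log_iff_exp_le (radial_arg_pos hr), le_div_iff₀ hc] at h1
    rw [radial, log_le_iff_le_exp (radial_arg_pos hr), div_le_iff₀ hc] at h2
    constructor
    · rw [div_le_iff₀ (by positivity)]
      linarith
    · rw [le_div_iff₀ (by positivity)]
      linarith

variable (K) in
/-- A cutoff whose support shrinks at the speed `c` as `s` grows. -/
def cutoff (c k M : ℝ) (p : ℝ × ℝ) : ℝ :=
  expNegInvGlue (K.radial p.2 - c * p.1 - k) * expNegInvGlue (M - c * p.1 - K.radial p.2)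

theorem contDiffOn_cutoff (c k M : ℝ) :
    ContDiffOn ℝ ∞ (K.cutoff c k M) (univ ×ˢ Ioo K.rp K.rc) := by
  have h1 : ContDiffOn ℝ ∞ (fun p : ℝ × ℝ => K.radial p.2) (univ ×ˢ Ioo K.rp K.rc) :=
    K.contDiffOn_radial.comp contDiff_snd.contDiffOn fun _ hp => hp.2
  have h2 : ContDiffOn ℝ ∞ (fun p : ℝ × ℝ => c * p.1) (univ ×ˢ Ioo K.rp K.rc) :=
    contDiffOn_const.mul contDiff_fst.contDiffOn
  exact ((expNegInvGlue.contDiff (n := ⊤)).comp_contDiffOn ((h1.sub h2).sub contDiffOn_const)).mul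
    ((expNegInvGlue.contDiff (n := ⊤)).comp_contDiffOn ((contDiffOn_const.sub h2).sub h1))

/-- α and β come from the inner and the outer edge of the cutoff. Both edges move inwards, hence the
sum in time, while they have opposite slopes in r, hence the difference; |α - β| ≤ α + β then gives
the decrease. -/
theorem fderiv_cutoff (c k M s : ℝ) {r : ℝ} (hr : r ∈ Ioo K.rp K.rc) :
    ∃ α β : ℝ, 0 ≤ α ∧ 0 ≤ β ∧ fderiv ℝ (K.cutoff c k M) (s, r) (1, 0) = -(c * (α + β)) ∧
      fderiv ℝ (K.cutoff c k M) (s, r) (0, 1)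
        = (K.rc - K.rp) / ((r - K.rp) * (K.rc - r)) * (α - β) := by
  have hd : DifferentiableAt ℝ (K.cutoff c k M) (s, r) :=
    ((contDiffOn_cutoff c k M (s, r) ⟨mem_univ _, hr⟩).contDiffAt
      ((isOpen_univ.prod isOpen_Ioo).mem_nhds ⟨mem_univ _, hr⟩)).differentiableAt (by simp)
  have e1 := hd.hasFDerivAt.comp_hasDerivAt s ((hasDerivAt_id s).prodMk (hasDerivAt_const s r))
  have e2 := hd.hasFDerivAt.comp_hasDerivAt r ((hasDerivAt_const r s).prodMk (hasDerivAt_id r))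
  have hL := hasDerivAt_radial hr
  have f1 := ((hasDerivAt_expNegInvGlue (K.radial r - c * s - k)).comp s
    ((((hasDerivAt_id s).const_mul c).const_sub (K.radial r)).sub_const k)).mul
    ((hasDerivAt_expNegInvGlue (M - c * s - K.radial r)).comp s
    ((((hasDerivAt_id s).const_mul c).const_sub M).sub_const (K.radial r)))
  have f2 := ((hasDerivAt_expNegInvGlue (K.radial r - c * s - k)).comp r
    ((hL.sub_const (c * s)).sub_const k)).mul
    ((hasDerivAt_expNegInvGlue (M - c * s - K.radial r)).comp r (hL.const_sub (M - c * s)))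
  refine ⟨deriv expNegInvGlue (K.radial r - c * s - k) * expNegInvGlue (M - c * s - K.radial r),
    expNegInvGlue (K.radial r - c * s - k) * deriv expNegInvGlue (M - c * s - K.radial r),
    mul_nonneg (deriv_expNegInvGlue_nonneg _) (expNegInvGlue.nonneg _),
    mul_nonneg (expNegInvGlue.nonneg _) (deriv_expNegInvGlue_nonneg _), ?_, ?_⟩
  · refine (e1.unique f1).trans ?_
    simp only [Function.comp_apply, id]
    ring
  · refine (e2.unique f2).trans ?_
    simp only [Function.comp_apply]
    ring

theorem cutoff_eq_zero {c k M s r : ℝ} (h : ¬(k < K.radial r - c * s ∧ K.radial r < M - c * s)) :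
    K.cutoff c k M (s, r) = 0 := by
  rw [not_and_or, not_lt, not_lt] at h
  rcases h with h | h
  · rw [cutoff, expNegInvGlue.zero_of_nonpos (by simp only; linarith), zero_mul]
  · rw [cutoff, expNegInvGlue.zero_of_nonpos (x := M - c * _ - _) (by simp only; linarith), mul_zero]

/-- σ = -1 reverses time, so a single forward estimate covers both time directions. -/
theorem AxisRegular.comp_affine (hQ : K.AxisRegular Q) (t₀ σ : ℝ) :
    K.AxisRegular fun s => Q (t₀ + σ * s) := by
  obtain ⟨⟨h1, h2, h3, h4⟩, h5⟩ := hQ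
  have hm : MapsTo (fun p : ℝ × (ℝ × ℝ) => (t₀ + σ * p.1, p.2)) K.cyl K.cyl :=
    fun p hp => ⟨mem_univ _, hp.2⟩
  have hc : ContDiffOn ℝ ∞ (fun p : ℝ × (ℝ × ℝ) => (t₀ + σ * p.1, p.2)) K.cyl :=
    ((contDiff_const.add (contDiff_const.mul contDiff_fst)).prodMk contDiff_snd).contDiffOn
  exact ⟨⟨h1.comp hc hm, h2.comp hc hm, h3.comp hc hm, h4.comp hc hm⟩, fun s => h5 _⟩

/-- Solutions that vanish initially where the radial coordinate lies in `(k, M)` vanish later in a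
region that shrinks at a finite speed. -/
theorem vanishes_of_radial (hom : K.IsTwistPotential om) (hQ : K.AxisRegular Q)
    (hF : K.FieldEquations om Q) (hσ : σ ^ 2 = 1) {t₀ k M : ℝ}
    (h0 : ∀ x ∈ K.quot, k < K.radial x.1 → K.radial x.1 < M → K.densityAlt om (Q t₀) x = 0)
    {s : ℝ} (hs : 0 ≤ s) {x : ℝ × ℝ} (hx : x ∈ K.quot)
    (hk : k + K.speed * (K.rc - K.rp) * s < K.radial x.1)
    (hM : K.radial x.1 < M - K.speed * (K.rc - K.rp) * s) :
    (Q (t₀ + σ * s)).lam x = 0 ∧ (Q (t₀ + σ * s)).eta x = 0 ∧ (Q (t₀ + σ * s)).u x = 0 ∧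
      (Q (t₀ + σ * s)).v x = 0 := by
  set c := K.speed * (K.rc - K.rp) with hc
  have hc0 : 0 < c := mul_pos K.speed_pos (sub_pos.2 K.rp_lt)
  have hR := hQ.comp_affine t₀ σ
  have hI := hR.interiorSmooth
  have hχ := contDiffOn_cutoff (K := K) c k M
  have hE0 : ∀ s, ∀ x ∈ K.quot, 0 ≤ K.cutoff c k M (s, x.1) * K.densityAlt om (Q (t₀ + σ * s)) x :=
    fun s x hx => mul_nonneg (mul_nonneg (expNegInvGlue.nonneg _) (expNegInvGlue.nonneg _))
      (densityAlt_nonneg om _ hx)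
  have hsupp : ∀ s₀, ∃ r₁ r₂, K.rp < r₁ ∧ r₂ < K.rc ∧ ∀ s ∈ Icc (s₀ - 1) (s₀ + 1),
      ∀ r ∈ Ioo K.rp K.rc, r ∉ Icc r₁ r₂ → K.cutoff c k M (s, r) = 0 := by
    intro s₀
    obtain ⟨r₁, r₂, h₁, h₂, h⟩ := exists_radial_bounds (K := K) (k + c * (s₀ - 1)) (M - c * (s₀ - 1))
    refine ⟨r₁, r₂, h₁, h₂, fun s hs r hr hr' => cutoff_eq_zero fun hcon => hr' (h r hr ?_ ?_)⟩
    · nlinarith [hcon.1, hs.1]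
    · nlinarith [hcon.2, hs.1]
  have hcE : ∀ s, ContinuousOn (fun x => K.cutoff c k M (s, x.1)
      * K.densityAlt om (Q (t₀ + σ * s)) x) K.quot := fun s =>
    (contDiffOn_weight_slice hχ s).continuousOn.mul
      (continuousOn_densityAlt hom.1 (hI.lam s) (hI.eta s) (hI.u s).continuousOn
        (hI.v s).continuousOn)
  have hiE : ∀ s, IntegrableOn (fun x => K.cutoff c k M (s, x.1)
      * K.densityAlt om (Q (t₀ + σ * s)) x) K.quot := by
    intro s
    obtain ⟨r₁, r₂, h₁, h₂, hr⟩ := hsupp s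
    have hs : s ∈ Icc (s - 1) (s + 1) := ⟨by linarith, by linarith⟩
    obtain ⟨C, -, hC⟩ := (axisBound_weight hχ (t₁ := s) (t₂ := s) h₁ h₂).1.mul
      (fun p hp => sin_pos_of_mem_box hp) (hR.bound_densityAlt (t₁ := s) (t₂ := s) h₁ h₂ hom)
    refine integrableOn_quot_of_support (r₁ := r₁) (r₂ := r₂) (C := C) (hcE s) (fun x hx hxr => ?_) fun x hx hxr => ?_
    · simpa using hC (s, x) ⟨⟨le_rfl, le_rfl⟩, hxr, hx.2⟩
    · rw [hr s hs x.1 hx.1 hxr, zero_mul]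
  -- The weighted energy is zero at s = 0, nonnegative and nonincreasing, hence zero. Its integrand
  -- then vanishes pointwise, and at the given x the cutoff is positive.
  have hanti := antitone_weighted_energy (σ := σ) hχ hsupp hom hR hσ (fun s x hx => ?_)
    fun s x hx => ?_
  · have h1 := hanti hs
    have h2 : ∫ x in K.quot, K.cutoff c k M (0, x.1) * K.densityAlt om (Q (t₀ + σ * 0)) x = 0 := by
      rw [setIntegral_congr_fun (g := fun _ => 0) measurableSet_quot, integral_zero]
      intro x hx
      simp only
      by_cases h : k < K.radial x.1 - c * 0 ∧ K.radial x.1 < M - c * 0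
      · rw [mul_zero, add_zero, h0 x hx (by linarith [h.1]) (by linarith [h.2]), mul_zero]
      · rw [cutoff_eq_zero h, zero_mul]
    simp only [h2] at h1
    have h3 := le_antisymm h1 (setIntegral_nonneg measurableSet_quot (hE0 s))
    have h4 := eqOn_zero_of_integral_eq_zero (hcE s) (hiE s) (hE0 s) h3 hx
    refine densityAlt_eq_zero_iff om _ hx ?_
    refine (mul_eq_zero.1 h4).resolve_left (mul_pos ?_ ?_).ne'
    · exact expNegInvGlue.pos_of_pos (by simp only; linarith)
    · exact expNegInvGlue.pos_of_pos (by simp only; linarith)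
  · have h1 := deriv_densityAlt_add_div hom hQ.interiorSmooth hF hx (t₀ + σ * s)
    have h2 := (hasDerivAt_densityAlt (om := om) hQ.interiorSmooth hx
      (t₀ + σ * s)).differentiableAt.hasDerivAt
    have h3 := h2.comp s (((hasDerivAt_id s).const_mul σ).const_add t₀)
    have h4 : deriv (fun s => K.densityAlt om (Q (t₀ + σ * s)) x) s
        = deriv (fun s => K.densityAlt om (Q s) x) (t₀ + σ * s) * (σ * 1) := h3.deriv
    rw [h4]
    linear_combination σ * h1
  · obtain ⟨α, β, hα, hβ, e1, e2⟩ := fderiv_cutoff c k M s hx.1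
    rw [e1, e2]
    have hy : 0 < (x.1 - K.rp) * (K.rc - x.1) := mul_pos (sub_pos.2 hx.1.1) (sub_pos.2 hx.1.2)
    have h1 := abs_momentum_le om (Q (t₀ + σ * s)) hx
    have hE := densityAlt_nonneg om (Q (t₀ + σ * s)) hx
    have hσ1 : |σ| = 1 := by
      rcases mul_self_eq_one_iff.1 ((sq σ).symm.trans hσ) with h | h <;> simp [h]
    have h2 : |σ * ((K.rc - K.rp) / ((x.1 - K.rp) * (K.rc - x.1)) * (α - β)
        * K.momentum om (Q (t₀ + σ * s)) 0 x)| ≤ c * (α + β) * K.densityAlt om (Q (t₀ + σ * s)) x := by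
      rw [abs_mul, abs_mul, abs_mul, hσ1, one_mul,
        abs_of_pos (div_pos (sub_pos.2 K.rp_lt) hy)]
      have h3 : |α - β| ≤ α + β := abs_sub_le_iff.2 ⟨by linarith, by linarith⟩
      calc (K.rc - K.rp) / ((x.1 - K.rp) * (K.rc - x.1)) * |α - β|
            * |K.momentum om (Q (t₀ + σ * s)) 0 x|
          ≤ (K.rc - K.rp) / ((x.1 - K.rp) * (K.rc - x.1)) * (α + β)
            * (K.speed * ((x.1 - K.rp) * (K.rc - x.1)) * K.densityAlt om (Q (t₀ + σ * s)) x) := by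
            have := (sub_pos.2 K.rp_lt).le
            gcongr
        _ = _ := by
          rw [hc]
          have := (sub_pos.2 hx.1.1).ne'
          have := (sub_pos.2 hx.1.2).ne'
          field_simp
    have h3 := (le_abs_self _).trans h2
    linarith

/-- Solutions with data supported away from the horizons stay supported away from them. -/
theorem exists_support (hom : K.IsTwistPotential om) (hQ : K.AxisRegular Q)
    (hF : K.FieldEquations om Q) {t₀ r₁ r₂ : ℝ} (h₁ : K.rp < r₁) (h₂ : r₂ < K.rc)
    (h0 : ∀ x ∈ K.quot, x.1 ∉ Icc r₁ r₂ → (Q t₀).lam x = 0 ∧ (Q t₀).eta x = 0 ∧ (Q t₀).u x = 0 ∧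
      (Q t₀).v x = 0) (t : ℝ) :
    ∃ r₃ r₄, K.rp < r₃ ∧ r₄ < K.rc ∧ ∀ x ∈ K.quot, x.1 ∉ Icc r₃ r₄ →
      (Q t).lam x = 0 ∧ (Q t).eta x = 0 ∧ (Q t).u x = 0 ∧ (Q t).v x = 0 := by
  obtain ⟨ρ₁, ρ₂, g1, g2, g3, g4⟩ := exists_radial_interval (K := K) h₁ h₂
  obtain ⟨σ, s, hσ, hs, rfl⟩ : ∃ σ s : ℝ, σ ^ 2 = 1 ∧ 0 ≤ s ∧ t = t₀ + σ * s := by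
    rcases le_total t₀ t with h | h
    · exact ⟨1, t - t₀, by norm_num, by linarith, by ring⟩
    · exact ⟨-1, t₀ - t, by norm_num, by linarith, by ring⟩
  have hmono : StrictMonoOn K.radial (Ioo K.rp K.rc) := by
    intro a ha b hb hab
    refine log_lt_log (radial_arg_pos ha) ?_
    have := sub_pos.2 ha.2
    have := sub_pos.2 hb.2
    rw [div_lt_div_iff₀ (by assumption) (by assumption)]
    nlinarith [K.rp_lt, ha.1, hb.1]
  have hρ₁ : ρ₁ ∈ Ioo K.rp K.rc := ⟨g1, g2.trans g3⟩
  have hρ₂ : ρ₂ ∈ Ioo K.rp K.rc := ⟨g1.trans g2, g3⟩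
  have hz : ∀ x ∈ K.quot, K.radial ρ₂ < K.radial x.1 ∨ K.radial x.1 < K.radial ρ₁ →
      K.densityAlt om (Q t₀) x = 0 := by
    intro x hx h
    refine densityAlt_eq_zero (isOpen_quot_diff r₁ r₂) inter_subset_left
      (fun y hy => h0 y hy.1 hy.2) ⟨hx, fun hxr => ?_⟩
    have := g4 hxr
    rcases h with h | h
    · exact absurd ((hmono.lt_iff_lt hρ₂ hx.1).1 h) (not_lt.2 this.2.le)
    · exact absurd ((hmono.lt_iff_lt hx.1 hρ₁).1 h) (not_lt.2 this.1.le)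
  set c := K.speed * (K.rc - K.rp) * s with hc
  obtain ⟨r₃, r₄, h₃, h₄, hr⟩ := exists_radial_bounds (K := K) (K.radial ρ₁ - c) (K.radial ρ₂ + c)
  refine ⟨r₃, r₄, h₃, h₄, fun x hx hxr => ?_⟩
  have hor : K.radial x.1 < K.radial ρ₁ - c ∨ K.radial ρ₂ + c < K.radial x.1 := by
    by_contra hcon
    rw [not_or, not_lt, not_lt] at hcon
    exact hxr (hr x.1 hx.1 hcon.1 hcon.2)
  -- The given point lies beyond the reach of the data on one side. The interval (k, M) is chosen
  -- inside the region free of data on that side, with its far end one unit beyond the distance c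
  -- that signals can cover.
  rcases hor with h | h
  · exact vanishes_of_radial hom hQ hF hσ (k := K.radial x.1 - c - 1) (M := K.radial ρ₁)
      (fun y hy _ h' => hz y hy (Or.inr h')) hs hx (by linarith) (by linarith)
  · exact vanishes_of_radial hom hQ hF hσ (k := K.radial ρ₂) (M := K.radial x.1 + c + 1)
      (fun y hy h' _ => hz y hy (Or.inl h')) hs hx (by linarith) (by linarith)

end KerrDeSitter

end

/-! ### The spacetime metric: raising indices and the ADM decomposition. -/

noncomputable section

namespace KerrDeSitter

variable {K : KerrDeSitter} {x : ℝ × ℝ}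

/-! ### The spacetime metric in terms of the reduced quantities -/

theorem wgt_eq (hx : x ∈ K.quot) : K.wgt x = K.kap 0 x * K.kap 1 x / K.nu x := by
  have := (sin_pos_of_mem_quot hx).ne'
  have := (SigmaFn_pos (K := K) (x := x) hx.1).ne'
  have := K.Xi_pos.ne'
  simp only [wgt, kap, nu, if_true, if_neg (by decide : ¬(1 : Fin 2) = 0)]
  field_simp

/-- Written in the reduced quantities, the inverse, the determinant, and the lapse and shift have
short closed forms, so that Maxwell's equations come out in the variables of the field equations. -/
theorem metric_eq_reduced (hx : x ∈ K.quot) : K.metric x =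
    !![K.twistT x ^ 2 * K.gphi x - K.kap 0 x * K.kap 1 x / K.gphi x, 0, 0,
        K.twistT x * K.gphi x;
       0, K.nu x / K.kap 0 x, 0, 0;
       0, 0, K.nu x / K.kap 1 x, 0;
       K.twistT x * K.gphi x, 0, 0, K.gphi x] := by
  have hS := (sin_pos_of_mem_quot hx).ne'
  have hSg := (SigmaFn_pos (K := K) (x := x) hx.1).ne'
  have hXi := K.Xi_pos.ne'
  have hB := (bigB_pos (K := K) (x := x) hx.1).ne'
  have hG := (gphi_pos hx).ne'
  have hP := (K.PiFn_pos x).ne'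
  have hD := (Delta_pos hx.1).ne'
  have e1 : K.twistT x * K.gphi x
      = -K.a * sin x.2 ^ 2 * K.bigT x / (K.SigmaFn x * K.Xi ^ 2) := by
    simp only [twistT, gphi]
    field_simp
  have e2 : K.kap 0 x * K.kap 1 x = K.Delta x.1 * K.PiFn x * sin x.2 ^ 2 / K.Xi ^ 4 := by
    simp only [kap, if_true, if_neg (by decide : ¬(1 : Fin 2) = 0)]
    field_simp
  have e3 : K.metric x 0 0 = K.twistT x ^ 2 * K.gphi x - K.kap 0 x * K.kap 1 x / K.gphi x := by
    have h := K.metric_block_det x hSg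
    rw [← e1, ← e2] at h
    field_simp
    linear_combination h
  have e4 : K.SigmaFn x / K.Delta x.1 = K.nu x / K.kap 0 x := by
    simp only [nu, kap, if_true]
    field_simp
  have e5 : K.SigmaFn x / K.PiFn x = K.nu x / K.kap 1 x := by
    simp only [nu, kap, if_neg (by decide : ¬(1 : Fin 2) = 0)]
    field_simp
  rw [metric_eq, e3, e4, e5, ← e1]

theorem metric_inv (hx : x ∈ K.quot) : (K.metric x)⁻¹ =
    !![-(K.gphi x / (K.kap 0 x * K.kap 1 x)), 0, 0,
        K.twistT x * K.gphi x / (K.kap 0 x * K.kap 1 x);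
       0, K.kap 0 x / K.nu x, 0, 0;
       0, 0, K.kap 1 x / K.nu x, 0;
       K.twistT x * K.gphi x / (K.kap 0 x * K.kap 1 x), 0, 0,
        1 / K.gphi x - K.twistT x ^ 2 * K.gphi x / (K.kap 0 x * K.kap 1 x)] := by
  have hG := (gphi_pos hx).ne'
  have h0 := (kap_pos hx 0).ne'
  have h1 := (kap_pos hx 1).ne'
  have hn := (nu_pos hx).ne'
  refine Matrix.inv_eq_right_inv ?_
  rw [metric_eq_reduced hx]
  ext i j
  fin_cases i <;> fin_cases j <;> simp [Matrix.mul_apply, Fin.sum_univ_four] <;> field_simp <;> ring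

theorem sqrt_neg_metric_det (hx : x ∈ K.quot) : √(-(K.metric x).det) = K.nu x := by
  have hG := (gphi_pos hx).ne'
  have h0 := (kap_pos hx 0).ne'
  have h1 := (kap_pos hx 1).ne'
  have h : -(K.metric x).det = K.nu x ^ 2 := by
    rw [metric_eq_reduced hx]
    simp [Matrix.det_succ_row_zero, Fin.sum_univ_succ, Fin.succAbove]
    field_simp
    ring
  rw [h, sqrt_sq (nu_pos hx).le]

/-- The components of `√(-det ḡ) F^{μν}` for an antisymmetric `F_{μν}`. -/
theorem raise_antisymm (hx : x ∈ K.quot) {F : Matrix (Fin 4) (Fin 4) ℝ}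
    (hF : ∀ i j, F i j = -F j i) {D : Matrix (Fin 4) (Fin 4) ℝ}
    (hD : D = √(-(K.metric x).det) • ((K.metric x)⁻¹ * F * ((K.metric x)⁻¹)ᵀ)) :
    D 0 1 = -(K.gphi x / K.kap 1 x * (F 0 1 + K.twistT x * F 1 3)) ∧
    D 0 2 = -(K.gphi x / K.kap 0 x * (F 0 2 + K.twistT x * F 2 3)) ∧
    D 0 3 = -(F 0 3 / K.wgt x) ∧
    D 1 2 = K.wgt x * F 1 2 ∧
    D 1 3 = K.kap 0 x / K.gphi x * F 1 3 + K.twistT x * D 0 1 ∧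
    D 2 3 = K.kap 1 x / K.gphi x * F 2 3 + K.twistT x * D 0 2 ∧
    ∀ i j, D i j = -D j i := by
  have hG := (gphi_pos hx).ne'
  have h0 := (kap_pos hx 0).ne'
  have h1 := (kap_pos hx 1).ne'
  have hn := (nu_pos hx).ne'
  have d0 : F 0 0 = 0 := self_eq_neg.1 (hF 0 0)
  have d1 : F 1 1 = 0 := self_eq_neg.1 (hF 1 1)
  have d2 : F 2 2 = 0 := self_eq_neg.1 (hF 2 2)
  have d3 : F 3 3 = 0 := self_eq_neg.1 (hF 3 3)
  have e1 := hF 1 0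
  have e2 := hF 2 0
  have e3 := hF 3 0
  have e4 := hF 2 1
  have e5 := hF 3 1
  have e6 := hF 3 2
  rw [sqrt_neg_metric_det hx, metric_inv hx] at hD
  rw [wgt_eq hx]
  have hij : ∀ i j, D i j = K.nu x * ∑ k, (∑ l, (!![-(K.gphi x / (K.kap 0 x * K.kap 1 x)), 0, 0,
        K.twistT x * K.gphi x / (K.kap 0 x * K.kap 1 x);
       0, K.kap 0 x / K.nu x, 0, 0;
       0, 0, K.kap 1 x / K.nu x, 0;
       K.twistT x * K.gphi x / (K.kap 0 x * K.kap 1 x), 0, 0,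
        1 / K.gphi x - K.twistT x ^ 2 * K.gphi x / (K.kap 0 x * K.kap 1 x)] :
          Matrix (Fin 4) (Fin 4) ℝ) i l * F l k) * (!![-(K.gphi x / (K.kap 0 x * K.kap 1 x)), 0, 0,
        K.twistT x * K.gphi x / (K.kap 0 x * K.kap 1 x);
       0, K.kap 0 x / K.nu x, 0, 0;
       0, 0, K.kap 1 x / K.nu x, 0;
       K.twistT x * K.gphi x / (K.kap 0 x * K.kap 1 x), 0, 0,
        1 / K.gphi x - K.twistT x ^ 2 * K.gphi x / (K.kap 0 x * K.kap 1 x)] :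
          Matrix (Fin 4) (Fin 4) ℝ) j k := fun i j => by
    rw [hD]
    simp only [Matrix.smul_apply, smul_eq_mul, Matrix.mul_apply, Matrix.transpose_apply]
  have hanti : ∀ i j, D i j = -D j i := by
    intro i j
    rw [hij, hij, ← mul_neg, ← Finset.sum_neg_distrib]
    congr 1
    -- Raising both indices with the same matrix preserves antisymmetry: the two contracted indices
    -- are exchanged.
    simp only [Finset.sum_mul, ← Finset.sum_neg_distrib]
    rw [Finset.sum_comm]
    refine Finset.sum_congr rfl fun k _ => Finset.sum_congr rfl fun l _ => ?_
    rw [hF k l]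
    ring
  have hD01 : D 0 1 = -(K.gphi x / K.kap 1 x * (F 0 1 + K.twistT x * F 1 3)) := by
    rw [hij]
    simp [Fin.sum_univ_four, e5]
    field_simp
    ring
  have hD02 : D 0 2 = -(K.gphi x / K.kap 0 x * (F 0 2 + K.twistT x * F 2 3)) := by
    rw [hij]
    simp [Fin.sum_univ_four, e6]
    field_simp
    ring
  refine ⟨hD01, hD02, ?_, ?_, ?_, ?_, hanti⟩
  · rw [hij]
    simp [Fin.sum_univ_four, d0, d3, e3]
    field_simp
    ring
  · rw [hij]
    simp [Fin.sum_univ_four]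
    field_simp
  · rw [hij, hD01]
    simp [Fin.sum_univ_four, e1]
    field_simp
    ring
  · rw [hij, hD02]
    simp [Fin.sum_univ_four, e2]
    field_simp
    ring

/-! ### The ADM decomposition of the spacetime metric -/

theorem lapse_metric (hx : x ∈ K.quot) :
    lapse (K.metric x) = √(K.kap 0 x * K.kap 1 x / K.gphi x) := by
  rw [lapse, metric_inv hx, show √(K.kap 0 x * K.kap 1 x / K.gphi x)
    = (√(K.gphi x / (K.kap 0 x * K.kap 1 x)))⁻¹ by rw [← sqrt_inv, inv_div]]
  simp

theorem shift_metric (hx : x ∈ K.quot) : shift (K.metric x) = ![0, 0, K.twistT x] := by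
  have hG := (gphi_pos hx).ne'
  have h0 := (kap_pos hx 0).ne'
  have h1 := (kap_pos hx 1).ne'
  funext i
  rw [shift, metric_inv hx]
  fin_cases i <;> simp
  field_simp

theorem spatialMetric_metric (hx : x ∈ K.quot) : spatialMetric (K.metric x)
    = Matrix.diagonal ![K.nu x / K.kap 0 x, K.nu x / K.kap 1 x, K.gphi x] := by
  rw [spatialMetric, metric_eq_reduced hx]
  ext i j
  fin_cases i <;> fin_cases j <;> simp

/-- The ADM energy density of electric and magnetic densities. -/
theorem adm_density_eq (hx : x ∈ K.quot) (E B : Fin 3 → ℝ) :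
    1 / 2 * lapse (K.metric x) * (√(spatialMetric (K.metric x)).det)⁻¹
      * ∑ i, ∑ j, spatialMetric (K.metric x) i j * (E i * E j + B i * B j)
      - shift (K.metric x) ⬝ᵥ (crossProduct E B)
    = 1 / 2 * K.wgt x * (E 2 ^ 2 + B 2 ^ 2)
      + (K.kap 1 x * (E 0 ^ 2 + B 0 ^ 2) + K.kap 0 x * (E 1 ^ 2 + B 1 ^ 2)) / (2 * K.gphi x)
      - K.twistT x * (E 0 * B 1 - E 1 * B 0) := by
  have hG := gphi_pos hx
  have h0 := kap_pos hx 0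
  have h1 := kap_pos hx 1
  have hn := nu_pos hx
  have hs : lapse (K.metric x) * (√(spatialMetric (K.metric x)).det)⁻¹ = K.wgt x / K.gphi x := by
    rw [lapse_metric hx, spatialMetric_metric hx, Matrix.det_diagonal, ← sqrt_inv,
      ← sqrt_mul (by positivity), wgt_eq hx]
    rw [show K.kap 0 x * K.kap 1 x / K.gphi x
        * (∏ i, (![K.nu x / K.kap 0 x, K.nu x / K.kap 1 x, K.gphi x] : Fin 3 → ℝ) i)⁻¹
        = (K.kap 0 x * K.kap 1 x / K.nu x / K.gphi x) ^ 2 by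
      simp [Fin.prod_univ_three]
      field_simp, sqrt_sq (by positivity)]
  rw [mul_assoc (1 / 2 : ℝ), hs, shift_metric hx, spatialMetric_metric hx, cross_apply]
  simp only [Fin.sum_univ_three, Matrix.diagonal_apply]
  simp [dotProduct, Fin.sum_univ_three]
  rw [wgt_eq hx]
  field_simp
  ring

end KerrDeSitter

end

/-! ### One-forms in spherical coordinates and their parity at the axes. -/

noncomputable section

namespace KerrDeSitter

variable {K : KerrDeSitter} {A : (Fin 4 → ℝ) → ((Fin 4 → ℝ) →L[ℝ] ℝ)}

/-! ### One-forms in spherical coordinates -/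

variable (K) in
/-- Coordinates `(t, r, θ, φ)` with `r₊ < r < r_c`. -/
def sphDomain : Set (Fin 4 → ℝ) := {c | c 1 ∈ Ioo K.rp K.rc}

variable (K) in
theorem isOpen_sphDomain : IsOpen K.sphDomain := isOpen_Ioo.preimage (continuous_apply 1)

theorem chart_subset_sphDomain : K.chart ⊆ K.sphDomain := fun _ hc => hc.1

variable (K) in
theorem isOpen_chart : IsOpen K.chart :=
  K.isOpen_quot.preimage ((continuous_apply 1).prodMk (continuous_apply 2))

theorem contDiff_sph : ContDiff ℝ ∞ sph := by
  rw [contDiff_pi]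
  intro i
  fin_cases i <;> simp [sph] <;> fun_prop

theorem sph_mem_spacetime {c : Fin 4 → ℝ} (hc : c ∈ K.sphDomain) : sph c ∈ K.spacetime := by
  have h : √((sph c 1) ^ 2 + (sph c 2) ^ 2 + (sph c 3) ^ 2) = c 1 := by
    have e : (sph c 1) ^ 2 + (sph c 2) ^ 2 + (sph c 3) ^ 2 = c 1 ^ 2 := by
      simp only [sph, Matrix.cons_val]
      linear_combination (c 1 ^ 2 * sin (c 2) ^ 2) * sin_sq_add_cos_sq (c 3)
        + c 1 ^ 2 * sin_sq_add_cos_sq (c 2)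
    rw [e, sqrt_sq (r_pos hc).le]
  show √((sph c 1) ^ 2 + (sph c 2) ^ 2 + (sph c 3) ^ 2) ∈ Ioo K.rp K.rc
  rw [h]
  exact hc

theorem contDiffOn_comp (hA : ContDiffOn ℝ ∞ A K.spacetime) (μ : Fin 4) :
    ContDiffOn ℝ ∞ (comp A μ) K.sphDomain := by
  have h1 : ContDiffOn ℝ ∞ (fun c => A (sph c)) K.sphDomain :=
    hA.comp contDiff_sph.contDiffOn fun c hc => sph_mem_spacetime hc
  have h2 : ContDiff ℝ ∞ fun c => fderiv ℝ sph c (Pi.single μ 1) :=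
    (contDiff_sph.fderiv_right (m := ∞) (by simp)).clm_apply contDiff_const
  exact h1.clm_apply h2.contDiffOn

theorem contDiffOn_pd4_comp (hA : ContDiffOn ℝ ∞ A K.spacetime) (μ ν : Fin 4) :
    ContDiffOn ℝ ∞ (pd4 ν (comp A μ)) K.sphDomain :=
  (contDiffOn_comp hA μ).fderiv_apply_of_isOpen K.isOpen_sphDomain _

theorem differentiableAt_comp (hA : ContDiffOn ℝ ∞ A K.spacetime) (μ : Fin 4) {c : Fin 4 → ℝ}
    (hc : c ∈ K.sphDomain) : DifferentiableAt ℝ (comp A μ) c :=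
  ((contDiffOn_comp hA μ c hc).contDiffAt (K.isOpen_sphDomain.mem_nhds hc)).differentiableAt
    (by simp)

/-! ### Reflection at the axes -/

/-- The signs of the coordinates under the reflection at an axis. -/
def reflSign : Fin 4 → ℝ := ![1, 1, -1, 1]

/-- The linear part of the reflection at an axis. -/
def reflLin : (Fin 4 → ℝ) →L[ℝ] (Fin 4 → ℝ) :=
  ContinuousLinearMap.pi fun i => reflSign i • ContinuousLinearMap.proj i

/-- The change of coordinates `(θ, φ) ↦ (2κ - θ, φ + π)`. -/
def refl (κ : ℝ) (c : Fin 4 → ℝ) : Fin 4 → ℝ := reflLin c + ![0, 0, 2 * κ, π]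

theorem refl_eq (κ : ℝ) (c : Fin 4 → ℝ) : refl κ c = ![c 0, c 1, 2 * κ - c 2, c 3 + π] := by
  funext i
  fin_cases i <;> simp [refl, reflLin, reflSign]
  ring

theorem reflLin_single (μ : Fin 4) :
    reflLin (Pi.single μ 1) = reflSign μ • (Pi.single μ 1 : Fin 4 → ℝ) := by
  funext i
  simp only [reflLin, ContinuousLinearMap.coe_pi', smul_apply,
    ContinuousLinearMap.proj_apply, Pi.smul_apply, smul_eq_mul]
  by_cases h : i = μ
  · rw [h]
  · simp [h]

theorem hasFDerivAt_refl (κ : ℝ) (c : Fin 4 → ℝ) : HasFDerivAt (refl κ) reflLin c :=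
  reflLin.hasFDerivAt.add_const _

/-- Continuing through an axis to negative polar angle is the same as turning by π. Thus the
components of a one-form on space extend smoothly across the axes with a definite parity. -/
theorem sph_refl {κ : ℝ} (hκ : κ ∈ ({0, π} : Set ℝ)) (c : Fin 4 → ℝ) : sph (refl κ c) = sph c := by
  have hs : sin (2 * κ - c 2) = -sin (c 2) := by
    rcases hκ with rfl | rfl
    · simp
    · rw [sin_two_pi_sub]
  have hc : cos (2 * κ - c 2) = cos (c 2) := by
    rcases hκ with rfl | rfl
    · simp
    · rw [cos_two_pi_sub]
  funext i
  rw [refl_eq]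
  fin_cases i <;> simp [sph, hs, hc, sin_add_pi, cos_add_pi]

theorem comp_refl {κ : ℝ} (hκ : κ ∈ ({0, π} : Set ℝ)) (μ : Fin 4) (c : Fin 4 → ℝ) :
    comp A μ c = reflSign μ * comp A μ (refl κ c) := by
  have h1 : HasFDerivAt (fun c => sph (refl κ c)) ((fderiv ℝ sph (refl κ c)).comp reflLin) c :=
    ((contDiff_sph.differentiable (by simp)) _).hasFDerivAt.comp c (hasFDerivAt_refl κ c)
  have h2 : (fun c => sph (refl κ c)) = sph := funext fun c => sph_refl hκ c
  rw [h2] at h1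
  rw [comp, comp, h1.fderiv, sph_refl hκ]
  simp only [ContinuousLinearMap.comp_apply, reflLin_single, map_smul, smul_eq_mul]

theorem refl_mem_sphDomain {κ : ℝ} {c : Fin 4 → ℝ} (hc : c ∈ K.sphDomain) :
    refl κ c ∈ K.sphDomain := by
  show refl κ c 1 ∈ Ioo K.rp K.rc
  rw [refl_eq]
  exact hc

theorem pd4_comp_refl (hA : ContDiffOn ℝ ∞ A K.spacetime) {κ : ℝ} (hκ : κ ∈ ({0, π} : Set ℝ))
    (μ ν : Fin 4) {c : Fin 4 → ℝ} (hc : c ∈ K.sphDomain) :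
    pd4 ν (comp A μ) c = reflSign μ * reflSign ν * pd4 ν (comp A μ) (refl κ c) := by
  have h1 : HasFDerivAt (fun c => reflSign μ * comp A μ (refl κ c))
      (reflSign μ • (fderiv ℝ (comp A μ) (refl κ c)).comp reflLin) c :=
    ((differentiableAt_comp hA μ (refl_mem_sphDomain hc)).hasFDerivAt.comp c
      (hasFDerivAt_refl κ c)).const_mul (reflSign μ)
  have h2 : (fun c => reflSign μ * comp A μ (refl κ c)) = comp A μ :=
    funext fun c => (comp_refl hκ μ c).symm
  rw [h2] at h1
  rw [pd4, pd4, h1.fderiv]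
  simp only [smul_apply, ContinuousLinearMap.comp_apply, reflLin_single,
    map_smul, smul_eq_mul]
  ring

/-! ### Reduction to the quotient -/

/-- The coordinates `(t, (r, θ))` as a linear function of `(t, r, θ, φ)`. -/
def projLin : (Fin 4 → ℝ) →L[ℝ] ℝ × (ℝ × ℝ) :=
  (ContinuousLinearMap.proj 0).prod
    ((ContinuousLinearMap.proj 1).prod (ContinuousLinearMap.proj 2))

/-- The half-plane `φ = 0`. -/
def emb : (ℝ × (ℝ × ℝ)) →L[ℝ] (Fin 4 → ℝ) :=
  ContinuousLinearMap.pi ![ContinuousLinearMap.fst ℝ ℝ (ℝ × ℝ),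
    (ContinuousLinearMap.fst ℝ ℝ ℝ).comp (ContinuousLinearMap.snd ℝ ℝ (ℝ × ℝ)),
    (ContinuousLinearMap.snd ℝ ℝ ℝ).comp (ContinuousLinearMap.snd ℝ ℝ (ℝ × ℝ)), 0]

theorem projLin_apply (c : Fin 4 → ℝ) : projLin c = (c 0, (c 1, c 2)) := rfl

theorem emb_apply (p : ℝ × (ℝ × ℝ)) : emb p = ![p.1, p.2.1, p.2.2, 0] := by
  funext i
  fin_cases i <;> rfl

theorem projLin_emb (p : ℝ × (ℝ × ℝ)) : projLin (emb p) = p := by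
  rw [projLin_apply, emb_apply]
  rfl

/-- The coordinate directions on `ℝ × Σ`. -/
def dir : Fin 4 → ℝ × (ℝ × ℝ) := ![(1, 0), (0, (1, 0)), (0, (0, 1)), 0]

theorem projLin_single (ν : Fin 4) : projLin (Pi.single ν 1) = dir ν := by
  rw [projLin_apply]
  fin_cases ν <;> simp [dir]

theorem emb_dir {ν : Fin 4} (hν : ν ≠ 3) : emb (dir ν) = Pi.single ν 1 := by
  rw [emb_apply]
  funext i
  fin_cases ν <;> fin_cases i <;> simp [dir] at hν ⊢

/-- A function of `(t, r, θ, φ)` that does not depend on `φ`. -/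
theorem pd4_of_eqOn_projLin {f : (Fin 4 → ℝ) → ℝ} {g : ℝ × (ℝ × ℝ) → ℝ}
    (h : ∀ c ∈ K.chart, f c = g (projLin c)) {c : Fin 4 → ℝ} (hc : c ∈ K.chart)
    (hg : DifferentiableAt ℝ g (projLin c)) (ν : Fin 4) :
    pd4 ν f c = fderiv ℝ g (projLin c) (dir ν) := by
  have h1 : HasFDerivAt (fun c => g (projLin c)) ((fderiv ℝ g (projLin c)).comp projLin) c :=
    hg.hasFDerivAt.comp c projLin.hasFDerivAt
  have h2 : f =ᶠ[nhds c] fun c => g (projLin c) := by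
    filter_upwards [K.isOpen_chart.mem_nhds hc] with c' hc' using h c' hc'
  rw [pd4, (h1.congr_of_eventuallyEq h2).fderiv, ContinuousLinearMap.comp_apply, projLin_single]

/-- The components of `A` in the half-plane `φ = 0`. -/
def redComp (A : (Fin 4 → ℝ) → ((Fin 4 → ℝ) →L[ℝ] ℝ)) (μ : Fin 4) (p : ℝ × (ℝ × ℝ)) : ℝ :=
  comp A μ (emb p)

variable (K) in
/-- The product `ℝ × Σ` with the angle `θ` extended to `ℝ`. -/
def tube : Set (ℝ × (ℝ × ℝ)) := univ ×ˢ K.strip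

variable (K) in
theorem isOpen_tube : IsOpen K.tube := isOpen_univ.prod K.isOpen_strip

variable (K) in
theorem cyl_subset_tube : K.cyl ⊆ K.tube := prod_mono_right K.quotAxis_subset_strip

theorem emb_mem_sphDomain {p : ℝ × (ℝ × ℝ)} (hp : p ∈ K.tube) : emb p ∈ K.sphDomain := by
  show emb p 1 ∈ Ioo K.rp K.rc
  rw [emb_apply]
  exact hp.2.1

theorem contDiffOn_redComp (hA : ContDiffOn ℝ ∞ A K.spacetime) (μ : Fin 4) :
    ContDiffOn ℝ ∞ (redComp A μ) K.tube :=
  (contDiffOn_comp hA μ).comp emb.contDiff.contDiffOn fun _ hp => emb_mem_sphDomain hp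

theorem fderiv_redComp (hA : ContDiffOn ℝ ∞ A K.spacetime) (μ : Fin 4) {ν : Fin 4} (hν : ν ≠ 3)
    {p : ℝ × (ℝ × ℝ)} (hp : p ∈ K.tube) :
    fderiv ℝ (redComp A μ) p (dir ν) = pd4 ν (comp A μ) (emb p) := by
  have h1 : HasFDerivAt (redComp A μ) ((fderiv ℝ (comp A μ) (emb p)).comp emb) p :=
    (differentiableAt_comp hA μ (emb_mem_sphDomain hp)).hasFDerivAt.comp p emb.hasFDerivAt
  rw [h1.fderiv, ContinuousLinearMap.comp_apply, emb_dir hν, pd4]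

section Axisymmetric

variable (hA : ContDiffOn ℝ ∞ A K.spacetime) (hs : ∀ c ∈ K.chart, ∀ μ, pd4 3 (comp A μ) c = 0)

include hA hs

/-- The whole circle c + s ∂_φ stays in the chart, so vanishing φ-derivative lets the value be read
at φ = 0. -/
theorem comp_eq_redComp {c : Fin 4 → ℝ} (hc : c ∈ K.chart) (μ : Fin 4) :
    comp A μ c = redComp A μ (projLin c) := by
  have key : ∀ s : ℝ, HasDerivAt (fun s : ℝ => comp A μ (c + s • Pi.single 3 1)) 0 s := by
    intro s
    have hc' : c + s • (Pi.single 3 1 : Fin 4 → ℝ) ∈ K.chart := by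
      show ((c + s • (Pi.single 3 1 : Fin 4 → ℝ)) 1, (c + s • (Pi.single 3 1 : Fin 4 → ℝ)) 2)
        ∈ K.quot
      simp only [Pi.add_apply, Pi.smul_apply, ne_eq, Fin.reduceEq, not_false_eq_true,
        Pi.single_eq_of_ne, smul_zero, add_zero]
      exact hc
    have h1 : HasDerivAt (fun s : ℝ => c + s • (Pi.single 3 1 : Fin 4 → ℝ)) (Pi.single 3 1) s := by
      simpa using ((hasDerivAt_id s).smul_const (Pi.single 3 1 : Fin 4 → ℝ)).const_add c
    have h2 := (differentiableAt_comp hA μ (chart_subset_sphDomain hc')).hasFDerivAt.comp_hasDerivAt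
      s h1
    have h3 := hs _ hc' μ
    rw [pd4] at h3
    rwa [h3] at h2
  have h := is_const_of_deriv_eq_zero (fun s => (key s).differentiableAt) (fun s => (key s).deriv)
    0 (-c 3)
  rw [redComp]
  convert h using 2
  · simp
  · rw [projLin_apply, emb_apply]
    funext i
    fin_cases i <;> simp

theorem pd4_comp_eq {c : Fin 4 → ℝ} (hc : c ∈ K.chart) (μ ν : Fin 4) :
    pd4 ν (comp A μ) c = fderiv ℝ (redComp A μ) (projLin c) (dir ν) := by
  refine pd4_of_eqOn_projLin (fun c hc => comp_eq_redComp hA hs hc μ) hc ?_ ν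
  refine ((contDiffOn_redComp hA μ).contDiffAt (K.isOpen_tube.mem_nhds ?_)).differentiableAt
    (by simp)
  exact ⟨mem_univ _, hc.1, mem_univ _⟩

/-- Derivatives of components that are odd under the reflection vanish on the axes. -/
theorem fderiv_redComp_axes {μ ν : Fin 4} (hμν : reflSign μ * reflSign ν = -1) (hν : ν ≠ 3) (t : ℝ)
    {x : ℝ × ℝ} (hx : x ∈ K.axes) : fderiv ℝ (redComp A μ) (t, x) (dir ν) = 0 := by
  rw [fderiv_redComp hA μ hν ⟨mem_univ _, hx.1, mem_univ _⟩]
  have hcont : ∀ φ : ℝ, Continuous fun θ => pd4 ν (comp A μ) ![t, x.1, θ, φ] := fun φ =>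
    (contDiffOn_pd4_comp hA μ ν).continuousOn.comp_continuous (by fun_prop) fun θ => hx.1
  -- Rotation invariance is given only off the axes; continuity in θ carries the agreement of φ = 0
  -- and φ = π to the axis. There the reflection relates the same two values with the sign -1, so
  -- both are zero.
  have heq : EqOn (fun θ => pd4 ν (comp A μ) ![t, x.1, θ, 0])
      (fun θ => pd4 ν (comp A μ) ![t, x.1, θ, π]) (Ioo 0 π) := by
    intro θ hθ
    simp only
    rw [pd4_comp_eq hA hs (c := ![t, x.1, θ, 0]) ⟨hx.1, hθ⟩,
      pd4_comp_eq hA hs (c := ![t, x.1, θ, π]) ⟨hx.1, hθ⟩]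
    rfl
  have h1 := heq.closure (hcont 0) (hcont π)
  rw [closure_Ioo pi_pos.ne] at h1
  have h2 : x.2 ∈ Icc 0 π := (axes_subset_quotAxis K hx).2
  have h3 := h1 h2
  have h4 := pd4_comp_refl hA hx.2 μ ν (c := ![t, x.1, x.2, 0]) hx.1
  rw [refl_eq, hμν] at h4
  simp only [Matrix.cons_val, zero_add] at h4
  rw [show 2 * x.2 - x.2 = x.2 by ring] at h4
  simp only at h3
  rw [← h3] at h4
  rw [emb_apply]
  linarith

end Axisymmetric

/-! ### The angular component -/

/-- The cartesian component `A_y` in the half-plane `φ = 0`. -/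
def redY (A : (Fin 4 → ℝ) → ((Fin 4 → ℝ) →L[ℝ] ℝ)) (p : ℝ × (ℝ × ℝ)) : ℝ :=
  A (sph (emb p)) (Pi.single 2 1)

theorem contDiffOn_redY (hA : ContDiffOn ℝ ∞ A K.spacetime) : ContDiffOn ℝ ∞ (redY A) K.tube :=
  (hA.comp (contDiff_sph.comp emb.contDiff).contDiffOn fun _ hp =>
    sph_mem_spacetime (emb_mem_sphDomain hp)).clm_apply contDiffOn_const

/-- At φ = 0 the vector ∂_φ is r sin θ ∂_y. This exhibits the factor sin θ of λ with a smooth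
cofactor. -/
theorem redComp_three (p : ℝ × (ℝ × ℝ)) : redComp A 3 p = p.2.1 * sin p.2.2 * redY A p := by
  have h1 : HasDerivAt (fun s : ℝ => emb p + s • (Pi.single 3 1 : Fin 4 → ℝ)) (Pi.single 3 1) 0 := by
    simpa using ((hasDerivAt_id (0 : ℝ)).smul_const (Pi.single 3 1 : Fin 4 → ℝ)).const_add (emb p)
  have h0 : emb p + (0 : ℝ) • (Pi.single 3 1 : Fin 4 → ℝ) = emb p := by simp
  have hd : HasFDerivAt sph (fderiv ℝ sph (emb p)) (emb p + (0 : ℝ) • (Pi.single 3 1 : Fin 4 → ℝ)) := by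
    rw [h0]
    exact ((contDiff_sph.differentiable (by simp)) _).hasFDerivAt
  have h2 := hd.comp_hasDerivAt 0 h1
  have h3 : HasDerivAt (sph ∘ fun s : ℝ => emb p + s • (Pi.single 3 1 : Fin 4 → ℝ))
      ((p.2.1 * sin p.2.2) • (Pi.single 2 1 : Fin 4 → ℝ)) 0 := by
    have e : (sph ∘ fun s : ℝ => emb p + s • (Pi.single 3 1 : Fin 4 → ℝ)) = fun s =>
        ![p.1, p.2.1 * sin p.2.2 * cos s, p.2.1 * sin p.2.2 * sin s, p.2.1 * cos p.2.2] := by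
      funext s
      have e' : ∀ i, (emb p + s • (Pi.single 3 1 : Fin 4 → ℝ)) i = ![p.1, p.2.1, p.2.2, s] i := by
        intro i
        rw [emb_apply]
        fin_cases i <;> simp
      simp only [Function.comp_apply, sph, e', Matrix.cons_val]
    rw [e, hasDerivAt_pi]
    intro i
    fin_cases i
    · simpa using hasDerivAt_const (0 : ℝ) p.1
    · simpa using (hasDerivAt_cos 0).const_mul (p.2.1 * sin p.2.2)
    · simpa using (hasDerivAt_sin 0).const_mul (p.2.1 * sin p.2.2)
    · simpa using hasDerivAt_const (0 : ℝ) (p.2.1 * cos p.2.2)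
  rw [redComp, comp, h2.unique h3, map_smul, smul_eq_mul, redY]

/-- ∂_θ A_φ is odd under the reflection, hence zero on the axes, where by `redComp_three` it equals
r cos θ A_y with cos θ = ±1. -/
theorem redY_axes (hA : ContDiffOn ℝ ∞ A K.spacetime)
    (hs : ∀ c ∈ K.chart, ∀ μ, pd4 3 (comp A μ) c = 0) (t : ℝ) {x : ℝ × ℝ} (hx : x ∈ K.axes) :
    redY A (t, x) = 0 := by
  have hp : (t, x) ∈ K.tube := ⟨mem_univ _, hx.1, mem_univ _⟩
  have hdir : HasDerivAt (fun θ : ℝ => (t, (x.1, θ))) (dir 2) x.2 :=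
    (hasDerivAt_const _ _).prodMk ((hasDerivAt_const _ _).prodMk (hasDerivAt_id _))
  have hd : ∀ {f : ℝ × (ℝ × ℝ) → ℝ}, ContDiffOn ℝ ∞ f K.tube →
      HasDerivAt (fun θ => f (t, (x.1, θ))) (fderiv ℝ f (t, x) (dir 2)) x.2 := fun hf =>
    ((hf.contDiffAt (K.isOpen_tube.mem_nhds hp)).differentiableAt
      (by simp)).hasFDerivAt.comp_hasDerivAt x.2 hdir
  have h1 := hd (contDiffOn_redComp hA 3)
  rw [fderiv_redComp_axes hA hs (by simp [reflSign]) (by decide) t hx] at h1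
  have h2 := ((hasDerivAt_sin x.2).const_mul x.1).mul (hd (contDiffOn_redY hA))
  have h3 : (fun θ => redComp A 3 (t, (x.1, θ)))
      = (fun θ => x.1 * sin θ) * fun θ => redY A (t, (x.1, θ)) :=
    funext fun θ => redComp_three _
  rw [h3] at h1
  have h4 := h1.unique h2
  have hsin : sin x.2 = 0 := by
    rcases hx.2 with h | h <;> rw [h] <;> simp
  have hcos : cos x.2 ≠ 0 := by
    rcases hx.2 with h | h <;> rw [h] <;> simp
  rw [hsin, mul_zero, zero_mul, add_zero] at h4
  exact (mul_eq_zero.1 h4.symm).resolve_left (mul_ne_zero (r_pos hx.1).ne' hcos)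

end KerrDeSitter

end

/-! ### Maxwell's equations in the half-plane φ = 0. -/

noncomputable section

namespace KerrDeSitter

variable {K : KerrDeSitter} {A : (Fin 4 → ℝ) → ((Fin 4 → ℝ) →L[ℝ] ℝ)} {t : ℝ} {x : ℝ × ℝ}

/-! ### Functions on the tube -/

section Tube

variable {f : ℝ × (ℝ × ℝ) → ℝ} (hf : ContDiffOn ℝ ∞ f K.tube)

variable (K) in
theorem quot_mem_tube (hx : x ∈ K.quot) (t : ℝ) : (t, x) ∈ K.tube :=
  ⟨mem_univ _, K.quot_subset_strip hx⟩

theorem axes_mem_tube (hx : x ∈ K.axes) (t : ℝ) : (t, x) ∈ K.tube :=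
  ⟨mem_univ _, hx.1, mem_univ _⟩

theorem contDiffOn_of_strip {g : ℝ × ℝ → ℝ} (hg : ContDiffOn ℝ ∞ g K.strip) :
    ContDiffOn ℝ ∞ (fun p : ℝ × (ℝ × ℝ) => g p.2) K.tube :=
  hg.comp contDiff_snd.contDiffOn fun _ hp => hp.2

include hf

theorem differentiableAt_tube {p : ℝ × (ℝ × ℝ)} (hp : p ∈ K.tube) : DifferentiableAt ℝ f p :=
  (hf.contDiffAt (K.isOpen_tube.mem_nhds hp)).differentiableAt (by simp)

theorem contDiffOn_fderiv_dir (ν : Fin 4) : ContDiffOn ℝ ∞ (fun p => fderiv ℝ f p (dir ν)) K.tube :=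
  hf.fderiv_apply_of_isOpen K.isOpen_tube _

theorem contDiffOn_slice_tube (t : ℝ) : ContDiffOn ℝ ∞ (fun y => f (t, y)) K.strip :=
  hf.slice (mem_univ t)

theorem deriv_slice_tube (hp : (t, x) ∈ K.tube) :
    deriv (fun s => f (s, x)) t = fderiv ℝ f (t, x) (dir 0) :=
  (hasDerivAt_slice (differentiableAt_tube hf hp)).deriv

theorem pd_zero_slice_tube (hp : (t, x) ∈ K.tube) :
    pd 0 (fun y => f (t, y)) x = fderiv ℝ f (t, x) (dir 1) :=
  pd_slice 0 (differentiableAt_tube hf hp)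

theorem pd_one_slice_tube (hp : (t, x) ∈ K.tube) :
    pd 1 (fun y => f (t, y)) x = fderiv ℝ f (t, x) (dir 2) :=
  pd_slice 1 (differentiableAt_tube hf hp)

theorem fderiv_dir_comm {p : ℝ × (ℝ × ℝ)} (hp : p ∈ K.tube) (μ ν : Fin 4) :
    fderiv ℝ (fun y => fderiv ℝ f y (dir μ)) p (dir ν)
      = fderiv ℝ (fun y => fderiv ℝ f y (dir ν)) p (dir μ) :=
  fderiv_fderiv_comm hf K.isOpen_tube hp _ _

end Tube

/-! ### The reduced Maxwell field -/

/-- The Faraday tensor in the half-plane `φ = 0`. -/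
def redF (A : (Fin 4 → ℝ) → ((Fin 4 → ℝ) →L[ℝ] ℝ)) (μ ν : Fin 4) (p : ℝ × (ℝ × ℝ)) : ℝ :=
  fderiv ℝ (redComp A ν) p (dir μ) - fderiv ℝ (redComp A μ) p (dir ν)

variable (K A) in
/-- The radial electric density in the half-plane `φ = 0`. -/
def redEr (p : ℝ × (ℝ × ℝ)) : ℝ :=
  -(sin p.2.2 * K.bigB p.2 / (K.SigmaFn p.2 * K.PiFn p.2)
    * (redF A 0 1 p + K.twistT p.2 * redF A 1 3 p))

variable (K A) in
/-- The polar electric density in the half-plane `φ = 0`. -/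
def redEθ (p : ℝ × (ℝ × ℝ)) : ℝ :=
  -(sin p.2.2 * K.bigB p.2 / (K.SigmaFn p.2 * K.Delta p.2.1)
    * (redF A 0 2 p + K.twistT p.2 * redF A 2 3 p))

variable (K A) in
/-- The negative azimuthal electric density in the half-plane `φ = 0`. -/
def redV (p : ℝ × (ℝ × ℝ)) : ℝ :=
  K.Xi ^ 2 * K.SigmaFn p.2 * p.2.1 / (K.Delta p.2.1 * K.PiFn p.2)
    * fderiv ℝ (redY A) p (dir 0)

theorem gphi_div_kap_zero (hx : x ∈ K.quot) :
    K.gphi x / K.kap 0 x = sin x.2 * K.bigB x / (K.SigmaFn x * K.Delta x.1) := by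
  have := (sin_pos_of_mem_quot hx).ne'
  have := (SigmaFn_pos (K := K) (x := x) hx.1).ne'
  have := K.Xi_pos.ne'
  have := (Delta_pos hx.1).ne'
  simp only [gphi, kap, if_true]
  field_simp

theorem gphi_div_kap_one (hx : x ∈ K.quot) :
    K.gphi x / K.kap 1 x = sin x.2 * K.bigB x / (K.SigmaFn x * K.PiFn x) := by
  have := (sin_pos_of_mem_quot hx).ne'
  have := (SigmaFn_pos (K := K) (x := x) hx.1).ne'
  have := K.Xi_pos.ne'
  have := (K.PiFn_pos x).ne'
  simp only [gphi, kap, if_neg (by decide : ¬(1 : Fin 2) = 0)]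
  field_simp

theorem redF_antisymm (μ ν : Fin 4) (p : ℝ × (ℝ × ℝ)) : redF A μ ν p = -redF A ν μ p := by
  rw [redF, redF, neg_sub]

section Smooth

variable (hA : ContDiffOn ℝ ∞ A K.spacetime)

include hA

theorem contDiffOn_redF (μ ν : Fin 4) : ContDiffOn ℝ ∞ (redF A μ ν) K.tube :=
  (contDiffOn_fderiv_dir (contDiffOn_redComp hA ν) μ).sub
    (contDiffOn_fderiv_dir (contDiffOn_redComp hA μ) ν)

theorem contDiffOn_redEr : ContDiffOn ℝ ∞ (redEr K A) K.tube := by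
  have h1 : ContDiffOn ℝ ∞ (fun y : ℝ × ℝ => sin y.2 * K.bigB y / (K.SigmaFn y * K.PiFn y))
      K.strip := ((contDiff_snd.sin.mul K.contDiff_bigB).contDiffOn).div
    (K.contDiff_SigmaFn.mul K.contDiff_PiFn).contDiffOn
    fun y hy => (mul_pos (SigmaFn_pos hy.1) (K.PiFn_pos y)).ne'
  exact ((contDiffOn_of_strip h1).mul ((contDiffOn_redF hA 0 1).add
    ((contDiffOn_of_strip K.contDiffOn_twistT).mul (contDiffOn_redF hA 1 3)))).neg

theorem contDiffOn_redEθ : ContDiffOn ℝ ∞ (redEθ K A) K.tube := by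
  have h1 : ContDiffOn ℝ ∞ (fun y : ℝ × ℝ => sin y.2 * K.bigB y / (K.SigmaFn y * K.Delta y.1))
      K.strip := ((contDiff_snd.sin.mul K.contDiff_bigB).contDiffOn).div
    (K.contDiff_SigmaFn.mul (K.contDiff_Delta.comp contDiff_fst)).contDiffOn
    fun y hy => (mul_pos (SigmaFn_pos hy.1) (Delta_pos hy.1)).ne'
  exact ((contDiffOn_of_strip h1).mul ((contDiffOn_redF hA 0 2).add
    ((contDiffOn_of_strip K.contDiffOn_twistT).mul (contDiffOn_redF hA 2 3)))).neg

theorem contDiffOn_redV : ContDiffOn ℝ ∞ (redV K A) K.tube := by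
  have h1 : ContDiffOn ℝ ∞ (fun y : ℝ × ℝ => K.Xi ^ 2 * K.SigmaFn y * y.1
      / (K.Delta y.1 * K.PiFn y)) K.strip :=
    (((contDiff_const.mul K.contDiff_SigmaFn).mul contDiff_fst).contDiffOn).div
      ((K.contDiff_Delta.comp contDiff_fst).mul K.contDiff_PiFn).contDiffOn
      fun y hy => (mul_pos (Delta_pos hy.1) (K.PiFn_pos y)).ne'
  exact (contDiffOn_of_strip h1).mul (contDiffOn_fderiv_dir (contDiffOn_redY hA) 0)

omit hA in
theorem redF_three (ν : Fin 4) (p : ℝ × (ℝ × ℝ)) :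
    redF A ν 3 p = fderiv ℝ (redComp A 3) p (dir ν) := by
  simp [redF, dir]

/-- The quotient F_tφ / `wgt` has the form 0/0 on the axes. Since A_φ = r sin θ A_y, the factor sin
θ cancels, and `redV` is the resulting expression, smooth across the axes. -/
theorem redV_eq (hx : x ∈ K.quot) (t : ℝ) : redV K A (t, x) = redF A 0 3 (t, x) / K.wgt x := by
  have h1 := (sin_pos_of_mem_quot hx).ne'
  have h2 := (SigmaFn_pos (K := K) (x := x) hx.1).ne'
  have h3 := K.Xi_pos.ne'
  have h4 := (K.PiFn_pos x).ne'
  have h5 := (Delta_pos hx.1).ne'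
  have hp := K.quot_mem_tube hx t
  have e1 : deriv (fun s => redComp A 3 (s, x)) t
      = x.1 * sin x.2 * deriv (fun s => redY A (s, x)) t := by
    rw [← deriv_const_mul_field]
    congr 1
    funext s
    exact redComp_three _
  rw [deriv_slice_tube (contDiffOn_redComp hA 3) hp,
    deriv_slice_tube (contDiffOn_redY hA) hp] at e1
  rw [redF_three, e1, redV, wgt]
  field_simp

end Smooth

section Maxwell

variable (hA : K.IsAxisymmetricMaxwell A)

include hA

theorem faraday_eq_redF {c : Fin 4 → ℝ} (hc : c ∈ K.chart) (μ ν : Fin 4) :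
    faraday A c μ ν = redF A μ ν (projLin c) := by
  rw [faraday, pd4_comp_eq hA.1 hA.2.1 hc, pd4_comp_eq hA.1 hA.2.1 hc, redF]

/-- The components of `√(-det ḡ) F^{μν}`. -/
theorem faradayDensity_eq {c : Fin 4 → ℝ} (hc : c ∈ K.chart) :
    K.faradayDensity A c 0 1 = redEr K A (projLin c) ∧
    K.faradayDensity A c 0 2 = redEθ K A (projLin c) ∧
    K.faradayDensity A c 0 3 = -redV K A (projLin c) ∧
    K.faradayDensity A c 1 2 = K.wgt (projLin c).2 * redF A 1 2 (projLin c) ∧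
    K.faradayDensity A c 1 3 = K.kap 0 (projLin c).2 * redF A 1 3 (projLin c) / K.gphi (projLin c).2
      + K.twistT (projLin c).2 * redEr K A (projLin c) ∧
    K.faradayDensity A c 2 3 = K.kap 1 (projLin c).2 * redF A 2 3 (projLin c) / K.gphi (projLin c).2
      + K.twistT (projLin c).2 * redEθ K A (projLin c) ∧
    ∀ i j, K.faradayDensity A c i j = -K.faradayDensity A c j i := by
  have hx : (c 1, c 2) ∈ K.quot := hc
  obtain ⟨h1, h2, h3, h4, h5, h6, h7⟩ := raise_antisymm hx (F := faraday A c)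
    (fun i j => by rw [faraday, faraday, neg_sub]) (D := K.faradayDensity A c) rfl
  have e1 : K.faradayDensity A c 0 1 = redEr K A (projLin c) := by
    rw [h1, gphi_div_kap_one hx, faraday_eq_redF hA hc, faraday_eq_redF hA hc]
    rfl
  have e2 : K.faradayDensity A c 0 2 = redEθ K A (projLin c) := by
    rw [h2, gphi_div_kap_zero hx, faraday_eq_redF hA hc, faraday_eq_redF hA hc]
    rfl
  refine ⟨e1, e2, ?_, ?_, ?_, ?_, h7⟩
  · rw [h3, faraday_eq_redF hA hc, projLin_apply, redV_eq hA.1 hx]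
  · rw [h4, faraday_eq_redF hA hc, projLin_apply]
  · rw [h5, e1, faraday_eq_redF hA hc, projLin_apply, div_mul_eq_mul_div]
  · rw [h6, e2, faraday_eq_redF hA hc, projLin_apply, div_mul_eq_mul_div]

theorem contDiffOn_wgt_mul_redF :
    ContDiffOn ℝ ∞ (fun p : ℝ × (ℝ × ℝ) => K.wgt p.2 * redF A 1 2 p) K.tube :=
  (contDiffOn_of_strip K.contDiffOn_wgt).mul (contDiffOn_redF hA.1 1 2)

/-- Maxwell's equations in the half-plane `φ = 0`. -/
theorem reduced_maxwell (hx : x ∈ K.quot) (t : ℝ) :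
    fderiv ℝ (redEr K A) (t, x) (dir 1) + fderiv ℝ (redEθ K A) (t, x) (dir 2) = 0 ∧
    fderiv ℝ (redEr K A) (t, x) (dir 0)
      = fderiv ℝ (fun p => K.wgt p.2 * redF A 1 2 p) (t, x) (dir 2) ∧
    fderiv ℝ (redEθ K A) (t, x) (dir 0)
      = -fderiv ℝ (fun p => K.wgt p.2 * redF A 1 2 p) (t, x) (dir 1) ∧
    fderiv ℝ (redV K A) (t, x) (dir 0)
      = fderiv ℝ (fun p => K.kap 0 p.2 * redF A 1 3 p / K.gphi p.2
          + K.twistT p.2 * redEr K A p) (t, x) (dir 1)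
        + fderiv ℝ (fun p => K.kap 1 p.2 * redF A 2 3 p / K.gphi p.2
          + K.twistT p.2 * redEθ K A p) (t, x) (dir 2) := by
  set c := emb (t, x) with hcdef
  have hpc : projLin c = (t, x) := projLin_emb _
  have hc : c ∈ K.chart := by
    have h : (c 1, c 2) = x := congrArg Prod.snd hpc
    show (c 1, c 2) ∈ K.quot
    rwa [h]
  have hp := K.quot_mem_tube hx t
  have dR := differentiableAt_tube (contDiffOn_redEr hA.1) hp
  have dT := differentiableAt_tube (contDiffOn_redEθ hA.1) hp
  have dV := differentiableAt_tube (contDiffOn_redV hA.1) hp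
  have dW := differentiableAt_tube (contDiffOn_wgt_mul_redF hA) hp
  have hG : DifferentiableAt ℝ (fun p : ℝ × (ℝ × ℝ) => K.gphi p.2) (t, x) :=
    differentiableAt_tube (contDiffOn_of_strip K.contDiffOn_gphi) hp
  have hG0 : (fun p : ℝ × (ℝ × ℝ) => K.gphi p.2) (t, x) ≠ 0 := (gphi_pos hx).ne'
  have hGi : DifferentiableAt ℝ (fun p : ℝ × (ℝ × ℝ) => (K.gphi p.2)⁻¹) (t, x) :=
    DifferentiableAt.inv (h := fun p : ℝ × (ℝ × ℝ) => K.gphi p.2) hG hG0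
  have dtw : DifferentiableAt ℝ (fun p : ℝ × (ℝ × ℝ) => K.twistT p.2) (t, x) :=
    differentiableAt_tube (contDiffOn_of_strip K.contDiffOn_twistT) hp
  have dk : ∀ b, DifferentiableAt ℝ (fun p : ℝ × (ℝ × ℝ) => K.kap b p.2) (t, x) := fun b =>
    differentiableAt_tube (contDiffOn_of_strip (K.contDiff_kap b).contDiffOn) hp
  have dF := fun μ ν => differentiableAt_tube (contDiffOn_redF hA.1 μ ν) hp
  have dRφ : DifferentiableAt ℝ (fun p : ℝ × (ℝ × ℝ) => K.kap 0 p.2 * redF A 1 3 p / K.gphi p.2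
      + K.twistT p.2 * redEr K A p) (t, x) := (((dk 0).mul (dF 1 3)).mul hGi).add (dtw.mul dR)
  have dTφ : DifferentiableAt ℝ (fun p : ℝ × (ℝ × ℝ) => K.kap 1 p.2 * redF A 2 3 p / K.gphi p.2
      + K.twistT p.2 * redEθ K A p) (t, x) := (((dk 1).mul (dF 2 3)).mul hGi).add (dtw.mul dT)
  -- Every density factors through (t, r, θ). Its partial derivatives are then those of the reduced
  -- function, and the φ-derivatives disappear because `dir 3` is zero.
  have key : ∀ {f : (Fin 4 → ℝ) → ℝ} {g : ℝ × (ℝ × ℝ) → ℝ} (_ : ∀ c ∈ K.chart, f c = g (projLin c))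
      (_ : DifferentiableAt ℝ g (t, x)) (ν : Fin 4), pd4 ν f c = fderiv ℝ g (t, x) (dir ν) := by
    intro f g h hg ν
    rw [pd4_of_eqOn_projLin h hc (by rwa [hpc]) ν, hpc]
  have key' : ∀ {f : (Fin 4 → ℝ) → ℝ} {g : ℝ × (ℝ × ℝ) → ℝ}
      (_ : ∀ c ∈ K.chart, f c = -g (projLin c))
      (_ : DifferentiableAt ℝ g (t, x)) (ν : Fin 4), pd4 ν f c = -fderiv ℝ g (t, x) (dir ν) := by
    intro f g h hg ν
    rw [key (g := fun p => -g p) h hg.neg ν, fderiv_fun_neg]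
    rfl
  have hz : ∀ i, ∀ c ∈ K.chart, K.faradayDensity A c i i = 0 := fun i c hc =>
    self_eq_neg.1 ((faradayDensity_eq hA hc).2.2.2.2.2.2 i i)
  have hzz : ∀ i ν, pd4 ν (fun c' => K.faradayDensity A c' i i) c = 0 := fun i ν => by
    rw [key (g := fun _ => 0) (hz i) (differentiableAt_const _) ν]
    simp
  have hsw : ∀ c ∈ K.chart, ∀ i j, K.faradayDensity A c i j = -K.faradayDensity A c j i :=
    fun c hc => (faradayDensity_eq hA hc).2.2.2.2.2.2
  have hd3 : dir 3 = 0 := rfl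
  have M := hA.2.2 c hc
  have q01 := fun c hc => (faradayDensity_eq hA (c := c) hc).1
  have q02 := fun c hc => (faradayDensity_eq hA (c := c) hc).2.1
  have q03 := fun c hc => (faradayDensity_eq hA (c := c) hc).2.2.1
  have q12 := fun c hc => (faradayDensity_eq hA (c := c) hc).2.2.2.1
  have q13 := fun c hc => (faradayDensity_eq hA (c := c) hc).2.2.2.2.1
  have q23 := fun c hc => (faradayDensity_eq hA (c := c) hc).2.2.2.2.2.1
  have M0 := M 0
  have M1 := M 1
  have M2 := M 2
  have M3 := M 3
  rw [Fin.sum_univ_four] at M0 M1 M2 M3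
  rw [hzz, key' (fun c hc => by rw [hsw c hc, q01 c hc]) dR,
    key' (fun c hc => by rw [hsw c hc, q02 c hc]) dT,
    key (fun c hc => by rw [hsw c hc, q03 c hc, neg_neg]) dV, hd3, map_zero] at M0
  rw [hzz, key q01 dR, key' (fun c hc => by rw [hsw c hc, q12 c hc]) dW,
    key' (fun c hc => by rw [hsw c hc, q13 c hc]) dRφ, hd3, map_zero] at M1
  rw [hzz, key q02 dT, key q12 dW,
    key' (fun c hc => by rw [hsw c hc, q23 c hc]) dTφ, hd3, map_zero] at M2
  rw [hzz, key' q03 dV, key q13 dRφ, key q23 dTφ] at M3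
  refine ⟨?_, ?_, ?_, ?_⟩ <;> linarith

end Maxwell

end KerrDeSitter

end

/-! ### The dual potential η and the initial data. -/

noncomputable section

namespace KerrDeSitter

variable {K : KerrDeSitter} {A : (Fin 4 → ℝ) → ((Fin 4 → ℝ) →L[ℝ] ℝ)} {t t₀ : ℝ} {x : ℝ × ℝ}
  {om : ℝ × ℝ → ℝ}

/-! ### The dual potential -/

variable (K A) in
/-- The closed one-form whose primitive is the dual potential `η`. -/
def dualForm (p : ℝ × (ℝ × ℝ)) : (ℝ × (ℝ × ℝ)) →L[ℝ] ℝ :=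
  (K.wgt p.2 * redF A 1 2 p) • ContinuousLinearMap.fst ℝ ℝ (ℝ × ℝ)
    + (-redEθ K A p) • (ContinuousLinearMap.fst ℝ ℝ ℝ).comp (ContinuousLinearMap.snd ℝ ℝ (ℝ × ℝ))
    + redEr K A p • (ContinuousLinearMap.snd ℝ ℝ ℝ).comp (ContinuousLinearMap.snd ℝ ℝ (ℝ × ℝ))

theorem dualForm_apply (p y : ℝ × (ℝ × ℝ)) : dualForm K A p y =
    y.1 * (K.wgt p.2 * redF A 1 2 p) - y.2.1 * redEθ K A p + y.2.2 * redEr K A p := by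
  simp [dualForm]
  ring

theorem dualForm_eq_zero {p : ℝ × (ℝ × ℝ)} (h1 : K.wgt p.2 * redF A 1 2 p = 0)
    (h2 : redEθ K A p = 0) (h3 : redEr K A p = 0) : dualForm K A p = 0 := by
  refine ContinuousLinearMap.ext fun y => ?_
  simp [dualForm_apply, h1, h2, h3]

theorem sin_eq_zero_of_mem_axes (hx : x ∈ K.axes) : sin x.2 = 0 := by
  rcases hx.2 with h | h <;> rw [h] <;> simp

theorem dualForm_axes (hx : x ∈ K.axes) (t : ℝ) : dualForm K A (t, x) = 0 :=
  dualForm_eq_zero (by simp [wgt, sin_eq_zero_of_mem_axes hx])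
    (by simp [redEθ, sin_eq_zero_of_mem_axes hx]) (by simp [redEr, sin_eq_zero_of_mem_axes hx])

theorem eq_sum_dir (y : ℝ × (ℝ × ℝ)) : y = y.1 • dir 0 + y.2.1 • dir 1 + y.2.2 • dir 2 := by
  ext <;> simp [dir]

variable (K) in
theorem convex_cyl : Convex ℝ K.cyl :=
  convex_univ.prod ((convex_Ioo _ _).prod (convex_Icc _ _))

section DualPotential

variable (hA : K.IsAxisymmetricMaxwell A)

include hA

theorem contDiffOn_dualForm : ContDiffOn ℝ ∞ (dualForm K A) K.tube :=
  (((contDiffOn_wgt_mul_redF hA).smul contDiffOn_const).add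
    ((contDiffOn_redEθ hA.1).neg.smul contDiffOn_const)).add
    ((contDiffOn_redEr hA.1).smul contDiffOn_const)

theorem differentiableAt_dualForm {p : ℝ × (ℝ × ℝ)} (hp : p ∈ K.tube) :
    DifferentiableAt ℝ (dualForm K A) p :=
  ((contDiffOn_dualForm hA).contDiffAt (K.isOpen_tube.mem_nhds hp)).differentiableAt (by simp)

theorem fderiv_dualForm {p : ℝ × (ℝ × ℝ)} (hp : p ∈ K.tube) (y z : ℝ × (ℝ × ℝ)) :
    fderiv ℝ (dualForm K A) p y z =
      z.1 * fderiv ℝ (fun p => K.wgt p.2 * redF A 1 2 p) p y - z.2.1 * fderiv ℝ (redEθ K A) p y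
        + z.2.2 * fderiv ℝ (redEr K A) p y := by
  have h1 : HasFDerivAt (fun p => dualForm K A p z) ((fderiv ℝ (dualForm K A) p).flip z) p := by
    have := (differentiableAt_dualForm hA hp).hasFDerivAt.clm_apply (hasFDerivAt_const z p)
    simpa using this
  have dW := (differentiableAt_tube (contDiffOn_wgt_mul_redF hA) hp).hasFDerivAt
  have dT := (differentiableAt_tube (contDiffOn_redEθ hA.1) hp).hasFDerivAt
  have dR := (differentiableAt_tube (contDiffOn_redEr hA.1) hp).hasFDerivAt
  have h2 := ((dW.const_mul z.1).sub (dT.const_mul z.2.1)).add (dR.const_mul z.2.2)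
  have h3 : (fun p => dualForm K A p z) = fun p => z.1 * (K.wgt p.2 * redF A 1 2 p)
      - z.2.1 * redEθ K A p + z.2.2 * redEr K A p := funext fun p => dualForm_apply p z
  rw [h3] at h1
  have h4 := congrArg (fun L : (ℝ × (ℝ × ℝ)) →L[ℝ] ℝ => L y) (h1.unique h2)
  simpa using h4

/-- Maxwell's equations make the dual form closed. -/
theorem fderiv_dualForm_comm {p : ℝ × (ℝ × ℝ)} (hp : p ∈ K.cyl) (y z : ℝ × (ℝ × ℝ)) :
    fderiv ℝ (dualForm K A) p y z = fderiv ℝ (dualForm K A) p z y := by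
  have hint : ∀ x ∈ K.quot, fderiv ℝ (dualForm K A) (p.1, x) y z
      = fderiv ℝ (dualForm K A) (p.1, x) z y := by
    intro x hx
    -- The Gauss law and the r- and θ-components of Ampère's law are exactly the three symmetry
    -- conditions for the one-form wgt F_rθ dt - 𝔈^θ dr + 𝔈^r dθ.
    obtain ⟨m1, m2, m3, -⟩ := reduced_maxwell hA hx p.1
    have hd := K.quot_mem_tube hx p.1
    have hL : ∀ (L : (ℝ × (ℝ × ℝ)) →L[ℝ] ℝ) (y : ℝ × (ℝ × ℝ)),
        L y = y.1 * L (dir 0) + y.2.1 * L (dir 1) + y.2.2 * L (dir 2) := fun L y => by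
      conv_lhs => rw [eq_sum_dir y]
      simp only [map_add, map_smul, smul_eq_mul]
    rw [fderiv_dualForm hA hd, fderiv_dualForm hA hd, hL _ y, hL (fderiv ℝ (redEθ K A) _) y,
      hL (fderiv ℝ (redEr K A) _) y, hL _ z, hL (fderiv ℝ (redEθ K A) _) z,
      hL (fderiv ℝ (redEr K A) _) z, m2, m3]
    linear_combination (y.2.1 * z.2.2 - y.2.2 * z.2.1) * m1
  obtain ⟨t, r, θ⟩ := p
  have hcont : ∀ y z, Continuous fun θ => fderiv ℝ (dualForm K A) (t, (r, θ)) y z := fun y z =>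
    (((contDiffOn_dualForm hA).continuousOn_fderiv_of_isOpen K.isOpen_tube
      (by simp)).comp_continuous (f := fun θ : ℝ => (t, (r, θ))) (by fun_prop)
      fun θ => ⟨mem_univ _, hp.2.1, mem_univ _⟩).clm_apply continuous_const |>.clm_apply
      continuous_const
  -- The equations hold off the axes; symmetry of the derivative extends to the closed interval by
  -- continuity.
  have heq : EqOn (fun θ => fderiv ℝ (dualForm K A) (t, (r, θ)) y z)
      (fun θ => fderiv ℝ (dualForm K A) (t, (r, θ)) z y) (Ioo 0 π) :=
    fun θ hθ => hint (r, θ) ⟨hp.2.1, hθ⟩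
  have h := heq.closure (hcont y z) (hcont z y)
  rw [closure_Ioo pi_pos.ne] at h
  exact h hp.2.2

/-- The Poincaré lemma on the convex set `cyl`. The axes belong to this set, so the primitive is
controlled up to the boundary from the start. -/
theorem exists_primitive : ∃ η : ℝ × (ℝ × ℝ) → ℝ,
    ∀ p ∈ K.cyl, HasFDerivWithinAt η (dualForm K A p) K.cyl p := by
  refine K.convex_cyl.exists_forall_hasFDerivWithinAt_of_fderivWithin_symmetric
    (fun p hp => (differentiableAt_dualForm hA (K.cyl_subset_tube hp)).differentiableWithinAt)
    fun p hp y _ z _ => ?_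
  rw [fderivWithin_eq_fderiv (K.uniqueDiffOn_cyl p hp)
    (differentiableAt_dualForm hA (K.cyl_subset_tube hp))]
  exact fderiv_dualForm_comm hA hp y z

omit hA in
theorem primitive_const {η : ℝ × (ℝ × ℝ) → ℝ}
    (hη : ∀ p ∈ K.cyl, HasFDerivWithinAt η (dualForm K A p) K.cyl p) {s : Set (ℝ × (ℝ × ℝ))}
    (hs : Convex ℝ s) (hsub : s ⊆ K.cyl) (h0 : ∀ p ∈ s, dualForm K A p = 0)
    {p p' : ℝ × (ℝ × ℝ)} (hp : p ∈ s) (hp' : p' ∈ s) : η p = η p' := by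
  have h := hs.norm_image_sub_le_of_norm_hasFDerivWithin_le (C := 0)
    (fun p hp => (hη p (hsub hp)).mono hsub) (fun p hp => by rw [h0 p hp, norm_zero]) hp' hp
  rw [zero_mul, norm_le_zero_iff, sub_eq_zero] at h
  exact h

theorem contDiffOn_primitive {η : ℝ × (ℝ × ℝ) → ℝ}
    (hη : ∀ p ∈ K.cyl, HasFDerivWithinAt η (dualForm K A p) K.cyl p) :
    ContDiffOn ℝ ∞ η K.cyl := by
  rw [contDiffOn_infty_iff_fderivWithin K.uniqueDiffOn_cyl]
  refine ⟨fun p hp => (hη p hp).differentiableWithinAt, ?_⟩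
  exact ((contDiffOn_dualForm hA).mono K.cyl_subset_tube).congr
    fun p hp => (hη p hp).fderivWithin (K.uniqueDiffOn_cyl p hp)

end DualPotential

/-! ### The reduced data -/

theorem HasCompactData.exists_interval (hA : K.IsAxisymmetricMaxwell A)
    (h : K.HasCompactData A t₀) : ∃ r₁ r₂, K.rp < r₁ ∧ r₁ ≤ r₂ ∧ r₂ < K.rc ∧
      ∀ x ∈ K.quot, x.1 ∉ Icc r₁ r₂ → ∀ μ ν, redF A μ ν (t₀, x) = 0 := by
  obtain ⟨S, hS, hSq, hF⟩ := h
  have hF' : ∀ x ∈ K.quot, x ∉ S → ∀ μ ν, redF A μ ν (t₀, x) = 0 := by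
    intro x hx hxS μ ν
    have hc : (emb (t₀, x) 1, emb (t₀, x) 2) = x := congrArg Prod.snd (projLin_emb (t₀, x))
    have hch : emb (t₀, x) ∈ K.chart := by
      show (emb (t₀, x) 1, emb (t₀, x) 2) ∈ K.quot
      rwa [hc]
    have h := faraday_eq_redF hA hch μ ν
    rw [projLin_emb, hF _ hch (by rw [emb_apply]; rfl) (by rwa [hc])] at h
    exact h.symm
  have hc : IsCompact (Prod.fst '' S) := hS.image continuous_fst
  by_cases hne : (Prod.fst '' S).Nonempty
  · obtain ⟨_, ⟨y, hy, rfl⟩, h1⟩ := hc.exists_isLeast hne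
    obtain ⟨_, ⟨y', hy', rfl⟩, h2⟩ := hc.exists_isGreatest hne
    refine ⟨y.1, y'.1, (hSq hy).1.1, h1 ⟨y', hy', rfl⟩, (hSq hy').1.2, fun x hx hxr => ?_⟩
    exact hF' x hx fun hxS => hxr ⟨h1 ⟨x, hxS, rfl⟩, h2 ⟨x, hxS, rfl⟩⟩
  · refine ⟨(K.rp + K.rc) / 2, (K.rp + K.rc) / 2, by linarith [K.rp_lt], le_rfl,
      by linarith [K.rp_lt], fun x hx _ => hF' x hx fun hxS => hne ⟨x.1, x, hxS, rfl⟩⟩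

/-- The dual potential, normalized to vanish on the axes. -/
theorem exists_dualPotential (hA : K.IsAxisymmetricMaxwell A) (h : K.HasCompactData A t₀) :
    ∃ η : ℝ × (ℝ × ℝ) → ℝ, (∀ p ∈ K.cyl, HasFDerivWithinAt η (dualForm K A p) K.cyl p) ∧
      (∀ t, ∀ x ∈ K.axes, η (t, x) = 0) ∧ ∃ r₁ r₂, K.rp < r₁ ∧ r₂ < K.rc ∧
        ∀ x ∈ K.quot, x.1 ∉ Icc r₁ r₂ → η (t₀, x) = 0 ∧ ∀ μ ν, redF A μ ν (t₀, x) = 0 := by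
  obtain ⟨r₁, r₂, h₁, h₁₂, h₂, hF⟩ := h.exists_interval hA
  obtain ⟨η₀, hη₀⟩ := exists_primitive hA
  -- A radius outside the data. At t₀ the meridian r = r₀ joins the two axes and `dualForm` vanishes
  -- on it: no electric flux crosses the hemispheres. As η is also constant along each axis, fixing
  -- it at one point makes it zero on both.
  set r₀ := (K.rp + r₁) / 2 with hr₀
  have hr₀' : r₀ ∈ Ioo K.rp K.rc := ⟨by linarith, by linarith⟩
  have hr₀'' : r₀ ∉ Icc r₁ r₂ := fun h => by linarith [h.1]
  set η : ℝ × (ℝ × ℝ) → ℝ := fun p => η₀ p - η₀ (0, (r₀, 0)) with hηdef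
  have hη : ∀ p ∈ K.cyl, HasFDerivWithinAt η (dualForm K A p) K.cyl p := fun p hp =>
    (hη₀ p hp).sub_const _
  have hline : ∀ r ∈ Ioo K.rp K.rc, r ∉ Icc r₁ r₂ → ∀ θ ∈ Icc 0 π, ∀ θ' ∈ Icc 0 π,
      η (t₀, (r, θ)) = η (t₀, (r, θ')) := by
    intro r hr hr' θ hθ θ' hθ'
    refine primitive_const hη (s := {t₀} ×ˢ ({r} ×ˢ Icc 0 π))
      ((convex_singleton _).prod ((convex_singleton _).prod (convex_Icc _ _))) ?_ ?_
      ⟨rfl, rfl, hθ⟩ ⟨rfl, rfl, hθ'⟩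
    · rintro ⟨a, b, c⟩ ⟨-, hb, hc⟩
      rw [mem_singleton_iff] at hb
      subst hb
      exact ⟨mem_univ _, hr, hc⟩
    · rintro ⟨a, b, c⟩ ⟨ha, hb, hc⟩
      simp only [mem_singleton_iff] at ha hb
      subst ha hb
      by_cases hax : c ∈ Ioo 0 π
      · have hz := hF (b, c) ⟨hr, hax⟩ hr'
        exact dualForm_eq_zero (by simp [hz]) (by simp [redEθ, hz]) (by simp [redEr, hz])
      · refine dualForm_axes ⟨hr, ?_⟩ _
        simp only at hc
        rcases eq_endpoints_or_mem_Ioo_of_mem_Icc hc with h | h | h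
        · exact Or.inl h
        · exact Or.inr h
        · exact absurd h hax
  have haxis : ∀ κ ∈ ({0, π} : Set ℝ), ∀ t t', ∀ r ∈ Ioo K.rp K.rc, ∀ r' ∈ Ioo K.rp K.rc,
      η (t, (r, κ)) = η (t', (r', κ)) := by
    intro κ hκ t t' r hr r' hr'
    refine primitive_const hη (s := univ ×ˢ (Ioo K.rp K.rc ×ˢ {κ}))
      (convex_univ.prod ((convex_Ioo _ _).prod (convex_singleton _))) ?_ ?_
      ⟨mem_univ _, hr, rfl⟩ ⟨mem_univ _, hr', rfl⟩
    · rintro ⟨a, b⟩ ⟨-, hb, hc⟩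
      rw [mem_singleton_iff] at hc
      exact ⟨mem_univ _, axes_subset_quotAxis K ⟨hb, by rwa [hc]⟩⟩
    · rintro ⟨a, b⟩ ⟨-, hb, hc⟩
      rw [mem_singleton_iff] at hc
      exact dualForm_axes ⟨hb, by rwa [hc]⟩ a
  have h0 : (0 : ℝ) ∈ Icc 0 π := ⟨le_rfl, pi_pos.le⟩
  have hπ : π ∈ Icc 0 π := ⟨pi_pos.le, le_rfl⟩
  have z0 : η (0, (r₀, 0)) = 0 := sub_self _
  have zt : ∀ r ∈ Ioo K.rp K.rc, η (t₀, (r, 0)) = 0 := fun r hr =>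
    (haxis 0 (Or.inl rfl) t₀ 0 r hr r₀ hr₀').trans z0
  have hax0 : ∀ t, ∀ x ∈ K.axes, η (t, x) = 0 := by
    rintro t ⟨r, θ⟩ ⟨hr, hθ⟩
    rcases hθ with h | h
    · simp only at h
      rw [h, haxis 0 (Or.inl rfl) t 0 r hr r₀ hr₀', z0]
    · simp only [mem_singleton_iff] at h
      rw [h, haxis π (Or.inr rfl) t t₀ r hr r₀ hr₀', hline r₀ hr₀' hr₀'' π hπ 0 h0, zt r₀ hr₀']
  refine ⟨η, hη, hax0, r₁, r₂, h₁, h₂, fun x hx hxr => ⟨?_, hF x hx hxr⟩⟩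
  have := hline x.1 hx.1 hxr x.2 (Ioo_subset_Icc_self hx.2) 0 h0
  rw [zt x.1 hx.1] at this
  exact this

/-- The component `A_φ` vanishes where the initial field does. -/
theorem redComp_three_eq_zero (hA : ContDiffOn ℝ ∞ A K.spacetime) {r : ℝ} (hr : r ∈ Ioo K.rp K.rc)
    (hF : ∀ θ ∈ Ioo 0 π, redF A 2 3 (t₀, (r, θ)) = 0) {θ : ℝ} (hθ : θ ∈ Ioo 0 π) :
    redComp A 3 (t₀, (r, θ)) = 0 := by
  have hd : ∀ θ', HasDerivAt (fun θ' => redComp A 3 (t₀, (r, θ'))) (redF A 2 3 (t₀, (r, θ'))) θ' := by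
    intro θ'
    have hp : (t₀, (r, θ')) ∈ K.tube := ⟨mem_univ _, hr, mem_univ _⟩
    rw [redF_three]
    have hdir : HasDerivAt (fun θ : ℝ => (t₀, (r, θ))) (dir 2) θ' :=
      (hasDerivAt_const _ _).prodMk ((hasDerivAt_const _ _).prodMk (hasDerivAt_id _))
    exact (differentiableAt_tube (contDiffOn_redComp hA 3) hp).hasFDerivAt.comp_hasDerivAt θ' hdir
  have h := constant_of_has_deriv_right_zero (a := 0) (b := θ)
    (fun θ' _ => (hd θ').continuousAt.continuousWithinAt)
    (fun θ' hθ' => by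
      -- At the endpoint on the axis the vanishing of the field is obtained as a limit from the
      -- interior.
      rcases eq_or_lt_of_le hθ'.1 with h | h
      · have h1 := (hd θ').hasDerivWithinAt (s := Ici θ')
        have hc : Continuous fun θ => redF A 2 3 (t₀, (r, θ)) :=
          (contDiffOn_redF hA 2 3).continuousOn.comp_continuous (f := fun θ : ℝ => (t₀, (r, θ)))
            (by fun_prop) fun θ => ⟨mem_univ _, hr, mem_univ _⟩
        have h2 : EqOn (fun θ => redF A 2 3 (t₀, (r, θ))) (fun _ => 0) (Ioo 0 π) := hF
        have h3 := h2.closure hc continuous_const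
        rw [closure_Ioo pi_pos.ne] at h3
        have h4 := h3 (⟨hθ'.1, by linarith [hθ'.2, hθ.2]⟩ : θ' ∈ Icc 0 π)
        simp only at h4
        rwa [h4] at h1
      · have h1 := (hd θ').hasDerivWithinAt (s := Ici θ')
        rwa [hF θ' ⟨h, hθ'.2.trans hθ.2⟩] at h1)
    θ ⟨hθ.1.le, le_rfl⟩
  rw [h, redComp_three]
  simp

end KerrDeSitter

end

/-! ### The reduced curve of a Maxwell field. -/

noncomputable section

namespace KerrDeSitter

variable {K : KerrDeSitter} {A : (Fin 4 → ℝ) → ((Fin 4 → ℝ) →L[ℝ] ℝ)} {t t₀ : ℝ} {x : ℝ × ℝ}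
  {om : ℝ × ℝ → ℝ} {η : ℝ × (ℝ × ℝ) → ℝ}

/-! ### The reduced curve -/

variable (K A) in
/-- The canonical variables of a Maxwell field with dual potential `η`. -/
def maxwellCurve (η : ℝ × (ℝ × ℝ) → ℝ) (t : ℝ) : PhasePoint where
  lam := fun x => redComp A 3 (t, x)
  eta := fun x => η (t, x)
  u := fun x => redF A 1 2 (t, x)
  v := fun x => redV K A (t, x)

section Axes

variable (hA : ContDiffOn ℝ ∞ A K.spacetime) (hs : ∀ c ∈ K.chart, ∀ μ, pd4 3 (comp A μ) c = 0)

theorem redComp_three_axes (hx : x ∈ K.axes) : redComp A 3 (t, x) = 0 := by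
  simp [redComp_three, sin_eq_zero_of_mem_axes hx]

include hA hs

theorem redF_one_two_axes (hx : x ∈ K.axes) : redF A 1 2 (t, x) = 0 := by
  rw [redF, fderiv_redComp_axes hA hs (by simp [reflSign]) (by decide) t hx,
    fderiv_redComp_axes hA hs (by simp [reflSign]) (by decide) t hx, sub_zero]

/-- A_y vanishes on the axes at all times, and so does its time derivative. -/
theorem redV_axes (hx : x ∈ K.axes) : redV K A (t, x) = 0 := by
  have h := deriv_slice_tube (contDiffOn_redY hA) (axes_mem_tube hx t)
  have h0 : (fun s => redY A (s, x)) = fun _ => 0 := funext fun s => redY_axes hA hs s hx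
  rw [h0, deriv_const] at h
  rw [redV, ← h, mul_zero]

theorem fderivWithin_redComp_three_axes (hx : x ∈ K.axes) :
    fderivWithin ℝ (fun y => redComp A 3 (t, y)) K.quotAxis x = 0 := by
  have hp := axes_mem_tube hx t
  have hc := contDiffOn_redComp hA 3
  have hd : DifferentiableAt ℝ (fun y => redComp A 3 (t, y)) x :=
    (contDiffOn_slice_tube hc t).differentiableAt_of_isOpen K.isOpen_strip (by simp) hp.2
  have h1 : pd 1 (fun y => redComp A 3 (t, y)) x = 0 := by
    rw [pd_one_slice_tube hc hp]
    exact fderiv_redComp_axes hA hs (by simp [reflSign]) (by decide) t hx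
  have h0 : pd 0 (fun y => redComp A 3 (t, y)) x = 0 := by
    refine pd_zero_eq hd ?_
    have : (fun r => redComp A 3 (t, (r, x.2))) = fun _ => 0 := funext fun r => by
      simp [redComp_three, sin_eq_zero_of_mem_axes hx]
    rw [this]
    exact hasDerivAt_const _ _
  rw [fderivWithin_eq_fderiv (K.uniqueDiffOn_quotAxis x (axes_subset_quotAxis K hx)) hd]
  refine ContinuousLinearMap.ext fun y => ?_
  rw [fderiv_eq_pd, h0, h1]
  simp

end Axes

section Primitive

variable (hη : ∀ p ∈ K.cyl, HasFDerivWithinAt η (dualForm K A p) K.cyl p)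

include hη

theorem fderivWithin_primitive_axes (hx : x ∈ K.axes) :
    fderivWithin ℝ (fun y => η (t, y)) K.quotAxis x = 0 := by
  have hxq := axes_subset_quotAxis K hx
  have h := hη (t, x) ⟨mem_univ t, hxq⟩
  rw [dualForm_axes hx] at h
  have e : HasFDerivWithinAt (fun y => η (t, y))
      ((0 : (ℝ × (ℝ × ℝ)) →L[ℝ] ℝ).comp (ContinuousLinearMap.inr ℝ ℝ (ℝ × ℝ))) K.quotAxis x :=
    h.comp x (hasFDerivAt_prodMk_right t x).hasFDerivWithinAt fun y hy => ⟨mem_univ t, hy⟩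
  rw [ContinuousLinearMap.zero_comp] at e
  exact e.fderivWithin (K.uniqueDiffOn_quotAxis x hxq)

theorem hasFDerivAt_primitive (hx : x ∈ K.quot) : HasFDerivAt η (dualForm K A (t, x)) (t, x) :=
  (hη (t, x) ⟨mem_univ t, K.quot_subset_quotAxis hx⟩).hasFDerivAt (cyl_mem_nhds hx)

theorem deriv_primitive (hx : x ∈ K.quot) :
    deriv (fun s => η (s, x)) t = K.wgt x * redF A 1 2 (t, x) := by
  have h := hasFDerivAt_primitive hη (t := t) hx
  rw [(hasDerivAt_slice h.differentiableAt).deriv, h.fderiv, dualForm_apply]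
  simp

theorem pd_zero_primitive (hx : x ∈ K.quot) : pd 0 (fun y => η (t, y)) x = -redEθ K A (t, x) := by
  have h := hasFDerivAt_primitive hη (t := t) hx
  rw [pd_slice 0 h.differentiableAt, h.fderiv, dualForm_apply]
  simp [coordVec]

theorem pd_one_primitive (hx : x ∈ K.quot) : pd 1 (fun y => η (t, y)) x = redEr K A (t, x) := by
  have h := hasFDerivAt_primitive hη (t := t) hx
  rw [pd_slice 1 h.differentiableAt, h.fderiv, dualForm_apply]
  simp [coordVec]

theorem axisRegular_maxwellCurve (hA : K.IsAxisymmetricMaxwell A)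
    (h0 : ∀ t, ∀ x ∈ K.axes, η (t, x) = 0) : K.AxisRegular (K.maxwellCurve A η) := by
  refine ⟨⟨(contDiffOn_redComp hA.1 3).mono K.cyl_subset_tube, contDiffOn_primitive hA hη,
    (contDiffOn_redF hA.1 1 2).mono K.cyl_subset_tube,
    (contDiffOn_redV hA.1).mono K.cyl_subset_tube⟩, fun t x hx => ⟨redComp_three_axes hx, h0 t x hx,
    redF_one_two_axes hA.1 hA.2.1 hx, redV_axes hA.1 hA.2.1 hx,
    fderivWithin_redComp_three_axes hA.1 hA.2.1 hx, fderivWithin_primitive_axes hη hx⟩⟩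

theorem isReduction_maxwellCurve (hA : K.IsAxisymmetricMaxwell A) :
    K.IsReduction A (K.maxwellCurve A η) := by
  intro c hc
  obtain ⟨e0, e1, e2, -⟩ := faradayDensity_eq hA hc
  have p0 := pd_zero_primitive hη (t := c 0) hc
  have p1 := pd_one_primitive hη (t := c 0) hc
  rw [projLin_apply] at e0 e1 e2
  refine ⟨(comp_eq_redComp hA.1 hA.2.1 hc 3).symm, fun b => ?_, ?_, ?_⟩
  · fin_cases b
    · simp only [Fin.sum_univ_two, maxwellCurve]
      simp [eps2, p1, electric, e0]
    · simp only [Fin.sum_univ_two, maxwellCurve]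
      simp [eps2, p0, electric, e1]
  · exact (faraday_eq_redF hA hc 1 2).symm
  · have : K.electric A c 2 = K.faradayDensity A c 0 3 := rfl
    rw [this, e2, neg_neg]
    rfl

theorem maxwellDensityADM_eq (hA : K.IsAxisymmetricMaxwell A) {c : Fin 4 → ℝ} (hc : c ∈ K.chart) :
    K.maxwellDensityADM A c = K.densityADM (K.maxwellCurve A η (c 0)) (c 1, c 2) := by
  have hx : (c 1, c 2) ∈ K.quot := hc
  have hd := K.quot_mem_tube hx (c 0)
  obtain ⟨-, hE, hu, hv⟩ := isReduction_maxwellCurve hη hA c hc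
  have hE0 := hE 0
  have hE1 := hE 1
  have hl0 := pd_zero_slice_tube (contDiffOn_redComp hA.1 3) hd
  have hl1 := pd_one_slice_tube (contDiffOn_redComp hA.1 3) hd
  rw [← redF_three] at hl0 hl1
  have b0 : magnetic A c 0 = redF A 2 3 (c 0, (c 1, c 2)) := faraday_eq_redF hA hc 2 3
  have b1 : magnetic A c 1 = -redF A 1 3 (c 0, (c 1, c 2)) := by
    rw [← redF_antisymm]
    exact faraday_eq_redF hA hc 3 1
  rw [maxwellDensityADM, adm_density_eq hx, densityADM_eq _ hx]
  simp only [Fin.sum_univ_two, eps2, Matrix.of_apply, Matrix.cons_val', Matrix.cons_val_zero,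
    Matrix.cons_val_one, Matrix.cons_val_fin_one] at hE0 hE1 ⊢
  have hE0' : K.electric A c 0 = pd 1 (K.maxwellCurve A η (c 0)).eta (c 1, c 2) := by
    have : K.electric A c 0 = K.electric A c (Fin.castSucc 0) := rfl
    rw [this, hE0]
    ring
  have hE1' : K.electric A c 1 = -pd 0 (K.maxwellCurve A η (c 0)).eta (c 1, c 2) := by
    have : K.electric A c 1 = K.electric A c (Fin.castSucc 1) := rfl
    rw [this, hE1]
    ring
  have hl0' : pd 0 (K.maxwellCurve A η (c 0)).lam (c 1, c 2) = redF A 1 3 (c 0, (c 1, c 2)) := hl0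
  have hl1' : pd 1 (K.maxwellCurve A η (c 0)).lam (c 1, c 2) = redF A 2 3 (c 0, (c 1, c 2)) := hl1
  rw [hE0', hE1', hl0', hl1', b0, b1, hu, hv]
  ring

/-- The equation for u is the Bianchi identity for F_rθ. The fluxes kap dη / e^{2γ} are F_tθ + 𝒜_t
F_θφ and -(F_tr + 𝒜_t F_rφ); the derivatives of 𝒜_t cancel against the twist term, and those of F by
commuting second derivatives of A. -/
theorem forceU_maxwellCurve (hom : K.IsTwistPotential om) (hA : K.IsAxisymmetricMaxwell A)
    (hx : x ∈ K.quot) : K.forceU om (K.maxwellCurve A η t) x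
      = deriv (fun s => redF A 1 2 (s, x)) t := by
  have hp := K.quot_mem_tube hx t
  have hx' := K.quot_subset_strip hx
  have sF := fun μ ν => contDiffOn_redF hA.1 μ ν
  have dF := fun μ ν => (contDiffOn_slice_tube (sF μ ν) t).differentiableAt_of_isOpen K.isOpen_strip
    (by simp) hx'
  have dT := K.contDiffOn_twistT.differentiableAt_of_isOpen K.isOpen_strip (by simp) hx'
  have dM : ∀ μ ν, DifferentiableAt ℝ (fun y => K.twistT y * redF A μ ν (t, y)) x :=
    fun μ ν => dT.mul (dF μ ν)
  have h0 : EqOn (fun y => K.kap 0 y * pd 0 (K.maxwellCurve A η t).eta y / K.gphi y)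
      (fun y => redF A 0 2 (t, y) + K.twistT y * redF A 2 3 (t, y)) K.quot := by
    intro y hy
    have hk := (kap_pos hy 0).ne'
    have hG := (gphi_pos hy).ne'
    have : pd 0 (K.maxwellCurve A η t).eta y = _ := pd_zero_primitive hη hy
    simp only [this, redEθ, ← gphi_div_kap_zero hy]
    field_simp
  have h1 : EqOn (fun y => K.kap 1 y * pd 1 (K.maxwellCurve A η t).eta y / K.gphi y)
      (fun y => -(redF A 0 1 (t, y) + K.twistT y * redF A 1 3 (t, y))) K.quot := by
    intro y hy
    have hk := (kap_pos hy 1).ne'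
    have hG := (gphi_pos hy).ne'
    have : pd 1 (K.maxwellCurve A η t).eta y = _ := pd_one_primitive hη hy
    simp only [this, redEr, ← gphi_div_kap_one hy]
    field_simp
  have hl0 : pd 0 (K.maxwellCurve A η t).lam x = redF A 1 3 (t, x) := by
    rw [redF_three]
    exact pd_zero_slice_tube (contDiffOn_redComp hA.1 3) hp
  have hl1 : pd 1 (K.maxwellCurve A η t).lam x = redF A 2 3 (t, x) := by
    rw [redF_three]
    exact pd_one_slice_tube (contDiffOn_redComp hA.1 3) hp
  have hD : ∀ μ ν ρ, fderiv ℝ (redF A μ ν) (t, x) (dir ρ)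
      = fderiv ℝ (fun y => fderiv ℝ (redComp A ν) y (dir μ)) (t, x) (dir ρ)
        - fderiv ℝ (fun y => fderiv ℝ (redComp A μ) y (dir ν)) (t, x) (dir ρ) := fun μ ν ρ => by
    have d := fun μ ν => differentiableAt_tube
      (contDiffOn_fderiv_dir (contDiffOn_redComp hA.1 ν) μ) hp
    have : redF A μ ν = fun y => fderiv ℝ (redComp A ν) y (dir μ)
      - fderiv ℝ (redComp A μ) y (dir ν) := rfl
    rw [this, fderiv_fun_sub (d μ ν) (d ν μ)]
    rfl
  have hC := fun μ ν ρ => fderiv_dir_comm (contDiffOn_redComp hA.1 μ) hp ν ρ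
  have hz : ∀ ν ρ, fderiv ℝ (fun y => fderiv ℝ (redComp A ν) y (dir 3)) (t, x) (dir ρ) = 0 := by
    intro ν ρ
    have : (fun y => fderiv ℝ (redComp A ν) y (dir 3)) = fun _ => 0 :=
      funext fun y => by rw [show dir 3 = 0 from rfl, map_zero]
    rw [this, (hasFDerivAt_const _ _).fderiv]
    rfl
  rw [forceU, Fin.sum_univ_two, Fin.sum_univ_two, pd_congr 0 K.isOpen_quot h0 hx,
    pd_congr 1 K.isOpen_quot h1 hx, pd_neg, pd_add 0 (dF 0 2) (dM 2 3),
    pd_add 1 (dF 0 1) (dM 1 3), pd_mul 0 dT (dF 2 3), pd_mul 1 dT (dF 1 3),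
    pd_zero_slice_tube (sF 0 2) hp, pd_zero_slice_tube (sF 2 3) hp, pd_one_slice_tube (sF 0 1) hp,
    pd_one_slice_tube (sF 1 3) hp, pd_zero_twistT hx, pd_one_twistT hx, hom.pd_zero hx,
    hom.pd_one hx, hl0, hl1, deriv_slice_tube (sF 1 2) hp, hD, hD, hD, hD, hD, hz, hz,
    hC 0 1 2, hC 1 0 2, hC 2 0 1, hC 3 1 2]
  ring

/-- The equation for v is the φ-component of Ampère's law. The twist contributes div(𝒜_t 𝔈): the
part with d𝒜_t is the twist term of the force, and 𝒜_t div 𝔈 vanishes by the Gauss law. -/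
theorem forceV_maxwellCurve (hom : K.IsTwistPotential om) (hA : K.IsAxisymmetricMaxwell A)
    (hx : x ∈ K.quot) : K.forceV om (K.maxwellCurve A η t) x
      = deriv (fun s => redV K A (s, x)) t := by
  have hp := K.quot_mem_tube hx t
  have hx' := K.quot_subset_strip hx
  obtain ⟨m0, -, -, m3⟩ := reduced_maxwell hA hx t
  have hO := K.isOpen_quot
  have dT := K.contDiffOn_twistT.differentiableAt_of_isOpen K.isOpen_strip (by simp) hx'
  have dEr := (contDiffOn_slice_tube (contDiffOn_redEr hA.1) t).differentiableAt_of_isOpen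
    K.isOpen_strip (by simp) hx'
  have dEθ := (contDiffOn_slice_tube (contDiffOn_redEθ hA.1) t).differentiableAt_of_isOpen
    K.isOpen_strip (by simp) hx'
  have dMr : DifferentiableAt ℝ (fun y => K.twistT y * redEr K A (t, y)) x := dT.mul dEr
  have dMθ : DifferentiableAt ℝ (fun y => K.twistT y * redEθ K A (t, y)) x := dT.mul dEθ
  have sl : ContDiffOn ℝ ∞ (K.maxwellCurve A η t).lam K.strip :=
    contDiffOn_slice_tube (contDiffOn_redComp hA.1 3) t
  have dF : ∀ μ ν, DifferentiableAt ℝ (redF A μ ν) (t, x) := fun μ ν =>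
    differentiableAt_tube (contDiffOn_redF hA.1 μ ν) hp
  have dT' : DifferentiableAt ℝ (fun p : ℝ × (ℝ × ℝ) => K.twistT p.2) (t, x) :=
    differentiableAt_tube (contDiffOn_of_strip K.contDiffOn_twistT) hp
  have dk : ∀ b, DifferentiableAt ℝ (fun p : ℝ × (ℝ × ℝ) => K.kap b p.2) (t, x) := fun b =>
    differentiableAt_tube (contDiffOn_of_strip (K.contDiff_kap b).contDiffOn) hp
  have dG : DifferentiableAt ℝ (fun p : ℝ × (ℝ × ℝ) => (K.gphi p.2)⁻¹) (t, x) :=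
    DifferentiableAt.inv (h := fun p : ℝ × (ℝ × ℝ) => K.gphi p.2)
      (differentiableAt_tube (contDiffOn_of_strip K.contDiffOn_gphi) hp) (gphi_pos hx).ne'
  have hl0 : EqOn (pd 0 (K.maxwellCurve A η t).lam) (fun y => redF A 1 3 (t, y)) K.quot :=
    fun y hy => by
      simp only [redF_three]
      exact pd_zero_slice_tube (contDiffOn_redComp hA.1 3) (K.quot_mem_tube hy t)
  have hl1 : EqOn (pd 1 (K.maxwellCurve A η t).lam) (fun y => redF A 2 3 (t, y)) K.quot :=
    fun y hy => by
      simp only [redF_three]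
      exact pd_one_slice_tube (contDiffOn_redComp hA.1 3) (K.quot_mem_tube hy t)
  have dq : ∀ b, DifferentiableAt ℝ
      (fun y => K.kap b y * pd b (K.maxwellCurve A η t).lam y / K.gphi y) x := fun b =>
    (((K.contDiff_kap b).contDiffOn.mul ((sl.mono K.quot_subset_strip).pd hO b)).div
      (K.contDiffOn_gphi.mono K.quot_subset_strip)
      fun y hy => (gphi_pos hy).ne').differentiableAt_of_isOpen hO (by simp) hx
  have q0 : fderiv ℝ (fun p => K.kap 0 p.2 * redF A 1 3 p / K.gphi p.2
      + K.twistT p.2 * redEr K A p) (t, x) (dir 1)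
      = pd 0 (fun y => K.kap 0 y * pd 0 (K.maxwellCurve A η t).lam y / K.gphi y
        + K.twistT y * redEr K A (t, y)) x := by
    have hd : DifferentiableAt ℝ (fun p : ℝ × (ℝ × ℝ) => K.kap 0 p.2 * redF A 1 3 p / K.gphi p.2
      + K.twistT p.2 * redEr K A p) (t, x) := (((dk 0).mul (dF 1 3)).mul dG).add
        (dT'.mul (differentiableAt_tube (contDiffOn_redEr hA.1) hp))
    refine (pd_slice 0 hd).symm.trans (pd_congr 0 hO (fun y hy => ?_) hx)
    simp only [hl0 hy]
  have q1 : fderiv ℝ (fun p => K.kap 1 p.2 * redF A 2 3 p / K.gphi p.2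
      + K.twistT p.2 * redEθ K A p) (t, x) (dir 2)
      = pd 1 (fun y => K.kap 1 y * pd 1 (K.maxwellCurve A η t).lam y / K.gphi y
        + K.twistT y * redEθ K A (t, y)) x := by
    have hd : DifferentiableAt ℝ (fun p : ℝ × (ℝ × ℝ) => K.kap 1 p.2 * redF A 2 3 p / K.gphi p.2
      + K.twistT p.2 * redEθ K A p) (t, x) := (((dk 1).mul (dF 2 3)).mul dG).add
        (dT'.mul (differentiableAt_tube (contDiffOn_redEθ hA.1) hp))
    refine (pd_slice 1 hd).symm.trans (pd_congr 1 hO (fun y hy => ?_) hx)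
    simp only [hl1 hy]
  have he0 : pd 0 (K.maxwellCurve A η t).eta x = _ := pd_zero_primitive hη hx
  have he1 : pd 1 (K.maxwellCurve A η t).eta x = _ := pd_one_primitive hη hx
  rw [deriv_slice_tube (contDiffOn_redV hA.1) hp, m3, q0, q1, pd_add 0 (dq 0) dMr,
    pd_add 1 (dq 1) dMθ, pd_mul 0 dT dEr, pd_mul 1 dT dEθ,
    pd_zero_slice_tube (contDiffOn_redEr hA.1) hp, pd_one_slice_tube (contDiffOn_redEθ hA.1) hp,
    pd_zero_twistT hx, pd_one_twistT hx, forceV, Fin.sum_univ_two, Fin.sum_univ_two, he0, he1,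
    hom.pd_zero hx, hom.pd_one hx]
  linear_combination -K.twistT x * m0

/-- The equation for η is the dt component of `dualForm`, and the one for λ unwinds the definition
of v; Maxwell's equations enter the other two through the lemmas above. -/
theorem fieldEquations_maxwellCurve (hom : K.IsTwistPotential om) (hA : K.IsAxisymmetricMaxwell A) :
    K.FieldEquations om (K.maxwellCurve A η) := by
  rw [fieldEquations_iff]
  intro t x hx
  refine ⟨deriv_primitive hη hx, ?_, (forceU_maxwellCurve hη hom hA hx).symm,
    (forceV_maxwellCurve hη hom hA hx).symm⟩
  have hw := (wgt_pos hx).ne'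
  have h := deriv_slice_tube (contDiffOn_redComp hA.1 3) (K.quot_mem_tube hx t)
  refine h.trans ?_
  show _ = K.wgt x * redV K A (t, x)
  rw [redV_eq hA.1 hx, redF_three]
  field_simp

/-- Regularity at the axes is already known; the support condition of X at every time is finite
speed of propagation. The explicit `twistPotential` is used for that, so the curve depends on no
choice of ω. -/
theorem isSmoothCurve_maxwellCurve (hA : K.IsAxisymmetricMaxwell A)
    (hax : ∀ t, ∀ x ∈ K.axes, η (t, x) = 0) {r₁ r₂ : ℝ} (h₁ : K.rp < r₁) (h₂ : r₂ < K.rc)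
    (h0 : ∀ x ∈ K.quot, x.1 ∉ Icc r₁ r₂ → η (t₀, x) = 0 ∧ ∀ μ ν, redF A μ ν (t₀, x) = 0) :
    K.IsSmoothCurve (K.maxwellCurve A η) := by
  have hQ := axisRegular_maxwellCurve hη hA hax
  have hF := fieldEquations_maxwellCurve hη K.isTwistPotential_twistPotential hA
  have hd : ∀ x ∈ K.quot, x.1 ∉ Icc r₁ r₂ → (K.maxwellCurve A η t₀).lam x = 0 ∧
      (K.maxwellCurve A η t₀).eta x = 0 ∧ (K.maxwellCurve A η t₀).u x = 0 ∧
      (K.maxwellCurve A η t₀).v x = 0 := by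
    intro x hx hxr
    obtain ⟨he, hz⟩ := h0 x hx hxr
    refine ⟨redComp_three_eq_zero hA.1 hx.1 (fun θ hθ => (h0 (x.1, θ) ⟨hx.1, hθ⟩ hxr).2 2 3) hx.2,
      he, hz 1 2, ?_⟩
    show redV K A (t₀, x) = 0
    rw [redV_eq hA.1 hx, hz, zero_div]
  refine ⟨fun t => ?_, hQ.1⟩
  obtain ⟨r₃, r₄, h₃, h₄, hs⟩ :=
    exists_support K.isTwistPotential_twistPotential hQ hF h₁ h₂ hd t
  have hsl : ∀ {f : ℝ × (ℝ × ℝ) → ℝ}, ContDiffOn ℝ ∞ f K.cyl →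
      ContDiffOn ℝ ∞ (fun x => f (t, x)) K.quotAxis := fun hf => hf.slice (mem_univ t)
  refine ⟨⟨hsl hQ.1.1, hsl hQ.1.2.1, hsl hQ.1.2.2.1, hsl hQ.1.2.2.2⟩,
    ⟨r₃, r₄, h₃, h₄, fun x hx hxr => ?_⟩, hQ.2 t⟩
  by_cases hax' : x.2 ∈ Ioo 0 π
  · exact hs x ⟨hx.1, hax'⟩ hxr
  · have hx' : x ∈ K.axes := by
      refine ⟨hx.1, ?_⟩
      rcases eq_endpoints_or_mem_Ioo_of_mem_Icc hx.2 with h | h | h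
      · exact Or.inl h
      · exact Or.inr h
      · exact absurd h hax'
    obtain ⟨a1, a2, a3, a4, -⟩ := hQ.2 t x hx'
    exact ⟨a1, a2, a3, a4⟩

end Primitive

/-- One curve works for all twist potentials at once, since the field equations involve ω only
through dω, which is the same for all of them. -/
theorem exists_reduction (hA : K.IsAxisymmetricMaxwell A) (h : K.HasCompactData A t₀) :
    ∃ Q : ℝ → PhasePoint, K.IsSmoothCurve Q ∧ K.IsReduction A Q ∧
      (∀ c ∈ K.chart, K.maxwellDensityADM A c = K.densityADM (Q (c 0)) (c 1, c 2)) ∧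
      ∀ om, K.IsTwistPotential om → K.FieldEquations om Q := by
  obtain ⟨η, hη, hax, r₁, r₂, h₁, h₂, h0⟩ := exists_dualPotential hA h
  exact ⟨K.maxwellCurve A η, isSmoothCurve_maxwellCurve hη hA hax h₁ h₂ h0,
    isReduction_maxwellCurve hη hA, fun c hc => maxwellDensityADM_eq hη hA hc,
    fun om hom => fieldEquations_maxwellCurve hη hom hA⟩

end KerrDeSitter

end

/-! ### The conserved currents, and the theorem. -/

noncomputable section

namespace KerrDeSitter

variable {K : KerrDeSitter} {om : ℝ × ℝ → ℝ} {Q : ℝ → PhasePoint}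

/-! ### The conserved currents -/

theorem isDivergenceFree_currentAlt (hom : K.IsTwistPotential om) (hQ : K.IsSmoothCurve Q)
    (hF : K.FieldEquations om Q) : K.IsDivergenceFree (K.currentAlt om Q) := by
  intro t x hx
  have h := deriv_densityAlt_add_div hom hQ.axisRegular.interiorSmooth hF hx t
  rw [← h]
  congr 1
  exact Finset.sum_congr rfl fun b _ => pd_congr b K.isOpen_quot (currentAlt_snd_eqOn om Q t b) hx

/-- The factors e^{γ} of the momenta and e^{-γ} of the covariant derivatives cancel, so the two
currents are one and the same and conservation needs no second computation. -/
theorem currentReg_regularize (om : ℝ × ℝ → ℝ) (hQ : K.IsSmoothCurve Q) (t : ℝ) {x : ℝ × ℝ}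
    (hx : x ∈ K.quot) :
    K.currentReg om (fun t => K.regularize (Q t)) t x = K.currentAlt om Q t x := by
  have hI := hQ.axisRegular.interiorSmooth
  have hl := (hI.lam t).differentiableAt_of_isOpen K.isOpen_quot (by simp) hx
  have he := (hI.eta t).differentiableAt_of_isOpen K.isOpen_quot (by simp) hx
  exact Prod.ext (densityReg_regularize om hx hl he)
    (funext fun b => currentReg_snd_regularize om Q t hx hl he b)

theorem isDivergenceFree_currentReg (hom : K.IsTwistPotential om) (hQ : K.IsSmoothCurve Q)
    (hF : K.FieldEquations om Q) :
    K.IsDivergenceFree (K.currentReg om fun t => K.regularize (Q t)) := by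
  intro t x hx
  rw [← isDivergenceFree_currentAlt hom hQ hF t x hx]
  simp only [currentReg_regularize om hQ _ hx]
  congr 1
  exact Finset.sum_congr rfl fun b _ => pd_congr b K.isOpen_quot
    (fun y hy => congrArg (fun J : ℝ × (Fin 2 → ℝ) => J.2 b) (currentReg_regularize om hQ t hy)) hx

end KerrDeSitter

end

theorem mainTheorem1 (K : KerrDeSitter) :
    (∃ om, K.IsTwistPotential om) ∧
    ∀ om : ℝ × ℝ → ℝ, K.IsTwistPotential om →
      -- the ADM Hamiltonian on `X` equals `H^Alt`, which is positive-definite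
      (∀ P ∈ K.phaseSpace, IntegrableOn (K.densityADM P) K.quot ∧
        K.energy K.densityADM P = K.energy (K.densityAlt om) P) ∧
      K.IsPositiveDefinite (K.densityAlt om) K.phaseSpace ∧
      -- `H^Alt` generates the field equations
      (∀ Q, K.IsSmoothCurve Q →
        (K.IsHamiltonFlow (K.energy (K.densityAlt om)) Q ↔ K.FieldEquations om Q)) ∧
      -- the canonical transformation to the regularized phase space, and `H^Reg`
      BijOn K.regularize K.phaseSpace K.regPhaseSpace ∧
      (∀ P ∈ K.phaseSpace, ∀ P' ∈ K.phaseSpace,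
        K.symplecticForm (K.regularize P) (K.regularize P') = K.symplecticForm P P') ∧
      (∀ P ∈ K.phaseSpace,
        K.energy (K.densityReg om) (K.regularize P) = K.energy (K.densityAlt om) P) ∧
      K.IsPositiveDefinite (K.densityReg om) K.regPhaseSpace ∧
      (∀ Q, K.IsSmoothCurve Q →
        (K.IsHamiltonFlow (K.energy (K.densityReg om)) (fun t => K.regularize (Q t)) ↔
          K.FieldEquations om Q)) ∧
      -- the dynamics of axially symmetric Maxwell fields
      ∀ (A : (Fin 4 → ℝ) → ((Fin 4 → ℝ) →L[ℝ] ℝ)) (t₀ : ℝ),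
        K.IsAxisymmetricMaxwell A → K.HasCompactData A t₀ →
        ∃ Q : ℝ → PhasePoint, K.IsSmoothCurve Q ∧ K.IsReduction A Q ∧
          (∀ c ∈ K.chart, K.maxwellDensityADM A c = K.densityADM (Q (c 0)) (c 1, c 2)) ∧
          K.FieldEquations om Q ∧
          K.IsHamiltonFlow (K.energy (K.densityAlt om)) Q ∧
          K.IsDivergenceFree (K.currentAlt om Q) ∧
          (∀ t, 0 ≤ K.flux (K.currentAlt om Q) t ∧
            (K.flux (K.currentAlt om Q) t = 0 ↔ K.Vanishes (Q t))) ∧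
          K.IsHamiltonFlow (K.energy (K.densityReg om)) (fun t => K.regularize (Q t)) ∧
          K.IsDivergenceFree (K.currentReg om (fun t => K.regularize (Q t))) ∧
          (∀ t, 0 ≤ K.flux (K.currentReg om (fun t => K.regularize (Q t))) t ∧
            (K.flux (K.currentReg om (fun t => K.regularize (Q t))) t = 0 ↔
              K.Vanishes (Q t))) := by
  refine ⟨⟨_, K.isTwistPotential_twistPotential⟩, fun om hom => ⟨fun P hP =>
    ⟨KerrDeSitter.integrableOn_densityADM hP, KerrDeSitter.energy_densityADM_eq hom hP⟩,
    KerrDeSitter.isPositiveDefinite_densityAlt hom,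
    fun Q hQ => KerrDeSitter.isHamiltonFlow_densityAlt_iff hom hQ,
    ⟨mapsTo_image _ _, K.regularize_injective.injOn, surjOn_image _ _⟩,
    fun P _ P' _ => KerrDeSitter.symplecticForm_regularize P P',
    fun P hP => KerrDeSitter.energy_densityReg_regularize om hP,
    KerrDeSitter.isPositiveDefinite_densityReg hom,
    fun Q hQ => KerrDeSitter.isHamiltonFlow_densityReg_iff hom hQ, fun A t₀ hA hD => ?_⟩⟩
  obtain ⟨Q, hQ, hR, hE, hF⟩ := KerrDeSitter.exists_reduction hA hD
  refine ⟨Q, hQ, hR, hE, hF om hom,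
    (KerrDeSitter.isHamiltonFlow_densityAlt_iff hom hQ).2 (hF om hom),
    KerrDeSitter.isDivergenceFree_currentAlt hom hQ (hF om hom),
    -- The flux through a t-slice is by definition the energy of Q t, so positive-definiteness on X
    -- is the claim.
    fun t => (KerrDeSitter.isPositiveDefinite_densityAlt hom (Q t) (hQ.1 t)).2,
    (KerrDeSitter.isHamiltonFlow_densityReg_iff hom hQ).2 (hF om hom),
    KerrDeSitter.isDivergenceFree_currentReg hom hQ (hF om hom), fun t => ?_⟩
  obtain ⟨-, h1, h2⟩ := KerrDeSitter.isPositiveDefinite_densityReg hom _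
    (mem_image_of_mem K.regularize (hQ.1 t))
  exact ⟨h1, h2.trans KerrDeSitter.vanishes_regularize_iff⟩
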